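/- Let $R=R(x,y,z,p,q,s)$ and $T=T(x,y,z,p,q,s)$ be smooth functions on an open set $\mathcal J\subseteq\mathbb R^6$ of 2-jets ($p=z_x$, $q=z_y$, $s=z_{xy}$), and consider the system $z_{xx}=R$, $z_{yy}=T$. Assume $1-R_sT_s>0$, let $$D_x=\partial_x+p\partial_z+R\partial_p+s\partial_q+(D_yR)\partial_s,\qquad D_y=\partial_y+q\partial_z+s\partial_p+T\partial_q+(D_xT)\partial_s$$ (these implicit formulas determine $D_yR$ and $D_xT$, since $R_sT_s\ne1$), and assume the compatibility (finite type) condition $D_x^2T=D_y^2R$. Put $w=\sqrt{1-R_sT_s}$, $$\lambda=dz-p\,dx-q\,dy,\quad \nu_1=dp-R\,dx-s\,dy,\quad \nu_2=dq-s\,dx-T\,dy,\quad \nu_3=ds-(D_yR)dx-(D_xT)dy,\quad \mu_1=dx,\quad \mu_2=dy,$$ and consider lifted forms $$\theta^4=a\lambda,\quad \theta^i=b_i\lambda+\sum_{k}f_{ik}\nu_k\ (i=1,2,3),\quad \Omega_3=c_1\lambda+h_{11}\mu_1+h_{12}\mu_2,\quad \Omega_2=c_2\lambda+h_{21}\mu_1+h_{22}\mu_2,$$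 with $a\det(f_{ik})\det(h_{\alpha\beta})\neq0$. Suppose that Newman's metricity conditions $J_1\equiv J_2\equiv0$ hold, where $$J_1=(R_sT_s-4)D_xR_s+R_s(2D_yR_s-R_sD_xT_s)+8R_q-6R_qR_sT_s+4R_pR_s+2R_s^2T_q-2R_pR_s^2T_s+2R_s^3T_p,$$ $$J_2=(R_sT_s-4)D_yT_s+T_s(2D_xT_s-T_sD_yR_s)+8T_p-6R_sT_pT_s+4T_qT_s+2R_pT_s^2-2R_sT_qT_s^2+2R_qT_s^3.$$ **(1)** Suppose $R_s\ne0$ on $\mathcal J$, and let $\varepsilon=\pm1$. On the 11-dimensional manifold $P$ with coordinates $(x,y,z,p,q,s)\in\mathcal J$ and $(a,f_{12},f_{22},f_{31},f_{32})$, $af_{12}f_{22}\neq0$, the remaining parameters can be chosen as smooth functions, with $f_{11}=\frac{-1-\varepsilon w}{R_s}f_{12}$ and $f_{21}=\frac{-1+\varepsilon w}{R_s}f_{22}$, and there are smooth 1-forms $\Omega_1,\Omega_4,\Omega_5,\Omega_6,A$ on $P$, such that $(\theta^1,\dots,\theta^4,\Omega_1,\dots,\Omega_6,A)$ is a coframe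 on $P$ and $$\begin{aligned} d\theta^1&=(\Omega_1-\tfrac12A)\wedge\theta^1-\Omega_3\wedge\theta^3-\Omega_5\wedge\theta^4+t^1_{23}\,\theta^2\wedge\theta^3,\\ d\theta^2&=(-\Omega_1-\tfrac12A)\wedge\theta^2-\Omega_2\wedge\theta^3-\Omega_4\wedge\theta^4+t^2_{13}\,\theta^1\wedge\theta^3,\\ d\theta^3&=\Omega_4\wedge\theta^1+\Omega_5\wedge\theta^2+(\Omega_6-\tfrac12A)\wedge\theta^3,\\ d\theta^4&=\Omega_2\wedge\theta^1+\Omega_3\wedge\theta^2+(-\Omega_6-\tfrac12A)\wedge\theta^4, \end{aligned}$$ $$t^1_{23}=-\frac{a}{8f_{22}^2w^4}\big(R_{ss}(1+\varepsilon w)^2+T_{ss}R_s^2\big),\qquad t^2_{13}=-\frac{a}{8f_{12}^2w^4}\big(R_{ss}(1-\varepsilon w)^2+T_{ss}R_s^2\big).$$ **(2)** Without any assumption on the zeros of $R_s$, the same holds with fibre coordinates $(a,f_{12},f_{21},f_{31},f_{32})$, $af_{12}f_{21}\ne0$, with $f_{11}=-\frac{T_s}{1+w}f_{12}$, $f_{22}=-\frac{R_s}{1+w}f_{21}$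 and $$t^1_{23}=-\frac{a}{8f_{21}^2w^4}\big(R_{ss}T_s^2+T_{ss}(1+w)^2\big),\qquad t^2_{13}=-\frac{a}{8f_{12}^2w^4}\big(R_{ss}(1+w)^2+T_{ss}R_s^2\big).$$ **(3)** In (1) and in (2) the normalization can be chosen so that moreover $G=2(\theta^1\theta^2+\theta^3\theta^4)$ descends to a conformal metric of signature $(+,+,-,-)$ on the 4-dimensional (local) leaf space of the foliation of $P$ tangent to the distribution annihilated by $\theta^1,\dots,\theta^4$. That is, every point of $P$ has an open neighbourhood $V$ and a general solution $z=\psi(x,y,a_0,a_1,a_2,a_3)$ of the system, with parameters in an open set $N\subseteq\mathbb R^4$, such that $(x,y,a_i)\mapsto(x,y,\psi,\psi_x,\psi_y,\psi_{xy})$ is a diffeomorphism onto the open set of jets underlying $V$; the induced map $\pi:V\to N$ is a surjective submersion with connected fibres and $\ker d\pi=\ker\theta^1\cap\dots\cap\ker\theta^4$; and $G=\varphi\,\pi^*g$ on $V$ for a smooth metric $g$ of signature $(+,+,-,-)$ on $N$ and a smooth function $\varphi>0$. Thus $N$ is both the leaf space and the solution space. **(4)** Let $\bar z_{\bar x\bar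 x}=\bar R$, $\bar z_{\bar y\bar y}=\bar T$ be another such system (smooth on an open set $\bar{\mathcal J}$, $1-\bar R_{\bar s}\bar T_{\bar s}>0$, compatible), to which the first one is carried by a point transformation, i.e. by a diffeomorphism of the $(x,y,z)$-space whose prolongation $\Phi$ is a diffeomorphism $\mathcal J\to\bar{\mathcal J}$ respecting the systems. Let $$K_1=R_{ss}(1-w)^2+T_{ss}R_s^2,\qquad K_2=R_{ss}(1+w)^2+T_{ss}R_s^2 .$$ If $\mathcal J$ is connected, $R_s\ne0$ on $\mathcal J$ and $\bar R_{\bar s}\neq0$ on $\bar{\mathcal J}$, then either, at every $j\in\mathcal J$, $K_1(j)=0\iff\bar K_1(\Phi(j))=0$ and $K_2(j)=0\iff\bar K_2(\Phi(j))=0$; or, at every $j\in\mathcal J$, $K_1(j)=0\iff\bar K_2(\Phi(j))=0$ and $K_2(j)=0\iff\bar K_1(\Phi(j))=0$. So, up to the interchange of $\theta^1$ and $\theta^2$, the vanishing of each of $K_1,K_2$ is a point invariant property. Without assumptions on the zeros of $R_s$, $\bar R_{\bar s}$ and on connectedness, $R_{ss}=T_{ss}=0$ holds at $j\in\mathcal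 J$ if and only if $\bar R_{\bar s\bar s}=\bar T_{\bar s\bar s}=0$ holds at $\Phi(j)$; in particular $R_{ss}\equiv T_{ss}\equiv0$ is a point invariant property. -/

import Mathlib

open Set
open scoped ContDiff

noncomputable section

/-! ### The pair of equations `z_xx = R`, `z_yy = T` on the space of 2-jets

A point of the jet space is `j = (x, y, z, p, q, s)`, with `p = z_x`, `q = z_y`, `s = z_xy`. -/

/-- The 6-dimensional jet space with coordinates `(x, y, z, p, q, s) = (j 0, …, j 5)`. -/
abbrev Jet : Type := Fin 6 → ℝ

/-- The partial derivative of `F` in the `i`-th jet coordinate. -/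
def pd (i : Fin 6) (F : Jet → ℝ) (j : Jet) : ℝ := fderiv ℝ F j (Pi.single i 1)

/-- The function `D_y R`, solved from the implicit definition of `D_x`, `D_y`
(see `dyR_eq`, `dxT_eq` and `dyR_dxT_unique`). -/
def dyR (R T : Jet → ℝ) (j : Jet) : ℝ :=
  ((pd 1 R j + j 4 * pd 2 R j + j 5 * pd 3 R j + T j * pd 4 R j)
    + pd 5 R j * (pd 0 T j + j 3 * pd 2 T j + R j * pd 3 T j + j 5 * pd 4 T j))
    / (1 - pd 5 R j * pd 5 T j)

/-- The function `D_x T`, solved from the implicit definition of `D_x`, `D_y`. -/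
def dxT (R T : Jet → ℝ) (j : Jet) : ℝ :=
  ((pd 0 T j + j 3 * pd 2 T j + R j * pd 3 T j + j 5 * pd 4 T j)
    + pd 5 T j * (pd 1 R j + j 4 * pd 2 R j + j 5 * pd 3 R j + T j * pd 4 R j))
    / (1 - pd 5 R j * pd 5 T j)

theorem dyR_eq (R T : Jet → ℝ) (j : Jet) (h : pd 5 R j * pd 5 T j ≠ 1) :
    dyR R T j = pd 1 R j + j 4 * pd 2 R j + j 5 * pd 3 R j + T j * pd 4 R j
      + dxT R T j * pd 5 R j := by
  have h' : 1 - pd 5 R j * pd 5 T j ≠ 0 := sub_ne_zero.mpr (Ne.symm h)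
  rw [dyR, dxT, div_eq_iff h', add_mul, div_mul_eq_mul_div, div_mul_cancel₀ _ h']
  ring

theorem dxT_eq (R T : Jet → ℝ) (j : Jet) (h : pd 5 R j * pd 5 T j ≠ 1) :
    dxT R T j = pd 0 T j + j 3 * pd 2 T j + R j * pd 3 T j + j 5 * pd 4 T j
      + dyR R T j * pd 5 T j := by
  have h' : 1 - pd 5 R j * pd 5 T j ≠ 0 := sub_ne_zero.mpr (Ne.symm h)
  rw [dyR, dxT, div_eq_iff h', add_mul, div_mul_eq_mul_div, div_mul_cancel₀ _ h']
  ring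

theorem dyR_dxT_unique (R T : Jet → ℝ) (j : Jet) (h : pd 5 R j * pd 5 T j ≠ 1) (A B : ℝ)
    (hA : A = pd 1 R j + j 4 * pd 2 R j + j 5 * pd 3 R j + T j * pd 4 R j + B * pd 5 R j)
    (hB : B = pd 0 T j + j 3 * pd 2 T j + R j * pd 3 T j + j 5 * pd 4 T j + A * pd 5 T j) :
    A = dyR R T j ∧ B = dxT R T j := by
  have h' : 1 - pd 5 R j * pd 5 T j ≠ 0 := sub_ne_zero.mpr (Ne.symm h)
  constructor
  · rw [dyR, eq_div_iff h']
    linear_combination hA + pd 5 R j * hB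
  · rw [dxT, eq_div_iff h']
    linear_combination hB + pd 5 T j * hA

/-- The vector field `D_x = ∂_x + p ∂_z + R ∂_p + s ∂_q + (D_y R) ∂_s`. -/
def vecDx (R T : Jet → ℝ) (j : Jet) : Jet := ![1, 0, j 3, R j, j 5, dyR R T j]

/-- The vector field `D_y = ∂_y + q ∂_z + s ∂_p + T ∂_q + (D_x T) ∂_s`. -/
def vecDy (R T : Jet → ℝ) (j : Jet) : Jet := ![0, 1, j 4, j 5, T j, dxT R T j]

/-- The operator `D_x` on functions. -/
def opDx (R T F : Jet → ℝ) (j : Jet) : ℝ := fderiv ℝ F j (vecDx R T j)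

/-- The operator `D_y` on functions. -/
def opDy (R T F : Jet → ℝ) (j : Jet) : ℝ := fderiv ℝ F j (vecDy R T j)

theorem fderiv_apply_eq_sum_pd (F : Jet → ℝ) (j v : Jet) :
    fderiv ℝ F j v = ∑ i, v i * pd i F j := by
  have h : v = ∑ i, v i • (Pi.single i 1 : Jet) := by
    conv_lhs => rw [← Finset.univ_sum_single v]
    refine Finset.sum_congr rfl fun i _ => ?_
    rw [← Pi.single_smul, smul_eq_mul, mul_one]
  conv_lhs => rw [h, map_sum]
  refine Finset.sum_congr rfl fun i _ => ?_
  rw [map_smul, smul_eq_mul, pd]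

theorem opDx_eq (R T F : Jet → ℝ) (j : Jet) :
    opDx R T F j = pd 0 F j + j 3 * pd 2 F j + R j * pd 3 F j + j 5 * pd 4 F j
      + dyR R T j * pd 5 F j := by
  simp [opDx, fderiv_apply_eq_sum_pd, Fin.sum_univ_succ, vecDx]
  ring

theorem opDy_eq (R T F : Jet → ℝ) (j : Jet) :
    opDy R T F j = pd 1 F j + j 4 * pd 2 F j + j 5 * pd 3 F j + T j * pd 4 F j
      + dxT R T j * pd 5 F j := by
  simp [opDy, fderiv_apply_eq_sum_pd, Fin.sum_univ_succ, vecDy]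
  ring

/-- A pair `z_xx = R(x,y,z,z_x,z_y,z_xy)`, `z_yy = T(x,y,z,z_x,z_y,z_xy)` of smooth equations over
an open set of 2-jets, with `1 - R_s T_s > 0` and satisfying the compatibility condition
`D_x² T = D_y² R`. -/
structure PDESystem where
  dom : Set Jet
  R : Jet → ℝ
  T : Jet → ℝ
  isOpen_dom : IsOpen dom
  smooth_R : ContDiffOn ℝ ∞ R dom
  smooth_T : ContDiffOn ℝ ∞ T dom
  pos : ∀ j ∈ dom, 0 < 1 - pd 5 R j * pd 5 T j
  compat : ∀ j ∈ dom, opDx R T (dxT R T) j = opDy R T (dyR R T) j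

namespace PDESystem

variable (S : PDESystem)

def Rs : Jet → ℝ := pd 5 S.R

def Ts : Jet → ℝ := pd 5 S.T

def Rss : Jet → ℝ := pd 5 (pd 5 S.R)

def Tss : Jet → ℝ := pd 5 (pd 5 S.T)

/-- `w = √(1 - R_s T_s)`. -/
def w (j : Jet) : ℝ := Real.sqrt (1 - S.Rs j * S.Ts j)

def Dx (F : Jet → ℝ) : Jet → ℝ := opDx S.R S.T F

def Dy (F : Jet → ℝ) : Jet → ℝ := opDy S.R S.T F

/-- The first of Newman's metricity expressions. -/
def J1 (j : Jet) : ℝ :=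
  (S.Rs j * S.Ts j - 4) * S.Dx S.Rs j + S.Rs j * (2 * S.Dy S.Rs j - S.Rs j * S.Dx S.Ts j)
    + 8 * pd 4 S.R j - 6 * pd 4 S.R j * S.Rs j * S.Ts j + 4 * pd 3 S.R j * S.Rs j
    + 2 * S.Rs j ^ 2 * pd 4 S.T j - 2 * pd 3 S.R j * S.Rs j ^ 2 * S.Ts j
    + 2 * S.Rs j ^ 3 * pd 3 S.T j

/-- The second of Newman's metricity expressions. -/
def J2 (j : Jet) : ℝ :=
  (S.Rs j * S.Ts j - 4) * S.Dy S.Ts j + S.Ts j * (2 * S.Dx S.Ts j - S.Ts j * S.Dy S.Rs j)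
    + 8 * pd 3 S.T j - 6 * S.Rs j * pd 3 S.T j * S.Ts j + 4 * pd 4 S.T j * S.Ts j
    + 2 * pd 3 S.R j * S.Ts j ^ 2 - 2 * S.Rs j * pd 4 S.T j * S.Ts j ^ 2
    + 2 * pd 4 S.R j * S.Ts j ^ 3

/-- `K_1 = R_ss (1 - √(1 - R_s T_s))² + T_ss R_s²`. -/
def K1 (j : Jet) : ℝ := S.Rss j * (1 - S.w j) ^ 2 + S.Tss j * S.Rs j ^ 2

/-- `K_2 = R_ss (1 + √(1 - R_s T_s))² + T_ss R_s²`. -/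
def K2 (j : Jet) : ℝ := S.Rss j * (1 + S.w j) ^ 2 + S.Tss j * S.Rs j ^ 2

end PDESystem

/-! ### The para-CR coframe of the system -/

/-- `λ = dz - p dx - q dy`. -/
def lamForm (j : Jet) : Jet →L[ℝ] ℝ :=
  ContinuousLinearMap.proj 2 - j 3 • ContinuousLinearMap.proj 0
    - j 4 • ContinuousLinearMap.proj 1

/-- `μ₁ = dx`, `μ₂ = dy`. -/
def muForm (i : Fin 2) : Jet →L[ℝ] ℝ :=
  ![ContinuousLinearMap.proj 0, ContinuousLinearMap.proj 1] i

/-- `ν₁ = dp - R dx - s dy`, `ν₂ = dq - s dx - T dy`, `ν₃ = ds - (D_y R) dx - (D_x T) dy`. -/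
def PDESystem.nu (S : PDESystem) (i : Fin 3) (j : Jet) : Jet →L[ℝ] ℝ :=
  ![ContinuousLinearMap.proj 3 - S.R j • ContinuousLinearMap.proj 0
      - j 5 • ContinuousLinearMap.proj 1,
    ContinuousLinearMap.proj 4 - j 5 • ContinuousLinearMap.proj 0
      - S.T j • ContinuousLinearMap.proj 1,
    ContinuousLinearMap.proj 5 - dyR S.R S.T j • ContinuousLinearMap.proj 0
      - dxT S.R S.T j • ContinuousLinearMap.proj 1] i

/-! ### Exterior calculus of 1-forms -/

section Forms

variable {E : Type*} [NormedAddCommGroup E] [NormedSpace ℝ E]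

/-- The exterior derivative of a 1-form `α`, evaluated at the point `u` on the vectors `v₁`, `v₂`. -/
def dForm (α : E → (E →L[ℝ] ℝ)) (u v₁ v₂ : E) : ℝ :=
  extDeriv (fun y => ContinuousAlternatingMap.ofSubsingleton ℝ E ℝ (0 : Fin 1) (α y)) u ![v₁, v₂]

/-- The wedge product of two covectors, `(α ∧ β)(v₁, v₂) = α(v₁) β(v₂) - α(v₂) β(v₁)`. -/
def wedge (α β : E →L[ℝ] ℝ) (v₁ v₂ : E) : ℝ := α v₁ * β v₂ - α v₂ * β v₁

theorem dForm_eq (α : E → (E →L[ℝ] ℝ)) (u v₁ v₂ : E) (h : DifferentiableAt ℝ α u) :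
    dForm α u v₁ v₂ = fderiv ℝ α u v₁ v₂ - fderiv ℝ α u v₂ v₁ := by
  have h' : DifferentiableAt ℝ
      (fun y => ContinuousAlternatingMap.ofSubsingleton ℝ E ℝ (0 : Fin 1) (α y)) u :=
    (ContinuousAlternatingMap.ofSubsingletonLIE (𝕜 := ℝ) (E := E) (F := ℝ)
      (0 : Fin 1)).toContinuousLinearEquiv |>.differentiableAt.comp u h
  have key : ∀ a b : E, fderiv ℝ (fun y => α y a) u b = fderiv ℝ α u b a := fun a b => by
    rw [fderiv_clm_apply h (differentiableAt_const a)]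
    simp
  rw [dForm, extDeriv_apply h']
  simp [Fin.sum_univ_succ, Fin.removeNth, Fin.succAbove, key, sub_eq_add_neg]

end Forms

/-! ### Lifted coframes -/

/-- The 11-dimensional space on which lifted coframes live: a 2-jet together with five fibre
coordinates. -/
abbrev Lift : Type := Jet × (Fin 5 → ℝ)

/-- The group parameters `a, b_i, c_α, f_ij, h_αβ` of a para-CR transformation of type `(1,2,3)`,
as functions on the lifted space (indices are shifted by one). -/
structure GroupParams where
  a : Lift → ℝ
  b : Fin 3 → Lift → ℝ
  c : Fin 2 → Lift → ℝ
  f : Fin 3 → Fin 3 → Lift → ℝ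
  h : Fin 2 → Fin 2 → Lift → ℝ

namespace GroupParams

/-- Smoothness of all the group parameters on `P`. -/
def Smooth (g : GroupParams) (P : Set Lift) : Prop :=
  ContDiffOn ℝ ∞ g.a P ∧ (∀ i, ContDiffOn ℝ ∞ (g.b i) P) ∧ (∀ i, ContDiffOn ℝ ∞ (g.c i) P) ∧
    (∀ i k, ContDiffOn ℝ ∞ (g.f i k) P) ∧ ∀ i k, ContDiffOn ℝ ∞ (g.h i k) P

/-- The condition `a det(f) det(h) ≠ 0` on `P`. -/
def Nondegenerate (g : GroupParams) (P : Set Lift) : Prop :=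
  ∀ u ∈ P, g.a u * (Matrix.of fun i k => g.f i k u).det * (Matrix.of fun i k => g.h i k u).det ≠ 0

/-- The pullback to the lifted space of a covector at the underlying jet. -/
def pull (α : Jet →L[ℝ] ℝ) : Lift →L[ℝ] ℝ := α.comp (ContinuousLinearMap.fst ℝ Jet (Fin 5 → ℝ))

/-- The lifted forms `θ^i = b_i λ + f_i1 ν₁ + f_i2 ν₂ + f_i3 ν₃` for `i = 1, 2, 3` and
`θ⁴ = a λ`; the values at `0, …, 3` are `θ¹, …, θ⁴`. -/
def theta (g : GroupParams) (S : PDESystem) : Fin 4 → Lift → (Lift →L[ℝ] ℝ) :=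
  Fin.snoc (α := fun _ => Lift → (Lift →L[ℝ] ℝ))
    (fun (i : Fin 3) (u : Lift) =>
      g.b i u • pull (lamForm u.1) + ∑ k, g.f i k u • pull (S.nu k u.1))
    (fun u => g.a u • pull (lamForm u.1))

/-- `Ω₃ = c₁ λ + h₁₁ μ₁ + h₁₂ μ₂`. -/
def omega3 (g : GroupParams) (u : Lift) : Lift →L[ℝ] ℝ :=
  g.c 0 u • pull (lamForm u.1) + ∑ k, g.h 0 k u • pull (muForm k)

/-- `Ω₂ = c₂ λ + h₂₁ μ₁ + h₂₂ μ₂`. -/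
def omega2 (g : GroupParams) (u : Lift) : Lift →L[ℝ] ℝ :=
  g.c 1 u • pull (lamForm u.1) + ∑ k, g.h 1 k u • pull (muForm k)

end GroupParams

/-- The structure equations for `dθ¹, …, dθ⁴` at every point of `P`, with torsion functions
`t1 = t¹₂₃` and `t2 = t²₁₃`. The forms `θ 0, …, θ 3` are `θ¹, …, θ⁴`. -/
def StructureEquations (P : Set Lift) (θ : Fin 4 → Lift → (Lift →L[ℝ] ℝ))
    (Ω₁ Ω₂ Ω₃ Ω₄ Ω₅ Ω₆ A : Lift → (Lift →L[ℝ] ℝ)) (t1 t2 : Lift → ℝ) : Prop :=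
  ∀ u ∈ P, ∀ v₁ v₂ : Lift,
    dForm (θ 0) u v₁ v₂ = wedge (Ω₁ u - (1 / 2 : ℝ) • A u) (θ 0 u) v₁ v₂
        - wedge (Ω₃ u) (θ 2 u) v₁ v₂ - wedge (Ω₅ u) (θ 3 u) v₁ v₂
        + t1 u * wedge (θ 1 u) (θ 2 u) v₁ v₂ ∧
    dForm (θ 1) u v₁ v₂ = wedge (-Ω₁ u - (1 / 2 : ℝ) • A u) (θ 1 u) v₁ v₂
        - wedge (Ω₂ u) (θ 2 u) v₁ v₂ - wedge (Ω₄ u) (θ 3 u) v₁ v₂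
        + t2 u * wedge (θ 0 u) (θ 2 u) v₁ v₂ ∧
    dForm (θ 2) u v₁ v₂ = wedge (Ω₄ u) (θ 0 u) v₁ v₂ + wedge (Ω₅ u) (θ 1 u) v₁ v₂
        + wedge (Ω₆ u - (1 / 2 : ℝ) • A u) (θ 2 u) v₁ v₂ ∧
    dForm (θ 3) u v₁ v₂ = wedge (Ω₂ u) (θ 0 u) v₁ v₂ + wedge (Ω₃ u) (θ 1 u) v₁ v₂
        + wedge (-Ω₆ u - (1 / 2 : ℝ) • A u) (θ 3 u) v₁ v₂

/-- The group parameters `g` are normalized on the open set `P`: they are smooth and nondegenerate,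
and there are smooth auxiliary forms `Ω₁, Ω₄, Ω₅, Ω₆, A` on `P` which complete the lifted forms
`θ¹, …, θ⁴, Ω₂, Ω₃` to a coframe and with which the structure equations hold. -/
def GroupParams.IsNormalized (g : GroupParams) (S : PDESystem) (P : Set Lift)
    (t1 t2 : Lift → ℝ) : Prop :=
  g.Smooth P ∧ g.Nondegenerate P ∧
    ∃ Ω₁ Ω₄ Ω₅ Ω₆ A : Lift → (Lift →L[ℝ] ℝ),
      ContDiffOn ℝ ∞ Ω₁ P ∧ ContDiffOn ℝ ∞ Ω₄ P ∧ ContDiffOn ℝ ∞ Ω₅ P ∧ ContDiffOn ℝ ∞ Ω₆ P ∧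
      ContDiffOn ℝ ∞ A P ∧
      (∀ u ∈ P, LinearIndependent ℝ
        ![g.theta S 0 u, g.theta S 1 u, g.theta S 2 u, g.theta S 3 u,
          Ω₁ u, g.omega2 u, g.omega3 u, Ω₄ u, Ω₅ u, Ω₆ u, A u]) ∧
      StructureEquations P (g.theta S) Ω₁ (g.omega2) (g.omega3) Ω₄ Ω₅ Ω₆ A t1 t2

/-- The part of the lifted space over the domain of `S` where the first three fibre coordinates
do not vanish. -/
def PDESystem.lift (S : PDESystem) : Set Lift :=
  {u | u.1 ∈ S.dom ∧ u.2 0 ≠ 0 ∧ u.2 1 ≠ 0 ∧ u.2 2 ≠ 0}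

/-! ### Solutions and the leaf space -/

def derivX (ζ : ℝ × ℝ → ℝ) (m : ℝ × ℝ) : ℝ := fderiv ℝ ζ m (1, 0)

def derivY (ζ : ℝ × ℝ → ℝ) (m : ℝ × ℝ) : ℝ := fderiv ℝ ζ m (0, 1)

/-- The 2-jet `(x, y, ζ, ζ_x, ζ_y, ζ_xy)` of a function `ζ` at `m = (x, y)`. -/
def jetOf (ζ : ℝ × ℝ → ℝ) (m : ℝ × ℝ) : Jet :=
  ![m.1, m.2, ζ m, derivX ζ m, derivY ζ m, derivY (derivX ζ) m]

/-- `ζ` is a smooth solution of the system `S` on the open set `D`. -/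
def PDESystem.IsSolution (S : PDESystem) (D : Set (ℝ × ℝ)) (ζ : ℝ × ℝ → ℝ) : Prop :=
  ContDiffOn ℝ ∞ ζ D ∧ ∀ m ∈ D, jetOf ζ m ∈ S.dom ∧
    derivX (derivX ζ) m = S.R (jetOf ζ m) ∧ derivY (derivY ζ) m = S.T (jetOf ζ m)

/-- `z = ψ(x, y, a)`, with `(x, y) ∈ D` and `a` in the open set `N ⊆ ℝ⁴`, is the general solution
of `S` over the open set `W` of jets: every `ψ(·, a)` is a solution, and `(x, y, a) ↦` (2-jet of
`ψ(·, a)` at `(x, y)`) is a diffeomorphism of `D × N` onto `W`. The map `sol : W → N` sends a jet to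
the parameter of the solution through it. -/
structure PDESystem.IsGeneralSolution (S : PDESystem) (D : Set (ℝ × ℝ)) (N : Set (Fin 4 → ℝ))
    (W : Set Jet) (ψ : ℝ × ℝ → (Fin 4 → ℝ) → ℝ) (sol : Jet → (Fin 4 → ℝ)) : Prop where
  isOpen_base : IsOpen D
  isOpen_param : IsOpen N
  isOpen_jets : IsOpen W
  smooth : ContDiffOn ℝ ∞ (fun r : (ℝ × ℝ) × (Fin 4 → ℝ) => ψ r.1 r.2) (D ×ˢ N)
  isSolution : ∀ a ∈ N, S.IsSolution D (fun m => ψ m a)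
  smooth_sol : ContDiffOn ℝ ∞ sol W
  jet_mem : ∀ m ∈ D, ∀ a ∈ N, jetOf (fun m' => ψ m' a) m ∈ W
  sol_jet : ∀ m ∈ D, ∀ a ∈ N, sol (jetOf (fun m' => ψ m' a) m) = a
  base_mem : ∀ j ∈ W, (j 0, j 1) ∈ D
  sol_mem : ∀ j ∈ W, sol j ∈ N
  jet_sol : ∀ j ∈ W, jetOf (fun m => ψ m (sol j)) (j 0, j 1) = j

/-- The bilinear form `G = 2(θ¹θ² + θ³θ⁴)`, where `αβ` is the symmetrized product
`(α ⊗ β + β ⊗ α)/2`. -/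
def formG (θ : Fin 4 → Lift → (Lift →L[ℝ] ℝ)) (u v₁ v₂ : Lift) : ℝ :=
  θ 0 u v₁ * θ 1 u v₂ + θ 1 u v₁ * θ 0 u v₂ + θ 2 u v₁ * θ 3 u v₂ + θ 3 u v₁ * θ 2 u v₂

/-- A smooth metric of signature `(+,+,-,-)` on the open set `N` of `ℝ⁴`. -/
def IsSplitMetric (N : Set (Fin 4 → ℝ))
    (γ : (Fin 4 → ℝ) → ((Fin 4 → ℝ) →L[ℝ] (Fin 4 → ℝ) →L[ℝ] ℝ)) : Prop :=
  ContDiffOn ℝ ∞ γ N ∧ ∀ a ∈ N, (∀ v₁ v₂, γ a v₁ v₂ = γ a v₂ v₁) ∧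
    ∃ e : Module.Basis (Fin 4) ℝ (Fin 4 → ℝ), ∀ i k,
      γ a (e i) (e k) = if i = k then (![1, 1, -1, -1] : Fin 4 → ℝ) i else 0

/-- `G` descends to a conformal metric of signature `(+,+,-,-)` on the leaf space of the foliation
of `P` by the integral manifolds of the distribution annihilated by `θ¹, …, θ⁴`. Around each point
of `P` there is an open set `V ⊆ P` and a general solution `z = ψ(x, y, a)`, `a ∈ N ⊆ ℝ⁴`, over the
jets of `V` such that the map `V → N` sending a point to the solution through its jet is a surjective
submersion with connected fibres whose vertical distribution is the one annihilated by
`θ¹, …, θ⁴` (so `N` is the leaf space, and also the solution space), and `G` is on `V` a positive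
multiple of the pullback of a metric on `N`. -/
def DescendsToConformalMetric (S : PDESystem) (P : Set Lift)
    (θ : Fin 4 → Lift → (Lift →L[ℝ] ℝ)) : Prop :=
  ∀ u₀ ∈ P, ∃ (V : Set Lift) (D : Set (ℝ × ℝ)) (N : Set (Fin 4 → ℝ))
    (ψ : ℝ × ℝ → (Fin 4 → ℝ) → ℝ) (sol : Jet → (Fin 4 → ℝ)),
    IsOpen V ∧ u₀ ∈ V ∧ V ⊆ P ∧ S.IsGeneralSolution D N (Prod.fst '' V) ψ sol ∧
    (fun u : Lift => sol u.1) '' V = N ∧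
    (∀ u ∈ V, Function.Surjective (fderiv ℝ (fun u' : Lift => sol u'.1) u)) ∧
    (∀ u ∈ V, ∀ v, (∀ i, θ i u v = 0) ↔ fderiv ℝ (fun u' : Lift => sol u'.1) u v = 0) ∧
    (∀ a ∈ N, IsConnected {u ∈ V | sol u.1 = a}) ∧
    ∃ (γ : (Fin 4 → ℝ) → ((Fin 4 → ℝ) →L[ℝ] (Fin 4 → ℝ) →L[ℝ] ℝ)) (φ : Lift → ℝ),
      IsSplitMetric N γ ∧ ContDiffOn ℝ ∞ φ V ∧ (∀ u ∈ V, 0 < φ u) ∧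
      ∀ u ∈ V, ∀ v₁ v₂, formG θ u v₁ v₂ = φ u * γ (sol u.1)
        (fderiv ℝ (fun u' : Lift => sol u'.1) u v₁) (fderiv ℝ (fun u' : Lift => sol u'.1) u v₂)

/-! ### Point transformations -/

/-- The point `(x, y, z)` under a jet. -/
def basePoint (j : Jet) : Fin 3 → ℝ := ![j 0, j 1, j 2]

/-- A point equivalence of two systems: a diffeomorphism `(x, y, z) ↦ base (x, y, z)` whose
prolongation to 2-jets carries the first system to the second. The prolongation `toFun` is a
diffeomorphism between the domains, covers `base`, and at each jet it satisfies the chain rule: with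
`(x̄, ȳ, z̄, p̄, q̄, s̄)` the components of `toFun`, the forms `dz̄ - p̄ dx̄ - q̄ dȳ`,
`dp̄ - R̄ dx̄ - s̄ dȳ` and `dq̄ - s̄ dx̄ - T̄ dȳ` vanish on the total derivatives `D_x`, `D_y` of the
first system. -/
structure PointEquivalence (S S' : PDESystem) where
  base : (Fin 3 → ℝ) → (Fin 3 → ℝ)
  baseInv : (Fin 3 → ℝ) → (Fin 3 → ℝ)
  toFun : Jet → Jet
  invFun : Jet → Jet
  smooth_base : ContDiffOn ℝ ∞ base (basePoint '' S.dom)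
  smooth_baseInv : ContDiffOn ℝ ∞ baseInv (basePoint '' S'.dom)
  smooth_toFun : ContDiffOn ℝ ∞ toFun S.dom
  smooth_invFun : ContDiffOn ℝ ∞ invFun S'.dom
  mapsTo : MapsTo toFun S.dom S'.dom
  mapsTo_inv : MapsTo invFun S'.dom S.dom
  left_inv : LeftInvOn invFun toFun S.dom
  right_inv : RightInvOn invFun toFun S'.dom
  base_toFun : ∀ j ∈ S.dom, basePoint (toFun j) = base (basePoint j)
  base_invFun : ∀ j ∈ S'.dom, basePoint (invFun j) = baseInv (basePoint j)
  prolongs_x : ∀ j ∈ S.dom,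
    lamForm (toFun j) (fderiv ℝ toFun j (vecDx S.R S.T j)) = 0 ∧
    S'.nu 0 (toFun j) (fderiv ℝ toFun j (vecDx S.R S.T j)) = 0 ∧
    S'.nu 1 (toFun j) (fderiv ℝ toFun j (vecDx S.R S.T j)) = 0
  prolongs_y : ∀ j ∈ S.dom,
    lamForm (toFun j) (fderiv ℝ toFun j (vecDy S.R S.T j)) = 0 ∧
    S'.nu 0 (toFun j) (fderiv ℝ toFun j (vecDy S.R S.T j)) = 0 ∧
    S'.nu 1 (toFun j) (fderiv ℝ toFun j (vecDy S.R S.T j)) = 0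

end

/-! The vector fields D_x and D_y commute, and their joint orbits are the 2-jets of solutions. The
forms λ, ν₁, ν₂, ν₃ span the covectors that annihilate both fields, so they are coordinates on
variations of a solution. A conformal metric on the solution space is therefore a quadratic form Q
in these four forms, nondegenerate of split signature, with L_{D_x}Q = ρ_x Q and L_{D_y}Q = ρ_y Q.

If in addition the hypersurfaces z = const (at fixed x, y) are to be null, Q is, up to a factor,
`metricForm`: Q = T_s ν₁² - 2ν₁ν₂ + R_s ν₂² + 2(1 - R_sT_s)λν₃ + Eλν₁ + Fλν₂ + Gλ². Compare
coefficients in the two conformal equations. Two of them determine E and F (`cE_cF_rel`), two more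
are J₁ = 0 and J₂ = 0 (`Dx_Rs`, `Dy_Ts`), one defines G, and the λν₃ coefficients hold
automatically. Five defects remain, all in terms divisible by λ. They vanish because the complete
lifts of D_x and D_y to the tangent bundle commute: applied to Q in both orders they give an
algebraic identity that kills first the linear defects and then the λ² defects (`def_top_eq_zero`,
`def_eq_zero`).

Since 1 - R_sT_s = w² > 0, the binary part of Q splits into real linear factors, and a multiple of Q
equals β₁β₂ + β₃β₄ with β₄ = λ. Conformal invariance places the Lie derivatives of β along D_x and
D_y in the conformal Lie algebra (`conformal_frame_algebra`), which gives the horizontal part of dβ.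
The vertical part can be absorbed into connection forms, except for one term in dβ₁ and one in dβ₂,
proportional to the s-derivatives of k = T_s/(1+w) and l = R_s/(1+w) (`exists_frameEquations`,
`pd_five_fk`). A five-parameter group of rescalings and shears preserves the conformal class and the
shape of these equations (`FrameEquations.change`). With its parameters as fibre coordinates, the
eleven-dimensional coframe results (`isNormalized_aux`).

For the leaf space, the joint flow of D_x and D_y yields charts (x, y, a) in which a = const is a
solution (`exists_solutionChart`). Values of Q on two variations of one solution obey the same
linear equation, so their quotient is constant, and Q descends (`SolutionChart.metricForm_eq`,
`descendsToConformalMetric`). Smoothness of flows is obtained from the inverse function theorem on a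
space of paths.

For point transformations, the prolongation formulas are differentiated once and twice in s. The
form R_sα² + 2αβ + T_sβ² is carried to a multiple of its counterpart, and R_ssα² + T_ssβ² likewise
up to a multiple of that form (`exists_relations`). Hence the values of the second form on the two
null lines of the first, which are K₁ and K₂, have invariant zeros. The bijection between null lines
is described by a continuous sign, constant on a connected domain. -/

/-! ### Smooth dependence of solutions of differential equations on initial values -/

section SmoothFlow

open Metric Filter Topology

universe u

/-- The inverse function theorem for smooth maps, with smoothness of the local inverse on its whole
domain. -/
theorem exists_openPartialHomeomorph_contDiffOn_symm {E F : Type*} [NormedAddCommGroup E]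
    [NormedSpace ℝ E] [CompleteSpace E] [NormedAddCommGroup F] [NormedSpace ℝ F]
    {f : E → F} {U : Set E} (hU : IsOpen U) (hf : ContDiffOn ℝ ∞ f U) {x₀ : E} (hx₀ : x₀ ∈ U)
    (f' : E ≃L[ℝ] F) (hf' : HasFDerivAt f (f' : E →L[ℝ] F) x₀) :
    ∃ h : OpenPartialHomeomorph E F, x₀ ∈ h.source ∧ h.source ⊆ U ∧ (∀ x, h x = f x) ∧
      ContDiffOn ℝ ∞ h.symm h.target := by
  have hat : ∀ x ∈ U, ContDiffAt ℝ ∞ f x := fun x hx => hf.contDiffAt (hU.mem_nhds hx)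
  let h₀ := (hat x₀ hx₀).toOpenPartialHomeomorph f hf' (by simp)
  have hcont : ContinuousOn (fderiv ℝ f) U := hf.continuousOn_fderiv_of_isOpen hU (by simp)
  -- Invertibility of the derivative is an open condition. Shrinking the source to `U'` makes the
  -- inverse smooth at every point of its domain and not only at the image of x₀.
  let U' : Set E := U ∩ fderiv ℝ f ⁻¹' range ((↑) : (E ≃L[ℝ] F) → (E →L[ℝ] F))
  have hU' : IsOpen U' := hcont.isOpen_inter_preimage hU ContinuousLinearEquiv.isOpen
  refine ⟨h₀.restrOpen U' hU', ?_, ?_, fun x => rfl, ?_⟩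
  · rw [OpenPartialHomeomorph.restrOpen_source]
    exact ⟨(hat x₀ hx₀).mem_toOpenPartialHomeomorph_source hf' (by simp), hx₀, f', hf'.fderiv.symm⟩
  · rw [OpenPartialHomeomorph.restrOpen_source]
    exact fun x hx => hx.2.1
  · intro y hy
    have hx := (h₀.restrOpen U' hU').map_target hy
    rw [OpenPartialHomeomorph.restrOpen_source] at hx
    obtain ⟨e, he⟩ := hx.2.2
    have hd := hat _ hx.2.1
    refine ((h₀.restrOpen U' hU').contDiffAt_symm (f₀' := e) hy ?_ hd).contDiffWithinAt
    rw [he]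
    exact (hd.differentiableAt (by simp)).hasFDerivAt

set_option linter.unusedSectionVars false

variable {E F : Type u} [NormedAddCommGroup E] [NormedSpace ℝ E] [NormedAddCommGroup F]
  [NormedSpace ℝ F] {K : Type*} [TopologicalSpace K] [CompactSpace K]

/-- The superposition operator `γ ↦ X ∘ γ` on continuous maps. -/
def superposition (K : Type*) [TopologicalSpace K] (X : E → F) (hX : Continuous X) (γ : C(K, E)) :
    C(K, F) :=
  ContinuousMap.comp ⟨X, hX⟩ γ

@[simp]
theorem superposition_apply (X : E → F) (hX : Continuous X) (γ : C(K, E)) (t : K) :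
    superposition K X hX γ t = X (γ t) := rfl

theorem continuous_superposition (X : E → F) (hX : Continuous X) :
    Continuous (superposition K X hX) :=
  ContinuousMap.continuous_postcomp _

/-- Pointwise application of a continuous family of operators to a continuous family of vectors. -/
noncomputable def pointwiseApply (K : Type*) [TopologicalSpace K] [CompactSpace K] (E F : Type u)
    [NormedAddCommGroup E] [NormedSpace ℝ E] [NormedAddCommGroup F] [NormedSpace ℝ F] :
    C(K, E →L[ℝ] F) →L[ℝ] C(K, E) →L[ℝ] C(K, F) :=
  LinearMap.mkContinuous₂
    (LinearMap.mk₂ ℝ (fun (A : C(K, E →L[ℝ] F)) (γ : C(K, E)) =>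
        (⟨fun t => A t (γ t), by fun_prop⟩ : C(K, F)))
      (fun _ _ _ => by ext; simp) (fun _ _ _ => by ext; simp) (fun _ _ _ => by ext; simp)
      (fun _ _ _ => by ext; simp)) 1 (by
    intro A γ
    refine (ContinuousMap.norm_le _ (by positivity)).2 fun t => ?_
    calc ‖A t (γ t)‖ ≤ ‖A t‖ * ‖γ t‖ := (A t).le_opNorm _
      _ ≤ 1 * ‖A‖ * ‖γ‖ := by
        rw [one_mul]
        gcongr
        · exact A.norm_coe_le_norm t
        · exact γ.norm_coe_le_norm t)

/-- The remainder is estimated uniformly in t: γ ↦ `fderiv ℝ X` ∘ γ is continuous for the sup norm,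
so the mean value inequality on the segment from γ t to γ t + η t gives one δ for all t. -/
theorem hasFDerivAt_superposition (X : E → F) (hX : ContDiff ℝ ∞ X) (γ : C(K, E)) :
    HasFDerivAt (superposition K X hX.continuous)
      (pointwiseApply K E F
        (superposition K (fderiv ℝ X) (hX.continuous_fderiv (by simp)) γ)) γ := by
  rw [hasFDerivAt_iff_isLittleO_nhds_zero, Asymptotics.isLittleO_iff]
  intro c hc
  have hcont := (continuous_superposition (K := K) (fderiv ℝ X)
    (hX.continuous_fderiv (by simp))).continuousAt (x := γ)
  obtain ⟨δ, hδ, h⟩ := Metric.continuousAt_iff.1 hcont c hc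
  filter_upwards [ball_mem_nhds (0 : C(K, E)) hδ] with η hη
  rw [mem_ball_zero_iff] at hη
  refine (ContinuousMap.norm_le _ (by positivity)).2 fun t => ?_
  have key : ‖X (γ t + η t) - X (γ t) - fderiv ℝ X (γ t) (γ t + η t - γ t)‖
      ≤ c * ‖γ t + η t - γ t‖ := by
    refine (convex_segment (𝕜 := ℝ) (γ t) (γ t + η t)).norm_image_sub_le_of_norm_hasFDerivWithin_le'
      (f' := fderiv ℝ X)
      (fun x _ => (hX.differentiable (by simp) x).hasFDerivAt.hasFDerivWithinAt) ?_
      (left_mem_segment ℝ _ _) (right_mem_segment ℝ _ _)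
    intro x hx
    rw [segment_eq_image'] at hx
    obtain ⟨s, hs, rfl⟩ := hx
    have h1 : dist (γ + s • η) γ < δ := by
      rw [dist_eq_norm, add_sub_cancel_left, norm_smul, Real.norm_of_nonneg hs.1]
      exact lt_of_le_of_lt (mul_le_of_le_one_left (norm_nonneg _) hs.2) hη
    have h2 := (ContinuousMap.norm_coe_le_norm _ t).trans ((dist_eq_norm _ _).symm.le.trans
      (h h1).le)
    simpa using h2
  rw [add_sub_cancel_left] at key
  exact key.trans (by gcongr; exact η.norm_coe_le_norm t)

/-- Induction on the order of differentiability. The derivative is a bounded linear map applied to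
the superposition operator of `fderiv ℝ X`, which is of the same kind with another target space;
hence `F` is generalized. -/
theorem contDiff_superposition (X : E → F) (hX : ContDiff ℝ ∞ X) :
    ContDiff ℝ ∞ (superposition K X hX.continuous) := by
  rw [contDiff_infty]
  intro n
  induction n generalizing F with
  | zero => exact contDiff_zero.2 (continuous_superposition _ _)
  | succ n ih =>
    have hX' : ContDiff ℝ ∞ (fderiv ℝ X) := hX.fderiv_right (by simp)
    rw [show ((n + 1 : ℕ) : WithTop ℕ∞) = (n : WithTop ℕ∞) + 1 by push_cast; rfl,
      contDiff_succ_iff_fderiv]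
    refine ⟨fun γ => (hasFDerivAt_superposition X hX γ).differentiableAt, by simp, ?_⟩
    have : fderiv ℝ (superposition K X hX.continuous) = fun γ => pointwiseApply K E F
        (superposition K (fderiv ℝ X) (hX.continuous_fderiv (by simp)) γ) :=
      funext fun γ => (hasFDerivAt_superposition X hX γ).fderiv
    rw [this]
    exact (pointwiseApply K E F).contDiff.comp (ih _ hX')

/-- Integration from the left end point of the unit interval. -/
noncomputable def primitiveCLM (E : Type u) [NormedAddCommGroup E] [NormedSpace ℝ E] :
    C(unitInterval, E) →L[ℝ] C(unitInterval, E) :=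
  LinearMap.mkContinuous
    { toFun := fun γ => ⟨fun t => ∫ s in (0 : ℝ)..t, γ (projIcc 0 1 zero_le_one s),
        (intervalIntegral.continuous_primitive
          (fun a b => (γ.continuous.comp continuous_projIcc).intervalIntegrable a b) 0).comp
          continuous_subtype_val⟩
      map_add' := fun γ η => by
        ext t
        exact intervalIntegral.integral_add
          ((γ.continuous.comp continuous_projIcc).intervalIntegrable _ _)
          ((η.continuous.comp continuous_projIcc).intervalIntegrable _ _)
      map_smul' := fun c γ => by
        ext t
        exact intervalIntegral.integral_smul c _ } 1 (by
    intro γ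
    refine (ContinuousMap.norm_le _ (by positivity)).2 fun t => ?_
    refine (intervalIntegral.norm_integral_le_of_norm_le_const
      (C := ‖γ‖) fun s _ => γ.norm_coe_le_norm _).trans ?_
    rw [one_mul, sub_zero, abs_of_nonneg t.2.1]
    exact mul_le_of_le_one_right (norm_nonneg _) t.2.2)

theorem primitiveCLM_apply (γ : C(unitInterval, E)) (t : unitInterval) :
    primitiveCLM E γ t = ∫ s in (0 : ℝ)..t, γ (projIcc 0 1 zero_le_one s) := rfl

/-- The constant path, as a continuous linear map. -/
noncomputable def constPath (E : Type u) [NormedAddCommGroup E] [NormedSpace ℝ E] :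
    E →L[ℝ] C(unitInterval, E) :=
  LinearMap.mkContinuous
    { toFun := fun x => ContinuousMap.const _ x
      map_add' := fun _ _ => rfl
      map_smul' := fun _ _ => rfl } 1 (by
    intro x
    exact (ContinuousMap.norm_le _ (by positivity)).2 fun t => (one_mul ‖x‖).ge)

@[simp]
theorem constPath_apply (x : E) (t : unitInterval) : constPath E x t = x := rfl

/-- The map whose zero fibres over `(t, x)` are the solutions, reparametrized to the unit interval, of
`γ' = X γ`, `γ 0 = x` on `[0, t]`. -/
noncomputable def pathMap (X : E → E) (hX : ContDiff ℝ ∞ X) (r : (ℝ × E) × C(unitInterval, E)) :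
    (ℝ × E) × C(unitInterval, E) :=
  (r.1, r.2 - constPath E r.1.2
    - r.1.1 • primitiveCLM E (superposition unitInterval X hX.continuous r.2))

theorem contDiff_pathMap (X : E → E) (hX : ContDiff ℝ ∞ X) : ContDiff ℝ ∞ (pathMap X hX) := by
  have h1 := contDiff_superposition (K := unitInterval) X hX
  unfold pathMap
  fun_prop

/-- At t = 0 the factor in front of the integral vanishes, so the derivative of X drops out. What
remains is unipotent: the identity on (t, x), and on paths the identity minus a map `B` of (t, x)
alone. Changing the sign of `B` inverts it. -/
theorem exists_hasFDerivAt_pathMap (X : E → E) (hX : ContDiff ℝ ∞ X) (x₀ : E) :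
    ∃ e : ((ℝ × E) × C(unitInterval, E)) ≃L[ℝ] ((ℝ × E) × C(unitInterval, E)),
      HasFDerivAt (pathMap X hX) (e : ((ℝ × E) × C(unitInterval, E)) →L[ℝ] _)
        ((0, x₀), constPath E x₀) := by
  let c := primitiveCLM E (superposition unitInterval X hX.continuous (constPath E x₀))
  let P := ContinuousLinearMap.fst ℝ (ℝ × E) C(unitInterval, E)
  let N := ContinuousLinearMap.snd ℝ (ℝ × E) C(unitInterval, E)
  let B := (constPath E).comp ((ContinuousLinearMap.snd ℝ ℝ E).comp P)
    + ((ContinuousLinearMap.fst ℝ ℝ E).comp P).smulRight c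
  let e := ContinuousLinearEquiv.equivOfInverse (P.prod (N - B)) (P.prod (N + B))
    (fun r => by ext <;> simp [P, N, B]) (fun r => by ext <;> simp [P, N, B])
  refine ⟨e, ?_⟩
  have h1 : HasFDerivAt (superposition unitInterval X hX.continuous) _
      (((0, x₀), constPath E x₀) : (ℝ × E) × C(unitInterval, E)).2 :=
    ((contDiff_superposition (K := unitInterval) X hX).differentiable (by simp)
      (constPath E x₀)).hasFDerivAt
  have h2 : HasFDerivAt (fun r : (ℝ × E) × C(unitInterval, E) =>
      primitiveCLM E (superposition unitInterval X hX.continuous r.2)) _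
      ((0, x₀), constPath E x₀) :=
    (primitiveCLM E).hasFDerivAt.comp _ (h1.comp _ hasFDerivAt_snd)
  have h3 : HasFDerivAt (fun r : (ℝ × E) × C(unitInterval, E) => r.1.1)
      ((ContinuousLinearMap.fst ℝ ℝ E).comp P) ((0, x₀), constPath E x₀) :=
    ((ContinuousLinearMap.fst ℝ ℝ E).comp P).hasFDerivAt
  have h4 : HasFDerivAt (fun r : (ℝ × E) × C(unitInterval, E) => r.2 - constPath E r.1.2)
      (N - (constPath E).comp ((ContinuousLinearMap.snd ℝ ℝ E).comp P)) ((0, x₀), constPath E x₀) :=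
    (N - (constPath E).comp ((ContinuousLinearMap.snd ℝ ℝ E).comp P)).hasFDerivAt
  have h5 := (P.hasFDerivAt (x := (((0, x₀), constPath E x₀) : (ℝ × E) × C(unitInterval, E)))).prodMk
    (h4.sub (h3.smul h2))
  refine h5.congr_fderiv ?_
  ext r <;> simp [e, P, N, B, c, ContinuousLinearEquiv.equivOfInverse, sub_sub]


/-- Multiplication by a bump function. The superposition operator is defined only for fields that
are smooth on the whole space. -/
theorem exists_contDiff_eqOn_ball [FiniteDimensional ℝ E] {X : E → F} {O : Set E} (hO : IsOpen O)
    (hX : ContDiffOn ℝ ∞ X O) {x₀ : E} (hx₀ : x₀ ∈ O) :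
    ∃ Y : E → F, ContDiff ℝ ∞ Y ∧ ∃ ρ > 0, ball x₀ ρ ⊆ O ∧ EqOn Y X (ball x₀ ρ) := by
  obtain ⟨ρ, hρ, hsub⟩ := Metric.isOpen_iff.1 hO x₀ hx₀
  let χ : ContDiffBump x₀ := ⟨ρ / 4, ρ / 2, by positivity, by linarith⟩
  refine ⟨fun x => χ x • X x, ?_, ρ / 4, by positivity,
    (ball_subset_ball (by linarith)).trans hsub, fun x hx => ?_⟩
  · rw [contDiff_iff_contDiffAt]
    intro x
    by_cases hx : x ∈ ball x₀ ρ
    · exact χ.contDiff.contDiffAt.smul (hX.contDiffAt (hO.mem_nhds (hsub hx)))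
    · have hx' : x ∈ (closedBall x₀ (ρ / 2))ᶜ := fun h =>
        hx (closedBall_subset_ball (by linarith) h)
      have : (fun x => χ x • X x) =ᶠ[𝓝 x] fun _ => 0 := by
        filter_upwards [isClosed_closedBall.isOpen_compl.mem_nhds hx'] with y hy
        rw [χ.zero_of_le_dist (by simpa [χ] using (not_le.1 (show ¬ dist y x₀ ≤ ρ / 2 from hy)).le), zero_smul]
      exact contDiffAt_const.congr_of_eventuallyEq this
  · simp only
    rw [χ.one_of_mem_closedBall (ball_subset_closedBall hx), one_smul]

/-- A smooth vector field has a smooth local flow. -/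
theorem exists_smooth_local_flow [FiniteDimensional ℝ E] {X : E → E} {O : Set E} (hO : IsOpen O)
    (hX : ContDiffOn ℝ ∞ X O) {x₀ : E} (hx₀ : x₀ ∈ O) :
    ∃ φ : ℝ × E → E, ∃ ε > 0, ContDiffOn ℝ ∞ φ (ball 0 ε ×ˢ ball x₀ ε) ∧
      ∀ x ∈ ball x₀ ε, φ (0, x) = x ∧ ∀ t ∈ ball (0 : ℝ) ε, φ (t, x) ∈ O ∧
        HasDerivAt (fun s => φ (s, x)) (X (φ (t, x))) t := by
  have : CompleteSpace E := FiniteDimensional.complete ℝ E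
  obtain ⟨Y, hY, ρ, hρ, hsub, hYX⟩ := exists_contDiff_eqOn_ball hO hX hx₀
  -- Picard–Lindelöf provides a flow `α` that is only jointly continuous. Its smoothness will follow
  -- by identifying it with a component of the local inverse of `pathMap`.
  obtain ⟨ε, hε, a, r, L, K, hr, hpl⟩ :=
    IsPicardLindelof.of_contDiffAt_one ((hY.of_le (by simp)).contDiffAt (x := x₀) : ContDiffAt ℝ 1 Y x₀)
  obtain ⟨α, hα, hαc⟩ := (hpl 0).exists_forall_mem_closedBall_eq_hasDerivWithinAt_continuousOn
  simp only [zero_sub, zero_add] at hα hαc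
  have hα0 : ∀ x ∈ ball x₀ r, α (x, 0) = x := fun x hx => (hα x (ball_subset_closedBall hx)).1
  have hαd : ∀ x ∈ ball x₀ r, ∀ t ∈ Ioo (-ε) ε,
      HasDerivAt (fun s => α (x, s)) (Y (α (x, t))) t := fun x hx t ht =>
    ((hα x (ball_subset_closedBall hx)).2 t (Ioo_subset_Icc_self ht)).hasDerivAt
      (Icc_mem_nhds ht.1 ht.2)
  obtain ⟨e, he⟩ := exists_hasFDerivAt_pathMap Y hY x₀
  obtain ⟨h, hsrc, -, hval, hsymm⟩ := exists_openPartialHomeomorph_contDiffOn_symm isOpen_univ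
    (contDiff_pathMap Y hY).contDiffOn (mem_univ ((0, x₀), constPath E x₀)) e he
  obtain ⟨δ, hδ, hball⟩ := Metric.isOpen_iff.1 h.open_source _ hsrc
  -- nearby initial data stay near
  have hnear : ∃ η > 0, η ≤ ε ∧ η ≤ r ∧ η ≤ δ ∧ ∀ x ∈ ball x₀ η, ∀ t ∈ ball (0 : ℝ) η,
      dist (α (x, t)) x₀ < min ρ (δ / 2) := by
    have hc : ContinuousAt α (x₀, 0) := hαc.continuousAt
      (prod_mem_nhds (closedBall_mem_nhds _ hr) (Icc_mem_nhds (by linarith) hε))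
    obtain ⟨η, hη, hh⟩ := Metric.continuousAt_iff.1 hc (min ρ (δ / 2)) (by positivity)
    rw [hα0 x₀ (mem_ball_self hr)] at hh
    have hr' : (0 : ℝ) < r := hr
    refine ⟨min (min ε r) (min δ η), by positivity, (min_le_left _ _).trans (min_le_left _ _),
      (min_le_left _ _).trans (min_le_right _ _), (min_le_right _ _).trans (min_le_left _ _),
      fun x hx t ht => hh ?_⟩
    rw [Prod.dist_eq]
    exact max_lt (lt_of_lt_of_le hx ((min_le_right _ _).trans (min_le_right _ _)))
      (lt_of_lt_of_le ht ((min_le_right _ _).trans (min_le_right _ _)))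
  obtain ⟨η, hη, hηε, hηr, hηδ, hnear⟩ := hnear
  have hmul : ∀ t ∈ ball (0 : ℝ) η, ∀ s ∈ Icc (0 : ℝ) 1, t * s ∈ ball (0 : ℝ) η := by
    intro t ht s hs
    rw [mem_ball_zero_iff] at ht ⊢
    rw [norm_mul, Real.norm_of_nonneg hs.1]
    exact lt_of_le_of_lt (mul_le_of_le_one_right (norm_nonneg _) hs.2) ht
  have hIoo : ∀ t ∈ ball (0 : ℝ) η, t ∈ Ioo (-ε) ε := by
    intro t ht
    rw [mem_ball_zero_iff, Real.norm_eq_abs] at ht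
    exact abs_lt.1 (lt_of_lt_of_le ht hηε)
  have hkey : ∀ x ∈ ball x₀ η, ∀ t ∈ ball (0 : ℝ) η, ((t, x), (0 : C(unitInterval, E))) ∈ h.target ∧
      α (x, t) = (h.symm ((t, x), 0)).2 1 := by
    intro x hx t ht
    have hxr : x ∈ ball x₀ (r : ℝ) := ball_subset_ball hηr hx
    have hd : ∀ s ∈ Icc (0 : ℝ) 1,
        HasDerivAt (fun s => α (x, t * s)) (t • Y (α (x, t * s))) s := by
      intro s hs
      have h1 := hαd x hxr (t * s) (hIoo _ (hmul t ht s hs))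
      have h2 : HasDerivAt (fun s : ℝ => t * s) t s := by
        simpa using (hasDerivAt_id s).const_mul t
      exact h1.scomp s h2
    -- The orbit over [0, t], reparametrized to [0, 1]. It is a zero of the path component of
    -- `pathMap` and stays near the constant path, so it is the value of the local inverse at ((t,
    -- x), 0), which depends smoothly on (t, x). Evaluation at 1 recovers α(x, t).
    let γ : C(unitInterval, E) := ⟨fun s => α (x, t * s),
      ContinuousOn.domRestrict fun s hs => (hd s hs).continuousAt.continuousWithinAt⟩
    have hγv : ∀ s, γ s = α (x, t * s) := fun s => rfl
    have hγ : ((t, x), γ) ∈ h.source := by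
      refine hball ?_
      rw [mem_ball, Prod.dist_eq]
      refine max_lt (lt_of_lt_of_le ?_ hηδ) ?_
      · rw [Prod.dist_eq]
        exact max_lt ht hx
      · refine lt_of_le_of_lt ((ContinuousMap.dist_le (C := δ / 2) (by positivity)).2 fun s => ?_)
          (by linarith)
        exact ((hnear x hx _ (hmul t ht s s.2)).le).trans (min_le_right _ _)
    have hG : h ((t, x), γ) = ((t, x), 0) := by
      rw [hval, pathMap]
      refine Prod.ext rfl ?_
      ext s
      have hsub : uIcc (0 : ℝ) s ⊆ Icc 0 1 := by
        rw [uIcc_of_le s.2.1]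
        exact Icc_subset_Icc_right s.2.2
      have hint : ∫ τ in (0 : ℝ)..s, t • Y (α (x, t * τ)) = α (x, t * s) - α (x, t * 0) := by
        refine intervalIntegral.integral_eq_sub_of_hasDerivAt (fun τ hτ => hd τ (hsub hτ)) ?_
        refine ContinuousOn.intervalIntegrable fun τ hτ => ?_
        exact ((hY.continuous.continuousAt.comp (hd τ (hsub hτ)).continuousAt).const_smul
          t).continuousWithinAt
      rw [mul_zero, hα0 x hxr] at hint
      have hcongr : ∫ τ in (0 : ℝ)..s, Y (γ (projIcc 0 1 zero_le_one τ))
          = ∫ τ in (0 : ℝ)..s, Y (α (x, t * τ)) := by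
        refine intervalIntegral.integral_congr fun τ hτ => ?_
        simp only [hγv, projIcc_of_mem zero_le_one (hsub hτ)]
      rw [intervalIntegral.integral_smul] at hint
      simp only [ContinuousMap.sub_apply, ContinuousMap.smul_apply, primitiveCLM_apply,
        superposition_apply, constPath_apply, hcongr, hint, ContinuousMap.zero_apply]
      simp [hγv]
    have hsy : h.symm ((t, x), 0) = ((t, x), γ) := by
      rw [← hG, h.left_inv hγ]
    refine ⟨hG ▸ h.map_source hγ, ?_⟩
    rw [hsy]
    simp [hγv]
  refine ⟨fun p => α (p.2, p.1), η, hη, ?_, fun x hx => ⟨hα0 x (ball_subset_ball hηr hx),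
    fun t ht => ?_⟩⟩
  · have h1 : ContDiffOn ℝ ∞ (fun p : ℝ × E => (h.symm (p, 0)).2 1) (ball 0 η ×ˢ ball x₀ η) := by
      have h2 : ContDiffOn ℝ ∞ (fun p : ℝ × E => h.symm (p, 0)) (ball 0 η ×ˢ ball x₀ η) :=
        hsymm.comp (contDiff_id.prodMk contDiff_const).contDiffOn
          fun p hp => (hkey p.2 hp.2 p.1 hp.1).1
      exact (ContinuousMap.evalCLM ℝ (1 : unitInterval)).contDiff.comp_contDiffOn
        (contDiff_snd.comp_contDiffOn h2)
    exact h1.congr fun p hp => (hkey p.2 hp.2 p.1 hp.1).2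
  · have h1 : α (x, t) ∈ ball x₀ ρ := (hnear x hx t ht).trans_le (min_le_left _ _)
    refine ⟨hsub h1, ?_⟩
    have h2 := hαd x (ball_subset_ball hηr hx) t (hIoo t ht)
    rwa [hYX h1] at h2

end SmoothFlow

/-! ### Derivatives along vector fields -/

section LieDerivative

theorem minSmoothness_two_le_infty : minSmoothness ℝ 2 ≤ ∞ := by
  rw [minSmoothness_of_isRCLikeNormedField]
  exact WithTop.coe_le_coe.2 (le_top : (2 : ℕ∞) ≤ ⊤)

variable {E : Type*} [NormedAddCommGroup E] [NormedSpace ℝ E]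

/-- The derivative of the function `F` along the vector field `V`. -/
noncomputable def lieD (V : E → E) (F : E → ℝ) (x : E) : ℝ := fderiv ℝ F x (V x)

/-- The complete lift of a vector field to the tangent bundle. -/
noncomputable def tangentLift (V : E → E) (x : E × E) : E × E := (V x.1, fderiv ℝ V x.1 x.2)

theorem hasDerivAt_lieD {V : E → E} {F : E → ℝ} {x : E} (hF : DifferentiableAt ℝ F x) :
    HasDerivAt (fun t : ℝ => F (x + t • V x)) (lieD V F x) 0 := by
  have h1 : HasDerivAt (fun t : ℝ => x + t • V x) (V x) 0 := by
    simpa using ((hasDerivAt_id (0 : ℝ)).smul_const (V x)).const_add x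
  have h2 : HasFDerivAt F (fderiv ℝ F x) (x + (0 : ℝ) • V x) := by
    simpa using hF.hasFDerivAt
  exact h2.comp_hasDerivAt 0 h1

theorem lieD_congr {V : E → E} {F G : E → ℝ} {O : Set E} (hO : IsOpen O) (h : EqOn F G O) {x : E}
    (hx : x ∈ O) : lieD V F x = lieD V G x := by
  rw [lieD, lieD, (h.eventuallyEq_of_mem (hO.mem_nhds hx)).fderiv_eq]

theorem contDiffOn_lieD {V : E → E} {F : E → ℝ} {O : Set E} (hO : IsOpen O)
    (hV : ContDiffOn ℝ ∞ V O) (hF : ContDiffOn ℝ ∞ F O) : ContDiffOn ℝ ∞ (lieD V F) O :=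
  (hF.fderiv_of_isOpen hO (by simp)).clm_apply hV

theorem contDiffOn_tangentLift {V : E → E} {O : Set E} (hO : IsOpen O) (hV : ContDiffOn ℝ ∞ V O) :
    ContDiffOn ℝ ∞ (tangentLift V) (O ×ˢ univ) := by
  have hf : ContDiffOn ℝ ∞ (fun x : E × E => fderiv ℝ V x.1) (O ×ˢ univ) :=
    (hV.fderiv_of_isOpen hO (by simp)).comp contDiffOn_fst fun x hx => hx.1
  exact (hV.comp contDiffOn_fst fun x hx => hx.1).prodMk (hf.clm_apply contDiffOn_snd)

theorem fderiv_lieD {V : E → E} {F : E → ℝ} {O : Set E} (hO : IsOpen O)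
    (hV : ContDiffOn ℝ ∞ V O) (hF : ContDiffOn ℝ ∞ F O) {x : E} (hx : x ∈ O) (v : E) :
    fderiv ℝ (lieD V F) x v = fderiv ℝ (fderiv ℝ F) x v (V x) + fderiv ℝ F x (fderiv ℝ V x v) := by
  have h1 : DifferentiableAt ℝ (fderiv ℝ F) x :=
    ((hF.fderiv_of_isOpen hO (m := ∞) (by simp)).contDiffAt (hO.mem_nhds hx)).differentiableAt
      (by simp)
  have h2 : DifferentiableAt ℝ V x := (hV.contDiffAt (hO.mem_nhds hx)).differentiableAt (by simp)
  have := fderiv_clm_apply h1 h2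
  unfold lieD
  rw [this]
  simp [add_comm]

/-- Derivatives along commuting vector fields commute. -/
theorem lieD_comm {V W : E → E} {F : E → ℝ} {O : Set E} (hO : IsOpen O)
    (hV : ContDiffOn ℝ ∞ V O) (hW : ContDiffOn ℝ ∞ W O) (hF : ContDiffOn ℝ ∞ F O)
    (hVW : ∀ x ∈ O, fderiv ℝ V x (W x) = fderiv ℝ W x (V x)) {x : E} (hx : x ∈ O) :
    lieD V (lieD W F) x = lieD W (lieD V F) x := by
  rw [lieD, fderiv_lieD hO hW hF hx, lieD, fderiv_lieD hO hV hF hx, hVW x hx]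
  have hs : IsSymmSndFDerivAt ℝ F x :=
    (hF.contDiffAt (hO.mem_nhds hx)).isSymmSndFDerivAt minSmoothness_two_le_infty
  rw [hs.eq]

theorem hasFDerivAt_tangentLift {V : E → E} {O : Set E} (hO : IsOpen O)
    (hV : ContDiffOn ℝ ∞ V O) {x : E × E} (hx : x.1 ∈ O) (y : E × E) :
    fderiv ℝ (tangentLift V) x y = (fderiv ℝ V x.1 y.1,
      fderiv ℝ (fderiv ℝ V) x.1 y.1 x.2 + fderiv ℝ V x.1 y.2) := by
  have h2 : HasFDerivAt V _ x.1 :=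
    ((hV.contDiffAt (hO.mem_nhds hx)).differentiableAt (by simp)).hasFDerivAt
  have h1 : HasFDerivAt (fderiv ℝ V) _ x.1 :=
    (((hV.fderiv_of_isOpen hO (m := ∞) (by simp)).contDiffAt (hO.mem_nhds hx)).differentiableAt
      (by simp)).hasFDerivAt
  have h3 := (h2.comp x hasFDerivAt_fst).prodMk ((h1.comp x hasFDerivAt_fst).clm_apply
    hasFDerivAt_snd)
  rw [show tangentLift V = fun x => (V x.1, fderiv ℝ V x.1 x.2) from rfl]
  erw [h3.fderiv]
  simp [add_comm]

/-- The complete lifts of commuting vector fields commute. -/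
theorem tangentLift_comm {V W : E → E} {O : Set E} (hO : IsOpen O)
    (hV : ContDiffOn ℝ ∞ V O) (hW : ContDiffOn ℝ ∞ W O)
    (hVW : ∀ x ∈ O, fderiv ℝ V x (W x) = fderiv ℝ W x (V x)) {x : E × E}
    (hx : x ∈ O ×ˢ (univ : Set E)) :
    fderiv ℝ (tangentLift V) x (tangentLift W x) = fderiv ℝ (tangentLift W) x (tangentLift V x) := by
  rw [hasFDerivAt_tangentLift hO hV hx.1, hasFDerivAt_tangentLift hO hW hx.1]
  have hVd := hV.contDiffAt (hO.mem_nhds hx.1)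
  have hWd := hW.contDiffAt (hO.mem_nhds hx.1)
  have hVs : IsSymmSndFDerivAt ℝ V x.1 := hVd.isSymmSndFDerivAt minSmoothness_two_le_infty
  have hWs : IsSymmSndFDerivAt ℝ W x.1 := hWd.isSymmSndFDerivAt minSmoothness_two_le_infty
  have d1 : DifferentiableAt ℝ (fderiv ℝ V) x.1 :=
    ((hV.fderiv_of_isOpen hO (m := ∞) (by simp)).contDiffAt (hO.mem_nhds hx.1)).differentiableAt
      (by simp)
  have d2 : DifferentiableAt ℝ (fderiv ℝ W) x.1 :=
    ((hW.fderiv_of_isOpen hO (m := ∞) (by simp)).contDiffAt (hO.mem_nhds hx.1)).differentiableAt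
      (by simp)
  have e1 := fderiv_clm_apply d1 (hWd.differentiableAt (by simp))
  have e2 := fderiv_clm_apply d2 (hVd.differentiableAt (by simp))
  -- The fibre component of the bracket of two complete lifts is the derivative of the bracket of
  -- the fields. Differentiating the relation [V, W] = 0 and using symmetry of second derivatives
  -- therefore suffices.
  have e3 : fderiv ℝ (fun y => fderiv ℝ V y (W y)) x.1 = fderiv ℝ (fun y => fderiv ℝ W y (V y)) x.1 :=
    (Set.EqOn.eventuallyEq_of_mem hVW (hO.mem_nhds hx.1)).fderiv_eq
  rw [e1, e2] at e3
  have e4 := congrArg (fun A => A x.2) e3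
  simp only [add_apply, ContinuousLinearMap.comp_apply,
    ContinuousLinearMap.flip_apply] at e4
  refine Prod.ext (hVW _ hx.1) ?_
  simp only [tangentLift]
  rw [hVs.eq, hWs.eq, add_comm, e4, add_comm]

end LieDerivative

/-! ### The exterior derivative -/

section ExteriorDerivative

variable {E : Type*} [NormedAddCommGroup E] [NormedSpace ℝ E]

theorem fderiv_eval {α : E → (E →L[ℝ] ℝ)} {u : E} (h : DifferentiableAt ℝ α u) (v w : E) :
    fderiv ℝ (fun y => α y w) u v = fderiv ℝ α u v w := by
  rw [fderiv_clm_apply h (differentiableAt_const w)]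
  simp

theorem dForm_eq_eval {α : E → (E →L[ℝ] ℝ)} {u : E} (h : DifferentiableAt ℝ α u) (v₁ v₂ : E) :
    dForm α u v₁ v₂ = fderiv ℝ (fun y => α y v₂) u v₁ - fderiv ℝ (fun y => α y v₁) u v₂ := by
  rw [dForm_eq α u v₁ v₂ h, fderiv_eval h, fderiv_eval h]

theorem dForm_add {α β : E → (E →L[ℝ] ℝ)} {u : E} (hα : DifferentiableAt ℝ α u)
    (hβ : DifferentiableAt ℝ β u) (v₁ v₂ : E) :
    dForm (fun y => α y + β y) u v₁ v₂ = dForm α u v₁ v₂ + dForm β u v₁ v₂ := by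
  rw [dForm_eq (fun y => α y + β y) _ _ _ (hα.add hβ), dForm_eq _ _ _ _ hα, dForm_eq _ _ _ _ hβ, fderiv_fun_add hα hβ]
  simp only [add_apply]
  ring

theorem dForm_smul {f : E → ℝ} {α : E → (E →L[ℝ] ℝ)} {u : E} (hf : DifferentiableAt ℝ f u)
    (hα : DifferentiableAt ℝ α u) (v₁ v₂ : E) :
    dForm (fun y => f y • α y) u v₁ v₂ = wedge (fderiv ℝ f u) (α u) v₁ v₂ + f u * dForm α u v₁ v₂ := by
  rw [dForm_eq (fun y => f y • α y) _ _ _ (hf.smul hα), dForm_eq _ _ _ _ hα, fderiv_fun_smul hf hα, wedge]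
  simp
  ring

end ExteriorDerivative

/-- The exterior derivative commutes with the pullback to the lifted space. -/
theorem dForm_pull {α : Jet → (Jet →L[ℝ] ℝ)} {u : Lift} (h : DifferentiableAt ℝ α u.1)
    (v₁ v₂ : Lift) :
    dForm (fun y : Lift => GroupParams.pull (α y.1)) u v₁ v₂ = dForm α u.1 v₁.1 v₂.1 := by
  have hc : DifferentiableAt ℝ (fun y : Lift => α y.1) u := h.comp u differentiableAt_fst
  have hp : DifferentiableAt ℝ (fun y : Lift => GroupParams.pull (α y.1)) u :=
    hc.clm_comp (differentiableAt_const _)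
  rw [dForm_eq_eval hp, dForm_eq_eval h]
  have key : ∀ a b : Lift, fderiv ℝ (fun y : Lift => GroupParams.pull (α y.1) a) u b
      = fderiv ℝ (fun y => α y a.1) u.1 b.1 := by
    intro a b
    have hd : DifferentiableAt ℝ (fun y => α y a.1) u.1 := h.clm_apply (differentiableAt_const _)
    have := (hd.hasFDerivAt.comp u (hasFDerivAt_fst (𝕜 := ℝ) (p := u))).fderiv
    exact congrArg (fun A => A b) this
  rw [key, key]

/-! ### Calculus of the total derivatives -/

theorem lamForm_apply (j v : Jet) : lamForm j v = v 2 - j 3 * v 0 - j 4 * v 1 := by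
  simp [lamForm]

theorem muForm_zero_apply (v : Jet) : muForm 0 v = v 0 := by simp [muForm]

theorem muForm_one_apply (v : Jet) : muForm 1 v = v 1 := by simp [muForm]

theorem contDiff_lamForm : ContDiff ℝ ∞ lamForm := by
  unfold lamForm
  fun_prop

theorem contDiffOn_pd {O : Set Jet} (hO : IsOpen O) {F : Jet → ℝ} (hF : ContDiffOn ℝ ∞ F O)
    (i : Fin 6) : ContDiffOn ℝ ∞ (pd i F) O :=
  (hF.fderiv_of_isOpen hO (by simp)).clm_apply contDiffOn_const

namespace PDESystem

variable (S : PDESystem)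

/-- The function `D_y R`. -/
noncomputable abbrev U : Jet → ℝ := dyR S.R S.T

/-- The function `D_x T`. -/
noncomputable abbrev V : Jet → ℝ := dxT S.R S.T

/-- Smooth functions on the domain of the system. -/
abbrev Sm (F : Jet → ℝ) : Prop := ContDiffOn ℝ ∞ F S.dom

theorem nu_zero_apply (j v : Jet) : S.nu 0 j v = v 3 - S.R j * v 0 - j 5 * v 1 := by
  simp [nu]

theorem nu_one_apply (j v : Jet) : S.nu 1 j v = v 4 - j 5 * v 0 - S.T j * v 1 := by
  simp [nu]

theorem nu_two_apply (j v : Jet) : S.nu 2 j v = v 5 - S.U j * v 0 - S.V j * v 1 := by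
  simp [nu]

variable {S}

theorem Sm.differentiableAt {F : Jet → ℝ} (hF : S.Sm F) {j : Jet} (hj : j ∈ S.dom) :
    DifferentiableAt ℝ F j :=
  (hF.contDiffAt (S.isOpen_dom.mem_nhds hj)).differentiableAt (by simp)

theorem Sm.pd {F : Jet → ℝ} (hF : S.Sm F) (i : Fin 6) : S.Sm (_root_.pd i F) :=
  contDiffOn_pd S.isOpen_dom hF i

variable (S)

theorem sm_coord (i : Fin 6) : S.Sm fun j => j i :=
  (contDiff_apply ℝ ℝ i).contDiffOn

theorem sm_R : S.Sm S.R := S.smooth_R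

theorem sm_T : S.Sm S.T := S.smooth_T

theorem ne_one {j : Jet} (hj : j ∈ S.dom) : pd 5 S.R j * pd 5 S.T j ≠ 1 := by
  have := S.pos j hj
  intro h
  linarith

theorem sm_U : S.Sm S.U := by
  refine ContDiffOn.div ?_ ?_ fun j hj => (S.pos j hj).ne'
  · exact ContDiffOn.add
      ((((S.sm_R.pd 1).add ((S.sm_coord 4).mul (S.sm_R.pd 2))).add
        ((S.sm_coord 5).mul (S.sm_R.pd 3))).add (S.sm_T.mul (S.sm_R.pd 4)))
      ((S.sm_R.pd 5).mul ((((S.sm_T.pd 0).add ((S.sm_coord 3).mul (S.sm_T.pd 2))).add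
        (S.sm_R.mul (S.sm_T.pd 3))).add ((S.sm_coord 5).mul (S.sm_T.pd 4))))
  · exact contDiffOn_const.sub ((S.sm_R.pd 5).mul (S.sm_T.pd 5))

theorem sm_V : S.Sm S.V := by
  refine ContDiffOn.div ?_ ?_ fun j hj => (S.pos j hj).ne'
  · exact ContDiffOn.add
      ((((S.sm_T.pd 0).add ((S.sm_coord 3).mul (S.sm_T.pd 2))).add (S.sm_R.mul (S.sm_T.pd 3))).add
        ((S.sm_coord 5).mul (S.sm_T.pd 4)))
      ((S.sm_T.pd 5).mul ((((S.sm_R.pd 1).add ((S.sm_coord 4).mul (S.sm_R.pd 2))).add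
          ((S.sm_coord 5).mul (S.sm_R.pd 3))).add (S.sm_T.mul (S.sm_R.pd 4))))
  · exact contDiffOn_const.sub ((S.sm_R.pd 5).mul (S.sm_T.pd 5))

theorem smooth_vecDx : ContDiffOn ℝ ∞ (vecDx S.R S.T) S.dom := by
  refine contDiffOn_pi.2 fun i => ?_
  fin_cases i
  · exact contDiffOn_const
  · exact contDiffOn_const
  · exact S.sm_coord 3
  · exact S.sm_R
  · exact S.sm_coord 5
  · exact S.sm_U

theorem smooth_vecDy : ContDiffOn ℝ ∞ (vecDy S.R S.T) S.dom := by
  refine contDiffOn_pi.2 fun i => ?_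
  fin_cases i
  · exact contDiffOn_const
  · exact contDiffOn_const
  · exact S.sm_coord 4
  · exact S.sm_coord 5
  · exact S.sm_T
  · exact S.sm_V

variable {S}

theorem Sm.Dx {F : Jet → ℝ} (hF : S.Sm F) : S.Sm (S.Dx F) :=
  contDiffOn_lieD S.isOpen_dom S.smooth_vecDx hF

theorem Sm.Dy {F : Jet → ℝ} (hF : S.Sm F) : S.Sm (S.Dy F) :=
  contDiffOn_lieD S.isOpen_dom S.smooth_vecDy hF

variable (S)

theorem Dy_R {j : Jet} (hj : j ∈ S.dom) : S.Dy S.R j = S.U j := by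
  rw [Dy, opDy_eq, ← dyR_eq _ _ _ (S.ne_one hj)]

theorem Dx_T {j : Jet} (hj : j ∈ S.dom) : S.Dx S.T j = S.V j := by
  rw [Dx, opDx_eq, ← dxT_eq _ _ _ (S.ne_one hj)]

theorem Dx_V {j : Jet} (hj : j ∈ S.dom) : S.Dx S.V j = S.Dy S.U j := S.compat j hj

/-- The part of the differential of `F` in the span of `λ, ν₁, ν₂, ν₃`. -/
noncomputable def vert (F : Jet → ℝ) (j v : Jet) : ℝ :=
  pd 2 F j * lamForm j v + pd 3 F j * S.nu 0 j v + pd 4 F j * S.nu 1 j v + pd 5 F j * S.nu 2 j v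

theorem fderiv_eq_vert (F : Jet → ℝ) (j v : Jet) :
    fderiv ℝ F j v = v 0 * S.Dx F j + v 1 * S.Dy F j + S.vert F j v := by
  rw [fderiv_apply_eq_sum_pd, Dx, Dy, opDx_eq, opDy_eq, vert, lamForm_apply, nu_zero_apply,
    nu_one_apply, nu_two_apply]
  simp [Fin.sum_univ_succ]
  ring

theorem fderiv_pi_apply {G : Jet → Jet} {j : Jet} (h : DifferentiableAt ℝ G j) (v : Jet) (i : Fin 6) :
    fderiv ℝ G j v i = fderiv ℝ (fun y => G y i) j v := by
  have := (hasFDerivAt_pi'.1 h.hasFDerivAt i).fderiv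
  rw [this]
  rfl

theorem fderiv_coord (j v : Jet) (i : Fin 6) : fderiv ℝ (fun y : Jet => y i) j v = v i := by
  rw [(hasFDerivAt_apply i j).fderiv]
  rfl

theorem fderiv_vecDx {j : Jet} (hj : j ∈ S.dom) (v : Jet) :
    fderiv ℝ (vecDx S.R S.T) j v = ![0, 0, v 3, fderiv ℝ S.R j v, v 5, fderiv ℝ S.U j v] := by
  have h := (S.smooth_vecDx.contDiffAt (S.isOpen_dom.mem_nhds hj)).differentiableAt (by simp)
  ext i
  rw [fderiv_pi_apply h]
  fin_cases i
  · simp [vecDx]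
  · simp [vecDx]
  · simpa [vecDx] using fderiv_coord j v 3
  · simp [vecDx]
  · simpa [vecDx] using fderiv_coord j v 5
  · simp [vecDx]

theorem fderiv_vecDy {j : Jet} (hj : j ∈ S.dom) (v : Jet) :
    fderiv ℝ (vecDy S.R S.T) j v = ![0, 0, v 4, v 5, fderiv ℝ S.T j v, fderiv ℝ S.V j v] := by
  have h := (S.smooth_vecDy.contDiffAt (S.isOpen_dom.mem_nhds hj)).differentiableAt (by simp)
  ext i
  rw [fderiv_pi_apply h]
  fin_cases i
  · simp [vecDy]
  · simp [vecDy]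
  · simpa [vecDy] using fderiv_coord j v 4
  · simpa [vecDy] using fderiv_coord j v 5
  · simp [vecDy]
  · simp [vecDy]

/-- `[D_x, D_y] = 0`. -/
theorem vecD_comm {j : Jet} (hj : j ∈ S.dom) :
    fderiv ℝ (vecDx S.R S.T) j (vecDy S.R S.T j) = fderiv ℝ (vecDy S.R S.T) j (vecDx S.R S.T j) := by
  rw [S.fderiv_vecDx hj, S.fderiv_vecDy hj]
  have h1 : fderiv ℝ S.R j (vecDy S.R S.T j) = S.U j := S.Dy_R hj
  have h2 : fderiv ℝ S.T j (vecDx S.R S.T j) = S.V j := S.Dx_T hj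
  -- The p and q components of the bracket vanish by the very definition of D_yR and D_xT; only the
  -- s component needs the compatibility condition D_x²T = D_y²R.
  have h3 : fderiv ℝ S.V j (vecDx S.R S.T j) = fderiv ℝ S.U j (vecDy S.R S.T j) := S.Dx_V hj
  rw [h1, h2, h3]
  ext i
  fin_cases i <;> simp [vecDx, vecDy]

/-! ### The complete lifts of the total derivatives -/

/-- The tangent bundle over the domain. -/
def tdom : Set (Jet × Jet) := S.dom ×ˢ univ

theorem isOpen_tdom : IsOpen S.tdom := S.isOpen_dom.prod isOpen_univ

/-- The complete lift of `D_x`, acting on functions on the tangent bundle. -/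
noncomputable def hatX (F : Jet × Jet → ℝ) : Jet × Jet → ℝ := lieD (tangentLift (vecDx S.R S.T)) F

/-- The complete lift of `D_y`, acting on functions on the tangent bundle. -/
noncomputable def hatY (F : Jet × Jet → ℝ) : Jet × Jet → ℝ := lieD (tangentLift (vecDy S.R S.T)) F

theorem hatX_hatY {F : Jet × Jet → ℝ} (hF : ContDiffOn ℝ ∞ F S.tdom) {x : Jet × Jet}
    (hx : x ∈ S.tdom) : S.hatX (S.hatY F) x = S.hatY (S.hatX F) x :=
  lieD_comm S.isOpen_tdom (contDiffOn_tangentLift S.isOpen_dom S.smooth_vecDx)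
    (contDiffOn_tangentLift S.isOpen_dom S.smooth_vecDy) hF
    (fun _ h => tangentLift_comm S.isOpen_dom S.smooth_vecDx S.smooth_vecDy
      (fun _ h => S.vecD_comm h) h) hx

end PDESystem

namespace PDESystem

variable (S : PDESystem)

attribute [fun_prop] PDESystem.smooth_R PDESystem.smooth_T

@[fun_prop]
theorem contDiffOn_dyR : ContDiffOn ℝ ∞ (fun j => dyR S.R S.T j) S.dom := S.sm_U

@[fun_prop]
theorem contDiffOn_dxT : ContDiffOn ℝ ∞ (fun j => dxT S.R S.T j) S.dom := S.sm_V

@[fun_prop]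
theorem contDiffOn_pd_dom {F : Jet → ℝ} (hF : ContDiffOn ℝ ∞ F S.dom) (i : Fin 6) :
    ContDiffOn ℝ ∞ (fun j => pd i F j) S.dom := Sm.pd hF i

@[fun_prop]
theorem contDiffOn_Dx {F : Jet → ℝ} (hF : ContDiffOn ℝ ∞ F S.dom) :
    ContDiffOn ℝ ∞ (fun j => S.Dx F j) S.dom := Sm.Dx hF

@[fun_prop]
theorem contDiffOn_Dy {F : Jet → ℝ} (hF : ContDiffOn ℝ ∞ F S.dom) :
    ContDiffOn ℝ ∞ (fun j => S.Dy F j) S.dom := Sm.Dy hF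

@[fun_prop]
theorem contDiffOn_Rs : ContDiffOn ℝ ∞ (fun j => S.Rs j) S.dom := S.sm_R.pd 5

@[fun_prop]
theorem contDiffOn_Ts : ContDiffOn ℝ ∞ (fun j => S.Ts j) S.dom := S.sm_T.pd 5

/-! ### Derivatives of the coframe along the complete lifts -/

section Hat

variable {S}

/-- A 1-form is regarded as a function on the tangent bundle, linear on fibres. Its derivative along
the complete lift of W is the Lie derivative L_W α evaluated on the vector `x.2`, so Lie derivatives
of quadratic forms reduce to the product rule for functions. -/
theorem lieD_tangentLift_eval {W : Jet → Jet} {α : Jet → (Jet →L[ℝ] ℝ)} {x : Jet × Jet}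
    (hα : DifferentiableAt ℝ α x.1) :
    lieD (tangentLift W) (fun x : Jet × Jet => α x.1 x.2) x
      = fderiv ℝ (fun y => α y x.2) x.1 (W x.1) + α x.1 (fderiv ℝ W x.1 x.2) := by
  have h := ((hα.hasFDerivAt.comp x hasFDerivAt_fst).clm_apply hasFDerivAt_snd).fderiv
  rw [lieD]
  simp only [Function.comp_def] at h
  rw [h, fderiv_eval hα, tangentLift]
  simp [add_comm]

theorem lieD_tangentLift_fst {W : Jet → Jet} {F : Jet → ℝ} {x : Jet × Jet}
    (hF : DifferentiableAt ℝ F x.1) :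
    lieD (tangentLift W) (fun x : Jet × Jet => F x.1) x = lieD W F x.1 := by
  have h := (hF.hasFDerivAt.comp x (hasFDerivAt_fst (𝕜 := ℝ) (p := x))).fderiv
  simp only [Function.comp_def] at h
  rw [lieD, h]
  rfl

variable (S)

theorem contDiffOn_nu (i : Fin 3) : ContDiffOn ℝ ∞ (S.nu i) S.dom := by
  have hR := S.smooth_R
  have hT := S.smooth_T
  have hU := S.contDiffOn_dyR
  have hV := S.contDiffOn_dxT
  have hc : ∀ i : Fin 6, ContDiffOn ℝ ∞ (fun j : Jet => j i) S.dom := S.sm_coord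
  unfold nu
  fin_cases i
  · exact (contDiffOn_const.sub (hR.smul contDiffOn_const)).sub ((hc 5).smul contDiffOn_const)
  · exact (contDiffOn_const.sub ((hc 5).smul contDiffOn_const)).sub (hT.smul contDiffOn_const)
  · exact (contDiffOn_const.sub (hU.smul contDiffOn_const)).sub (hV.smul contDiffOn_const)

theorem differentiableAt_nu (i : Fin 3) {j : Jet} (hj : j ∈ S.dom) :
    DifferentiableAt ℝ (S.nu i) j :=
  ((S.contDiffOn_nu i).contDiffAt (S.isOpen_dom.mem_nhds hj)).differentiableAt (by simp)

theorem differentiableAt_lamForm (j : Jet) : DifferentiableAt ℝ lamForm j :=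
  contDiff_lamForm.differentiable (by simp) j

theorem fderiv_lamForm_eval (j v X : Jet) :
    fderiv ℝ (fun y => lamForm y v) j X = - (X 3 * v 0) - X 4 * v 1 := by
  simp only [lamForm_apply]
  have h := ((hasFDerivAt_const (𝕜 := ℝ) (v 2) j).sub ((hasFDerivAt_apply (𝕜 := ℝ) (3 : Fin 6)
    j).mul_const (v 0))).sub ((hasFDerivAt_apply (𝕜 := ℝ) (4 : Fin 6) j).mul_const (v 1))
  erw [h.fderiv]
  simp
  ring

theorem fderiv_nu_zero_eval {j : Jet} (hj : j ∈ S.dom) (v X : Jet) :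
    fderiv ℝ (fun y => S.nu 0 y v) j X = - (fderiv ℝ S.R j X * v 0) - X 5 * v 1 := by
  simp only [nu_zero_apply]
  have h := ((hasFDerivAt_const (𝕜 := ℝ) (v 3) j).sub ((Sm.differentiableAt S.smooth_R
    hj).hasFDerivAt.mul_const (v 0))).sub ((hasFDerivAt_apply (𝕜 := ℝ) (5 : Fin 6) j).mul_const (v 1))
  erw [h.fderiv]
  simp
  ring

theorem fderiv_nu_one_eval {j : Jet} (hj : j ∈ S.dom) (v X : Jet) :
    fderiv ℝ (fun y => S.nu 1 y v) j X = - (X 5 * v 0) - fderiv ℝ S.T j X * v 1 := by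
  simp only [nu_one_apply]
  have h := ((hasFDerivAt_const (𝕜 := ℝ) (v 4) j).sub ((hasFDerivAt_apply (𝕜 := ℝ) (5 : Fin 6)
    j).mul_const (v 0))).sub ((Sm.differentiableAt S.smooth_T hj).hasFDerivAt.mul_const (v 1))
  erw [h.fderiv]
  simp
  ring

theorem fderiv_nu_two_eval {j : Jet} (hj : j ∈ S.dom) (v X : Jet) :
    fderiv ℝ (fun y => S.nu 2 y v) j X = - (fderiv ℝ S.U j X * v 0) - fderiv ℝ S.V j X * v 1 := by
  simp only [nu_two_apply]
  have h := ((hasFDerivAt_const (𝕜 := ℝ) (v 5) j).sub ((Sm.differentiableAt S.sm_U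
    hj).hasFDerivAt.mul_const (v 0))).sub ((Sm.differentiableAt S.sm_V hj).hasFDerivAt.mul_const
      (v 1))
  erw [h.fderiv]
  simp
  ring

/-- The forms `λ, ν₁, ν₂, ν₃` as functions on the tangent bundle. -/
noncomputable def lamHat (x : Jet × Jet) : ℝ := lamForm x.1 x.2

/-- The forms `ν₁, ν₂, ν₃` as functions on the tangent bundle. -/
noncomputable def nuHat (i : Fin 3) (x : Jet × Jet) : ℝ := S.nu i x.1 x.2

variable {S}
variable {x : Jet × Jet}

/-- In this and the following formulas no dx or dy appears: the fields D_x and D_y commute, so the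
space of covectors annihilating both is invariant under their Lie derivatives. -/
theorem hatX_lam (hx : x ∈ S.tdom) : S.hatX lamHat x = S.nu 0 x.1 x.2 := by
  rw [hatX, show lamHat = fun x : Jet × Jet => lamForm x.1 x.2 from rfl,
    lieD_tangentLift_eval (differentiableAt_lamForm _), fderiv_lamForm_eval, S.fderiv_vecDx hx.1,
    lamForm_apply, nu_zero_apply]
  simp [vecDx]
  ring

theorem hatY_lam (hx : x ∈ S.tdom) : S.hatY lamHat x = S.nu 1 x.1 x.2 := by
  rw [hatY, show lamHat = fun x : Jet × Jet => lamForm x.1 x.2 from rfl,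
    lieD_tangentLift_eval (differentiableAt_lamForm _), fderiv_lamForm_eval, S.fderiv_vecDy hx.1,
    lamForm_apply, nu_one_apply]
  simp [vecDy]
  ring

theorem hatX_nu_zero (hx : x ∈ S.tdom) : S.hatX (S.nuHat 0) x = S.vert S.R x.1 x.2 := by
  have h1 : fderiv ℝ S.R x.1 (vecDx S.R S.T x.1) = S.Dx S.R x.1 := rfl
  rw [hatX, show S.nuHat 0 = fun x : Jet × Jet => S.nu 0 x.1 x.2 from rfl,
    lieD_tangentLift_eval (S.differentiableAt_nu 0 hx.1), S.fderiv_nu_zero_eval hx.1,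
    S.fderiv_vecDx hx.1, nu_zero_apply, S.fderiv_eq_vert S.R x.1 x.2, h1, S.Dy_R hx.1]
  simp [vecDx]
  ring

theorem hatX_nu_one (hx : x ∈ S.tdom) : S.hatX (S.nuHat 1) x = S.nu 2 x.1 x.2 := by
  have h1 : fderiv ℝ S.T x.1 (vecDx S.R S.T x.1) = S.V x.1 := S.Dx_T hx.1
  rw [hatX, show S.nuHat 1 = fun x : Jet × Jet => S.nu 1 x.1 x.2 from rfl,
    lieD_tangentLift_eval (S.differentiableAt_nu 1 hx.1), S.fderiv_nu_one_eval hx.1,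
    S.fderiv_vecDx hx.1, nu_one_apply, nu_two_apply, h1]
  simp [vecDx]
  ring

theorem hatX_nu_two (hx : x ∈ S.tdom) : S.hatX (S.nuHat 2) x = S.vert S.U x.1 x.2 := by
  have h1 : fderiv ℝ S.U x.1 (vecDx S.R S.T x.1) = S.Dx S.U x.1 := rfl
  have h2 : fderiv ℝ S.V x.1 (vecDx S.R S.T x.1) = S.Dy S.U x.1 := S.Dx_V hx.1
  rw [hatX, show S.nuHat 2 = fun x : Jet × Jet => S.nu 2 x.1 x.2 from rfl,
    lieD_tangentLift_eval (S.differentiableAt_nu 2 hx.1), S.fderiv_nu_two_eval hx.1,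
    S.fderiv_vecDx hx.1, nu_two_apply, S.fderiv_eq_vert S.U x.1 x.2, h1, h2]
  simp
  ring

theorem hatY_nu_zero (hx : x ∈ S.tdom) : S.hatY (S.nuHat 0) x = S.nu 2 x.1 x.2 := by
  have h1 : fderiv ℝ S.R x.1 (vecDy S.R S.T x.1) = S.U x.1 := S.Dy_R hx.1
  rw [hatY, show S.nuHat 0 = fun x : Jet × Jet => S.nu 0 x.1 x.2 from rfl,
    lieD_tangentLift_eval (S.differentiableAt_nu 0 hx.1), S.fderiv_nu_zero_eval hx.1,
    S.fderiv_vecDy hx.1, nu_zero_apply, nu_two_apply, h1]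
  simp [vecDy]
  ring

theorem hatY_nu_one (hx : x ∈ S.tdom) : S.hatY (S.nuHat 1) x = S.vert S.T x.1 x.2 := by
  have h1 : fderiv ℝ S.T x.1 (vecDy S.R S.T x.1) = S.Dy S.T x.1 := rfl
  rw [hatY, show S.nuHat 1 = fun x : Jet × Jet => S.nu 1 x.1 x.2 from rfl,
    lieD_tangentLift_eval (S.differentiableAt_nu 1 hx.1), S.fderiv_nu_one_eval hx.1,
    S.fderiv_vecDy hx.1, nu_one_apply, S.fderiv_eq_vert S.T x.1 x.2, h1, S.Dx_T hx.1]
  simp [vecDy]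
  ring

theorem hatY_nu_two (hx : x ∈ S.tdom) : S.hatY (S.nuHat 2) x = S.vert S.V x.1 x.2 := by
  have h1 : fderiv ℝ S.V x.1 (vecDy S.R S.T x.1) = S.Dy S.V x.1 := rfl
  have h2 : fderiv ℝ S.U x.1 (vecDy S.R S.T x.1) = S.Dx S.V x.1 := (S.Dx_V hx.1).symm
  rw [hatY, show S.nuHat 2 = fun x : Jet × Jet => S.nu 2 x.1 x.2 from rfl,
    lieD_tangentLift_eval (S.differentiableAt_nu 2 hx.1), S.fderiv_nu_two_eval hx.1,
    S.fderiv_vecDy hx.1, nu_two_apply, S.fderiv_eq_vert S.V x.1 x.2, h1, h2]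
  simp
  ring

end Hat

/-! ### Quadratic forms in `λ, ν₁, ν₂, ν₃` -/

/-- The quadratic form `a ν₁² + b ν₁ν₂ + c ν₂² + d λν₃ + e λν₁ + f λν₂ + g λ²`. -/
noncomputable def quad (a b c d e f g : Jet → ℝ) (x : Jet × Jet) : ℝ :=
  a x.1 * S.nuHat 0 x ^ 2 + b x.1 * (S.nuHat 0 x * S.nuHat 1 x) + c x.1 * S.nuHat 1 x ^ 2
    + d x.1 * (lamHat x * S.nuHat 2 x) + e x.1 * (lamHat x * S.nuHat 0 x)
    + f x.1 * (lamHat x * S.nuHat 1 x) + g x.1 * lamHat x ^ 2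

@[fun_prop]
theorem contDiffOn_lamHat : ContDiffOn ℝ ∞ lamHat S.tdom :=
  (contDiff_lamForm.comp_contDiffOn contDiffOn_fst).clm_apply contDiffOn_snd

@[fun_prop]
theorem contDiffOn_nuHat (i : Fin 3) : ContDiffOn ℝ ∞ (S.nuHat i) S.tdom :=
  ((S.contDiffOn_nu i).comp contDiffOn_fst fun _ h => h.1).clm_apply contDiffOn_snd

theorem contDiffOn_tdom_fst {F : Jet → ℝ} (hF : ContDiffOn ℝ ∞ F S.dom) :
    ContDiffOn ℝ ∞ (fun x : Jet × Jet => F x.1) S.tdom :=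
  hF.comp contDiffOn_fst fun _ h => h.1

variable {S}

theorem differentiableAt_of_tdom {F : Jet × Jet → ℝ} (hF : ContDiffOn ℝ ∞ F S.tdom)
    {x : Jet × Jet} (hx : x ∈ S.tdom) : DifferentiableAt ℝ F x :=
  (hF.contDiffAt (S.isOpen_tdom.mem_nhds hx)).differentiableAt (by simp)

variable {a b c d e f g : Jet → ℝ}

theorem contDiffOn_quad (ha : S.Sm a) (hb : S.Sm b) (hc : S.Sm c) (hd : S.Sm d) (he : S.Sm e)
    (hf : S.Sm f) (hg : S.Sm g) : ContDiffOn ℝ ∞ (S.quad a b c d e f g) S.tdom := by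
  have ha := S.contDiffOn_tdom_fst ha
  have hb := S.contDiffOn_tdom_fst hb
  have hc := S.contDiffOn_tdom_fst hc
  have hd := S.contDiffOn_tdom_fst hd
  have he := S.contDiffOn_tdom_fst he
  have hf := S.contDiffOn_tdom_fst hf
  have hg := S.contDiffOn_tdom_fst hg
  have h0 := S.contDiffOn_nuHat 0
  have h1 := S.contDiffOn_nuHat 1
  have h2 := S.contDiffOn_nuHat 2
  have hl := S.contDiffOn_lamHat
  exact ((((((ha.mul (h0.pow 2)).add (hb.mul (h0.mul h1))).add (hc.mul (h1.pow 2))).add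
    (hd.mul (hl.mul h2))).add (he.mul (hl.mul h0))).add (hf.mul (hl.mul h1))).add (hg.mul (hl.pow 2))

/-- The derivative of a quadratic form along a vector field on the tangent bundle. -/
theorem lieD_quad {W : Jet × Jet → Jet × Jet} {x : Jet × Jet} (hx : x ∈ S.tdom) (ha : S.Sm a)
    (hb : S.Sm b) (hc : S.Sm c) (hd : S.Sm d) (he : S.Sm e) (hf : S.Sm f) (hg : S.Sm g)
    {a' b' c' d' e' f' g' l m0 m1 m2 : ℝ} (hl : lieD W lamHat x = l)
    (h0 : lieD W (S.nuHat 0) x = m0) (h1 : lieD W (S.nuHat 1) x = m1)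
    (h2 : lieD W (S.nuHat 2) x = m2)
    (ha' : lieD W (fun x => a x.1) x = a') (hb' : lieD W (fun x => b x.1) x = b')
    (hc' : lieD W (fun x => c x.1) x = c') (hd' : lieD W (fun x => d x.1) x = d')
    (he' : lieD W (fun x => e x.1) x = e') (hf' : lieD W (fun x => f x.1) x = f')
    (hg' : lieD W (fun x => g x.1) x = g') :
    lieD W (S.quad a b c d e f g) x =
      a' * S.nuHat 0 x ^ 2 + 2 * a x.1 * S.nuHat 0 x * m0
      + b' * (S.nuHat 0 x * S.nuHat 1 x) + b x.1 * (m0 * S.nuHat 1 x + S.nuHat 0 x * m1)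
      + c' * S.nuHat 1 x ^ 2 + 2 * c x.1 * S.nuHat 1 x * m1
      + d' * (lamHat x * S.nuHat 2 x) + d x.1 * (l * S.nuHat 2 x + lamHat x * m2)
      + e' * (lamHat x * S.nuHat 0 x) + e x.1 * (l * S.nuHat 0 x + lamHat x * m0)
      + f' * (lamHat x * S.nuHat 1 x) + f x.1 * (l * S.nuHat 1 x + lamHat x * m1)
      + g' * lamHat x ^ 2 + 2 * g x.1 * lamHat x * l := by
  have D : ∀ {F : Jet × Jet → ℝ} {y : ℝ}, ContDiffOn ℝ ∞ F S.tdom → lieD W F x = y →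
      HasDerivAt (fun t : ℝ => F (x + t • W x)) y 0 := fun hF h =>
    h ▸ hasDerivAt_lieD (differentiableAt_of_tdom hF hx)
  have ea := D (S.contDiffOn_tdom_fst ha) ha'
  have eb := D (S.contDiffOn_tdom_fst hb) hb'
  have ec := D (S.contDiffOn_tdom_fst hc) hc'
  have ed := D (S.contDiffOn_tdom_fst hd) hd'
  have ee := D (S.contDiffOn_tdom_fst he) he'
  have ef := D (S.contDiffOn_tdom_fst hf) hf'
  have eg := D (S.contDiffOn_tdom_fst hg) hg'
  have e0 := D (S.contDiffOn_nuHat 0) h0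
  have e1 := D (S.contDiffOn_nuHat 1) h1
  have e2 := D (S.contDiffOn_nuHat 2) h2
  have el := D S.contDiffOn_lamHat hl
  have tot := ((((((ea.mul (e0.pow 2)).add (eb.mul (e0.mul e1))).add (ec.mul (e1.pow 2))).add
    (ed.mul (el.mul e2))).add (ee.mul (el.mul e0))).add (ef.mul (el.mul e1))).add
      (eg.mul (el.pow 2))
  have := (hasDerivAt_lieD (V := W)
    (differentiableAt_of_tdom (contDiffOn_quad ha hb hc hd he hf hg) hx)).unique tot
  rw [this]
  simp only [zero_smul, add_zero, Pi.pow_apply, Pi.mul_apply]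
  push_cast
  ring

theorem hatX_quad {x : Jet × Jet} (hx : x ∈ S.tdom) (ha : S.Sm a)
    (hb : S.Sm b) (hc : S.Sm c) (hd : S.Sm d) (he : S.Sm e) (hf : S.Sm f) (hg : S.Sm g) :
    S.hatX (S.quad a b c d e f g) x =
      S.Dx a x.1 * S.nuHat 0 x ^ 2 + 2 * a x.1 * S.nuHat 0 x * S.vert S.R x.1 x.2
      + S.Dx b x.1 * (S.nuHat 0 x * S.nuHat 1 x) + b x.1 * (S.vert S.R x.1 x.2 * S.nuHat 1 x + S.nuHat 0 x * S.nuHat 2 x)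
      + S.Dx c x.1 * S.nuHat 1 x ^ 2 + 2 * c x.1 * S.nuHat 1 x * S.nuHat 2 x
      + S.Dx d x.1 * (lamHat x * S.nuHat 2 x) + d x.1 * (S.nuHat 0 x * S.nuHat 2 x + lamHat x * S.vert S.U x.1 x.2)
      + S.Dx e x.1 * (lamHat x * S.nuHat 0 x) + e x.1 * (S.nuHat 0 x * S.nuHat 0 x + lamHat x * S.vert S.R x.1 x.2)
      + S.Dx f x.1 * (lamHat x * S.nuHat 1 x) + f x.1 * (S.nuHat 0 x * S.nuHat 1 x + lamHat x * S.nuHat 2 x)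
      + S.Dx g x.1 * lamHat x ^ 2 + 2 * g x.1 * lamHat x * S.nuHat 0 x :=
  lieD_quad hx ha hb hc hd he hf hg (hatX_lam hx) (hatX_nu_zero hx) (hatX_nu_one hx)
    (hatX_nu_two hx) (lieD_tangentLift_fst (Sm.differentiableAt ha hx.1))
    (lieD_tangentLift_fst (Sm.differentiableAt hb hx.1))
    (lieD_tangentLift_fst (Sm.differentiableAt hc hx.1))
    (lieD_tangentLift_fst (Sm.differentiableAt hd hx.1))
    (lieD_tangentLift_fst (Sm.differentiableAt he hx.1))
    (lieD_tangentLift_fst (Sm.differentiableAt hf hx.1))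
    (lieD_tangentLift_fst (Sm.differentiableAt hg hx.1))

theorem hatY_quad {x : Jet × Jet} (hx : x ∈ S.tdom) (ha : S.Sm a)
    (hb : S.Sm b) (hc : S.Sm c) (hd : S.Sm d) (he : S.Sm e) (hf : S.Sm f) (hg : S.Sm g) :
    S.hatY (S.quad a b c d e f g) x =
      S.Dy a x.1 * S.nuHat 0 x ^ 2 + 2 * a x.1 * S.nuHat 0 x * S.nuHat 2 x
      + S.Dy b x.1 * (S.nuHat 0 x * S.nuHat 1 x) + b x.1 * (S.nuHat 2 x * S.nuHat 1 x + S.nuHat 0 x * S.vert S.T x.1 x.2)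
      + S.Dy c x.1 * S.nuHat 1 x ^ 2 + 2 * c x.1 * S.nuHat 1 x * S.vert S.T x.1 x.2
      + S.Dy d x.1 * (lamHat x * S.nuHat 2 x) + d x.1 * (S.nuHat 1 x * S.nuHat 2 x + lamHat x * S.vert S.V x.1 x.2)
      + S.Dy e x.1 * (lamHat x * S.nuHat 0 x) + e x.1 * (S.nuHat 1 x * S.nuHat 0 x + lamHat x * S.nuHat 2 x)
      + S.Dy f x.1 * (lamHat x * S.nuHat 1 x) + f x.1 * (S.nuHat 1 x * S.nuHat 1 x + lamHat x * S.vert S.T x.1 x.2)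
      + S.Dy g x.1 * lamHat x ^ 2 + 2 * g x.1 * lamHat x * S.nuHat 1 x :=
  lieD_quad hx ha hb hc hd he hf hg (hatY_lam hx) (hatY_nu_zero hx) (hatY_nu_one hx)
    (hatY_nu_two hx) (lieD_tangentLift_fst (Sm.differentiableAt ha hx.1))
    (lieD_tangentLift_fst (Sm.differentiableAt hb hx.1))
    (lieD_tangentLift_fst (Sm.differentiableAt hc hx.1))
    (lieD_tangentLift_fst (Sm.differentiableAt hd hx.1))
    (lieD_tangentLift_fst (Sm.differentiableAt he hx.1))
    (lieD_tangentLift_fst (Sm.differentiableAt hf hx.1))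
    (lieD_tangentLift_fst (Sm.differentiableAt hg hx.1))

end PDESystem

/-! ### Rules for derivatives along vector fields -/

section LieRules

variable {E : Type*} [NormedAddCommGroup E] [NormedSpace ℝ E] {V : E → E} {F G : E → ℝ} {x : E}

theorem lieD_add (hF : DifferentiableAt ℝ F x) (hG : DifferentiableAt ℝ G x) :
    lieD V (fun y => F y + G y) x = lieD V F x + lieD V G x := by
  rw [lieD, fderiv_fun_add hF hG]
  rfl

theorem lieD_sub (hF : DifferentiableAt ℝ F x) (hG : DifferentiableAt ℝ G x) :
    lieD V (fun y => F y - G y) x = lieD V F x - lieD V G x := by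
  rw [lieD, fderiv_fun_sub hF hG]
  rfl

theorem lieD_mul (hF : DifferentiableAt ℝ F x) (hG : DifferentiableAt ℝ G x) :
    lieD V (fun y => F y * G y) x = lieD V F x * G x + F x * lieD V G x := by
  rw [lieD, fderiv_fun_mul hF hG]
  simp [lieD]
  ring

theorem lieD_const (c : ℝ) : lieD V (fun _ => c) x = 0 := by
  simp [lieD]

theorem lieD_const_mul (c : ℝ) (hF : DifferentiableAt ℝ F x) :
    lieD V (fun y => c * F y) x = c * lieD V F x := by
  rw [lieD_mul (differentiableAt_const c) hF, lieD_const]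
  ring

end LieRules

namespace PDESystem

variable (S : PDESystem)

/-! ### The conformal structure -/

theorem fderiv_pd {F : Jet → ℝ} (hF : S.Sm F) {j : Jet} (hj : j ∈ S.dom) (i : Fin 6) (v : Jet) :
    fderiv ℝ (pd i F) j v = fderiv ℝ (fderiv ℝ F) j v (Pi.single i 1) := by
  have h1 : DifferentiableAt ℝ (fderiv ℝ F) j :=
    ((hF.fderiv_of_isOpen S.isOpen_dom (m := ∞) (by simp)).contDiffAt
      (S.isOpen_dom.mem_nhds hj)).differentiableAt (by simp)
  exact fderiv_eval h1 v _

theorem fderiv_comm_pd {F : Jet → ℝ} (hF : S.Sm F) {j : Jet} (hj : j ∈ S.dom) (i : Fin 6) (v : Jet) :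
    fderiv ℝ (fderiv ℝ F) j (Pi.single i 1) v = fderiv ℝ (pd i F) j v := by
  have hs : IsSymmSndFDerivAt ℝ F j :=
    (hF.contDiffAt (S.isOpen_dom.mem_nhds hj)).isSymmSndFDerivAt minSmoothness_two_le_infty
  rw [S.fderiv_pd hF hj, hs.eq]

/-- Obtained by applying ∂_s to D_yR with the commutator [∂_s, D_y] = ∂_p + T_s ∂_q + (∂_s D_xT)
∂_s. Together with the formula for D_xT below, it is what makes the λν₃ coefficient of the conformal
equations consistent. -/
theorem pd_five_U {j : Jet} (hj : j ∈ S.dom) :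
    pd 5 S.U j = S.Dy S.Rs j + pd 3 S.R j + S.Ts j * pd 4 S.R j + pd 5 S.V j * S.Rs j := by
  have h1 : pd 5 S.U j = pd 5 (S.Dy S.R) j :=
    congrArg (fun A : Jet →L[ℝ] ℝ => A (Pi.single 5 1))
      ((Set.EqOn.eventuallyEq_of_mem (fun y hy => (S.Dy_R hy).symm)
        (S.isOpen_dom.mem_nhds hj)).fderiv_eq)
  have h2 := fderiv_lieD S.isOpen_dom S.smooth_vecDy S.smooth_R hj (Pi.single 5 1)
  rw [S.fderiv_comm_pd S.smooth_R hj, S.fderiv_vecDy hj, fderiv_apply_eq_sum_pd S.R] at h2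
  rw [h1]
  refine Eq.trans h2 ?_
  have p : ∀ F : Jet → ℝ, fderiv ℝ F j (Pi.single 5 1) = pd 5 F j := fun _ => rfl
  simp only [Dy, opDy, Rs, Ts, Fin.sum_univ_six, p]
  simp
  ring

theorem pd_five_V {j : Jet} (hj : j ∈ S.dom) :
    pd 5 S.V j = S.Dx S.Ts j + pd 4 S.T j + S.Rs j * pd 3 S.T j + pd 5 S.U j * S.Ts j := by
  have h1 : pd 5 S.V j = pd 5 (S.Dx S.T) j :=
    congrArg (fun A : Jet →L[ℝ] ℝ => A (Pi.single 5 1))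
      ((Set.EqOn.eventuallyEq_of_mem (fun y hy => (S.Dx_T hy).symm)
        (S.isOpen_dom.mem_nhds hj)).fderiv_eq)
  have h2 := fderiv_lieD S.isOpen_dom S.smooth_vecDx S.smooth_T hj (Pi.single 5 1)
  rw [S.fderiv_comm_pd S.smooth_T hj, S.fderiv_vecDx hj, fderiv_apply_eq_sum_pd S.T] at h2
  rw [h1]
  refine Eq.trans h2 ?_
  have p : ∀ F : Jet → ℝ, fderiv ℝ F j (Pi.single 5 1) = pd 5 F j := fun _ => rfl
  simp only [Dx, opDx, Rs, Ts, Fin.sum_univ_six, p]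
  simp
  ring

/-- Coefficient of `λν₁` in the metric. -/
noncomputable def cE (j : Jet) : ℝ :=
  2 * (2 * (-S.Dx S.Ts j - S.Ts j * pd 3 S.R j - S.Ts j ^ 2 * pd 4 S.R j)
    - S.Ts j * (-S.Dy S.Rs j - S.Rs j * pd 4 S.T j - S.Rs j ^ 2 * pd 3 S.T j))
    / (4 - S.Rs j * S.Ts j)

/-- Coefficient of `λν₂` in the metric. -/
noncomputable def cF (j : Jet) : ℝ :=
  2 * (2 * (-S.Dy S.Rs j - S.Rs j * pd 4 S.T j - S.Rs j ^ 2 * pd 3 S.T j)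
    - S.Rs j * (-S.Dx S.Ts j - S.Ts j * pd 3 S.R j - S.Ts j ^ 2 * pd 4 S.R j))
    / (4 - S.Rs j * S.Ts j)

/-- Conformal weight of the metric along `D_x`. -/
noncomputable def rhoX (j : Jet) : ℝ := pd 3 S.R j - S.Ts j * pd 4 S.R j - S.cF j / 2

/-- Conformal weight of the metric along `D_y`. -/
noncomputable def rhoY (j : Jet) : ℝ := pd 4 S.T j - S.Rs j * pd 3 S.T j - S.cE j / 2

/-- Coefficient of `λν₃` in the metric. -/
noncomputable def cD (j : Jet) : ℝ := 2 * (1 - S.Rs j * S.Ts j)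

/-- Coefficient of `λ²` in the metric. -/
noncomputable def cG (j : Jet) : ℝ :=
  -(2 * S.Ts j * pd 2 S.R j + S.cD j * pd 3 S.U j + S.Dx S.cE j + S.cE j * pd 3 S.R j
    - S.rhoX j * S.cE j) / 2

/-- The quadratic form defining the conformal structure. -/
noncomputable def metricForm : Jet × Jet → ℝ :=
  S.quad S.Ts (fun _ => -2) S.Rs S.cD S.cE S.cF S.cG

theorem one_sub_pos {j : Jet} (hj : j ∈ S.dom) : 0 < 1 - S.Rs j * S.Ts j := S.pos j hj

theorem four_sub_pos {j : Jet} (hj : j ∈ S.dom) : 0 < 4 - S.Rs j * S.Ts j := by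
  linarith [S.one_sub_pos hj]

@[fun_prop]
theorem contDiffOn_cE : ContDiffOn ℝ ∞ (fun j => S.cE j) S.dom := by
  have h : ∀ j ∈ S.dom, 4 - S.Rs j * S.Ts j ≠ 0 := fun j hj => (S.four_sub_pos hj).ne'
  unfold cE
  fun_prop (disch := assumption)

@[fun_prop]
theorem contDiffOn_cF : ContDiffOn ℝ ∞ (fun j => S.cF j) S.dom := by
  have h : ∀ j ∈ S.dom, 4 - S.Rs j * S.Ts j ≠ 0 := fun j hj => (S.four_sub_pos hj).ne'
  unfold cF
  fun_prop (disch := assumption)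

@[fun_prop]
theorem contDiffOn_rhoX : ContDiffOn ℝ ∞ (fun j => S.rhoX j) S.dom := by
  unfold rhoX
  fun_prop

@[fun_prop]
theorem contDiffOn_rhoY : ContDiffOn ℝ ∞ (fun j => S.rhoY j) S.dom := by
  unfold rhoY
  fun_prop

@[fun_prop]
theorem contDiffOn_cD : ContDiffOn ℝ ∞ (fun j => S.cD j) S.dom := by
  unfold cD
  fun_prop

@[fun_prop]
theorem contDiffOn_cG : ContDiffOn ℝ ∞ (fun j => S.cG j) S.dom := by
  unfold cG
  fun_prop

variable {S}

theorem contDiffOn_metricForm : ContDiffOn ℝ ∞ S.metricForm S.tdom :=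
  contDiffOn_quad S.contDiffOn_Ts contDiffOn_const S.contDiffOn_Rs S.contDiffOn_cD S.contDiffOn_cE
    S.contDiffOn_cF S.contDiffOn_cG

/-- The ν₁² coefficient of the conformal equation along D_x and the ν₂² coefficient along D_y. After
substitution of the weights they form a linear system for E and F whose determinant is proportional
to 4 - R_sT_s, and `cE`, `cF` are its solution. -/
theorem cE_cF_rel {j : Jet} (hj : j ∈ S.dom) :
    S.Dx S.Ts j + 2 * S.Ts j * pd 3 S.R j + S.cE j = S.rhoX j * S.Ts j ∧
    S.Dy S.Rs j + 2 * S.Rs j * pd 4 S.T j + S.cF j = S.rhoY j * S.Rs j := by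
  have h := (S.four_sub_pos hj).ne'
  have hE := div_mul_cancel₀ (2 * (2 * (-S.Dx S.Ts j - S.Ts j * pd 3 S.R j - S.Ts j ^ 2 * pd 4 S.R j)
    - S.Ts j * (-S.Dy S.Rs j - S.Rs j * pd 4 S.T j - S.Rs j ^ 2 * pd 3 S.T j))) h
  have hF := div_mul_cancel₀ (2 * (2 * (-S.Dy S.Rs j - S.Rs j * pd 4 S.T j - S.Rs j ^ 2 * pd 3 S.T j)
    - S.Rs j * (-S.Dx S.Ts j - S.Ts j * pd 3 S.R j - S.Ts j ^ 2 * pd 4 S.R j))) h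
  rw [← cE] at hE
  rw [← cF] at hF
  rw [rhoX, rhoY]
  constructor
  · apply mul_right_cancel₀ h
    linear_combination hE + S.Ts j / 2 * hF
  · apply mul_right_cancel₀ h
    linear_combination hF + S.Rs j / 2 * hE

/-- The ν₂² coefficient along D_x. Once E and F have been eliminated, the difference of the two
sides times 4 - R_sT_s is -J₁: this is where the metricity condition comes from. -/
theorem Dx_Rs {j : Jet} (hj : j ∈ S.dom) (h₁ : S.J1 j = 0) :
    S.Dx S.Rs j = 2 * pd 4 S.R j + S.rhoX j * S.Rs j := by
  have h := (S.four_sub_pos hj).ne'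
  have hF := div_mul_cancel₀ (2 * (2 * (-S.Dy S.Rs j - S.Rs j * pd 4 S.T j - S.Rs j ^ 2 * pd 3 S.T j)
    - S.Rs j * (-S.Dx S.Ts j - S.Ts j * pd 3 S.R j - S.Ts j ^ 2 * pd 4 S.R j))) h
  rw [← cF] at hF
  rw [J1] at h₁
  rw [rhoX]
  apply mul_right_cancel₀ h
  linear_combination -h₁ + S.Rs j / 2 * hF

theorem Dy_Ts {j : Jet} (hj : j ∈ S.dom) (h₂ : S.J2 j = 0) :
    S.Dy S.Ts j = 2 * pd 3 S.T j + S.rhoY j * S.Ts j := by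
  have h := (S.four_sub_pos hj).ne'
  have hE := div_mul_cancel₀ (2 * (2 * (-S.Dx S.Ts j - S.Ts j * pd 3 S.R j - S.Ts j ^ 2 * pd 4 S.R j)
    - S.Ts j * (-S.Dy S.Rs j - S.Rs j * pd 4 S.T j - S.Rs j ^ 2 * pd 3 S.T j))) h
  rw [← cE] at hE
  rw [J2] at h₂
  rw [rhoY]
  apply mul_right_cancel₀ h
  linear_combination -h₂ + S.Ts j / 2 * hE

theorem Dx_cD {j : Jet} (hj : j ∈ S.dom) :
    S.Dx S.cD j = -2 * (S.Dx S.Rs j * S.Ts j + S.Rs j * S.Dx S.Ts j) := by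
  have h1 := Sm.differentiableAt S.contDiffOn_Rs hj
  have h2 := Sm.differentiableAt S.contDiffOn_Ts hj
  change lieD (vecDx S.R S.T) (fun j => 2 * (1 - S.Rs j * S.Ts j)) j = _
  rw [lieD_const_mul _ ((differentiableAt_const _).fun_sub (h1.fun_mul h2)),
    lieD_sub (differentiableAt_const _) (h1.fun_mul h2), lieD_mul h1 h2, lieD_const]
  simp only [lieD, Dx, opDx]
  ring

theorem Dy_cD {j : Jet} (hj : j ∈ S.dom) :
    S.Dy S.cD j = -2 * (S.Dy S.Rs j * S.Ts j + S.Rs j * S.Dy S.Ts j) := by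
  have h1 := Sm.differentiableAt S.contDiffOn_Rs hj
  have h2 := Sm.differentiableAt S.contDiffOn_Ts hj
  change lieD (vecDy S.R S.T) (fun j => 2 * (1 - S.Rs j * S.Ts j)) j = _
  rw [lieD_const_mul _ ((differentiableAt_const _).fun_sub (h1.fun_mul h2)),
    lieD_sub (differentiableAt_const _) (h1.fun_mul h2), lieD_mul h1 h2, lieD_const]
  simp only [lieD, Dy, opDy]
  ring

/-- The λν₃ coefficient along D_x. It imposes nothing new: it is a consequence of the ν-quadratic
coefficients and of the s-derivatives of D_yR and D_xT. -/
theorem cD_rel_x {j : Jet} (hj : j ∈ S.dom) (h₁ : S.J1 j = 0) :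
    S.Dx S.cD j + S.cD j * pd 5 S.U j + S.cE j * S.Rs j + S.cF j = S.rhoX j * S.cD j := by
  have hU := S.pd_five_U hj
  have hV := S.pd_five_V hj
  have h1 := Dx_Rs hj h₁
  obtain ⟨h2, h3⟩ := cE_cF_rel hj
  rw [Dx_cD hj]
  have hr : S.rhoX j = pd 3 S.R j - S.Ts j * pd 4 S.R j - S.cF j / 2 := rfl
  have hr' : S.rhoY j = pd 4 S.T j - S.Rs j * pd 3 S.T j - S.cE j / 2 := rfl
  rw [cD]
  linear_combination 2 * hU + 2 * S.Rs j * hV - 2 * S.Ts j * h1 + 2 * h3 - 2 * hr + 2 * S.Rs j * hr'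

theorem cD_rel_y {j : Jet} (hj : j ∈ S.dom) (h₂ : S.J2 j = 0) :
    S.Dy S.cD j + S.cD j * pd 5 S.V j + S.cF j * S.Ts j + S.cE j = S.rhoY j * S.cD j := by
  have hU := S.pd_five_U hj
  have hV := S.pd_five_V hj
  have h1 := Dy_Ts hj h₂
  obtain ⟨h2, h3⟩ := cE_cF_rel hj
  rw [Dy_cD hj]
  have hr : S.rhoX j = pd 3 S.R j - S.Ts j * pd 4 S.R j - S.cF j / 2 := rfl
  have hr' : S.rhoY j = pd 4 S.T j - S.Rs j * pd 3 S.T j - S.cE j / 2 := rfl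
  rw [cD]
  linear_combination 2 * hV + 2 * S.Ts j * hU - 2 * S.Rs j * h1 + 2 * h2 - 2 * hr' + 2 * S.Ts j * hr

/-- The failure of the metric to be conformally invariant along `D_x`. -/
noncomputable def defX (S : PDESystem) : Fin 3 → Jet → ℝ :=
  ![fun j => 2 * S.Ts j * pd 2 S.R j + S.cD j * pd 3 S.U j + S.Dx S.cE j + S.cE j * pd 3 S.R j
      + 2 * S.cG j - S.rhoX j * S.cE j,
    fun j => -2 * pd 2 S.R j + S.cD j * pd 4 S.U j + S.Dx S.cF j + S.cE j * pd 4 S.R j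
      - S.rhoX j * S.cF j,
    fun j => S.cD j * pd 2 S.U j + S.cE j * pd 2 S.R j + S.Dx S.cG j - S.rhoX j * S.cG j]

/-- The failure of the metric to be conformally invariant along `D_y`. -/
noncomputable def defY (S : PDESystem) : Fin 3 → Jet → ℝ :=
  ![fun j => -2 * pd 2 S.T j + S.cD j * pd 3 S.V j + S.Dy S.cE j + S.cF j * pd 3 S.T j
      - S.rhoY j * S.cE j,
    fun j => 2 * S.Rs j * pd 2 S.T j + S.cD j * pd 4 S.V j + S.Dy S.cF j + S.cF j * pd 4 S.T j
      + 2 * S.cG j - S.rhoY j * S.cF j,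
    fun j => S.cD j * pd 2 S.V j + S.cF j * pd 2 S.T j + S.Dy S.cG j - S.rhoY j * S.cG j]

theorem contDiffOn_defX (i : Fin 3) : ContDiffOn ℝ ∞ (S.defX i) S.dom := by
  fin_cases i <;> simp only [defX] <;> simp <;> fun_prop

theorem contDiffOn_defY (i : Fin 3) : ContDiffOn ℝ ∞ (S.defY i) S.dom := by
  fin_cases i <;> simp only [defY] <;> simp <;> fun_prop

/-- G was chosen to solve this one equation; the five other defects are dealt with by commutation.
-/
theorem defX_zero (j : Jet) : S.defX 0 j = 0 := by
  simp only [defX, Matrix.cons_val_zero, cG]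
  ring

theorem hatX_metricForm_aux (h₁ : ∀ j ∈ S.dom, S.J1 j = 0) {x : Jet × Jet} (hx : x ∈ S.tdom) :
    S.hatX S.metricForm x = S.rhoX x.1 * S.metricForm x
      + S.quad 0 0 0 0 (S.defX 0) (S.defX 1) (S.defX 2) x := by
  have hj := hx.1
  rw [metricForm, hatX_quad hx S.contDiffOn_Ts contDiffOn_const S.contDiffOn_Rs S.contDiffOn_cD
    S.contDiffOn_cE S.contDiffOn_cF S.contDiffOn_cG]
  have h0 : S.Dx (fun _ => (-2 : ℝ)) x.1 = 0 := lieD_const _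
  have e1 := (cE_cF_rel hj).1
  have e2 := Dx_Rs hj (h₁ _ hj)
  have e3 := cD_rel_x hj (h₁ _ hj)
  have e4 : S.rhoX x.1 = pd 3 S.R x.1 - S.Ts x.1 * pd 4 S.R x.1 - S.cF x.1 / 2 := rfl
  have e5 : S.cD x.1 = 2 * (1 - S.Rs x.1 * S.Ts x.1) := rfl
  have t1 : pd 5 S.R = S.Rs := rfl
  simp only [quad, vert, h0, t1, defX, Pi.zero_apply, Matrix.cons_val_zero, Matrix.cons_val_one,
    Matrix.cons_val]
  simp only [show ∀ i, S.nu i x.1 x.2 = S.nuHat i x from fun _ => rfl,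
    show lamForm x.1 x.2 = lamHat x from rfl]
  linear_combination S.nuHat 0 x ^ 2 * e1 + S.nuHat 1 x ^ 2 * e2 + lamHat x * S.nuHat 2 x * e3
    + 2 * S.nuHat 0 x * S.nuHat 1 x * e4 + S.nuHat 0 x * S.nuHat 2 x * e5

theorem hatY_metricForm_aux (h₂ : ∀ j ∈ S.dom, S.J2 j = 0) {x : Jet × Jet} (hx : x ∈ S.tdom) :
    S.hatY S.metricForm x = S.rhoY x.1 * S.metricForm x
      + S.quad 0 0 0 0 (S.defY 0) (S.defY 1) (S.defY 2) x := by
  have hj := hx.1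
  rw [metricForm, hatY_quad hx S.contDiffOn_Ts contDiffOn_const S.contDiffOn_Rs S.contDiffOn_cD
    S.contDiffOn_cE S.contDiffOn_cF S.contDiffOn_cG]
  have h0 : S.Dy (fun _ => (-2 : ℝ)) x.1 = 0 := lieD_const _
  have e1 := (cE_cF_rel hj).2
  have e2 := Dy_Ts hj (h₂ _ hj)
  have e3 := cD_rel_y hj (h₂ _ hj)
  have e4 : S.rhoY x.1 = pd 4 S.T x.1 - S.Rs x.1 * pd 3 S.T x.1 - S.cE x.1 / 2 := rfl
  have e5 : S.cD x.1 = 2 * (1 - S.Rs x.1 * S.Ts x.1) := rfl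
  have t1 : pd 5 S.T = S.Ts := rfl
  simp only [quad, vert, h0, t1, defY, Pi.zero_apply, Matrix.cons_val_zero, Matrix.cons_val_one,
    Matrix.cons_val]
  simp only [show ∀ i, S.nu i x.1 x.2 = S.nuHat i x from fun _ => rfl,
    show lamForm x.1 x.2 = lamHat x from rfl]
  linear_combination S.nuHat 1 x ^ 2 * e1 + S.nuHat 0 x ^ 2 * e2 + lamHat x * S.nuHat 2 x * e3
    + 2 * S.nuHat 0 x * S.nuHat 1 x * e4 + S.nuHat 1 x * S.nuHat 2 x * e5

/-- Comparison of `D_x D_y` and `D_y D_x` on the metric. -/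
theorem hat_comm_metricForm (h₁ : ∀ j ∈ S.dom, S.J1 j = 0) (h₂ : ∀ j ∈ S.dom, S.J2 j = 0)
    {x : Jet × Jet} (hx : x ∈ S.tdom) :
    (S.Dx S.rhoY x.1 - S.Dy S.rhoX x.1) * S.metricForm x
      + S.rhoY x.1 * S.quad 0 0 0 0 (S.defX 0) (S.defX 1) (S.defX 2) x
      - S.rhoX x.1 * S.quad 0 0 0 0 (S.defY 0) (S.defY 1) (S.defY 2) x
      + S.hatX (S.quad 0 0 0 0 (S.defY 0) (S.defY 1) (S.defY 2)) x
      - S.hatY (S.quad 0 0 0 0 (S.defX 0) (S.defX 1) (S.defX 2)) x = 0 := by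
  have hz : S.Sm 0 := contDiffOn_const
  have qX := contDiffOn_quad hz hz hz hz (S.contDiffOn_defX 0) (S.contDiffOn_defX 1)
    (S.contDiffOn_defX 2)
  have qY := contDiffOn_quad hz hz hz hz (S.contDiffOn_defY 0) (S.contDiffOn_defY 1)
    (S.contDiffOn_defY 2)
  have rX := S.contDiffOn_tdom_fst S.contDiffOn_rhoX
  have rY := S.contDiffOn_tdom_fst S.contDiffOn_rhoY
  have hc := S.hatX_hatY contDiffOn_metricForm hx
  have hX : S.hatX (S.hatY S.metricForm) x = S.Dx S.rhoY x.1 * S.metricForm x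
      + S.rhoY x.1 * S.hatX S.metricForm x
      + S.hatX (S.quad 0 0 0 0 (S.defY 0) (S.defY 1) (S.defY 2)) x := by
    rw [hatX, lieD_congr S.isOpen_tdom (fun y hy => hatY_metricForm_aux h₂ hy) hx,
      lieD_add ((differentiableAt_of_tdom rY hx).fun_mul
        (differentiableAt_of_tdom contDiffOn_metricForm hx)) (differentiableAt_of_tdom qY hx),
      lieD_mul (differentiableAt_of_tdom rY hx)
        (differentiableAt_of_tdom contDiffOn_metricForm hx),
      lieD_tangentLift_fst (Sm.differentiableAt S.contDiffOn_rhoY hx.1)]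
    rfl
  have hY : S.hatY (S.hatX S.metricForm) x = S.Dy S.rhoX x.1 * S.metricForm x
      + S.rhoX x.1 * S.hatY S.metricForm x
      + S.hatY (S.quad 0 0 0 0 (S.defX 0) (S.defX 1) (S.defX 2)) x := by
    rw [hatY, lieD_congr S.isOpen_tdom (fun y hy => hatX_metricForm_aux h₁ hy) hx,
      lieD_add ((differentiableAt_of_tdom rX hx).fun_mul
        (differentiableAt_of_tdom contDiffOn_metricForm hx)) (differentiableAt_of_tdom qX hx),
      lieD_mul (differentiableAt_of_tdom rX hx)
        (differentiableAt_of_tdom contDiffOn_metricForm hx),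
      lieD_tangentLift_fst (Sm.differentiableAt S.contDiffOn_rhoX hx.1)]
    rfl
  rw [hX, hY, hatX_metricForm_aux h₁ hx, hatY_metricForm_aux h₂ hx] at hc
  linear_combination hc


/-- The tangent vector at `j` with the given values of `λ, ν₁, ν₂, ν₃`. -/
theorem exists_tangent (S : PDESystem) (j : Jet) (l n₀ n₁ n₂ : ℝ) :
    ∃ v : Jet, lamHat (j, v) = l ∧ S.nuHat 0 (j, v) = n₀ ∧ S.nuHat 1 (j, v) = n₁ ∧
      S.nuHat 2 (j, v) = n₂ := by
  refine ⟨![0, 0, l, n₀, n₁, n₂], ?_, ?_, ?_, ?_⟩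
  · simp [lamHat, lamForm_apply]
  · simp [nuHat, nu_zero_apply]
  · simp [nuHat, nu_one_apply]
  · simp [nuHat, nu_two_apply]

/-- The four forms take arbitrary independent values at a jet, so the commutation identity becomes a
polynomial identity in l, n₀, n₁, n₂ whose coefficients can be separated. -/
theorem hat_comm_coeff (h₁ : ∀ j ∈ S.dom, S.J1 j = 0) (h₂ : ∀ j ∈ S.dom, S.J2 j = 0)
    {j : Jet} (hj : j ∈ S.dom) (l n₀ n₁ n₂ : ℝ) :
    (S.Dx S.rhoY j - S.Dy S.rhoX j) * (S.Ts j * n₀ ^ 2 - 2 * (n₀ * n₁) + S.Rs j * n₁ ^ 2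
        + S.cD j * (l * n₂) + S.cE j * (l * n₀) + S.cF j * (l * n₁) + S.cG j * l ^ 2)
      + l * (S.rhoY j * (S.defX 0 j * n₀ + S.defX 1 j * n₁ + S.defX 2 j * l)
        - S.rhoX j * (S.defY 0 j * n₀ + S.defY 1 j * n₁ + S.defY 2 j * l)
        + (S.Dx (S.defY 0) j * n₀ + S.Dx (S.defY 1) j * n₁ + S.Dx (S.defY 2) j * l)
        - (S.Dy (S.defX 0) j * n₀ + S.Dy (S.defX 1) j * n₁ + S.Dy (S.defX 2) j * l)
        + S.defY 0 j * (pd 2 S.R j * l + pd 3 S.R j * n₀ + pd 4 S.R j * n₁ + S.Rs j * n₂)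
        + S.defY 1 j * n₂ + 2 * S.defY 2 j * n₀ - S.defX 0 j * n₂
        - S.defX 1 j * (pd 2 S.T j * l + pd 3 S.T j * n₀ + pd 4 S.T j * n₁ + S.Ts j * n₂)
        - 2 * S.defX 2 j * n₁)
      + n₀ * (S.defY 0 j * n₀ + S.defY 1 j * n₁) - n₁ * (S.defX 0 j * n₀ + S.defX 1 j * n₁) = 0 := by
  obtain ⟨v, e0, e1, e2, e3⟩ := S.exists_tangent j l n₀ n₁ n₂
  have hx : (j, v) ∈ S.tdom := ⟨hj, mem_univ _⟩
  have hz : S.Sm 0 := contDiffOn_const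
  have h := hat_comm_metricForm h₁ h₂ hx
  rw [hatX_quad hx hz hz hz hz (S.contDiffOn_defY 0) (S.contDiffOn_defY 1) (S.contDiffOn_defY 2),
    hatY_quad hx hz hz hz hz (S.contDiffOn_defX 0) (S.contDiffOn_defX 1) (S.contDiffOn_defX 2)] at h
  have z1 : S.Dx 0 j = 0 := lieD_const 0
  have z2 : S.Dy 0 j = 0 := lieD_const 0
  have t1 : pd 5 S.R = S.Rs := rfl
  have t2 : pd 5 S.T = S.Ts := rfl
  simp only [metricForm, quad, vert, z1, z2, Pi.zero_apply, t1, t2] at h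
  simp only [show ∀ i, S.nu i j v = S.nuHat i (j, v) from fun _ => rfl,
    show lamForm j v = lamHat (j, v) from rfl, e0, e1, e2, e3] at h
  linear_combination h

/-- Let δ = D_xρ_y - D_yρ_x. The terms without λ give `defY 0` = -δT_s, `defX 1` = δR_s and `defY 1`
- `defX 0` = 2δ. Substituted in the λν₃ coefficient they leave 4(1 - R_sT_s)δ = 0, so δ and with it
all four defects vanish. -/
theorem def_top_eq_zero (h₁ : ∀ j ∈ S.dom, S.J1 j = 0) (h₂ : ∀ j ∈ S.dom, S.J2 j = 0)
    {j : Jet} (hj : j ∈ S.dom) :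
    S.defX 0 j = 0 ∧ S.defX 1 j = 0 ∧ S.defY 0 j = 0 ∧ S.defY 1 j = 0 := by
  have H := hat_comm_coeff h₁ h₂ hj
  have a1 := H 0 1 0 0
  have a2 := H 0 0 1 0
  have a3 := H 0 1 1 0
  -- The difference of the values at n₂ = 1 and n₂ = -1 isolates the λν₃ coefficient.
  have a4 := H 1 0 0 1
  have a5 := H 1 0 0 (-1)
  have hw := (S.one_sub_pos hj).ne'
  have hD : S.cD j = 2 * (1 - S.Rs j * S.Ts j) := rfl
  have hX := S.defX_zero j
  have hδ : S.Dx S.rhoY j - S.Dy S.rhoX j = 0 := by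
    apply mul_right_cancel₀ hw
    linear_combination (a4 - a5) / 8 - (S.Rs j / 4) * a1 - (S.Ts j / 4) * a2 - (a3 - a1 - a2) / 4
      - (S.Dx S.rhoY j - S.Dy S.rhoX j) / 4 * hD
  refine ⟨hX, ?_, ?_, ?_⟩
  · linear_combination -a2 + S.Rs j * hδ
  · linear_combination a1 - S.Ts j * hδ
  · linear_combination a3 - a1 - a2 + 2 * hδ + hX

/-- The linear defects vanish on the whole open domain, hence so do their derivatives along D_x and
D_y. The λν₁ and λν₂ coefficients of the commutation identity then reduce to 2 `defY 2` and -2 `defX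
2`. -/
theorem def_eq_zero (h₁ : ∀ j ∈ S.dom, S.J1 j = 0) (h₂ : ∀ j ∈ S.dom, S.J2 j = 0)
    {j : Jet} (hj : j ∈ S.dom) (i : Fin 3) : S.defX i j = 0 ∧ S.defY i j = 0 := by
  obtain ⟨x0, x1, y0, y1⟩ := def_top_eq_zero h₁ h₂ hj
  have hdx : ∀ F : Jet → ℝ, EqOn F (fun _ => 0) S.dom → S.Dx F j = 0 := fun F hF =>
    (lieD_congr S.isOpen_dom hF hj).trans (lieD_const 0)
  have hdy : ∀ F : Jet → ℝ, EqOn F (fun _ => 0) S.dom → S.Dy F j = 0 := fun F hF =>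
    (lieD_congr S.isOpen_dom hF hj).trans (lieD_const 0)
  have d1 := hdx (S.defY 0) fun y hy => (def_top_eq_zero h₁ h₂ hy).2.2.1
  have d2 := hdx (S.defY 1) fun y hy => (def_top_eq_zero h₁ h₂ hy).2.2.2
  have d3 := hdy (S.defX 0) fun y hy => (def_top_eq_zero h₁ h₂ hy).1
  have d4 := hdy (S.defX 1) fun y hy => (def_top_eq_zero h₁ h₂ hy).2.1
  have H := hat_comm_coeff h₁ h₂ hj
  simp only [x0, x1, y0, y1, d1, d2, d3, d4] at H
  have a1 := H 0 1 0 0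
  have a2 := H 0 0 1 0
  have a3 := H 0 1 1 0
  have hδ : S.Dx S.rhoY j - S.Dy S.rhoX j = 0 := by linear_combination -(a3 - a1 - a2) / 2
  simp only [hδ] at H
  have b1 := H 1 1 0 0
  have b2 := H 1 0 1 0
  have b3 := H 1 0 0 0
  fin_cases i
  · exact ⟨x0, y0⟩
  · exact ⟨x1, y1⟩
  · constructor
    · change S.defX 2 j = 0
      linear_combination (b3 - b2) / 2
    · change S.defY 2 j = 0
      linear_combination (b1 - b3) / 2

theorem hatX_metricForm (h₁ : ∀ j ∈ S.dom, S.J1 j = 0) (h₂ : ∀ j ∈ S.dom, S.J2 j = 0)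
    {x : Jet × Jet} (hx : x ∈ S.tdom) : S.hatX S.metricForm x = S.rhoX x.1 * S.metricForm x := by
  have h := fun i => (def_eq_zero h₁ h₂ hx.1 i).1
  rw [hatX_metricForm_aux h₁ hx]
  simp [quad, h]

theorem hatY_metricForm (h₁ : ∀ j ∈ S.dom, S.J1 j = 0) (h₂ : ∀ j ∈ S.dom, S.J2 j = 0)
    {x : Jet × Jet} (hx : x ∈ S.tdom) : S.hatY S.metricForm x = S.rhoY x.1 * S.metricForm x := by
  have h := fun i => (def_eq_zero h₁ h₂ hx.1 i).2
  rw [hatY_metricForm_aux h₂ hx]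
  simp [quad, h]

end PDESystem

/-! ### The conformal Lie algebra of the factored metric -/

/-- The conditions under which the derivative of a coframe `β` with
`β₁β₂ + β₃β₄ = σ Q` along a conformal direction is in the conformal Lie algebra. -/
theorem conformal_frame_algebra {k l σ b₁ b₂ b₃ f φ δ Rz Rp Rq Rs Ts Uz Up Uq Us E F G D ρ
    k' l' σ' b₁' b₂' b₃' f' Rs' Ts' E' F' G' D' n₁₁ n₁₃ n₁₄ n₂₂ n₂₃ n₂₄ n₃₃ n₄₄ : ℝ}
    (h1 : Ts' + 2 * Ts * Rp + E = ρ * Ts) (h2 : ρ = Rp - Ts * Rq - F / 2)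
    (h3 : Rs' = 2 * Rq + ρ * Rs) (h4 : D' + D * Us + E * Rs + F = ρ * D)
    (h5 : 2 * Ts * Rz + D * Up + E' + E * Rp + 2 * G - ρ * E = 0)
    (h6 : -2 * Rz + D * Uq + F' + E * Rq - ρ * F = 0)
    (h7 : D * Uz + E * Rz + G' - ρ * G = 0)
    (r1 : σ * Ts = -k) (r2 : σ * Rs = -l) (r3 : -2 * σ = 1 + k * l) (r4 : b₁ - k * b₂ = σ * E)
    (r5 : b₂ - l * b₁ = σ * F) (r6 : b₁ * b₂ + b₃ = σ * G) (r7 : f = σ * D)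
    (d1 : σ' * Ts + σ * Ts' = -k') (d2 : σ' * Rs + σ * Rs' = -l')
    (d3 : -2 * σ' = k' * l + k * l') (d4 : b₁' - (k' * b₂ + k * b₂') = σ' * E + σ * E')
    (d5 : b₂' - (l' * b₁ + l * b₁') = σ' * F + σ * F')
    (d6 : b₁' * b₂ + b₁ * b₂' + b₃' = σ' * G + σ * G') (d7 : f' = σ' * D + σ * D')
    (hD : D = 2 * (1 - Rs * Ts)) (hφ : φ * f = 1) (hδ : δ * (1 - k * l) = 1) (hσ : σ ≠ 0)
    (e11 : n₁₁ = -k * Rq) (e13 : n₁₃ = (1 - k * Rs) * φ)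
    (e14 : n₁₄ = -k * Rz + b₁' - n₁₁ * b₁ - n₁₃ * b₃) (e22 : n₂₂ = Rp + b₂)
    (e23 : n₂₃ = (Rs - l) * φ) (e24 : n₂₄ = Rz + b₂' - n₂₂ * b₂ - n₂₃ * b₃)
    (e33 : n₃₃ = φ * f' + Us) (e44 : n₄₄ = -(b₂ + l * b₁) * δ) :
    -k' - k * Rp + b₁ = -k * n₁₁ ∧ Rq - l' = -l * n₂₂ ∧
    f * Up + b₃ = k * n₂₄ - n₁₄ ∧ f * Uq = -n₂₄ + l * n₁₄ ∧
    f * Uz + b₃' = -n₂₄ * b₁ - n₁₄ * b₂ + n₃₃ * b₃ ∧ n₁₁ + n₂₂ = n₃₃ + n₄₄ ∧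
    n₂₃ = -(l * δ) ∧ n₁₃ = -δ := by
  have hkl : 1 - k * l ≠ 0 := by
    intro h
    rw [h, mul_zero] at hδ
    exact zero_ne_one hδ
  have hf : f ≠ 0 := by
    intro h
    rw [h, mul_zero] at hφ
    exact zero_ne_one hφ
  -- The first two facts `c8`, `c7` concern only the ν₃ entries; this identity expresses the factor
  -- of β₃ through k and l, and lets both be checked after clearing f, 1 - kl and σ.
  have hσf : σ * f = (1 - k * l) ^ 2 / 2 := by
    linear_combination σ * r7 + σ ^ 2 * hD - 2 * σ * Rs * r1 + 2 * k * r2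
      + (-σ + (1 + k * l) / 2) * r3
  have c8 : n₁₃ = -δ := by
    apply mul_right_cancel₀ hf
    apply mul_right_cancel₀ hkl
    apply mul_right_cancel₀ hσ
    rw [e13]
    linear_combination σ * (1 - k * Rs) * (1 - k * l) * hφ + σ * f * hδ - (1 - k * l) * k * r2
      + hσf - (1 - k * l) / 2 * r3
  have c7 : n₂₃ = -(l * δ) := by
    apply mul_right_cancel₀ hf
    apply mul_right_cancel₀ hkl
    apply mul_right_cancel₀ hσ
    rw [e23]
    linear_combination σ * (Rs - l) * (1 - k * l) * hφ + l * σ * f * hδ + (1 - k * l) * r2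
      + l * hσf + l * (1 - k * l) / 2 * r3
  -- The Lie derivative of β₁β₂ + β₃β₄ = σQ is (σ' + σρ)Q. The equations `s1`, `s2`, `s3` are its
  -- ν₁², ν₂² and ν₁ν₂ coefficients. Eliminating the off-diagonal unknowns from them, which needs 1
  -- - kl ≠ 0, gives in `s4` the common trace n₁₁ + n₂₂ = (σ' + σρ)/σ; the remaining relations
  -- follow from it coefficient by coefficient.
  have s1 : -k' - k * Rp + b₁ - k * n₂₂ = (σ' + σ * ρ) * Ts := by
    linear_combination -k * e22 + r4 - d1 - σ * h1 * (-1) + 2 * Rp * r1 * (-1)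
  have s2 : Rq - l' - l * n₁₁ = (σ' + σ * ρ) * Rs := by
    linear_combination -l * e11 + d2 * (-1) + σ * h3 - Rq * r3
  have s3 : n₁₁ + n₂₂ - l * (-k' - k * Rp + b₁) - k * (Rq - l') = -2 * (σ' + σ * ρ) := by
    linear_combination e11 + e22 + r5 - d3 + 2 * σ * h2 - Rp * r3 + 2 * Rq * r1 * (-1)
  have s4 : σ * (n₁₁ + n₂₂) = σ' + σ * ρ := by
    apply mul_right_cancel₀ hkl
    linear_combination σ * s3 + l * σ * s1 + k * σ * s2 + (σ' + σ * ρ) * (l * r1 + k * r2)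
      - (σ' + σ * ρ) * r3 * (-1)
  have c1 : -k' - k * Rp + b₁ = -k * n₁₁ := by
    linear_combination s1 - Ts * s4 + (n₁₁ + n₂₂) * r1
  have c2 : Rq - l' = -l * n₂₂ := by
    linear_combination s2 - Rs * s4 + (n₁₁ + n₂₂) * r2
  have c6 : n₁₁ + n₂₂ = n₃₃ + n₄₄ := by
    apply mul_right_cancel₀ hf
    linear_combination -f * e33 - f' * hφ - d7 - Us * r7 - σ * h4 + (n₁₁ + n₂₂) * r7 + D * s4
      - Rs * r4 - r5 - f * e44 + b₁ * f * (c7 - e23) - b₁ * (Rs - l) * hφ + b₂ * f * (c8 - e13)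
      - b₂ * (1 - k * Rs) * hφ
  refine ⟨c1, c2, ?_, ?_, ?_, c6, c7, c8⟩
  · linear_combination e14 - k * e24 - b₃ * c8 + k * b₃ * c7 + b₃ * hδ + d4 + σ * h5 + Up * r7
      - 2 * Rz * r1 + 2 * r6 - E * s4 - (n₁₁ + n₂₂ - Rp) * r4 + b₁ * e22 - b₂ * c1
  · linear_combination e24 - l * e14 - b₃ * c7 + l * b₃ * c8 + d5 + σ * h6 + Uq * r7 - Rz * r3
      - F * s4 - (n₁₁ + n₂₂) * r5 + Rq * r4 + b₂ * e11 - b₁ * c2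
  · linear_combination b₁ * e24 + b₂ * e14 + d6 + σ * h7 + Uz * r7 + Rz * r4 - G * s4
      - (n₁₁ + n₂₂) * r6 - b₃ * b₁ * c7 - b₃ * b₂ * c8 + b₃ * c6 + b₃ * e44

namespace PDESystem

variable (S : PDESystem)

/-! ### Exterior derivatives of combinations of `λ, ν₁, ν₂, ν₃` -/

theorem dForm_lamForm (j v₁ v₂ : Jet) : dForm lamForm j v₁ v₂ =
    v₁ 0 * S.nu 0 j v₂ - v₂ 0 * S.nu 0 j v₁ + (v₁ 1 * S.nu 1 j v₂ - v₂ 1 * S.nu 1 j v₁) := by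
  rw [dForm_eq_eval (differentiableAt_lamForm j), fderiv_lamForm_eval, fderiv_lamForm_eval]
  simp only [nu_zero_apply, nu_one_apply]
  ring

variable {S}

theorem dForm_nu_zero {j : Jet} (hj : j ∈ S.dom) (v₁ v₂ : Jet) : dForm (S.nu 0) j v₁ v₂ =
    v₁ 0 * S.vert S.R j v₂ - v₂ 0 * S.vert S.R j v₁
      + (v₁ 1 * S.nu 2 j v₂ - v₂ 1 * S.nu 2 j v₁) := by
  rw [dForm_eq_eval (S.differentiableAt_nu 0 hj), S.fderiv_nu_zero_eval hj,
    S.fderiv_nu_zero_eval hj, S.fderiv_eq_vert S.R j v₁, S.fderiv_eq_vert S.R j v₂, S.Dy_R hj]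
  simp only [nu_two_apply]
  ring

theorem dForm_nu_one {j : Jet} (hj : j ∈ S.dom) (v₁ v₂ : Jet) : dForm (S.nu 1) j v₁ v₂ =
    v₁ 0 * S.nu 2 j v₂ - v₂ 0 * S.nu 2 j v₁
      + (v₁ 1 * S.vert S.T j v₂ - v₂ 1 * S.vert S.T j v₁) := by
  rw [dForm_eq_eval (S.differentiableAt_nu 1 hj), S.fderiv_nu_one_eval hj,
    S.fderiv_nu_one_eval hj, S.fderiv_eq_vert S.T j v₁, S.fderiv_eq_vert S.T j v₂, S.Dx_T hj]
  simp only [nu_two_apply]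
  ring

theorem dForm_nu_two {j : Jet} (hj : j ∈ S.dom) (v₁ v₂ : Jet) : dForm (S.nu 2) j v₁ v₂ =
    v₁ 0 * S.vert S.U j v₂ - v₂ 0 * S.vert S.U j v₁
      + (v₁ 1 * S.vert S.V j v₂ - v₂ 1 * S.vert S.V j v₁) := by
  rw [dForm_eq_eval (S.differentiableAt_nu 2 hj), S.fderiv_nu_two_eval hj,
    S.fderiv_nu_two_eval hj, S.fderiv_eq_vert S.U j v₁, S.fderiv_eq_vert S.U j v₂,
    S.fderiv_eq_vert S.V j v₁, S.fderiv_eq_vert S.V j v₂, S.Dx_V hj]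
  ring

variable (S)

/-- The 1-form `f₀ λ + f₁ ν₁ + f₂ ν₂ + f₃ ν₃`. -/
noncomputable def para (f₀ f₁ f₂ f₃ : Jet → ℝ) (j : Jet) : Jet →L[ℝ] ℝ :=
  f₀ j • lamForm j + (f₁ j • S.nu 0 j + (f₂ j • S.nu 1 j + f₃ j • S.nu 2 j))

theorem para_apply (f₀ f₁ f₂ f₃ : Jet → ℝ) (j v : Jet) : S.para f₀ f₁ f₂ f₃ j v =
    f₀ j * lamForm j v + f₁ j * S.nu 0 j v + f₂ j * S.nu 1 j v + f₃ j * S.nu 2 j v := by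
  simp only [para, add_apply, smul_apply, smul_eq_mul]
  ring

variable {S} {f₀ f₁ f₂ f₃ : Jet → ℝ}

theorem contDiffOn_para (h₀ : S.Sm f₀) (h₁ : S.Sm f₁) (h₂ : S.Sm f₂) (h₃ : S.Sm f₃) :
    ContDiffOn ℝ ∞ (S.para f₀ f₁ f₂ f₃) S.dom :=
  (h₀.smul contDiff_lamForm.contDiffOn).add ((h₁.smul (S.contDiffOn_nu 0)).add
    ((h₂.smul (S.contDiffOn_nu 1)).add (h₃.smul (S.contDiffOn_nu 2))))

theorem dForm_para (h₀ : S.Sm f₀) (h₁ : S.Sm f₁) (h₂ : S.Sm f₂) (h₃ : S.Sm f₃) {j : Jet}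
    (hj : j ∈ S.dom) (v₁ v₂ : Jet) : dForm (S.para f₀ f₁ f₂ f₃) j v₁ v₂ =
    (fderiv ℝ f₀ j v₁ * lamForm j v₂ - fderiv ℝ f₀ j v₂ * lamForm j v₁
      + f₀ j * (v₁ 0 * S.nu 0 j v₂ - v₂ 0 * S.nu 0 j v₁
        + (v₁ 1 * S.nu 1 j v₂ - v₂ 1 * S.nu 1 j v₁)))
    + (fderiv ℝ f₁ j v₁ * S.nu 0 j v₂ - fderiv ℝ f₁ j v₂ * S.nu 0 j v₁
      + f₁ j * (v₁ 0 * S.vert S.R j v₂ - v₂ 0 * S.vert S.R j v₁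
        + (v₁ 1 * S.nu 2 j v₂ - v₂ 1 * S.nu 2 j v₁)))
    + (fderiv ℝ f₂ j v₁ * S.nu 1 j v₂ - fderiv ℝ f₂ j v₂ * S.nu 1 j v₁
      + f₂ j * (v₁ 0 * S.nu 2 j v₂ - v₂ 0 * S.nu 2 j v₁
        + (v₁ 1 * S.vert S.T j v₂ - v₂ 1 * S.vert S.T j v₁)))
    + (fderiv ℝ f₃ j v₁ * S.nu 2 j v₂ - fderiv ℝ f₃ j v₂ * S.nu 2 j v₁
      + f₃ j * (v₁ 0 * S.vert S.U j v₂ - v₂ 0 * S.vert S.U j v₁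
        + (v₁ 1 * S.vert S.V j v₂ - v₂ 1 * S.vert S.V j v₁))) := by
  have l₀ := differentiableAt_lamForm j
  have n₀ := S.differentiableAt_nu 0 hj
  have n₁ := S.differentiableAt_nu 1 hj
  have n₂ := S.differentiableAt_nu 2 hj
  have g₀ := Sm.differentiableAt h₀ hj
  have g₁ := Sm.differentiableAt h₁ hj
  have g₂ := Sm.differentiableAt h₂ hj
  have g₃ := Sm.differentiableAt h₃ hj
  rw [show S.para f₀ f₁ f₂ f₃ = fun j => f₀ j • lamForm j + (f₁ j • S.nu 0 j + (f₂ j • S.nu 1 j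
    + f₃ j • S.nu 2 j)) from rfl,
    dForm_add (g₀.fun_smul l₀) ((g₁.fun_smul n₀).fun_add ((g₂.fun_smul n₁).fun_add (g₃.fun_smul n₂))),
    dForm_add (g₁.fun_smul n₀) ((g₂.fun_smul n₁).fun_add (g₃.fun_smul n₂)),
    dForm_add (g₂.fun_smul n₁) (g₃.fun_smul n₂), dForm_smul g₀ l₀, dForm_smul g₁ n₀,
    dForm_smul g₂ n₁, dForm_smul g₃ n₂, dForm_lamForm S, dForm_nu_zero hj, dForm_nu_one hj,
    dForm_nu_two hj]
  simp only [wedge]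
  ring

variable (S)

/-! ### The normalized coframe -/

/-- `k = T_s / (1 + w)`. -/
noncomputable def fk (j : Jet) : ℝ := S.Ts j / (1 + S.w j)

/-- `l = R_s / (1 + w)`. -/
noncomputable def fl (j : Jet) : ℝ := S.Rs j / (1 + S.w j)

/-- The factor between the metric of the normalized coframe and `metricForm`. -/
noncomputable def fσ (j : Jet) : ℝ := -1 / (1 + S.w j)

/-- Coefficient of `λ` in `β₁`. -/
noncomputable def fb₁ (j : Jet) : ℝ := -(S.cE j + S.fk j * S.cF j) / (2 * S.w j)

/-- Coefficient of `λ` in `β₂`. -/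
noncomputable def fb₂ (j : Jet) : ℝ := -(S.cF j + S.fl j * S.cE j) / (2 * S.w j)

/-- Coefficient of `λ` in `β₃`. -/
noncomputable def fb₃ (j : Jet) : ℝ := S.fσ j * S.cG j - S.fb₁ j * S.fb₂ j

/-- Coefficient of `ν₃` in `β₃`. -/
noncomputable def ff (j : Jet) : ℝ := S.fσ j * S.cD j

/-- The inverse of `ff`. -/
noncomputable def fφ (j : Jet) : ℝ := -(1 + S.w j) / (2 * S.w j ^ 2)

/-- The inverse of `1 - k l`. -/
noncomputable def fδ (j : Jet) : ℝ := (1 + S.w j) / (2 * S.w j)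

theorem w_pos {j : Jet} (hj : j ∈ S.dom) : 0 < S.w j := Real.sqrt_pos.2 (S.one_sub_pos hj)

theorem w_sq {j : Jet} (hj : j ∈ S.dom) : S.w j ^ 2 = 1 - S.Rs j * S.Ts j :=
  Real.sq_sqrt (S.one_sub_pos hj).le

@[fun_prop]
theorem contDiffOn_w : ContDiffOn ℝ ∞ (fun j => S.w j) S.dom := by
  have h : ∀ j ∈ S.dom, 1 - S.Rs j * S.Ts j ≠ 0 := fun j hj => (S.one_sub_pos hj).ne'
  unfold w
  exact ContDiffOn.sqrt (by fun_prop) h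

theorem one_add_w_ne {j : Jet} (hj : j ∈ S.dom) : 1 + S.w j ≠ 0 := by
  have := S.w_pos hj
  positivity

theorem two_w_ne {j : Jet} (hj : j ∈ S.dom) : 2 * S.w j ≠ 0 := by
  have := S.w_pos hj
  positivity

@[fun_prop]
theorem contDiffOn_fk : ContDiffOn ℝ ∞ (fun j => S.fk j) S.dom := by
  have h : ∀ j ∈ S.dom, 1 + S.w j ≠ 0 := fun j hj => S.one_add_w_ne hj
  unfold fk
  fun_prop (disch := assumption)

@[fun_prop]
theorem contDiffOn_fl : ContDiffOn ℝ ∞ (fun j => S.fl j) S.dom := by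
  have h : ∀ j ∈ S.dom, 1 + S.w j ≠ 0 := fun j hj => S.one_add_w_ne hj
  unfold fl
  fun_prop (disch := assumption)

@[fun_prop]
theorem contDiffOn_fσ : ContDiffOn ℝ ∞ (fun j => S.fσ j) S.dom := by
  have h : ∀ j ∈ S.dom, 1 + S.w j ≠ 0 := fun j hj => S.one_add_w_ne hj
  unfold fσ
  fun_prop (disch := assumption)

@[fun_prop]
theorem contDiffOn_fδ : ContDiffOn ℝ ∞ (fun j => S.fδ j) S.dom := by
  have h : ∀ j ∈ S.dom, 2 * S.w j ≠ 0 := fun j hj => S.two_w_ne hj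
  unfold fδ
  fun_prop (disch := assumption)

@[fun_prop]
theorem contDiffOn_fφ : ContDiffOn ℝ ∞ (fun j => S.fφ j) S.dom := by
  have h : ∀ j ∈ S.dom, 2 * S.w j ^ 2 ≠ 0 := fun j hj => by
    have := S.w_pos hj
    positivity
  unfold fφ
  fun_prop (disch := assumption)

@[fun_prop]
theorem contDiffOn_fb₁ : ContDiffOn ℝ ∞ (fun j => S.fb₁ j) S.dom := by
  have h : ∀ j ∈ S.dom, 2 * S.w j ≠ 0 := fun j hj => S.two_w_ne hj
  unfold fb₁
  fun_prop (disch := assumption)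

@[fun_prop]
theorem contDiffOn_fb₂ : ContDiffOn ℝ ∞ (fun j => S.fb₂ j) S.dom := by
  have h : ∀ j ∈ S.dom, 2 * S.w j ≠ 0 := fun j hj => S.two_w_ne hj
  unfold fb₂
  fun_prop (disch := assumption)

@[fun_prop]
theorem contDiffOn_fb₃ : ContDiffOn ℝ ∞ (fun j => S.fb₃ j) S.dom := by
  unfold fb₃
  fun_prop

@[fun_prop]
theorem contDiffOn_ff : ContDiffOn ℝ ∞ (fun j => S.ff j) S.dom := by
  unfold ff
  fun_prop

variable {S}

section Relations

variable {j : Jet}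

/-- This relation and the next two express the factorization -(T_sν₁² - 2ν₁ν₂ + R_sν₂²)/(1 + w) =
(ν₂ - kν₁)(ν₁ - lν₂). It rests on R_sT_s = (1 - w)(1 + w), that is, kl = (1 - w)/(1 + w). The
denominator 1 + w never vanishes, so zeros of R_s and T_s do no harm. -/
theorem fσ_mul_Ts : S.fσ j * S.Ts j = -S.fk j := by
  rw [fσ, fk]
  ring

theorem fσ_mul_Rs : S.fσ j * S.Rs j = -S.fl j := by
  rw [fσ, fl]
  ring

theorem fk_mul_fl (hj : j ∈ S.dom) : 1 + S.fk j * S.fl j = -2 * S.fσ j := by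
  have h1 := S.one_add_w_ne hj
  have h2 := S.w_sq hj
  rw [fσ, fk, fl]
  field_simp
  linear_combination h2

theorem fδ_mul (hj : j ∈ S.dom) : S.fδ j * (1 - S.fk j * S.fl j) = 1 := by
  have h1 := S.one_add_w_ne hj
  have h3 := S.w_pos hj
  have h2 := S.w_sq hj
  rw [fδ, fk, fl]
  field_simp
  linear_combination -h2

theorem cD_eq (hj : j ∈ S.dom) : S.cD j = 2 * S.w j ^ 2 := by
  rw [S.w_sq hj, cD]

theorem fφ_mul_ff (hj : j ∈ S.dom) : S.fφ j * S.ff j = 1 := by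
  have h1 := S.one_add_w_ne hj
  have h3 := S.w_pos hj
  rw [fφ, ff, fσ, cD_eq hj]
  field_simp

theorem fσ_ne (hj : j ∈ S.dom) : S.fσ j ≠ 0 :=
  div_ne_zero (by norm_num) (S.one_add_w_ne hj)

/-- Matching of the λν₁ coefficients. With the corresponding λν₂ equation it is a linear system for
b₁, b₂ with determinant 1 - kl = 2w/(1 + w), which accounts for the 2w in the definitions. -/
theorem fb₁_sub (hj : j ∈ S.dom) : S.fb₁ j - S.fk j * S.fb₂ j = S.fσ j * S.cE j := by
  have h1 := S.two_w_ne hj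
  have h2 := fδ_mul hj
  have h3 := fk_mul_fl hj
  have h4 : S.fb₁ j * (2 * S.w j) = -(S.cE j + S.fk j * S.cF j) := div_mul_cancel₀ _ h1
  have h5 : S.fb₂ j * (2 * S.w j) = -(S.cF j + S.fl j * S.cE j) := div_mul_cancel₀ _ h1
  have h6 : S.fδ j * (2 * S.w j) = 1 + S.w j := div_mul_cancel₀ _ h1
  have h7 : S.fσ j * (1 + S.w j) = -1 := div_mul_cancel₀ _ (S.one_add_w_ne hj)
  have h8 : S.fσ j * S.fδ j * (2 * S.w j) = -1 := by linear_combination S.fσ j * h6 + h7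
  apply mul_right_cancel₀ h1
  linear_combination h4 - S.fk j * h5 + S.fσ j * S.cE j * 2 * S.w j * h2
    - S.cE j * (1 - S.fk j * S.fl j) * h8

theorem fb₂_sub (hj : j ∈ S.dom) : S.fb₂ j - S.fl j * S.fb₁ j = S.fσ j * S.cF j := by
  have h1 := S.two_w_ne hj
  have h2 := fδ_mul hj
  have h4 : S.fb₁ j * (2 * S.w j) = -(S.cE j + S.fk j * S.cF j) := div_mul_cancel₀ _ h1
  have h5 : S.fb₂ j * (2 * S.w j) = -(S.cF j + S.fl j * S.cE j) := div_mul_cancel₀ _ h1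
  have h6 : S.fδ j * (2 * S.w j) = 1 + S.w j := div_mul_cancel₀ _ h1
  have h7 : S.fσ j * (1 + S.w j) = -1 := div_mul_cancel₀ _ (S.one_add_w_ne hj)
  have h8 : S.fσ j * S.fδ j * (2 * S.w j) = -1 := by linear_combination S.fσ j * h6 + h7
  apply mul_right_cancel₀ h1
  linear_combination h5 - S.fl j * h4 + S.fσ j * S.cF j * 2 * S.w j * h2
    - S.cF j * (1 - S.fk j * S.fl j) * h8

theorem fb₃_add : S.fb₁ j * S.fb₂ j + S.fb₃ j = S.fσ j * S.cG j := by
  rw [fb₃]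
  ring

/-- The relations between the coefficients of the normalized coframe and of the metric,
differentiated along a vector field. -/
theorem lieD_frame_rel (W : Jet → Jet) (hj : j ∈ S.dom) :
    (lieD W S.fσ j * S.Ts j + S.fσ j * lieD W S.Ts j = -lieD W S.fk j) ∧
    (lieD W S.fσ j * S.Rs j + S.fσ j * lieD W S.Rs j = -lieD W S.fl j) ∧
    (-2 * lieD W S.fσ j = lieD W S.fk j * S.fl j + S.fk j * lieD W S.fl j) ∧
    (lieD W S.fb₁ j - (lieD W S.fk j * S.fb₂ j + S.fk j * lieD W S.fb₂ j)
      = lieD W S.fσ j * S.cE j + S.fσ j * lieD W S.cE j) ∧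
    (lieD W S.fb₂ j - (lieD W S.fl j * S.fb₁ j + S.fl j * lieD W S.fb₁ j)
      = lieD W S.fσ j * S.cF j + S.fσ j * lieD W S.cF j) ∧
    (lieD W S.fb₁ j * S.fb₂ j + S.fb₁ j * lieD W S.fb₂ j + lieD W S.fb₃ j
      = lieD W S.fσ j * S.cG j + S.fσ j * lieD W S.cG j) ∧
    (lieD W S.ff j = lieD W S.fσ j * S.cD j + S.fσ j * lieD W S.cD j) := by
  have dT := Sm.differentiableAt S.contDiffOn_Ts hj
  have dR := Sm.differentiableAt S.contDiffOn_Rs hj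
  have dσ := Sm.differentiableAt S.contDiffOn_fσ hj
  have dk := Sm.differentiableAt S.contDiffOn_fk hj
  have dl := Sm.differentiableAt S.contDiffOn_fl hj
  have d1 := Sm.differentiableAt S.contDiffOn_fb₁ hj
  have d2 := Sm.differentiableAt S.contDiffOn_fb₂ hj
  have d3 := Sm.differentiableAt S.contDiffOn_fb₃ hj
  have dE := Sm.differentiableAt S.contDiffOn_cE hj
  have dF := Sm.differentiableAt S.contDiffOn_cF hj
  have dG := Sm.differentiableAt S.contDiffOn_cG hj
  have dD := Sm.differentiableAt S.contDiffOn_cD hj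
  have C : ∀ {F G : Jet → ℝ}, EqOn F G S.dom → lieD W F j = lieD W G j := fun h =>
    lieD_congr S.isOpen_dom h hj
  refine ⟨?_, ?_, ?_, ?_, ?_, ?_, ?_⟩
  · have h := C (F := fun y => S.fσ y * S.Ts y) (G := fun y => (-1) * S.fk y) fun y _ => by
      simp only [fσ_mul_Ts, neg_one_mul]
    rw [lieD_mul dσ dT, lieD_const_mul _ dk] at h
    linear_combination h
  · have h := C (F := fun y => S.fσ y * S.Rs y) (G := fun y => (-1) * S.fl y) fun y _ => by
      simp only [fσ_mul_Rs, neg_one_mul]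
    rw [lieD_mul dσ dR, lieD_const_mul _ dl] at h
    linear_combination h
  · have h := C (F := fun y => (-2) * S.fσ y) (G := fun y => 1 + S.fk y * S.fl y) fun y hy =>
      (fk_mul_fl hy).symm
    rw [lieD_add (differentiableAt_const _) (dk.fun_mul dl), lieD_mul dk dl,
      lieD_const_mul _ dσ, lieD_const] at h
    linear_combination h
  · have h := C (F := fun y => S.fb₁ y - S.fk y * S.fb₂ y) (G := fun y => S.fσ y * S.cE y)
      fun y hy => fb₁_sub hy
    rwa [lieD_sub d1 (dk.fun_mul d2), lieD_mul dk d2, lieD_mul dσ dE] at h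
  · have h := C (F := fun y => S.fb₂ y - S.fl y * S.fb₁ y) (G := fun y => S.fσ y * S.cF y)
      fun y hy => fb₂_sub hy
    rwa [lieD_sub d2 (dl.fun_mul d1), lieD_mul dl d1, lieD_mul dσ dF] at h
  · have h := C (F := fun y => S.fb₁ y * S.fb₂ y + S.fb₃ y) (G := fun y => S.fσ y * S.cG y)
      fun y _ => fb₃_add
    rwa [lieD_add (d1.fun_mul d2) d3, lieD_mul d1 d2, lieD_mul dσ dG] at h
  · exact lieD_mul dσ dD

end Relations

end PDESystem

namespace PDESystem

variable (S : PDESystem)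

/-- `β₁ = ν₂ - k ν₁ + b₁ λ`. -/
noncomputable def β₁ : Jet → Jet →L[ℝ] ℝ := S.para S.fb₁ (fun j => -S.fk j) (fun _ => 1) fun _ => 0

/-- `β₂ = ν₁ - l ν₂ + b₂ λ`. -/
noncomputable def β₂ : Jet → Jet →L[ℝ] ℝ := S.para S.fb₂ (fun _ => 1) (fun j => -S.fl j) fun _ => 0

/-- `β₃ = f ν₃ + b₃ λ`. -/
noncomputable def β₃ : Jet → Jet →L[ℝ] ℝ := S.para S.fb₃ (fun _ => 0) (fun _ => 0) S.ff

/-- `β₄ = λ`. -/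
noncomputable def β₄ : Jet → Jet →L[ℝ] ℝ :=
  S.para (fun _ => 1) (fun _ => 0) (fun _ => 0) fun _ => 0

variable {S} {j : Jet}

theorem β₁_apply (v : Jet) :
    S.β₁ j v = S.nu 1 j v - S.fk j * S.nu 0 j v + S.fb₁ j * lamForm j v := by
  rw [β₁, para_apply]
  ring

theorem β₂_apply (v : Jet) :
    S.β₂ j v = S.nu 0 j v - S.fl j * S.nu 1 j v + S.fb₂ j * lamForm j v := by
  rw [β₂, para_apply]
  ring

theorem β₃_apply (v : Jet) : S.β₃ j v = S.ff j * S.nu 2 j v + S.fb₃ j * lamForm j v := by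
  rw [β₃, para_apply]
  ring

theorem β₄_apply (v : Jet) : S.β₄ j v = lamForm j v := by
  rw [β₄, para_apply]
  ring

variable (S)

theorem contDiffOn_β₁ : ContDiffOn ℝ ∞ S.β₁ S.dom :=
  contDiffOn_para (S := S) S.contDiffOn_fb₁ S.contDiffOn_fk.neg contDiffOn_const contDiffOn_const

theorem contDiffOn_β₂ : ContDiffOn ℝ ∞ S.β₂ S.dom :=
  contDiffOn_para (S := S) S.contDiffOn_fb₂ contDiffOn_const S.contDiffOn_fl.neg contDiffOn_const

theorem contDiffOn_β₃ : ContDiffOn ℝ ∞ S.β₃ S.dom :=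
  contDiffOn_para (S := S) S.contDiffOn_fb₃ contDiffOn_const contDiffOn_const S.contDiffOn_ff

theorem contDiffOn_β₄ : ContDiffOn ℝ ∞ S.β₄ S.dom :=
  contDiffOn_para (S := S) contDiffOn_const contDiffOn_const contDiffOn_const contDiffOn_const

variable {S}

theorem nu_zero_eq_β (hj : j ∈ S.dom) (v : Jet) : S.nu 0 j v =
    S.fδ j * (S.fl j * S.β₁ j v + S.β₂ j v - (S.fb₂ j + S.fl j * S.fb₁ j) * S.β₄ j v) := by
  rw [β₁_apply, β₂_apply, β₄_apply]
  linear_combination (-S.nu 0 j v) * fδ_mul hj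

theorem nu_one_eq_β (hj : j ∈ S.dom) (v : Jet) : S.nu 1 j v =
    S.fδ j * (S.β₁ j v + S.fk j * S.β₂ j v - (S.fb₁ j + S.fk j * S.fb₂ j) * S.β₄ j v) := by
  rw [β₁_apply, β₂_apply, β₄_apply]
  linear_combination (-S.nu 1 j v) * fδ_mul hj

theorem nu_two_eq_β (hj : j ∈ S.dom) (v : Jet) : S.nu 2 j v =
    S.fφ j * (S.β₃ j v - S.fb₃ j * S.β₄ j v) := by
  rw [β₃_apply, β₄_apply]
  linear_combination (-S.nu 2 j v) * fφ_mul_ff hj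

/-- The metric of the normalized coframe. -/
theorem β_metric (hj : j ∈ S.dom) (v : Jet) : S.β₁ j v * S.β₂ j v + S.β₃ j v * S.β₄ j v
    = S.fσ j * S.metricForm (j, v) := by
  rw [β₁_apply, β₂_apply, β₃_apply, β₄_apply, metricForm, quad]
  simp only [show ∀ i, S.nuHat i (j, v) = S.nu i j v from fun _ => rfl,
    show lamHat (j, v) = lamForm j v from rfl]
  have h4 := fb₁_sub hj
  have h5 := fb₂_sub hj
  have h6 := fb₃_add (S := S) (j := j)
  have h7 : S.ff j = S.fσ j * S.cD j := rfl
  linear_combination (-S.nu 0 j v ^ 2) * fσ_mul_Ts (S := S) (j := j)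
    - S.nu 1 j v ^ 2 * fσ_mul_Rs (S := S) (j := j) + S.nu 0 j v * S.nu 1 j v * fk_mul_fl hj
    + lamForm j v * S.nu 0 j v * h4 + lamForm j v * S.nu 1 j v * h5 + lamForm j v ^ 2 * h6
    + lamForm j v * S.nu 2 j v * h7

/-- The derivative of the normalized coframe along `D_x`. -/
theorem frame_lie_x (h₁ : ∀ j ∈ S.dom, S.J1 j = 0) (h₂ : ∀ j ∈ S.dom, S.J2 j = 0) :
    ∃ n₁₁ n₂₂ n₃₃ n₄₄ n₁₄ n₂₄ : Jet → ℝ,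
      S.Sm n₁₁ ∧ S.Sm n₂₂ ∧ S.Sm n₃₃ ∧ S.Sm n₄₄ ∧ S.Sm n₁₄ ∧ S.Sm n₂₄ ∧
      ∀ j ∈ S.dom, n₁₁ j + n₂₂ j = n₃₃ j + n₄₄ j ∧ ∀ v : Jet,
        S.Dx S.fb₁ j * lamForm j v + S.fb₁ j * S.nu 0 j v
          - (S.Dx S.fk j * S.nu 0 j v + S.fk j * S.vert S.R j v) + S.nu 2 j v
          = n₁₁ j * S.β₁ j v - S.fδ j * S.β₃ j v + n₁₄ j * S.β₄ j v ∧
        S.Dx S.fb₂ j * lamForm j v + S.fb₂ j * S.nu 0 j v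
          - (S.Dx S.fl j * S.nu 1 j v + S.fl j * S.nu 2 j v) + S.vert S.R j v
          = n₂₂ j * S.β₂ j v - S.fl j * S.fδ j * S.β₃ j v + n₂₄ j * S.β₄ j v ∧
        S.Dx S.fb₃ j * lamForm j v + S.fb₃ j * S.nu 0 j v
          + (S.Dx S.ff j * S.nu 2 j v + S.ff j * S.vert S.U j v)
          = -n₂₄ j * S.β₁ j v - n₁₄ j * S.β₂ j v + n₃₃ j * S.β₃ j v ∧
        S.nu 0 j v = S.fl j * S.fδ j * S.β₁ j v + S.fδ j * S.β₂ j v + n₄₄ j * S.β₄ j v := by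
  -- The diagonal entries are read off from the coefficient of ν₂ in the first row, ν₁ in the second
  -- and ν₃ in the third; n₄₄ comes from ν₁ expressed in the β frame, n₁₄ and n₂₄ from the
  -- coefficients of λ. That all other coefficients agree is the content of
  -- `conformal_frame_algebra`.
  refine ⟨fun j => -S.fk j * pd 4 S.R j, fun j => pd 3 S.R j + S.fb₂ j,
    fun j => S.fφ j * S.Dx S.ff j + pd 5 S.U j, fun j => -(S.fb₂ j + S.fl j * S.fb₁ j) * S.fδ j,
    fun j => -S.fk j * pd 2 S.R j + S.Dx S.fb₁ j - (-S.fk j * pd 4 S.R j) * S.fb₁ j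
      - (1 - S.fk j * S.Rs j) * S.fφ j * S.fb₃ j,
    fun j => pd 2 S.R j + S.Dx S.fb₂ j - (pd 3 S.R j + S.fb₂ j) * S.fb₂ j
      - (S.Rs j - S.fl j) * S.fφ j * S.fb₃ j, by unfold Sm; fun_prop, by unfold Sm; fun_prop,
    by unfold Sm; fun_prop, by unfold Sm; fun_prop, by unfold Sm; fun_prop, by unfold Sm; fun_prop,
    fun j hj => ?_⟩
  obtain ⟨d1, d2, d3, d4, d5, d6, d7⟩ := lieD_frame_rel (vecDx S.R S.T) hj
  simp only [show ∀ F, lieD (vecDx S.R S.T) F j = S.Dx F j from fun _ => rfl]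
    at d1 d2 d3 d4 d5 d6 d7
  have X0 := (def_eq_zero h₁ h₂ hj 0).1
  have X1 := (def_eq_zero h₁ h₂ hj 1).1
  have X2 := (def_eq_zero h₁ h₂ hj 2).1
  simp only [defX, Matrix.cons_val_zero, Matrix.cons_val_one, Matrix.cons_val] at X0 X1 X2
  obtain ⟨c1, c2, c3, c4, c5, c6, c7, c8⟩ := conformal_frame_algebra (cE_cF_rel hj).1 rfl
    (Dx_Rs hj (h₁ _ hj)) (cD_rel_x hj (h₁ _ hj)) X0 X1 X2
    fσ_mul_Ts fσ_mul_Rs (fk_mul_fl hj).symm (fb₁_sub hj) (fb₂_sub hj) fb₃_add rfl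
    d1 d2 d3 d4 d5 d6 d7 rfl (fφ_mul_ff hj) (fδ_mul hj) (fσ_ne hj) rfl rfl rfl rfl rfl rfl rfl rfl
  refine ⟨c6, fun v => ?_⟩
  have hφ := fφ_mul_ff hj
  have hR : pd 5 S.R j = S.Rs j := rfl
  have hff : S.ff j = S.fσ j * S.cD j := rfl
  rw [vert, vert, hR]
  refine ⟨?_, ?_, ?_, ?_⟩
  · rw [β₁_apply, β₃_apply, β₄_apply]
    linear_combination S.nu 0 j v * c1 - (S.ff j * S.nu 2 j v + S.fb₃ j * lamForm j v) * c8 * (-1)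
      + (1 - S.fk j * S.Rs j) * S.nu 2 j v * hφ * (-1)
  · rw [β₂_apply, β₃_apply, β₄_apply]
    linear_combination S.nu 1 j v * c2 + (S.ff j * S.nu 2 j v + S.fb₃ j * lamForm j v) * c7
      - (S.Rs j - S.fl j) * S.nu 2 j v * hφ
  · rw [β₁_apply, β₂_apply, β₃_apply]
    linear_combination S.nu 0 j v * c3 + S.nu 1 j v * c4 + lamForm j v * c5
      - S.Dx S.ff j * S.nu 2 j v * hφ
      + (lamForm j v * pd 2 S.U j + S.nu 0 j v * pd 3 S.U j + S.nu 1 j v * pd 4 S.U j) * hff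
  · rw [nu_zero_eq_β hj]
    ring

/-- The derivative of the normalized coframe along `D_y`. -/
theorem frame_lie_y (h₁ : ∀ j ∈ S.dom, S.J1 j = 0) (h₂ : ∀ j ∈ S.dom, S.J2 j = 0) :
    ∃ n₁₁ n₂₂ n₃₃ n₄₄ n₁₄ n₂₄ : Jet → ℝ,
      S.Sm n₁₁ ∧ S.Sm n₂₂ ∧ S.Sm n₃₃ ∧ S.Sm n₄₄ ∧ S.Sm n₁₄ ∧ S.Sm n₂₄ ∧
      ∀ j ∈ S.dom, n₁₁ j + n₂₂ j = n₃₃ j + n₄₄ j ∧ ∀ v : Jet,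
        S.Dy S.fb₁ j * lamForm j v + S.fb₁ j * S.nu 1 j v
          - (S.Dy S.fk j * S.nu 0 j v + S.fk j * S.nu 2 j v) + S.vert S.T j v
          = n₁₁ j * S.β₁ j v - S.fk j * S.fδ j * S.β₃ j v + n₁₄ j * S.β₄ j v ∧
        S.Dy S.fb₂ j * lamForm j v + S.fb₂ j * S.nu 1 j v
          - (S.Dy S.fl j * S.nu 1 j v + S.fl j * S.vert S.T j v) + S.nu 2 j v
          = n₂₂ j * S.β₂ j v - S.fδ j * S.β₃ j v + n₂₄ j * S.β₄ j v ∧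
        S.Dy S.fb₃ j * lamForm j v + S.fb₃ j * S.nu 1 j v
          + (S.Dy S.ff j * S.nu 2 j v + S.ff j * S.vert S.V j v)
          = -n₂₄ j * S.β₁ j v - n₁₄ j * S.β₂ j v + n₃₃ j * S.β₃ j v ∧
        S.nu 1 j v = S.fδ j * S.β₁ j v + S.fk j * S.fδ j * S.β₂ j v + n₄₄ j * S.β₄ j v := by
  refine ⟨fun j => pd 4 S.T j + S.fb₁ j, fun j => -S.fl j * pd 3 S.T j,
    fun j => S.fφ j * S.Dy S.ff j + pd 5 S.V j, fun j => -(S.fb₁ j + S.fk j * S.fb₂ j) * S.fδ j,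
    fun j => pd 2 S.T j + S.Dy S.fb₁ j - (pd 4 S.T j + S.fb₁ j) * S.fb₁ j
      - (S.Ts j - S.fk j) * S.fφ j * S.fb₃ j,
    fun j => -S.fl j * pd 2 S.T j + S.Dy S.fb₂ j - (-S.fl j * pd 3 S.T j) * S.fb₂ j
      - (1 - S.fl j * S.Ts j) * S.fφ j * S.fb₃ j, by unfold Sm; fun_prop, by unfold Sm; fun_prop,
    by unfold Sm; fun_prop, by unfold Sm; fun_prop, by unfold Sm; fun_prop, by unfold Sm; fun_prop,
    fun j hj => ?_⟩
  obtain ⟨d1, d2, d3, d4, d5, d6, d7⟩ := lieD_frame_rel (vecDy S.R S.T) hj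
  simp only [show ∀ F, lieD (vecDy S.R S.T) F j = S.Dy F j from fun _ => rfl]
    at d1 d2 d3 d4 d5 d6 d7
  have X0 := (def_eq_zero h₁ h₂ hj 0).2
  have X1 := (def_eq_zero h₁ h₂ hj 1).2
  have X2 := (def_eq_zero h₁ h₂ hj 2).2
  simp only [defY, Matrix.cons_val_zero, Matrix.cons_val_one, Matrix.cons_val] at X0 X1 X2
  have hk := fk_mul_fl hj
  have hδ := fδ_mul hj
  have hb := fb₃_add (S := S) (j := j)
  have hD : S.cD j = 2 * (1 - S.Rs j * S.Ts j) := rfl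
  -- Interchanging x and y interchanges R with T, k with l, β₁ with β₂ and E with F. The same
  -- algebra therefore applies with permuted arguments.
  obtain ⟨c1, c2, c3, c4, c5, c6, c7, c8⟩ := conformal_frame_algebra (k := S.fl j) (l := S.fk j)
    (b₁ := S.fb₂ j) (b₂ := S.fb₁ j) (b₃ := S.fb₃ j) (δ := S.fδ j) (k' := S.Dy S.fl j)
    (l' := S.Dy S.fk j) (σ' := S.Dy S.fσ j) (b₁' := S.Dy S.fb₂ j) (b₂' := S.Dy S.fb₁ j)
    (b₃' := S.Dy S.fb₃ j) (G' := S.Dy S.cG j) (cE_cF_rel hj).2 rfl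
    (Dy_Ts hj (h₂ _ hj)) (cD_rel_y hj (h₂ _ hj)) X1 X0 X2
    fσ_mul_Rs fσ_mul_Ts (by linear_combination -hk) (fb₂_sub hj) (fb₁_sub hj)
    (by linear_combination hb) rfl
    d2 d1 (by linear_combination d3) d5 d4 (by linear_combination d6) d7
    (by linear_combination hD) (fφ_mul_ff hj) (by linear_combination hδ) (fσ_ne hj)
    rfl rfl rfl rfl rfl rfl rfl rfl
  refine ⟨by linear_combination c6, fun v => ?_⟩
  have hφ := fφ_mul_ff hj
  have hT : pd 5 S.T j = S.Ts j := rfl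
  have hff : S.ff j = S.fσ j * S.cD j := rfl
  rw [vert, vert, hT]
  refine ⟨?_, ?_, ?_, ?_⟩
  · rw [β₁_apply, β₃_apply, β₄_apply]
    linear_combination S.nu 0 j v * c2 + (S.ff j * S.nu 2 j v + S.fb₃ j * lamForm j v) * c7
      - (S.Ts j - S.fk j) * S.nu 2 j v * hφ
  · rw [β₂_apply, β₃_apply, β₄_apply]
    linear_combination S.nu 1 j v * c1 + (S.ff j * S.nu 2 j v + S.fb₃ j * lamForm j v) * c8
      - (1 - S.fl j * S.Ts j) * S.nu 2 j v * hφ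
  · rw [β₁_apply, β₂_apply, β₃_apply]
    linear_combination S.nu 1 j v * c3 + S.nu 0 j v * c4 + lamForm j v * c5
      - S.Dy S.ff j * S.nu 2 j v * hφ
      + (lamForm j v * pd 2 S.V j + S.nu 0 j v * pd 3 S.V j + S.nu 1 j v * pd 4 S.V j) * hff
  · rw [nu_one_eq_β hj]
    ring

variable (S)

/-! ### Components of vertical derivatives in the normalized coframe -/

noncomputable def comp₁ (F : Jet → ℝ) (j : Jet) : ℝ := S.fδ j * (S.fl j * pd 3 F j + pd 4 F j)

noncomputable def comp₂ (F : Jet → ℝ) (j : Jet) : ℝ := S.fδ j * (pd 3 F j + S.fk j * pd 4 F j)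

noncomputable def comp₃ (F : Jet → ℝ) (j : Jet) : ℝ := S.fφ j * pd 5 F j

noncomputable def comp₄ (F : Jet → ℝ) (j : Jet) : ℝ :=
  pd 2 F j - S.fδ j * (S.fb₂ j + S.fl j * S.fb₁ j) * pd 3 F j
    - S.fδ j * (S.fb₁ j + S.fk j * S.fb₂ j) * pd 4 F j - S.fφ j * S.fb₃ j * pd 5 F j

variable {S} in
theorem vert_eq_comp (F : Jet → ℝ) (hj : j ∈ S.dom) (v : Jet) : S.vert F j v =
    S.comp₁ F j * S.β₁ j v + S.comp₂ F j * S.β₂ j v + S.comp₃ F j * S.β₃ j v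
      + S.comp₄ F j * S.β₄ j v := by
  rw [vert, nu_zero_eq_β hj, nu_one_eq_β hj, nu_two_eq_β hj, comp₁, comp₂, comp₃, comp₄,
    β₄_apply]
  ring

@[fun_prop]
theorem contDiffOn_comp₁ {F : Jet → ℝ} (hF : ContDiffOn ℝ ∞ F S.dom) :
    ContDiffOn ℝ ∞ (fun j => S.comp₁ F j) S.dom := by
  unfold comp₁
  fun_prop

@[fun_prop]
theorem contDiffOn_comp₂ {F : Jet → ℝ} (hF : ContDiffOn ℝ ∞ F S.dom) :
    ContDiffOn ℝ ∞ (fun j => S.comp₂ F j) S.dom := by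
  unfold comp₂
  fun_prop

@[fun_prop]
theorem contDiffOn_comp₃ {F : Jet → ℝ} (hF : ContDiffOn ℝ ∞ F S.dom) :
    ContDiffOn ℝ ∞ (fun j => S.comp₃ F j) S.dom := by
  unfold comp₃
  fun_prop

@[fun_prop]
theorem contDiffOn_comp₄ {F : Jet → ℝ} (hF : ContDiffOn ℝ ∞ F S.dom) :
    ContDiffOn ℝ ∞ (fun j => S.comp₄ F j) S.dom := by
  unfold comp₄
  fun_prop

/-- The covector field `x dx + y dy + g₁ β₁ + g₂ β₂ + g₃ β₃ + g₄ β₄`. -/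
noncomputable def cov (x y g₁ g₂ g₃ g₄ : Jet → ℝ) (j : Jet) : Jet →L[ℝ] ℝ :=
  x j • muForm 0 + y j • muForm 1 + g₁ j • S.β₁ j + g₂ j • S.β₂ j + g₃ j • S.β₃ j + g₄ j • S.β₄ j

theorem cov_apply (x y g₁ g₂ g₃ g₄ : Jet → ℝ) (j v : Jet) : S.cov x y g₁ g₂ g₃ g₄ j v =
    x j * v 0 + y j * v 1 + g₁ j * S.β₁ j v + g₂ j * S.β₂ j v + g₃ j * S.β₃ j v
      + g₄ j * S.β₄ j v := by
  simp only [cov, add_apply, smul_apply, smul_eq_mul, muForm_zero_apply, muForm_one_apply]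

theorem contDiffOn_cov {x y g₁ g₂ g₃ g₄ : Jet → ℝ} (hx : S.Sm x) (hy : S.Sm y) (h₁ : S.Sm g₁)
    (h₂ : S.Sm g₂) (h₃ : S.Sm g₃) (h₄ : S.Sm g₄) :
    ContDiffOn ℝ ∞ (S.cov x y g₁ g₂ g₃ g₄) S.dom :=
  (((((hx.smul contDiffOn_const).add (hy.smul contDiffOn_const)).add
    (h₁.smul S.contDiffOn_β₁)).add (h₂.smul S.contDiffOn_β₂)).add (h₃.smul S.contDiffOn_β₃)).add
    (h₄.smul S.contDiffOn_β₄)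

/-- `δ (dy + l dx)`. -/
noncomputable def ω₂ (j : Jet) : Jet →L[ℝ] ℝ := S.fδ j • (muForm 1 + S.fl j • muForm 0)

/-- `δ (dx + k dy)`. -/
noncomputable def ω₃ (j : Jet) : Jet →L[ℝ] ℝ := S.fδ j • (muForm 0 + S.fk j • muForm 1)

theorem ω₂_apply (j v : Jet) : S.ω₂ j v = S.fδ j * (v 1 + S.fl j * v 0) := by
  simp only [ω₂, add_apply, smul_apply, smul_eq_mul, muForm_zero_apply, muForm_one_apply]

theorem ω₃_apply (j v : Jet) : S.ω₃ j v = S.fδ j * (v 0 + S.fk j * v 1) := by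
  simp only [ω₃, add_apply, smul_apply, smul_eq_mul, muForm_zero_apply, muForm_one_apply]

/-- The structure equations of a coframe adapted to a para-CR structure, with connection forms
`α₁, …, α₄` of the diagonal. -/
structure FrameEquations {E : Type*} [NormedAddCommGroup E] [NormedSpace ℝ E]
    (θ₁ θ₂ θ₃ θ₄ α₁ α₂ α₃ α₄ ω₂ ω₃ ω₄ ω₅ : E → E →L[ℝ] ℝ) (τ₁ τ₂ : ℝ) (u : E) : Prop where
  trace : α₁ u + α₂ u = α₃ u + α₄ u
  one : ∀ v v', dForm θ₁ u v v' = wedge (α₁ u) (θ₁ u) v v' - wedge (ω₃ u) (θ₃ u) v v'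
    - wedge (ω₅ u) (θ₄ u) v v' + τ₁ * wedge (θ₂ u) (θ₃ u) v v'
  two : ∀ v v', dForm θ₂ u v v' = wedge (α₂ u) (θ₂ u) v v' - wedge (ω₂ u) (θ₃ u) v v'
    - wedge (ω₄ u) (θ₄ u) v v' + τ₂ * wedge (θ₁ u) (θ₃ u) v v'
  three : ∀ v v', dForm θ₃ u v v' = wedge (ω₄ u) (θ₁ u) v v' + wedge (ω₅ u) (θ₂ u) v v'
    + wedge (α₃ u) (θ₃ u) v v'
  four : ∀ v v', dForm θ₄ u v v' = wedge (ω₂ u) (θ₁ u) v v' + wedge (ω₃ u) (θ₂ u) v v'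
    + wedge (α₄ u) (θ₄ u) v v'


end PDESystem

namespace PDESystem

variable (S : PDESystem) {j : Jet}

-- Since the β's annihilate D_x and D_y, each dβᵢ is dx ∧ L_{D_x}βᵢ + dy ∧ L_{D_y}βᵢ plus a vertical
-- 2-form. The first part has conformal form by `frame_lie_x` and `frame_lie_y`. The vertical part
-- is absorbed into the β components of the connection forms, subject to the trace relation. What is
-- left over is β₂ ∧ β₃ in dβ₁ and β₁ ∧ β₃ in dβ₂; these arise from the β₃ components of dk and dl,
-- that is, from the s-derivatives of k and l.
set_option linter.unusedSimpArgs false in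
variable {S} in
theorem exists_frameEquations (h₁ : ∀ j ∈ S.dom, S.J1 j = 0) (h₂ : ∀ j ∈ S.dom, S.J2 j = 0) :
    ∃ α₁ α₂ α₃ α₄ ω₄ ω₅ : Jet → Jet →L[ℝ] ℝ, ContDiffOn ℝ ∞ α₁ S.dom ∧ ContDiffOn ℝ ∞ α₂ S.dom ∧
      ContDiffOn ℝ ∞ α₃ S.dom ∧ ContDiffOn ℝ ∞ α₄ S.dom ∧ ContDiffOn ℝ ∞ ω₄ S.dom ∧
      ContDiffOn ℝ ∞ ω₅ S.dom ∧ ∀ j ∈ S.dom,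
        FrameEquations S.β₁ S.β₂ S.β₃ S.β₄ α₁ α₂ α₃ α₄ S.ω₂ S.ω₃ ω₄ ω₅
          (S.fφ j * S.fδ j * pd 5 S.fk j) (S.fφ j * S.fδ j * pd 5 S.fl j) j := by
  obtain ⟨n₁₁, n₂₂, n₃₃, n₄₄, n₁₄, n₂₄, s₁₁, s₂₂, s₃₃, s₄₄, s₁₄, s₂₄, hn⟩ := frame_lie_x h₁ h₂
  obtain ⟨m₁₁, m₂₂, m₃₃, m₄₄, m₁₄, m₂₄, r₁₁, r₂₂, r₃₃, r₄₄, r₁₄, r₂₄, hm⟩ := frame_lie_y h₁ h₂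
  unfold Sm at *
  let p4 : Jet → ℝ := fun j => -S.fδ j * (S.fb₂ j + S.fl j * S.fb₁ j)
  let q4 : Jet → ℝ := fun j => -S.fδ j * (S.fb₁ j + S.fk j * S.fb₂ j)
  have hp4 : ContDiffOn ℝ ∞ (fun j => p4 j) S.dom := by
    simp only [p4]
    fun_prop
  have hq4 : ContDiffOn ℝ ∞ (fun j => q4 j) S.dom := by
    simp only [q4]
    fun_prop
  -- P, Q and O with indices ab are the coefficients of βₐ ∧ β_b in the vertical parts of dβ₁, dβ₂
  -- and dβ₃. The missing P23 and Q13 are the torsion.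
  let P12 : Jet → ℝ := fun j => -(S.comp₁ S.fk j * S.fδ j - S.comp₂ S.fk j * (S.fl j * S.fδ j))
  let P13 : Jet → ℝ := fun j => S.comp₃ S.fk j * (S.fl j * S.fδ j)
  let P14 : Jet → ℝ := fun j => -(S.comp₁ S.fk j * p4 j - S.comp₄ S.fk j * (S.fl j * S.fδ j))
    + S.comp₁ S.fb₁ j
  let P24 : Jet → ℝ := fun j => -(S.comp₂ S.fk j * p4 j - S.comp₄ S.fk j * S.fδ j)
    + S.comp₂ S.fb₁ j
  let P34 : Jet → ℝ := fun j => -(S.comp₃ S.fk j * p4 j) + S.comp₃ S.fb₁ j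
  let Q12 : Jet → ℝ := fun j => -(S.comp₁ S.fl j * (S.fk j * S.fδ j) - S.comp₂ S.fl j * S.fδ j)
  let Q14 : Jet → ℝ := fun j => -(S.comp₁ S.fl j * q4 j - S.comp₄ S.fl j * S.fδ j)
    + S.comp₁ S.fb₂ j
  let Q23 : Jet → ℝ := fun j => S.comp₃ S.fl j * (S.fk j * S.fδ j)
  let Q24 : Jet → ℝ := fun j => -(S.comp₂ S.fl j * q4 j - S.comp₄ S.fl j * (S.fk j * S.fδ j))
    + S.comp₂ S.fb₂ j
  let Q34 : Jet → ℝ := fun j => -(S.comp₃ S.fl j * q4 j) + S.comp₃ S.fb₂ j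
  let O13 : Jet → ℝ := fun j => S.comp₁ S.ff j * S.fφ j
  let O14 : Jet → ℝ := fun j => -(S.comp₁ S.ff j * S.fφ j * S.fb₃ j) + S.comp₁ S.fb₃ j
  let O23 : Jet → ℝ := fun j => S.comp₂ S.ff j * S.fφ j
  let O24 : Jet → ℝ := fun j => -(S.comp₂ S.ff j * S.fφ j * S.fb₃ j) + S.comp₂ S.fb₃ j
  let O34 : Jet → ℝ := fun j => -(S.comp₃ S.ff j * S.fφ j * S.fb₃ j) - S.comp₄ S.ff j * S.fφ j
    + S.comp₃ S.fb₃ j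
  -- The term -P34 β₃ in ω₅ produces β₃ ∧ β₄ in dβ₁ but also a multiple of β₂ ∧ β₃ in dβ₃, which α₃
  -- compensates by O23 - P34; Q34 and ω₄ behave in the same way. The rest of α₁, α₂ and α₄ is then
  -- forced by the other equations and by the trace.
  refine ⟨
    S.cov n₁₁ m₁₁ (fun j => O13 j - Q34 j - Q12 j) (fun j => -P12 j) (fun j => -P13 j)
      (fun j => -P14 j),
    S.cov n₂₂ m₂₂ (fun j => Q12 j) (fun j => O23 j - P34 j + P12 j) (fun j => -Q23 j)
      (fun j => -Q24 j),
    S.cov n₃₃ m₃₃ (fun j => O13 j - Q34 j) (fun j => O23 j - P34 j) (fun j => -P13 j - Q23 j)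
      (fun j => -O34 j),
    S.cov n₄₄ m₄₄ (fun _ => 0) (fun _ => 0) (fun _ => 0) (fun j => -P14 j - Q24 j + O34 j),
    S.cov (fun j => -n₂₄ j) (fun j => -m₂₄ j) (fun j => -Q14 j) (fun _ => 0) (fun j => -Q34 j)
      (fun j => -O14 j),
    S.cov (fun j => -n₁₄ j) (fun j => -m₁₄ j) (fun _ => 0) (fun j => -P24 j) (fun j => -P34 j)
      (fun j => -O24 j), ?_, ?_, ?_, ?_, ?_, ?_, fun j hj => ?_⟩
  iterate 6
    · apply contDiffOn_cov <;> unfold Sm <;>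
      try simp only [P12, P13, P14, P24, P34, Q12, Q14, Q23, Q24, Q34, O13, O14, O23, O24, O34]
      all_goals fun_prop
  obtain ⟨ht, hn⟩ := hn j hj
  obtain ⟨ht', hm⟩ := hm j hj
  have c0 : ∀ v c, fderiv ℝ (fun _ : Jet => (c : ℝ)) j v = 0 := fun v c => by simp
  have neg : ∀ (F : Jet → ℝ) v, fderiv ℝ (fun y => -F y) j v = -fderiv ℝ F j v := fun F v => by
    rw [fderiv_fun_neg]
    rfl
  have hL : ∀ v, lamForm j v = S.β₄ j v := fun v => (β₄_apply v).symm
  have hk3 : S.comp₃ S.fk j = S.fφ j * pd 5 S.fk j := rfl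
  have hl3 : S.comp₃ S.fl j = S.fφ j * pd 5 S.fl j := rfl
  refine ⟨?_, fun v v' => ?_, fun v v' => ?_, fun v v' => ?_, fun v v' => ?_⟩
  · ext v
    rw [add_apply, add_apply, cov_apply, cov_apply, cov_apply, cov_apply]
    linear_combination v 0 * ht + v 1 * ht'
  · have b := congrArg₂ (· * ·) (vert_eq_comp S.fb₁ hj v) (hL v')
    have b' := congrArg₂ (· * ·) (vert_eq_comp S.fb₁ hj v') (hL v)
    have k := congrArg₂ (· * ·) (vert_eq_comp S.fk hj v) (nu_zero_eq_β hj v')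
    have k' := congrArg₂ (· * ·) (vert_eq_comp S.fk hj v') (nu_zero_eq_β hj v)
    have e := dForm_para (S := S) S.contDiffOn_fb₁ S.contDiffOn_fk.neg (contDiffOn_const (c := 1))
      (contDiffOn_const (c := 0)) hj v v'
    simp only [c0, neg, S.fderiv_eq_vert S.fb₁, S.fderiv_eq_vert S.fk] at e
    refine (show _ = _ from e).trans ?_
    simp only [wedge, cov_apply, ω₂_apply, ω₃_apply, P12, P13, P14, P24, P34, Q12, Q14, Q23, Q24, Q34, O13, O14,
      O23, O24, O34, p4, q4]
    linear_combination v 0 * (hn v').1 - v' 0 * (hn v).1 + v 1 * (hm v').1 - v' 1 * (hm v).1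
      + b - b' - k + k' + S.fδ j * (S.β₂ j v * S.β₃ j v' - S.β₂ j v' * S.β₃ j v) * hk3
  · have b := congrArg₂ (· * ·) (vert_eq_comp S.fb₂ hj v) (hL v')
    have b' := congrArg₂ (· * ·) (vert_eq_comp S.fb₂ hj v') (hL v)
    have k := congrArg₂ (· * ·) (vert_eq_comp S.fl hj v) (nu_one_eq_β hj v')
    have k' := congrArg₂ (· * ·) (vert_eq_comp S.fl hj v') (nu_one_eq_β hj v)
    have e := dForm_para (S := S) S.contDiffOn_fb₂ (contDiffOn_const (c := 1)) S.contDiffOn_fl.neg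
      (contDiffOn_const (c := 0)) hj v v'
    simp only [c0, neg, S.fderiv_eq_vert S.fb₂, S.fderiv_eq_vert S.fl] at e
    refine (show _ = _ from e).trans ?_
    simp only [wedge, cov_apply, ω₂_apply, ω₃_apply, P12, P13, P14, P24, P34, Q12, Q14, Q23, Q24, Q34, O13, O14,
      O23, O24, O34, p4, q4]
    linear_combination v 0 * (hn v').2.1 - v' 0 * (hn v).2.1 + v 1 * (hm v').2.1
      - v' 1 * (hm v).2.1 + b - b' - k + k'
      + S.fδ j * (S.β₁ j v * S.β₃ j v' - S.β₁ j v' * S.β₃ j v) * hl3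
  · have b := congrArg₂ (· * ·) (vert_eq_comp S.fb₃ hj v) (hL v')
    have b' := congrArg₂ (· * ·) (vert_eq_comp S.fb₃ hj v') (hL v)
    have k := congrArg₂ (· * ·) (vert_eq_comp S.ff hj v) (nu_two_eq_β hj v')
    have k' := congrArg₂ (· * ·) (vert_eq_comp S.ff hj v') (nu_two_eq_β hj v)
    have e := dForm_para (S := S) S.contDiffOn_fb₃ (contDiffOn_const (c := 0))
      (contDiffOn_const (c := 0)) S.contDiffOn_ff hj v v'
    simp only [c0, S.fderiv_eq_vert S.fb₃, S.fderiv_eq_vert S.ff] at e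
    refine (show _ = _ from e).trans ?_
    simp only [wedge, cov_apply, ω₂_apply, ω₃_apply, P12, P13, P14, P24, P34, Q12, Q14, Q23, Q24, Q34, O13, O14,
      O23, O24, O34, p4, q4]
    linear_combination v 0 * (hn v').2.2.1 - v' 0 * (hn v).2.2.1 + v 1 * (hm v').2.2.1
      - v' 1 * (hm v).2.2.1 + b - b' + k - k'
  · have e := dForm_para (S := S) (contDiffOn_const (c := 1)) (contDiffOn_const (c := 0))
      (contDiffOn_const (c := 0)) (contDiffOn_const (c := 0)) hj v v'
    simp only [c0] at e
    refine (show _ = _ from e).trans ?_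
    simp only [wedge, cov_apply, ω₂_apply, ω₃_apply, P12, P13, P14, P24, P34, Q12, Q14, Q23, Q24, Q34, O13, O14,
      O23, O24, O34, p4, q4]
    linear_combination v 0 * (hn v').2.2.2 - v' 0 * (hn v).2.2.2 + v 1 * (hm v').2.2.2
      - v' 1 * (hm v).2.2.2

end PDESystem

/-! ### Action of the structure group on adapted coframes -/

section FrameChange

variable {E : Type*} [NormedAddCommGroup E] [NormedSpace ℝ E]

open PDESystem

theorem PDESystem.FrameEquations.swap {θ₁ θ₂ θ₃ θ₄ α₁ α₂ α₃ α₄ ω₂ ω₃ ω₄ ω₅ : E → E →L[ℝ] ℝ}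
    {τ₁ τ₂ : ℝ} {u : E} (h : FrameEquations θ₁ θ₂ θ₃ θ₄ α₁ α₂ α₃ α₄ ω₂ ω₃ ω₄ ω₅ τ₁ τ₂ u) :
    FrameEquations θ₂ θ₁ θ₃ θ₄ α₂ α₁ α₃ α₄ ω₃ ω₂ ω₅ ω₄ τ₂ τ₁ u where
  trace := by rw [add_comm, h.trace]
  one := h.two
  two := h.one
  three v v' := by rw [h.three, add_comm (wedge (ω₄ u) _ _ _)]
  four v v' := by rw [h.four, add_comm (wedge (ω₂ u) _ _ _)]

/-- The change of an adapted coframe by an element of the structure group. -/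
theorem PDESystem.FrameEquations.change {B₁ B₂ B₃ B₄ α₁ α₂ α₃ α₄ ω₂ ω₃ ω₄ ω₅ : E → E →L[ℝ] ℝ}
    {t₁ t₂ : E → ℝ} {u : E}
    (h : FrameEquations B₁ B₂ B₃ B₄ α₁ α₂ α₃ α₄ ω₂ ω₃ ω₄ ω₅ (t₁ u) (t₂ u) u)
    (d₁ : DifferentiableAt ℝ B₁ u) (d₂ : DifferentiableAt ℝ B₂ u) (d₃ : DifferentiableAt ℝ B₃ u)
    (d₄ : DifferentiableAt ℝ B₄ u) {a m n x y : E → ℝ} (da : DifferentiableAt ℝ a u)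
    (dm : DifferentiableAt ℝ m u) (dn : DifferentiableAt ℝ n u) (dx : DifferentiableAt ℝ x u)
    (dy : DifferentiableAt ℝ y u) (a0 : a u ≠ 0) (m0 : m u ≠ 0) (n0 : n u ≠ 0)
    {θ₁ θ₂ θ₃ θ₄ : E → E →L[ℝ] ℝ} (e₁ : θ₁ = fun u => m u • (B₁ u + (-y u) • B₄ u))
    (e₂ : θ₂ = fun u => n u • (B₂ u + (-x u) • B₄ u))
    (e₃ : θ₃ = fun u => (m u * n u / a u) • (B₃ u + (x u • B₁ u + (y u • B₂ u
      + (-(x u * y u)) • B₄ u))))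
    (e₄ : θ₄ = fun u => a u • B₄ u) :
    FrameEquations θ₁ θ₂ θ₃ θ₄
      (fun u => (1 / m u) • fderiv ℝ m u + α₁ u + x u • ω₃ u - y u • ω₂ u
        - (t₁ u * x u / n u) • θ₂ u - (2 * x u ^ 2 * t₁ u / a u) • θ₄ u
        + (3 * t₂ u * y u / m u) • θ₁ u)
      (fun u => (1 / n u) • fderiv ℝ n u + α₂ u + y u • ω₂ u - x u • ω₃ u
        - (t₂ u * y u / m u) • θ₁ u - (2 * y u ^ 2 * t₂ u / a u) • θ₄ u
        + (3 * t₁ u * x u / n u) • θ₂ u)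
      (fun u => (1 / m u) • fderiv ℝ m u + (1 / n u) • fderiv ℝ n u - (1 / a u) • fderiv ℝ a u
        + α₃ u - x u • ω₃ u - y u • ω₂ u + (2 * t₁ u * x u / n u) • θ₂ u
        + (2 * t₂ u * y u / m u) • θ₁ u + ((x u ^ 2 * t₁ u + y u ^ 2 * t₂ u) / a u) • θ₄ u)
      (fun u => (1 / a u) • fderiv ℝ a u + α₄ u + y u • ω₂ u + x u • ω₃ u
        - (3 * (x u ^ 2 * t₁ u + y u ^ 2 * t₂ u) / a u) • θ₄ u)
      (fun u => (a u / m u) • ω₂ u) (fun u => (a u / n u) • ω₃ u)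
      (fun u => (n u / a u) • (ω₄ u + fderiv ℝ x u - x u • α₂ u + x u • α₄ u + x u ^ 2 • ω₃ u)
        + (t₂ u * y u / m u) • θ₃ u + (y u ^ 2 * t₂ u / a u) • θ₂ u
        - (t₁ u * x u ^ 3 * n u / a u ^ 2) • θ₄ u)
      (fun u => (m u / a u) • (ω₅ u + fderiv ℝ y u - y u • α₁ u + y u • α₄ u + y u ^ 2 • ω₂ u)
        + (t₁ u * x u / n u) • θ₃ u + (x u ^ 2 * t₁ u / a u) • θ₁ u
        - (t₂ u * y u ^ 3 * m u / a u ^ 2) • θ₄ u)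
      (a u / n u ^ 2 * t₁ u) (a u / m u ^ 2 * t₂ u) u := by
  -- The change satisfies θ₁θ₂ + θ₃θ₄ = mn(B₁B₂ + B₃B₄), whatever the shears x and y. The shears
  -- spread the torsion terms over further 2-forms; the summands with `t₁`, `t₂` in the new
  -- connection forms reabsorb these and keep the trace relation.
  subst e₁ e₂ e₃ e₄
  obtain ⟨h0, h1, h2, h3, h4⟩ := h
  have ht : ∀ v, α₁ u v + α₂ u v = α₃ u v + α₄ u v := fun v => congrArg (fun A => A v) h0
  have p1 := d₁.fun_add (dy.fun_neg.fun_smul d₄)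
  have p2 := d₂.fun_add (dx.fun_neg.fun_smul d₄)
  have q3 := (dx.fun_mul dy).fun_neg.fun_smul d₄
  have q2 := (dy.fun_smul d₂).fun_add q3
  have q1 := (dx.fun_smul d₁).fun_add q2
  have df : DifferentiableAt ℝ (fun u => m u * n u / a u) u := by
    simpa only [div_eq_mul_inv] using (dm.fun_mul dn).fun_mul (da.fun_inv a0)
  have fm : ∀ v, fderiv ℝ (fun u => m u * n u / a u) u v = m u * n u / a u *
      (fderiv ℝ m u v / m u + fderiv ℝ n u v / n u - fderiv ℝ a u v / a u) := fun v => by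
    have e : (fun u' => m u' * n u' / a u' * a u') =ᶠ[nhds u] fun u' => m u' * n u' := by
      filter_upwards [da.continuousAt.eventually_ne a0] with u' hu'
      exact div_mul_cancel₀ _ hu'
    have e' := congrArg (fun A : E →L[ℝ] ℝ => A v) e.fderiv_eq
    simp only [fderiv_fun_mul df da, fderiv_fun_mul dm dn, add_apply, smul_apply, smul_eq_mul] at e'
    field_simp at e' ⊢
    linear_combination e'
  have fxy : ∀ v, fderiv ℝ (fun u => -(x u * y u)) u v = -(x u * fderiv ℝ y u v
      + y u * fderiv ℝ x u v) := fun v => by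
    rw [fderiv_fun_neg, fderiv_fun_mul dx dy]
    simp
  have fn : ∀ (F : E → ℝ) v, fderiv ℝ (fun y => -F y) u v = -fderiv ℝ F u v := fun F v => by
    rw [fderiv_fun_neg]
    rfl
  refine ⟨?_, fun v v' => ?_, fun v v' => ?_, fun v v' => ?_, fun v v' => ?_⟩
  · ext v
    simp only [add_apply, sub_apply, smul_apply, smul_eq_mul]
    linear_combination ht v
  · rw [dForm_smul dm p1, dForm_add d₁ (dy.fun_neg.fun_smul d₄), dForm_smul dy.fun_neg d₄, h1, h4]
    simp only [wedge, add_apply, sub_apply, smul_apply, smul_eq_mul, fn]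
    field_simp
    ring
  · rw [dForm_smul dn p2, dForm_add d₂ (dx.fun_neg.fun_smul d₄), dForm_smul dx.fun_neg d₄, h2, h4]
    simp only [wedge, add_apply, sub_apply, smul_apply, smul_eq_mul, fn]
    field_simp
    ring
  · rw [dForm_smul df (d₃.fun_add q1), dForm_add d₃ q1,
      dForm_add (dx.fun_smul d₁) q2, dForm_add (dy.fun_smul d₂) q3, dForm_smul dx d₁,
      dForm_smul dy d₂, dForm_smul (dx.fun_mul dy).fun_neg d₄, h1, h2, h3, h4]
    simp only [wedge, add_apply, sub_apply, smul_apply, smul_eq_mul, fm, fxy]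
    have e : ∀ v, α₃ u v = α₁ u v + α₂ u v - α₄ u v := fun v => by linear_combination -ht v
    rw [e, e]
    field_simp
    ring
  · rw [dForm_smul da d₄, h4]
    simp only [wedge, add_apply, sub_apply, smul_apply, smul_eq_mul]
    field_simp
    ring

end FrameChange

namespace PDESystem

variable (S : PDESystem)

/-! ### Torsion -/

section Torsion

variable {S} {j : Jet}

/-- The relations k(1 + w) = T_s, l(1 + w) = R_s and w² = 1 - R_sT_s are differentiated in s and
solved, so that no square root has to be differentiated explicitly. -/
theorem pd_five_fk (hj : j ∈ S.dom) : S.fφ j * S.fδ j * pd 5 S.fk j =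
    -(S.Rss j * S.Ts j ^ 2 + S.Tss j * (1 + S.w j) ^ 2) / (8 * S.w j ^ 4) ∧
    S.fφ j * S.fδ j * pd 5 S.fl j =
    -(S.Rss j * (1 + S.w j) ^ 2 + S.Tss j * S.Rs j ^ 2) / (8 * S.w j ^ 4) := by
  have hw := S.w_pos hj
  have h1 := S.one_add_w_ne hj
  have dw := Sm.differentiableAt S.contDiffOn_w hj
  have dk := Sm.differentiableAt S.contDiffOn_fk hj
  have dl := Sm.differentiableAt S.contDiffOn_fl hj
  have dR := Sm.differentiableAt S.contDiffOn_Rs hj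
  have dT := Sm.differentiableAt S.contDiffOn_Ts hj
  let W : Jet → Jet := fun _ => Pi.single 5 1
  have e1 := lieD_congr (V := W) (F := fun y => S.fk y * (1 + S.w y)) (G := S.Ts) S.isOpen_dom
    (fun y hy => div_mul_cancel₀ _ (S.one_add_w_ne hy)) hj
  have e2 := lieD_congr (V := W) (F := fun y => S.fl y * (1 + S.w y)) (G := S.Rs) S.isOpen_dom
    (fun y hy => div_mul_cancel₀ _ (S.one_add_w_ne hy)) hj
  have e3 := lieD_congr (V := W) (F := fun y => S.w y * S.w y)
    (G := fun y => 1 - S.Rs y * S.Ts y) S.isOpen_dom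
    (fun y hy => by simp only [← sq, S.w_sq hy]) hj
  rw [lieD_mul dk ((differentiableAt_const _).fun_add dw), lieD_add (differentiableAt_const _) dw,
    lieD_const] at e1
  rw [lieD_mul dl ((differentiableAt_const _).fun_add dw), lieD_add (differentiableAt_const _) dw,
    lieD_const] at e2
  rw [lieD_mul dw dw, lieD_sub (differentiableAt_const _) (dR.fun_mul dT), lieD_mul dR dT,
    lieD_const] at e3
  have cR : lieD W S.Rs j = S.Rss j := rfl
  have cT : lieD W S.Ts j = S.Tss j := rfl
  rw [show pd 5 S.fk j = lieD W S.fk j from rfl, show pd 5 S.fl j = lieD W S.fl j from rfl]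
  have hws : lieD W S.w j = -(S.Rss j * S.Ts j + S.Rs j * S.Tss j) / (2 * S.w j) := by
    rw [eq_div_iff (by positivity)]
    linear_combination e3 - S.Ts j * cR - S.Rs j * cT
  have hk : lieD W S.fk j = (S.Tss j - S.fk j * lieD W S.w j) / (1 + S.w j) := by
    rw [eq_div_iff h1]
    linear_combination e1 + cT
  have hl : lieD W S.fl j = (S.Rss j - S.fl j * lieD W S.w j) / (1 + S.w j) := by
    rw [eq_div_iff h1]
    linear_combination e2 + cR
  have hsq := S.w_sq hj
  rw [hk, hl, hws, fφ, fδ, fk, fl]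
  constructor
  · field_simp
    linear_combination (-8 * S.Tss j) * hsq
  · field_simp
    linear_combination (-8 * S.Rss j) * hsq

end Torsion

end PDESystem

/-! ### Lifted coframes -/

namespace GroupParams

theorem pull_apply (α : Jet →L[ℝ] ℝ) (v : Lift) : pull α v = α v.1 := rfl

theorem contDiffOn_pull {α : Jet → Jet →L[ℝ] ℝ} {O : Set Jet} {P : Set Lift}
    (hα : ContDiffOn ℝ ∞ α O) (hP : MapsTo Prod.fst P O) :
    ContDiffOn ℝ ∞ (fun u : Lift => pull (α u.1)) P :=
  (hα.comp contDiffOn_fst hP).clm_comp contDiffOn_const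

/-- The interchange of `θ¹` and `θ²`. -/
def swap (g : GroupParams) : GroupParams where
  a := g.a
  b := g.b ∘ ![1, 0, 2]
  c := g.c ∘ ![1, 0]
  f := g.f ∘ ![1, 0, 2]
  h := g.h ∘ ![1, 0]

variable (g : GroupParams) (S : PDESystem)

theorem swap_theta_zero : g.swap.theta S 0 = g.theta S 1 := rfl

theorem swap_theta_one : g.swap.theta S 1 = g.theta S 0 := rfl

theorem swap_theta_two : g.swap.theta S 2 = g.theta S 2 := rfl

theorem swap_theta_three : g.swap.theta S 3 = g.theta S 3 := rfl

variable {g S} {P : Set Lift}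

theorem Smooth.swap (hg : g.Smooth P) : g.swap.Smooth P :=
  ⟨hg.1, fun _ => hg.2.1 _, fun _ => hg.2.2.1 _, fun _ _ => hg.2.2.2.1 _ _,
    fun _ _ => hg.2.2.2.2 _ _⟩

theorem Nondegenerate.swap (hg : g.Nondegenerate P) : g.swap.Nondegenerate P := by
  intro u hu h
  apply hg u hu
  simp only [GroupParams.swap, Matrix.det_fin_three, Matrix.det_fin_two, Matrix.of_apply,
    Function.comp_apply, Matrix.cons_val_zero, Matrix.cons_val_one, Matrix.cons_val] at h ⊢
  linear_combination h

end GroupParams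

/-- Eleven covectors on the lifted space with trivial common kernel are linearly independent. -/
theorem linearIndependent_of_common_kernel {f : Fin 11 → (Lift →L[ℝ] ℝ)}
    (hf : ∀ v, (∀ i, f i v = 0) → v = 0) : LinearIndependent ℝ f := by
  let L : Lift →ₗ[ℝ] (Fin 11 → ℝ) := LinearMap.pi fun i => (f i : Lift →ₗ[ℝ] ℝ)
  have hinj : Function.Injective L := by
    rw [← LinearMap.ker_eq_bot, LinearMap.ker_eq_bot']
    exact fun v hv => hf v fun i => congrFun hv i
  have hsurj : Function.Surjective L :=
    (LinearMap.injective_iff_surjective_of_finrank_eq_finrank (by simp)).1 hinj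
  rw [Fintype.linearIndependent_iff]
  intro c hc i
  -- A vector on which the covectors take the coefficients of the given relation as values turns the
  -- relation into ∑ cᵢ² = 0.
  obtain ⟨v, hv⟩ := hsurj c
  have h1 : ∑ i, c i * c i = 0 := by
    have := congrArg (fun A : Lift →L[ℝ] ℝ => A v) hc
    simp only [sum_apply, smul_apply, smul_eq_mul, zero_apply] at this
    rw [← this]
    exact Finset.sum_congr rfl fun i _ => by rw [← congrFun hv i]; rfl
  exact mul_self_eq_zero.1 ((Finset.sum_eq_zero_iff_of_nonneg fun i _ => mul_self_nonneg _).1 h1 i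
    (Finset.mem_univ _))

open PDESystem

/-- The trace relation leaves three independent diagonal forms. Ω₁ and Ω₆ are the half differences
of A₁, A₂ and of A₃, A₄, and A is minus the common sum. -/
theorem GroupParams.isNormalized_of_frameEquations {g : GroupParams} {S : PDESystem} {P : Set Lift}
    {t₁ t₂ : Lift → ℝ} (hg : g.Smooth P) (hd : g.Nondegenerate P)
    {A₁ A₂ A₃ A₄ ω₄ ω₅ : Lift → Lift →L[ℝ] ℝ} (s₁ : ContDiffOn ℝ ∞ A₁ P)
    (s₂ : ContDiffOn ℝ ∞ A₂ P) (s₃ : ContDiffOn ℝ ∞ A₃ P) (s₄ : ContDiffOn ℝ ∞ A₄ P)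
    (r₄ : ContDiffOn ℝ ∞ ω₄ P) (r₅ : ContDiffOn ℝ ∞ ω₅ P)
    (h : ∀ u ∈ P, FrameEquations (g.theta S 0) (g.theta S 1) (g.theta S 2) (g.theta S 3)
      A₁ A₂ A₃ A₄ g.omega2 g.omega3 ω₄ ω₅ (t₁ u) (t₂ u) u)
    (hk : ∀ u ∈ P, ∀ v, (∀ i, g.theta S i u v = 0) → g.omega2 u v = 0 → g.omega3 u v = 0 →
      A₁ u v = 0 → A₂ u v = 0 → A₃ u v = 0 → A₄ u v = 0 → ω₄ u v = 0 → ω₅ u v = 0 → v = 0) :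
    g.IsNormalized S P t₁ t₂ := by
  refine ⟨hg, hd, fun u => (1 / 2 : ℝ) • (A₁ u - A₂ u), ω₄, ω₅,
    fun u => (1 / 2 : ℝ) • (A₃ u - A₄ u), fun u => -(A₁ u + A₂ u),
    (s₁.sub s₂).const_smul _, r₄, r₅, (s₃.sub s₄).const_smul _, (s₁.add s₂).neg,
    fun u hu => ?_, fun u hu v v' => ?_⟩
  · apply linearIndependent_of_common_kernel
    intro v hv
    have h0 := congrArg (fun A => A v) (h u hu).trace
    have e1 : (1 / 2 : ℝ) * (A₁ u v - A₂ u v) = 0 := hv 4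
    have e2 : (1 / 2 : ℝ) * (A₃ u v - A₄ u v) = 0 := hv 9
    have e3 : -(A₁ u v + A₂ u v) = 0 := hv 10
    simp only [add_apply] at h0
    refine hk u hu v (fun i => ?_) (hv 5) (hv 6) (by linarith) (by linarith) (by linarith)
      (by linarith) (hv 7) (hv 8)
    fin_cases i
    exacts [hv 0, hv 1, hv 2, hv 3]
  · obtain ⟨h0, h1, h2, h3, h4⟩ := h u hu
    have e1 : (1 / 2 : ℝ) • (A₁ u - A₂ u) - (1 / 2 : ℝ) • -(A₁ u + A₂ u) = A₁ u := by module
    have e2 : -((1 / 2 : ℝ) • (A₁ u - A₂ u)) - (1 / 2 : ℝ) • -(A₁ u + A₂ u) = A₂ u := by module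
    have e3 : (1 / 2 : ℝ) • (A₃ u - A₄ u) - (1 / 2 : ℝ) • -(A₁ u + A₂ u) = A₃ u := by
      rw [h0]
      module
    have e4 : -((1 / 2 : ℝ) • (A₃ u - A₄ u)) - (1 / 2 : ℝ) • -(A₁ u + A₂ u) = A₄ u := by
      rw [h0]
      module
    rw [e1, e2, e3, e4]
    exact ⟨h1 v v', h2 v v', h3 v v', h4 v v'⟩

namespace GroupParams

theorem theta_castSucc_apply (g : GroupParams) (S : PDESystem) (i : Fin 3) (u v : Lift) :
    g.theta S i.castSucc u v = g.b i u * lamForm u.1 v.1 + (g.f i 0 u * S.nu 0 u.1 v.1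
      + g.f i 1 u * S.nu 1 u.1 v.1 + g.f i 2 u * S.nu 2 u.1 v.1) := by
  rw [theta, Fin.snoc_castSucc]
  simp only [Fin.sum_univ_three, add_apply, smul_apply, smul_eq_mul, pull_apply]

end GroupParams

namespace PDESystem

open GroupParams

variable (S : PDESystem)

theorem isOpen_lift : IsOpen S.lift := by
  refine (S.isOpen_dom.preimage continuous_fst).inter ?_
  have h : ∀ i : Fin 5, IsOpen {u : Lift | u.2 i ≠ 0} := fun i =>
    isOpen_ne.preimage ((continuous_apply i).comp continuous_snd)
  exact (h 0).inter ((h 1).inter (h 2))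

/-- The group parameters for which
`θ¹ = m (β₁ - y β₄)`, `θ² = n (β₂ - x β₄)`, `θ³ = (m n / a) (β₃ + x β₁ + y β₂ - x y β₄)`,
`θ⁴ = a β₄`. -/
noncomputable def liftParams (a m n x y : Lift → ℝ) : GroupParams where
  a := a
  b := ![fun u => m u * (S.fb₁ u.1 - y u), fun u => n u * (S.fb₂ u.1 - x u),
    fun u => m u * n u / a u * (S.fb₃ u.1 + x u * S.fb₁ u.1 + y u * S.fb₂ u.1 - x u * y u)]
  c := fun _ _ => 0
  f := ![![fun u => -S.fk u.1 * m u, m, fun _ => 0], ![n, fun u => -S.fl u.1 * n u, fun _ => 0],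
    ![fun u => m u * n u / a u * (y u - S.fk u.1 * x u),
      fun u => m u * n u / a u * (x u - S.fl u.1 * y u), fun u => m u * n u / a u * S.ff u.1]]
  h := ![![fun u => a u / n u * S.fδ u.1, fun u => a u / n u * (S.fδ u.1 * S.fk u.1)],
    ![fun u => a u / m u * (S.fδ u.1 * S.fl u.1), fun u => a u / m u * S.fδ u.1]]

/-- The functions `a, m, n, x, y` on the lifted space are coordinates of the fibres. -/
structure FibreCoords (a m n x y : Lift → ℝ) : Prop where
  sa : ContDiffOn ℝ ∞ a S.lift
  sm : ContDiffOn ℝ ∞ m S.lift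
  sn : ContDiffOn ℝ ∞ n S.lift
  sx : ContDiffOn ℝ ∞ x S.lift
  sy : ContDiffOn ℝ ∞ y S.lift
  a0 : ∀ u ∈ S.lift, a u ≠ 0
  m0 : ∀ u ∈ S.lift, m u ≠ 0
  n0 : ∀ u ∈ S.lift, n u ≠ 0
  inj : ∀ u ∈ S.lift, ∀ v : Lift, v.1 = 0 → fderiv ℝ a u v = 0 → fderiv ℝ m u v = 0 →
    fderiv ℝ n u v = 0 → fderiv ℝ x u v = 0 → fderiv ℝ y u v = 0 → v = 0

theorem contDiffOn_ω₂ : ContDiffOn ℝ ∞ S.ω₂ S.dom :=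
  S.contDiffOn_fδ.smul (contDiffOn_const.add (S.contDiffOn_fl.smul contDiffOn_const))

theorem contDiffOn_ω₃ : ContDiffOn ℝ ∞ S.ω₃ S.dom :=
  S.contDiffOn_fδ.smul (contDiffOn_const.add (S.contDiffOn_fk.smul contDiffOn_const))

variable {S} {a m n x y : Lift → ℝ}

theorem contDiffOn_comp_fst {F : Jet → ℝ} (hF : ContDiffOn ℝ ∞ F S.dom) :
    ContDiffOn ℝ ∞ (fun u : Lift => F u.1) S.lift :=
  hF.comp contDiffOn_fst fun _ h => h.1

theorem theta_liftParams_zero : (S.liftParams a m n x y).theta S 0 =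
    fun u => m u • (pull (S.β₁ u.1) + (-y u) • pull (S.β₄ u.1)) := by
  ext1 u
  refine ContinuousLinearMap.ext fun v => ?_
  refine (theta_castSucc_apply _ S 0 u v).trans ?_
  simp only [add_apply, smul_apply, smul_eq_mul, pull_apply, β₁_apply,
    β₄_apply, liftParams, Matrix.cons_val_zero, Matrix.cons_val_one, Matrix.cons_val]
  ring

theorem theta_liftParams_one : (S.liftParams a m n x y).theta S 1 =
    fun u => n u • (pull (S.β₂ u.1) + (-x u) • pull (S.β₄ u.1)) := by
  ext1 u
  refine ContinuousLinearMap.ext fun v => ?_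
  refine (theta_castSucc_apply _ S 1 u v).trans ?_
  simp only [add_apply, smul_apply, smul_eq_mul, pull_apply, β₂_apply,
    β₄_apply, liftParams, Matrix.cons_val_zero, Matrix.cons_val_one, Matrix.cons_val]
  ring

theorem theta_liftParams_two : (S.liftParams a m n x y).theta S 2 =
    fun u => (m u * n u / a u) • (pull (S.β₃ u.1) + (x u • pull (S.β₁ u.1)
      + (y u • pull (S.β₂ u.1) + (-(x u * y u)) • pull (S.β₄ u.1)))) := by
  ext1 u
  refine ContinuousLinearMap.ext fun v => ?_
  refine (theta_castSucc_apply _ S 2 u v).trans ?_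
  simp only [add_apply, smul_apply, smul_eq_mul, pull_apply, β₁_apply, β₂_apply,
    β₃_apply, β₄_apply, liftParams, Matrix.cons_val_zero, Matrix.cons_val_one, Matrix.cons_val]
  ring

theorem theta_liftParams_three : (S.liftParams a m n x y).theta S 3 =
    fun u => a u • pull (S.β₄ u.1) := by
  ext1 u
  refine ContinuousLinearMap.ext fun v => ?_
  show (_ • _ : Lift →L[ℝ] ℝ) v = _
  simp only [smul_apply, smul_eq_mul, pull_apply, β₄_apply, liftParams]

theorem omega2_liftParams : (S.liftParams a m n x y).omega2 =
    fun u => (a u / m u) • pull (S.ω₂ u.1) := by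
  ext1 u
  refine ContinuousLinearMap.ext fun v => ?_
  simp only [omega2, Fin.sum_univ_two, add_apply, smul_apply, smul_eq_mul, pull_apply, ω₂_apply,
    liftParams, Matrix.cons_val_zero, Matrix.cons_val_one, muForm_zero_apply, muForm_one_apply]
  ring

theorem omega3_liftParams : (S.liftParams a m n x y).omega3 =
    fun u => (a u / n u) • pull (S.ω₃ u.1) := by
  ext1 u
  refine ContinuousLinearMap.ext fun v => ?_
  simp only [omega3, Fin.sum_univ_two, add_apply, smul_apply, smul_eq_mul, pull_apply, ω₃_apply,
    liftParams, Matrix.cons_val_zero, Matrix.cons_val_one, muForm_zero_apply, muForm_one_apply]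
  ring

theorem smooth_liftParams (hc : S.FibreCoords a m n x y) :
    (S.liftParams a m n x y).Smooth S.lift := by
  obtain ⟨sa, sm, sn, sx, sy, a0, m0, n0, -⟩ := hc
  have k := contDiffOn_comp_fst S.contDiffOn_fk
  have l := contDiffOn_comp_fst S.contDiffOn_fl
  have δ := contDiffOn_comp_fst S.contDiffOn_fδ
  have f := contDiffOn_comp_fst S.contDiffOn_ff
  have b₁ := contDiffOn_comp_fst S.contDiffOn_fb₁
  have b₂ := contDiffOn_comp_fst S.contDiffOn_fb₂
  have b₃ := contDiffOn_comp_fst S.contDiffOn_fb₃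
  refine ⟨sa, fun i => ?_, fun _ => contDiffOn_const, fun i k => ?_, fun i k => ?_⟩
  · fin_cases i <;> simp only [liftParams] <;> simp <;> fun_prop (disch := assumption)
  · fin_cases i <;> fin_cases k <;> simp only [liftParams] <;> simp <;>
      fun_prop (disch := assumption)
  · fin_cases i <;> fin_cases k <;> simp only [liftParams] <;> simp <;>
      fun_prop (disch := assumption)

theorem nondegenerate_liftParams (hc : S.FibreCoords a m n x y) :
    (S.liftParams a m n x y).Nondegenerate S.lift := by
  intro u hu
  have a0 := hc.a0 u hu
  have m0 := hc.m0 u hu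
  have n0 := hc.n0 u hu
  have hj : u.1 ∈ S.dom := hu.1
  have hδ := fδ_mul hj
  have h1 : S.fδ u.1 ≠ 0 := left_ne_zero_of_mul_eq_one hδ
  have h2 : 1 - S.fk u.1 * S.fl u.1 ≠ 0 := right_ne_zero_of_mul_eq_one hδ
  have h3 : S.ff u.1 ≠ 0 := right_ne_zero_of_mul_eq_one (fφ_mul_ff hj)
  have e1 : (Matrix.of fun i k => (S.liftParams a m n x y).f i k u).det
      = -(m u * n u * (m u * n u / a u) * S.ff u.1 * (1 - S.fk u.1 * S.fl u.1)) := by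
    simp only [liftParams, Matrix.det_fin_three, Matrix.of_apply, Matrix.cons_val_zero,
      Matrix.cons_val_one, Matrix.cons_val]
    ring
  have e2 : (Matrix.of fun i k => (S.liftParams a m n x y).h i k u).det
      = a u / n u * (a u / m u) * S.fδ u.1 ^ 2 * (1 - S.fk u.1 * S.fl u.1) := by
    simp only [liftParams, Matrix.det_fin_two, Matrix.of_apply, Matrix.cons_val_zero,
      Matrix.cons_val_one]
    ring
  rw [e1, e2, show (S.liftParams a m n x y).a u = a u from rfl]
  exact mul_ne_zero (mul_ne_zero a0 (neg_ne_zero.2 (mul_ne_zero (mul_ne_zero (mul_ne_zero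
    (mul_ne_zero m0 n0) (div_ne_zero (mul_ne_zero m0 n0) a0)) h3) h2)))
    (mul_ne_zero (mul_ne_zero (mul_ne_zero (div_ne_zero a0 n0) (div_ne_zero a0 m0))
      (pow_ne_zero 2 h1)) h2)

/-- The metric of a lifted coframe. -/
theorem formG_liftParams (hc : S.FibreCoords a m n x y) {u : Lift} (hu : u ∈ S.lift)
    (v v' : Lift) : formG ((S.liftParams a m n x y).theta S) u v v' =
    m u * n u * (S.β₁ u.1 v.1 * S.β₂ u.1 v'.1 + S.β₂ u.1 v.1 * S.β₁ u.1 v'.1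
      + S.β₃ u.1 v.1 * S.β₄ u.1 v'.1 + S.β₄ u.1 v.1 * S.β₃ u.1 v'.1) := by
  have a0 := hc.a0 u hu
  rw [formG, theta_liftParams_zero, theta_liftParams_one, theta_liftParams_two,
    theta_liftParams_three]
  simp only [add_apply, smul_apply, smul_eq_mul, pull_apply]
  field_simp
  ring

theorem theta_liftParams_eq_zero (hc : S.FibreCoords a m n x y) {u : Lift} (hu : u ∈ S.lift)
    (v : Lift) : (∀ i, (S.liftParams a m n x y).theta S i u v = 0) ↔
      S.β₁ u.1 v.1 = 0 ∧ S.β₂ u.1 v.1 = 0 ∧ S.β₃ u.1 v.1 = 0 ∧ S.β₄ u.1 v.1 = 0 := by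
  have a0 := hc.a0 u hu
  have m0 := hc.m0 u hu
  have n0 := hc.n0 u hu
  rw [Fin.forall_fin_succ, Fin.forall_fin_succ, Fin.forall_fin_succ, Fin.forall_fin_succ]
  show (S.liftParams a m n x y).theta S 0 u v = 0 ∧ (S.liftParams a m n x y).theta S 1 u v = 0 ∧
    (S.liftParams a m n x y).theta S 2 u v = 0 ∧ (S.liftParams a m n x y).theta S 3 u v = 0 ∧ _ ↔ _
  rw [theta_liftParams_zero, theta_liftParams_one, theta_liftParams_two, theta_liftParams_three]
  simp only [add_apply, smul_apply, smul_eq_mul, pull_apply, mul_eq_zero, a0, m0, n0, false_or,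
    div_eq_zero_iff, or_self]
  constructor
  · rintro ⟨h1, h2, h3, h4, -⟩
    rw [h4, mul_zero, add_zero] at h1 h2
    rw [h1, h2, h4] at h3
    exact ⟨h1, h2, by linarith, h4⟩
  · rintro ⟨h1, h2, h3, h4⟩
    simp [h1, h2, h3, h4]

theorem tangent_eq_zero {j : Jet} (hj : j ∈ S.dom) {v : Jet} (h1 : S.β₁ j v = 0)
    (h2 : S.β₂ j v = 0) (h3 : S.β₃ j v = 0) (h4 : S.β₄ j v = 0) (h5 : S.ω₂ j v = 0)
    (h6 : S.ω₃ j v = 0) : v = 0 := by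
  have hδ := fδ_mul hj
  have h0 : S.fδ j ≠ 0 := left_ne_zero_of_mul_eq_one hδ
  rw [ω₂_apply] at h5
  rw [ω₃_apply] at h6
  have h5' := (mul_eq_zero.1 h5).resolve_left h0
  have h6' := (mul_eq_zero.1 h6).resolve_left h0
  have v0 : v 0 = 0 := by linear_combination (-v 0) * hδ + S.fδ j * h6' - S.fδ j * S.fk j * h5'
  have v1 : v 1 = 0 := by linear_combination (-v 1) * hδ + S.fδ j * h5' - S.fδ j * S.fl j * h6'
  have n0 := nu_zero_eq_β hj v
  have n1 := nu_one_eq_β hj v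
  have n2 := nu_two_eq_β hj v
  rw [β₄_apply, lamForm_apply] at h4
  simp only [h1, h2, h3, β₄_apply, lamForm_apply, nu_zero_apply, nu_one_apply, nu_two_apply,
    v0, v1] at n0 n1 n2
  simp only [v0, v1, mul_zero, sub_zero, add_zero] at n0 n1 n2 h4
  ext i
  fin_cases i
  exacts [v0, v1, h4, by simpa [h4] using n0, by simpa [h4] using n1, by simpa [h4] using n2]

-- The structure equations of the β frame are pulled back and changed by the group element with
-- parameters a, m, n, x, y. For the coframe property, take a vector killed by all forms. The θ's
-- together with Ω₂ and Ω₃ force its jet part to vanish; on such a vector A₁, A₂, A₄, Ω₄, Ω₅ are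
-- nonzero multiples of dm, dn, da, dx, dy, which separate fibre directions.
set_option maxHeartbeats 1000000 in
theorem isNormalized_aux (h₁ : ∀ j ∈ S.dom, S.J1 j = 0) (h₂ : ∀ j ∈ S.dom, S.J2 j = 0)
    (hc : S.FibreCoords a m n x y) : ∃ A₁ A₂ A₃ A₄ Ω₄ Ω₅ : Lift → Lift →L[ℝ] ℝ,
      ContDiffOn ℝ ∞ A₁ S.lift ∧ ContDiffOn ℝ ∞ A₂ S.lift ∧ ContDiffOn ℝ ∞ A₃ S.lift ∧
      ContDiffOn ℝ ∞ A₄ S.lift ∧ ContDiffOn ℝ ∞ Ω₄ S.lift ∧ ContDiffOn ℝ ∞ Ω₅ S.lift ∧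
      (∀ u ∈ S.lift, FrameEquations ((S.liftParams a m n x y).theta S 0)
        ((S.liftParams a m n x y).theta S 1) ((S.liftParams a m n x y).theta S 2)
        ((S.liftParams a m n x y).theta S 3) A₁ A₂ A₃ A₄ (S.liftParams a m n x y).omega2
        (S.liftParams a m n x y).omega3 Ω₄ Ω₅
        (a u / n u ^ 2 * (S.fφ u.1 * S.fδ u.1 * pd 5 S.fk u.1))
        (a u / m u ^ 2 * (S.fφ u.1 * S.fδ u.1 * pd 5 S.fl u.1)) u) ∧
      ∀ u ∈ S.lift, ∀ v, (∀ i, (S.liftParams a m n x y).theta S i u v = 0) →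
        (S.liftParams a m n x y).omega2 u v = 0 → (S.liftParams a m n x y).omega3 u v = 0 →
        A₁ u v = 0 → A₂ u v = 0 → A₃ u v = 0 → A₄ u v = 0 → Ω₄ u v = 0 → Ω₅ u v = 0 → v = 0 := by
  obtain ⟨α₁, α₂, α₃, α₄, ω₄, ω₅, s₁, s₂, s₃, s₄, r₄, r₅, hF⟩ := exists_frameEquations h₁ h₂
  have hm : MapsTo Prod.fst S.lift S.dom := fun u hu => hu.1
  let t₁ : Lift → ℝ := fun u => S.fφ u.1 * S.fδ u.1 * pd 5 S.fk u.1
  let t₂ : Lift → ℝ := fun u => S.fφ u.1 * S.fδ u.1 * pd 5 S.fl u.1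
  have key : ∀ u ∈ S.lift, FrameEquations (fun u : Lift => pull (S.β₁ u.1))
      (fun u : Lift => pull (S.β₂ u.1)) (fun u : Lift => pull (S.β₃ u.1))
      (fun u : Lift => pull (S.β₄ u.1)) (fun u : Lift => pull (α₁ u.1))
      (fun u : Lift => pull (α₂ u.1)) (fun u : Lift => pull (α₃ u.1))
      (fun u : Lift => pull (α₄ u.1)) (fun u : Lift => pull (S.ω₂ u.1))
      (fun u : Lift => pull (S.ω₃ u.1)) (fun u : Lift => pull (ω₄ u.1))
      (fun u : Lift => pull (ω₅ u.1)) (t₁ u) (t₂ u) u := by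
    intro u hu
    obtain ⟨h0, h1, h2, h3, h4⟩ := hF u.1 hu.1
    have D : ∀ {β : Jet → Jet →L[ℝ] ℝ}, ContDiffOn ℝ ∞ β S.dom → DifferentiableAt ℝ β u.1 :=
      fun h => (h.contDiffAt (S.isOpen_dom.mem_nhds hu.1)).differentiableAt (by simp)
    refine ⟨?_, fun v v' => ?_, fun v v' => ?_, fun v v' => ?_, fun v v' => ?_⟩
    · exact ContinuousLinearMap.ext fun v => congrArg (fun A => A v.1) h0
    · rw [dForm_pull (D S.contDiffOn_β₁), h1]
      rfl
    · rw [dForm_pull (D S.contDiffOn_β₂), h2]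
      rfl
    · rw [dForm_pull (D S.contDiffOn_β₃), h3]
      rfl
    · rw [dForm_pull (D S.contDiffOn_β₄), h4]
      rfl
  have B₁ := contDiffOn_pull S.contDiffOn_β₁ hm
  have B₂ := contDiffOn_pull S.contDiffOn_β₂ hm
  have B₃ := contDiffOn_pull S.contDiffOn_β₃ hm
  have B₄ := contDiffOn_pull S.contDiffOn_β₄ hm
  have D : ∀ {F : Type} [NormedAddCommGroup F] [NormedSpace ℝ F] {β : Lift → F},
      ContDiffOn ℝ ∞ β S.lift → ∀ u ∈ S.lift, DifferentiableAt ℝ β u :=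
    fun h u hu => (h.contDiffAt (S.isOpen_lift.mem_nhds hu)).differentiableAt (by simp)
  have key' := fun u hu => (key u hu).change (D B₁ u hu) (D B₂ u hu) (D B₃ u hu) (D B₄ u hu)
    (D hc.sa u hu) (D hc.sm u hu) (D hc.sn u hu) (D hc.sx u hu) (D hc.sy u hu) (hc.a0 u hu)
    (hc.m0 u hu) (hc.n0 u hu) rfl rfl rfl rfl
  obtain ⟨ca, cm, cn, cx, cy, a0, m0, n0, inj⟩ := id hc
  have FD : ∀ {F : Lift → ℝ}, ContDiffOn ℝ ∞ F S.lift →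
      ContDiffOn ℝ ∞ (fun u => fderiv ℝ F u) S.lift :=
    fun h => h.fderiv_of_isOpen S.isOpen_lift (by simp)
  have fa := FD ca
  have fm := FD cm
  have fn := FD cn
  have fx := FD cx
  have fy := FD cy
  have c₁ := contDiffOn_pull s₁ hm
  have c₂ := contDiffOn_pull s₂ hm
  have c₃ := contDiffOn_pull s₃ hm
  have c₄ := contDiffOn_pull s₄ hm
  have o₄ := contDiffOn_pull r₄ hm
  have o₅ := contDiffOn_pull r₅ hm
  have o₂ := contDiffOn_pull S.contDiffOn_ω₂ hm
  have o₃ := contDiffOn_pull S.contDiffOn_ω₃ hm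
  have ct₁ : ContDiffOn ℝ ∞ (fun u => t₁ u) S.lift :=
    contDiffOn_comp_fst (F := fun j => S.fφ j * S.fδ j * pd 5 S.fk j) (by fun_prop)
  have ct₂ : ContDiffOn ℝ ∞ (fun u => t₂ u) S.lift :=
    contDiffOn_comp_fst (F := fun j => S.fφ j * S.fδ j * pd 5 S.fl j) (by fun_prop)
  have a0' : ∀ u ∈ S.lift, a u ^ 2 ≠ 0 := fun u hu => pow_ne_zero 2 (a0 u hu)
  rw [theta_liftParams_zero, theta_liftParams_one, theta_liftParams_two, theta_liftParams_three,
    omega2_liftParams, omega3_liftParams]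
  refine ⟨_, _, _, _, _, _, ?_, ?_, ?_, ?_, ?_, ?_, key', ?_⟩
  iterate 6
    fun_prop (disch := assumption)
  intro u hu v hv h5 h6 e1 e2 e3 e4 e5 e6
  obtain ⟨b1, b2, b3, b4⟩ := (theta_liftParams_eq_zero hc hu v).1 hv
  have z5 : S.ω₂ u.1 v.1 = 0 := (mul_eq_zero.1 h5).resolve_left (div_ne_zero (a0 u hu) (m0 u hu))
  have z6 : S.ω₃ u.1 v.1 = 0 := (mul_eq_zero.1 h6).resolve_left (div_ne_zero (a0 u hu) (n0 u hu))
  have z := tangent_eq_zero hu.1 b1 b2 b3 b4 z5 z6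
  have ma := a0 u hu
  have mm := m0 u hu
  have mn := n0 u hu
  simp only [add_apply, sub_apply, smul_apply, smul_eq_mul, pull_apply, z, map_zero, mul_zero,
    add_zero, sub_zero, zero_add, mul_eq_zero, one_div, inv_eq_zero, ma, mm, mn, false_or,
    div_eq_zero_iff, or_self] at e1 e2 e4 e5 e6
  exact inj u hu v z e4 e1 e2 e5 e6

end PDESystem

namespace PDESystem

open GroupParams

variable {S : PDESystem}

/-- The prescribed fibre coordinates include f₃₁ and f₃₂, whereas the group is parametrized by the
shears x, y. The two pairs are related by a linear system with determinant proportional to 1 - kl,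
solved here with δ = 1/(1 - kl). The weights r₁, r₂ allow the remaining coordinates to be either of
the two ν-coefficients of θ¹ and θ². -/
theorem exists_fibreCoords {r₁ r₂ : Jet → ℝ} (h₁ : S.Sm r₁) (h₂ : S.Sm r₂)
    (z₁ : ∀ j ∈ S.dom, r₁ j ≠ 0) (z₂ : ∀ j ∈ S.dom, r₂ j ≠ 0) {i i' : Fin 5}
    (hi : i = 1 ∧ i' = 2 ∨ i = 2 ∧ i' = 1) : ∃ x y : Lift → ℝ,
      S.FibreCoords (fun u => u.2 0) (fun u => r₁ u.1 * u.2 i) (fun u => r₂ u.1 * u.2 i') x y ∧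
      ∀ u ∈ S.lift,
        r₁ u.1 * u.2 i * (r₂ u.1 * u.2 i') / u.2 0 * (y u - S.fk u.1 * x u) = u.2 3 ∧
        r₁ u.1 * u.2 i * (r₂ u.1 * u.2 i') / u.2 0 * (x u - S.fl u.1 * y u) = u.2 4 := by
  have c : ∀ k : Fin 5, ContDiffOn ℝ ∞ (fun u : Lift => u.2 k) S.lift := fun k => by fun_prop
  have k := contDiffOn_comp_fst S.contDiffOn_fk
  have l := contDiffOn_comp_fst S.contDiffOn_fl
  have δ := contDiffOn_comp_fst S.contDiffOn_fδ
  have s₁ := contDiffOn_comp_fst h₁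
  have s₂ := contDiffOn_comp_fst h₂
  have n0 : ∀ u ∈ S.lift, u.2 0 ≠ 0 := fun u hu => hu.2.1
  have ni : ∀ u ∈ S.lift, u.2 i ≠ 0 ∧ u.2 i' ≠ 0 := fun u hu => by
    rcases hi with ⟨rfl, rfl⟩ | ⟨rfl, rfl⟩
    exacts [hu.2.2, hu.2.2.symm]
  have nm : ∀ u ∈ S.lift, r₁ u.1 * u.2 i ≠ 0 := fun u hu => mul_ne_zero (z₁ _ hu.1) (ni u hu).1
  have nn : ∀ u ∈ S.lift, r₂ u.1 * u.2 i' ≠ 0 := fun u hu => mul_ne_zero (z₂ _ hu.1) (ni u hu).2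
  have nmn : ∀ u ∈ S.lift, r₁ u.1 * u.2 i * (r₂ u.1 * u.2 i') ≠ 0 := fun u hu =>
    mul_ne_zero (nm u hu) (nn u hu)
  let x : Lift → ℝ := fun u => u.2 0 / (r₁ u.1 * u.2 i * (r₂ u.1 * u.2 i'))
    * (S.fδ u.1 * (S.fl u.1 * u.2 3 + u.2 4))
  let y : Lift → ℝ := fun u => u.2 0 / (r₁ u.1 * u.2 i * (r₂ u.1 * u.2 i'))
    * (S.fδ u.1 * (u.2 3 + S.fk u.1 * u.2 4))
  have cx : ContDiffOn ℝ ∞ x S.lift := by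
    exact ((c 0).div ((s₁.mul (c i)).mul (s₂.mul (c i'))) nmn).mul
      (δ.mul ((l.mul (c 3)).add (c 4)))
  have cy : ContDiffOn ℝ ∞ y S.lift := by
    exact ((c 0).div ((s₁.mul (c i)).mul (s₂.mul (c i'))) nmn).mul
      (δ.mul ((c 3).add (k.mul (c 4))))
  have hxy : ∀ u ∈ S.lift,
        r₁ u.1 * u.2 i * (r₂ u.1 * u.2 i') * (y u - S.fk u.1 * x u) = u.2 0 * u.2 3 ∧
        r₁ u.1 * u.2 i * (r₂ u.1 * u.2 i') * (x u - S.fl u.1 * y u) = u.2 0 * u.2 4 := by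
    intro u hu
    have hδ := fδ_mul hu.1
    have e : r₁ u.1 * u.2 i * (r₂ u.1 * u.2 i')
        * (u.2 0 / (r₁ u.1 * u.2 i * (r₂ u.1 * u.2 i'))) = u.2 0 := mul_div_cancel₀ _ (nmn u hu)
    simp only [x, y]
    constructor
    · linear_combination (S.fδ u.1 * (1 - S.fk u.1 * S.fl u.1) * u.2 3) * e + u.2 0 * u.2 3 * hδ
    · linear_combination (S.fδ u.1 * (1 - S.fk u.1 * S.fl u.1) * u.2 4) * e + u.2 0 * u.2 4 * hδ
  refine ⟨x, y, ⟨c 0, s₁.mul (c i), s₂.mul (c i'), cx, cy, n0, nm, nn, ?_⟩, fun u hu => ?_⟩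
  · intro u hu v hv e0 em en ex ey
    have D : ∀ {β : Lift → ℝ}, ContDiffOn ℝ ∞ β S.lift → DifferentiableAt ℝ β u :=
      fun h => (h.contDiffAt (S.isOpen_lift.mem_nhds hu)).differentiableAt (by simp)
    have dc : ∀ k : Fin 5, lieD (fun _ => v) (fun u : Lift => u.2 k) u = v.2 k := fun k => by
      have : HasFDerivAt (fun u : Lift => u.2 k) ((ContinuousLinearMap.proj k).comp
        (ContinuousLinearMap.snd ℝ Jet (Fin 5 → ℝ))) u :=
        ((ContinuousLinearMap.proj (R := ℝ) (φ := fun _ : Fin 5 => ℝ) k).comp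
          (ContinuousLinearMap.snd ℝ Jet (Fin 5 → ℝ))).hasFDerivAt
      rw [lieD, this.fderiv]
      rfl
    have df : ∀ F : Jet → ℝ, S.Sm F → lieD (fun _ => v) (fun u : Lift => F u.1) u = 0 :=
      fun F hF => by
        have := (Sm.differentiableAt hF hu.1).hasFDerivAt.comp u
          (hasFDerivAt_fst (𝕜 := ℝ) (E := Jet) (F := Fin 5 → ℝ))
        rw [lieD, show (fun u : Lift => F u.1) = F ∘ Prod.fst from rfl, this.fderiv]
        simp [hv]
    have d1 : lieD (fun _ => v) (fun u => r₁ u.1 * u.2 i) u = 0 := em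
    have d2 : lieD (fun _ => v) (fun u => r₂ u.1 * u.2 i') u = 0 := en
    have dx : lieD (fun _ => v) x u = 0 := ex
    have dy : lieD (fun _ => v) y u = 0 := ey
    have v0 : v.2 0 = 0 := (dc 0).symm.trans e0
    have vi : v.2 i = 0 := by
      have := d1
      rw [lieD_mul (D s₁) (D (c i)), df _ h₁, dc] at this
      simpa [z₁ _ hu.1] using this
    have vi' : v.2 i' = 0 := by
      have := d2
      rw [lieD_mul (D s₂) (D (c i')), df _ h₂, dc] at this
      simpa [z₂ _ hu.1] using this
    -- When da, dm, dn, dx and dy all vanish on v, differentiating the defining relations of x and y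
    -- leaves only a v₃ = 0 and a v₄ = 0.
    have e3 := lieD_congr (V := fun _ => v) S.isOpen_lift (fun u hu => (hxy u hu).1) hu
    have e4 := lieD_congr (V := fun _ => v) S.isOpen_lift (fun u hu => (hxy u hu).2) hu
    rw [lieD_mul ((D (s₁.mul (c i))).fun_mul (D (s₂.mul (c i'))))
        ((D cy).fun_sub ((D k).fun_mul (D cx))), lieD_mul (D (s₁.mul (c i))) (D (s₂.mul (c i'))),
      lieD_sub (D cy) ((D k).fun_mul (D cx)), lieD_mul (D k) (D cx), lieD_mul (D (c 0)) (D (c 3)),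
      dc, dc, d1, d2, dx, dy, df _ S.contDiffOn_fk, v0] at e3
    rw [lieD_mul ((D (s₁.mul (c i))).fun_mul (D (s₂.mul (c i'))))
        ((D cx).fun_sub ((D l).fun_mul (D cy))), lieD_mul (D (s₁.mul (c i))) (D (s₂.mul (c i'))),
      lieD_sub (D cx) ((D l).fun_mul (D cy)), lieD_mul (D l) (D cy), lieD_mul (D (c 0)) (D (c 4)),
      dc, dc, d1, d2, dx, dy, df _ S.contDiffOn_fl, v0] at e4
    have v3 : v.2 3 = 0 := by simpa [n0 u hu] using e3.symm
    have v4 : v.2 4 = 0 := by simpa [n0 u hu] using e4.symm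
    refine Prod.ext hv (funext fun k => ?_)
    fin_cases k
    · exact v0
    · rcases hi with ⟨rfl, rfl⟩ | ⟨rfl, rfl⟩
      exacts [vi, vi']
    · rcases hi with ⟨rfl, rfl⟩ | ⟨rfl, rfl⟩
      exacts [vi', vi]
    · exact v3
    · exact v4
  · obtain ⟨e3, e4⟩ := hxy u hu
    rw [div_mul_eq_mul_div, div_mul_eq_mul_div, e3, e4]
    exact ⟨mul_div_cancel_left₀ _ (n0 u hu), mul_div_cancel_left₀ _ (n0 u hu)⟩

variable {a m n x y : Lift → ℝ} {t₁ t₂ : Lift → ℝ}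

/-- Both orders of θ¹, θ² are recorded, since the sign ε decides which of the two null factors is
called θ¹. -/
theorem isNormalized_liftParams (h₁ : ∀ j ∈ S.dom, S.J1 j = 0) (h₂ : ∀ j ∈ S.dom, S.J2 j = 0)
    (hc : S.FibreCoords a m n x y)
    (ht₁ : ∀ u ∈ S.lift, t₁ u = -(a u / (8 * n u ^ 2 * S.w u.1 ^ 4))
      * (S.Rss u.1 * S.Ts u.1 ^ 2 + S.Tss u.1 * (1 + S.w u.1) ^ 2))
    (ht₂ : ∀ u ∈ S.lift, t₂ u = -(a u / (8 * m u ^ 2 * S.w u.1 ^ 4))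
      * (S.Rss u.1 * (1 + S.w u.1) ^ 2 + S.Tss u.1 * S.Rs u.1 ^ 2)) :
    (S.liftParams a m n x y).IsNormalized S S.lift t₁ t₂ ∧
      (S.liftParams a m n x y).swap.IsNormalized S S.lift t₂ t₁ := by
  obtain ⟨A₁, A₂, A₃, A₄, ω₄, ω₅, s₁, s₂, s₃, s₄, r₄, r₅, hF, hk⟩ := isNormalized_aux h₁ h₂ hc
  have hF' : ∀ u ∈ S.lift, FrameEquations ((S.liftParams a m n x y).theta S 0)
        ((S.liftParams a m n x y).theta S 1) ((S.liftParams a m n x y).theta S 2)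
        ((S.liftParams a m n x y).theta S 3) A₁ A₂ A₃ A₄ (S.liftParams a m n x y).omega2
        (S.liftParams a m n x y).omega3 ω₄ ω₅ (t₁ u) (t₂ u) u := by
    intro u hu
    have hw := S.w_pos hu.1
    have hm := hc.m0 u hu
    have hn := hc.n0 u hu
    obtain ⟨p1, p2⟩ := pd_five_fk hu.1
    convert hF u hu using 1
    · rw [ht₁ u hu, p1]
      field_simp
    · rw [ht₂ u hu, p2]
      field_simp
  refine ⟨isNormalized_of_frameEquations (smooth_liftParams hc) (nondegenerate_liftParams hc)
    s₁ s₂ s₃ s₄ r₄ r₅ hF' hk, isNormalized_of_frameEquations (smooth_liftParams hc).swap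
    (nondegenerate_liftParams hc).swap s₂ s₁ s₃ s₄ r₅ r₄ (fun u hu => (hF' u hu).swap) ?_⟩
  intro u hu v hv e2 e3 a1 a2 a3 a4 o4 o5
  refine hk u hu v (fun i => ?_) e3 e2 a2 a1 a3 a4 o5 o4
  fin_cases i
  exacts [hv 1, hv 0, hv 2, hv 3]

end PDESystem

/-! ### Joint flow of two commuting vector fields -/

section CommutingFlow

open Metric

variable {E A : Type*} [NormedAddCommGroup E] [NormedSpace ℝ E] [NormedAddCommGroup A]
  [NormedSpace ℝ A]

theorem eq_zero_of_hasDerivAt_linear {v : ℝ → E} {L : ℝ → E →L[ℝ] E} {K a b t₀ : ℝ}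
    (hL : ∀ t ∈ Ioo a b, ‖L t‖ ≤ K) (ht₀ : t₀ ∈ Ioo a b)
    (hv : ∀ t ∈ Ioo a b, HasDerivAt v (L t (v t)) t) (h0 : v t₀ = 0) {t : ℝ} (ht : t ∈ Ioo a b) :
    v t = 0 := by
  refine ODE_solution_unique_of_mem_Ioo (v := fun t x => L t x) (s := fun _ => univ)
    (K := K.toNNReal) (g := fun _ => (0 : E)) (fun t ht => ?_) ht₀
    (fun t ht => ⟨hv t ht, mem_univ _⟩) (fun t ht => ⟨?_, mem_univ _⟩) h0 ht
  · exact ((L t).lipschitz.weaken (by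
      rw [← NNReal.coe_le_coe]
      exact (hL t ht).trans (Real.le_coe_toNNReal K))).lipschitzOnWith
  · rw [map_zero]
    exact hasDerivAt_const t _

theorem hasDerivAt_line {F : (ℝ × ℝ) × A → E} {u : (ℝ × ℝ) × A} (hF : DifferentiableAt ℝ F u) :
    HasDerivAt (fun s => F ((s, u.1.2), u.2)) (fderiv ℝ F u ((1, 0), 0)) u.1.1 ∧
    HasDerivAt (fun s => F ((u.1.1, s), u.2)) (fderiv ℝ F u ((0, 1), 0)) u.1.2 := by
  have h1 : HasDerivAt (fun s : ℝ => (((s, u.1.2), u.2) : (ℝ × ℝ) × A)) ((1, 0), 0) u.1.1 :=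
    ((hasDerivAt_id _).prodMk (hasDerivAt_const _ _)).prodMk (hasDerivAt_const _ _)
  have h2 : HasDerivAt (fun s : ℝ => (((u.1.1, s), u.2) : (ℝ × ℝ) × A)) ((0, 1), 0) u.1.2 :=
    ((hasDerivAt_const _ _).prodMk (hasDerivAt_id _)).prodMk (hasDerivAt_const _ _)
  exact ⟨hF.hasFDerivAt.comp_hasDerivAt u.1.1 h1, hF.hasFDerivAt.comp_hasDerivAt u.1.2 h2⟩

/-- Commuting smooth vector fields have a joint local flow, here started on a smooth family of
points. -/
theorem exists_commuting_flow [FiniteDimensional ℝ E] {O : Set E} (hO : IsOpen O) {X Y : E → E}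
    (hX : ContDiffOn ℝ ∞ X O) (hY : ContDiffOn ℝ ∞ Y O)
    (hXY : ∀ j ∈ O, fderiv ℝ X j (Y j) = fderiv ℝ Y j (X j)) {ι : A → E} (hι : ContDiff ℝ ∞ ι)
    {a₀ : A} (ha₀ : ι a₀ ∈ O) (m₀ : ℝ × ℝ) :
    ∃ δ > 0, ∃ F : (ℝ × ℝ) × A → E, ContDiffOn ℝ ∞ F (ball (m₀, a₀) δ) ∧
      (∀ a ∈ ball a₀ δ, F (m₀, a) = ι a) ∧ ∀ u ∈ ball (m₀, a₀) δ, F u ∈ O ∧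
        fderiv ℝ F u ((1, 0), 0) = X (F u) ∧ fderiv ℝ F u ((0, 1), 0) = Y (F u) := by
  obtain ⟨φ, ε, hε, sφ, hφ⟩ := exists_smooth_local_flow hO hX ha₀
  obtain ⟨ψ, η, hη, sψ, hψ⟩ := exists_smooth_local_flow hO hY ha₀
  let base : (ℝ × ℝ) × A := (m₀, a₀)
  let p : (ℝ × ℝ) × A → ℝ × E := fun u => (u.1.1 - m₀.1, ι u.2)
  have sp : ContDiff ℝ ∞ p := by
    have := hι.comp (contDiff_snd (𝕜 := ℝ) (E := ℝ × ℝ) (F := A) (n := ∞))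
    exact ((contDiff_fst.comp contDiff_fst).sub contDiff_const).prodMk this
  let G : Set ((ℝ × ℝ) × A) := p ⁻¹' (ball 0 ε ×ˢ ball (ι a₀) ε)
  have hG : IsOpen G := (isOpen_ball.prod isOpen_ball).preimage sp.continuous
  have hbG : base ∈ G := by simp [G, p, base, hε]
  let g : (ℝ × ℝ) × A → E := fun u => φ (p u)
  have sg : ContDiffOn ℝ ∞ g G := sφ.comp sp.contDiffOn fun _ h => h
  let q : (ℝ × ℝ) × A → ℝ × E := fun u => (u.1.2 - m₀.2, g u)
  have sq : ContDiffOn ℝ ∞ q G := ContDiffOn.prodMk (by fun_prop) sg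
  let H : Set ((ℝ × ℝ) × A) := G ∩ q ⁻¹' (ball 0 η ×ˢ ball (ι a₀) η)
  have hH : IsOpen H := sq.continuousOn.isOpen_inter_preimage hG (isOpen_ball.prod isOpen_ball)
  have hgb : ∀ a ∈ ball (ι a₀) ε, φ (0, a) = a := fun a ha => (hφ a ha).1
  have hbH : base ∈ H := ⟨hbG, by simp [q, g, p, base, hη, hgb _ (mem_ball_self hε)]⟩
  -- The flow of X for time x - x₀ followed by the flow of Y for time y - y₀. Thus ∂_yF = Y(F)
  -- everywhere, while ∂_xF = X(F) is immediate only on the line y = y₀.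
  let F : (ℝ × ℝ) × A → E := fun u => ψ (q u)
  have sF : ContDiffOn ℝ ∞ F H := sψ.comp (sq.mono inter_subset_left) fun _ h => h.2
  have hFO : ∀ u ∈ H, F u ∈ O := fun u hu => ((hψ (q u).2 hu.2.2).2 (q u).1 hu.2.1).1
  have sYF : ContDiffOn ℝ ∞ (fun u => fderiv ℝ Y (F u)) H :=
    (hY.fderiv_of_isOpen hO (by simp)).comp sF hFO
  -- The derivative of Y along F is kept bounded, which supplies the Lipschitz constant for the
  -- uniqueness argument.
  let H' : Set ((ℝ × ℝ) × A) := H ∩ (fun u => ‖fderiv ℝ Y (F u)‖) ⁻¹'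
    Iio (‖fderiv ℝ Y (F base)‖ + 1)
  have hH' : IsOpen H' := sYF.continuousOn.norm.isOpen_inter_preimage hH isOpen_Iio
  have hbH' : base ∈ H' := ⟨hbH, by simp⟩
  obtain ⟨δ, hδ, hsub⟩ := Metric.isOpen_iff.1 hH' base hbH'
  have hsubH : ball (m₀, a₀) δ ⊆ H := fun u hu => (hsub hu).1
  have mem : ∀ {u : (ℝ × ℝ) × A}, u ∈ ball (m₀, a₀) δ ↔
      (u.1.1 ∈ ball m₀.1 δ ∧ u.1.2 ∈ ball m₀.2 δ) ∧ u.2 ∈ ball a₀ δ := fun {u} => by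
    rw [← ball_prod_same, mem_prod, ← Prod.mk.eta (p := m₀), ← ball_prod_same, mem_prod]
  have memδ : ∀ x : ℝ, x ∈ ball x δ := fun x => mem_ball_self hδ
  have dF : ∀ u ∈ H, DifferentiableAt ℝ F u := fun u hu =>
    (sF.contDiffAt (hH.mem_nhds hu)).differentiableAt (by simp)
  have FY : ∀ u ∈ H, fderiv ℝ F u ((0, 1), 0) = Y (F u) := by
    intro u hu
    have h1 := (hasDerivAt_line (dF u hu)).2
    have h2 := ((hψ (q u).2 hu.2.2).2 (q u).1 hu.2.1).2
    have h3 : HasDerivAt (fun s : ℝ => s - m₀.2) 1 u.1.2 := (hasDerivAt_id _).sub_const _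
    have h4 := h2.scomp u.1.2 h3
    rw [one_smul] at h4
    exact h1.unique h4
  have FX0 : ∀ u ∈ H, u.1.2 = m₀.2 → fderiv ℝ F u ((1, 0), 0) = X (F u) := by
    intro u hu hy
    have h1 := (hasDerivAt_line (dF u hu)).1
    have h2 := ((hφ (p u).2 hu.1.2).2 (p u).1 hu.1.1).2
    have h3 : HasDerivAt (fun s : ℝ => s - m₀.1) 1 u.1.1 := (hasDerivAt_id _).sub_const _
    have h4 := h2.scomp u.1.1 h3
    rw [one_smul] at h4
    have h5 : ∀ u' ∈ H, u'.1.2 = m₀.2 → F u' = g u' := fun u' hu' hy' => by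
      simp only [F, q, hy', sub_self]
      exact (hψ (g u') hu'.2.2).1
    have h6 : (fun s => F ((s, u.1.2), u.2)) =ᶠ[nhds u.1.1]
        fun s => φ (s - m₀.1, ι u.2) := by
      have hc : Continuous fun s : ℝ => (((s, u.1.2), u.2) : (ℝ × ℝ) × A) := by fun_prop
      filter_upwards [(hH.preimage hc).mem_nhds hu] with s hs
      exact h5 _ hs hy
    rw [h5 u hu hy]
    exact h1.unique (h4.congr_of_eventuallyEq h6)
  have hbsub : ball (m₀, a₀) δ ∈ nhds base := ball_mem_nhds _ hδ
  refine ⟨δ, hδ, F, sF.mono hsubH, fun a ha => ?_, fun u hu => ⟨hFO u (hsubH hu), ?_,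
    FY u (hsubH hu)⟩⟩
  · have hu : (m₀, a) ∈ ball (m₀, a₀) δ := mem.2 ⟨⟨memδ _, memδ _⟩, ha⟩
    have h := hsubH hu
    have e1 : g (m₀, a) = ι a := by
      simp only [g, p, sub_self]
      exact hgb _ h.1.2
    simp only [F, q, sub_self]
    rw [(hψ (g (m₀, a)) h.2.2).1, e1]
  · have hu' := mem.1 hu
    have hline : ∀ s ∈ ball m₀.2 δ, ((u.1.1, s), u.2) ∈ ball (m₀, a₀) δ := fun s hs =>
      mem.2 ⟨⟨hu'.1.1, hs⟩, hu'.2⟩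
    -- The failure of ∂_xF = X(F) along a line in the y direction. By symmetry of second derivatives
    -- and [X, Y] = 0 it solves the linear equation v' = DY(F) v, and it is zero at y₀.
    let v : ℝ → E := fun s => fderiv ℝ F ((u.1.1, s), u.2) ((1, 0), 0) - X (F ((u.1.1, s), u.2))
    have hv : ∀ s ∈ Ioo (m₀.2 - δ) (m₀.2 + δ),
        HasDerivAt v (fderiv ℝ Y (F ((u.1.1, s), u.2)) (v s)) s := by
      intro s hs
      rw [← Real.ball_eq_Ioo] at hs
      have hz := hline s hs
      set z : (ℝ × ℝ) × A := ((u.1.1, s), u.2) with hzdef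
      have hzH := hsubH hz
      have sfd : DifferentiableAt ℝ (fderiv ℝ F) z :=
        ((sF.fderiv_of_isOpen hH (m := ∞) (by simp)).contDiffAt
          (hH.mem_nhds hzH)).differentiableAt (by simp)
      have d1 : DifferentiableAt ℝ (fun z' => fderiv ℝ F z' ((1, 0), 0)) z :=
        sfd.clm_apply (differentiableAt_const _)
      have dX : DifferentiableAt ℝ X (F z) :=
        (hX.contDiffAt (hO.mem_nhds (hFO z hzH))).differentiableAt (by simp)
      have dY : DifferentiableAt ℝ Y (F z) :=
        (hY.contDiffAt (hO.mem_nhds (hFO z hzH))).differentiableAt (by simp)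
      have e1 := (hasDerivAt_line d1).2
      have dXF : DifferentiableAt ℝ (fun z' => X (F z')) z := dX.comp z (dF z hzH)
      have e2 := (hasDerivAt_line dXF).2
      have e3 : fderiv ℝ (fun z' => fderiv ℝ F z' ((1, 0), 0)) z ((0, 1), 0)
          = fderiv ℝ Y (F z) (fderiv ℝ F z ((1, 0), 0)) := by
        have hs2 : IsSymmSndFDerivAt ℝ F z :=
          (sF.contDiffAt (hH.mem_nhds hzH)).isSymmSndFDerivAt minSmoothness_two_le_infty
        have c1 : fderiv ℝ (fun z' => fderiv ℝ F z' ((1, 0), 0)) z ((0, 1), 0)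
            = fderiv ℝ (fderiv ℝ F) z ((0, 1), 0) ((1, 0), 0) := by
          rw [fderiv_clm_apply sfd (differentiableAt_const _)]
          simp
        have c2 : fderiv ℝ (fun z' => fderiv ℝ F z' ((0, 1), 0)) z ((1, 0), 0)
            = fderiv ℝ (fderiv ℝ F) z ((1, 0), 0) ((0, 1), 0) := by
          rw [fderiv_clm_apply sfd (differentiableAt_const _)]
          simp
        have c3 : (fun z' => fderiv ℝ F z' ((0, 1), 0)) =ᶠ[nhds z] fun z' => Y (F z') := by
          filter_upwards [hH.mem_nhds hzH] with z' hz'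
          exact FY z' hz'
        rw [c1, hs2.eq, ← c2, c3.fderiv_eq]
        have : fderiv ℝ (fun z' => Y (F z')) z = (fderiv ℝ Y (F z)).comp (fderiv ℝ F z) :=
          fderiv_comp z dY (dF z hzH)
        rw [this]
        rfl
      have e4 : fderiv ℝ (fun z' => X (F z')) z ((0, 1), 0)
          = fderiv ℝ Y (F z) (X (F z)) := by
        have : fderiv ℝ (fun z' => X (F z')) z = (fderiv ℝ X (F z)).comp (fderiv ℝ F z) :=
          fderiv_comp z dX (dF z hzH)
        rw [this, ContinuousLinearMap.comp_apply, FY z hzH, hXY _ (hFO z hzH)]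
      have e5 := e1.sub e2
      rw [e3, e4, ← map_sub] at e5
      exact e5
    have h0 : v m₀.2 = 0 := sub_eq_zero.2 (FX0 _ (hsubH (hline _ (memδ _))) rfl)
    have hy : u.1.2 ∈ Ioo (m₀.2 - δ) (m₀.2 + δ) := by
      rw [← Real.ball_eq_Ioo]
      exact hu'.1.2
    have hm : m₀.2 ∈ Ioo (m₀.2 - δ) (m₀.2 + δ) := by
      rw [← Real.ball_eq_Ioo]
      exact memδ _
    refine sub_eq_zero.1 (eq_zero_of_hasDerivAt_linear (K := ‖fderiv ℝ Y (F base)‖ + 1)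
      (fun s hs => ?_) hm hv h0 hy)
    rw [← Real.ball_eq_Ioo] at hs
    exact (hsub (hline s hs)).2.le

end CommutingFlow

/-! ### Functions with vanishing derivatives in x and y -/

section Partials

open Metric

variable {A E : Type*} [NormedAddCommGroup A] [NormedSpace ℝ A] [NormedAddCommGroup E]
  [NormedSpace ℝ E]

theorem fderiv_slice {G : (ℝ × ℝ) × A → E} {m : ℝ × ℝ} {a : A}
    (hG : DifferentiableAt ℝ G (m, a)) (v : ℝ × ℝ) :
    fderiv ℝ (fun m' => G (m', a)) m v = fderiv ℝ G (m, a) (v, 0) := by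
  have h1 : HasFDerivAt (fun m' : ℝ × ℝ => (m', a)) (ContinuousLinearMap.inl ℝ (ℝ × ℝ) A) m :=
    hasFDerivAt_prodMk_left m a
  have h2 : HasFDerivAt G (fderiv ℝ G (m, a)) (m, a) := hG.hasFDerivAt
  rw [show (fun m' => G (m', a)) = G ∘ fun m' => (m', a) from rfl, (h2.comp m h1).fderiv]
  rfl

theorem eq_center_of_partials_eq_zero {f : ℝ × ℝ → ℝ} {m₀ m : ℝ × ℝ} {r : ℝ}
    (hf : ∀ m ∈ ball m₀ r, DifferentiableAt ℝ f m ∧ fderiv ℝ f m (1, 0) = 0 ∧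
      fderiv ℝ f m (0, 1) = 0) (hm : m ∈ ball m₀ r) : f m = f m₀ := by
  have hr : 0 < r := pos_of_mem_ball hm
  refine (convex_ball m₀ r).is_const_of_fderivWithin_eq_zero (𝕜 := ℝ)
    (fun z hz => (hf z hz).1.differentiableWithinAt) (fun z hz => ?_) hm (mem_ball_self hr)
  rw [fderivWithin_of_isOpen isOpen_ball hz]
  ext
  · simpa using (hf z hz).2.1
  · simpa using (hf z hz).2.2

theorem eq_slice_center_of_partials_eq_zero {G : (ℝ × ℝ) × A → ℝ} {m₀ m : ℝ × ℝ} {a : A} {r : ℝ}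
    (hG : ∀ m ∈ ball m₀ r, DifferentiableAt ℝ G (m, a) ∧ fderiv ℝ G (m, a) ((1, 0), 0) = 0 ∧
      fderiv ℝ G (m, a) ((0, 1), 0) = 0) (hm : m ∈ ball m₀ r) : G (m, a) = G (m₀, a) := by
  refine eq_center_of_partials_eq_zero (f := fun m' => G (m', a)) (fun z hz => ?_) hm
  obtain ⟨h1, h2, h3⟩ := hG z hz
  refine ⟨h1.comp z (differentiableAt_id.prodMk (differentiableAt_const a)), ?_, ?_⟩
  · rw [fderiv_slice h1, h2]
  · rw [fderiv_slice h1, h3]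

theorem fderiv_quotient_eq_zero {f g : E → ℝ} {u w : E} {ρ : ℝ} (hf : DifferentiableAt ℝ f u)
    (hg : DifferentiableAt ℝ g u) (h0 : g u ≠ 0) (h1 : fderiv ℝ f u w = ρ * f u)
    (h2 : fderiv ℝ g u w = ρ * g u) : fderiv ℝ (fun x => f x * (g x)⁻¹) u w = 0 := by
  have e : (fun x => f x * (g x)⁻¹ * g x) =ᶠ[nhds u] f := by
    filter_upwards [hg.continuousAt.eventually_ne h0] with x hx
    rw [mul_assoc, inv_mul_cancel₀ hx, mul_one]
  have e' := congrArg (fun L : E →L[ℝ] ℝ => L w) e.fderiv_eq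
  simp only [fderiv_fun_mul (hf.fun_mul (hg.fun_inv h0)) hg, add_apply, smul_apply, smul_eq_mul,
    h1, h2] at e'
  have c : f u * (g u)⁻¹ * (ρ * g u) = ρ * f u := by field_simp
  rcases mul_eq_zero.1 (show g u * fderiv ℝ (fun x => f x * (g x)⁻¹) u w = 0 by
    linear_combination e' - c) with h | h
  exacts [absurd h h0, h]

end Partials

/-! ### Charts of the jet space straightened along solutions -/

namespace PDESystem

open Metric

/-- The inclusion of `(z, p, q, s)`-space in the space of jets. -/
noncomputable def sliceLin : (Fin 4 → ℝ) →L[ℝ] Jet :=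
  ContinuousLinearMap.pi ![0, 0, ContinuousLinearMap.proj 0, ContinuousLinearMap.proj 1,
    ContinuousLinearMap.proj 2, ContinuousLinearMap.proj 3]

theorem sliceLin_apply (α : Fin 4 → ℝ) : sliceLin α = ![0, 0, α 0, α 1, α 2, α 3] := by
  ext i
  fin_cases i <;> rfl

/-- The jet over `m` with fibre coordinates `a`. -/
noncomputable def slice (m : ℝ × ℝ) (a : Fin 4 → ℝ) : Jet := ![m.1, m.2, 0, 0, 0, 0] + sliceLin a

theorem slice_apply (m : ℝ × ℝ) (a : Fin 4 → ℝ) : slice m a = ![m.1, m.2, a 0, a 1, a 2, a 3] := by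
  rw [slice, sliceLin_apply]
  ext i
  fin_cases i <;> simp

theorem contDiff_slice (m : ℝ × ℝ) : ContDiff ℝ ∞ (slice m) := contDiff_const.add sliceLin.contDiff

theorem slice_self (j : Jet) : slice (j 0, j 1) ![j 2, j 3, j 4, j 5] = j := by
  rw [slice_apply]
  ext i
  fin_cases i <;> rfl

variable (S : PDESystem)

/-- A chart of the space of jets adapted to the foliation by (2-jets of) solutions. -/
structure SolutionChart (m₀ : ℝ × ℝ) (a₀ : Fin 4 → ℝ) (δ : ℝ)
    (h : OpenPartialHomeomorph ((ℝ × ℝ) × (Fin 4 → ℝ)) Jet) : Prop where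
  pos : 0 < δ
  subset : ball (m₀, a₀) δ ⊆ h.source
  smooth : ContDiffOn ℝ ∞ h (ball (m₀, a₀) δ)
  smooth_symm : ContDiffOn ℝ ∞ h.symm h.target
  mem_dom : ∀ u ∈ ball (m₀, a₀) δ, h u ∈ S.dom
  dx : ∀ u ∈ ball (m₀, a₀) δ, fderiv ℝ h u ((1, 0), 0) = vecDx S.R S.T (h u)
  dy : ∀ u ∈ ball (m₀, a₀) δ, fderiv ℝ h u ((0, 1), 0) = vecDy S.R S.T (h u)
  initial : ∀ a ∈ ball a₀ δ, h (m₀, a) = slice m₀ a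

variable {S}

/-- The joint flow of D_x and D_y is started on the fibre of jets over m₀. Its differential at the
centre is injective: D_x and D_y project to the coordinate vectors of the (x, y)-plane, and the
initial fibre supplies the four complementary directions. -/
theorem exists_solutionChart {j₀ : Jet} (hj₀ : j₀ ∈ S.dom) :
    ∃ δ h, S.SolutionChart (j₀ 0, j₀ 1) ![j₀ 2, j₀ 3, j₀ 4, j₀ 5] δ h := by
  set m₀ : ℝ × ℝ := (j₀ 0, j₀ 1) with hm₀
  set a₀ : Fin 4 → ℝ := ![j₀ 2, j₀ 3, j₀ 4, j₀ 5] with ha₀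
  have hs : slice m₀ a₀ = j₀ := slice_self j₀
  obtain ⟨δ, hδ, F, sF, hF0, hF⟩ := exists_commuting_flow S.isOpen_dom S.smooth_vecDx
    S.smooth_vecDy (fun j hj => S.vecD_comm hj) (contDiff_slice m₀) (a₀ := a₀)
    (by rw [hs]; exact hj₀) m₀
  have hb : (m₀, a₀) ∈ ball (m₀, a₀) δ := mem_ball_self hδ
  have dF : HasFDerivAt F (fderiv ℝ F (m₀, a₀)) (m₀, a₀) :=
    ((sF.contDiffAt (isOpen_ball.mem_nhds hb)).differentiableAt (by simp)).hasFDerivAt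
  have d3 : ∀ α, fderiv ℝ F (m₀, a₀) ((0, 0), α) = sliceLin α := by
    have h1 : HasFDerivAt (fun a : Fin 4 → ℝ => (m₀, a))
        (ContinuousLinearMap.inr ℝ (ℝ × ℝ) (Fin 4 → ℝ)) a₀ := hasFDerivAt_prodMk_right m₀ a₀
    have h2 := dF.comp a₀ h1
    have h3 : HasFDerivAt (slice m₀) sliceLin a₀ := sliceLin.hasFDerivAt.const_add _
    have h4 : F ∘ (fun a : Fin 4 → ℝ => (m₀, a)) =ᶠ[nhds a₀] slice m₀ := by
      filter_upwards [ball_mem_nhds a₀ hδ] with a ha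
      exact hF0 a ha
    have h5 := (h3.congr_of_eventuallyEq h4).unique h2
    intro α
    rw [h5]
    rfl
  obtain ⟨-, d1, d2⟩ := hF _ hb
  have key : ∀ v : (ℝ × ℝ) × (Fin 4 → ℝ), fderiv ℝ F (m₀, a₀) v =
      v.1.1 • vecDx S.R S.T (F (m₀, a₀)) + v.1.2 • vecDy S.R S.T (F (m₀, a₀)) + sliceLin v.2 := by
    intro v
    rw [← d1, ← d2, ← d3, ← map_smul, ← map_smul, ← map_add, ← map_add]
    refine congrArg _ (Prod.ext (Prod.ext ?_ ?_) ?_) <;> simp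
  have hinj : Function.Injective (fderiv ℝ F (m₀, a₀)) := by
    rw [injective_iff_map_eq_zero]
    intro v hv
    rw [key, sliceLin_apply] at hv
    have e0 : v.1.1 = 0 := by simpa [vecDx, vecDy] using congrFun hv 0
    have e1 : v.1.2 = 0 := by simpa [vecDx, vecDy] using congrFun hv 1
    rw [e0, e1, zero_smul, zero_smul, zero_add, zero_add] at hv
    refine Prod.ext (Prod.ext e0 e1) (funext fun i => ?_)
    fin_cases i
    exacts [congrFun hv 2, congrFun hv 3, congrFun hv 4, congrFun hv 5]
  let e : ((ℝ × ℝ) × (Fin 4 → ℝ)) ≃L[ℝ] Jet :=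
    (LinearEquiv.ofInjectiveOfFinrankEq (fderiv ℝ F (m₀, a₀)).toLinearMap hinj
      (by simp)).toContinuousLinearEquiv
  have he : HasFDerivAt F (e : ((ℝ × ℝ) × (Fin 4 → ℝ)) →L[ℝ] Jet) (m₀, a₀) := by
    convert dF using 1
    exact ContinuousLinearMap.ext fun _ => rfl
  obtain ⟨h, hb', hsub, heq, hsymm⟩ := exists_openPartialHomeomorph_contDiffOn_symm isOpen_ball sF
    hb e he
  obtain ⟨r, hr, hrsub⟩ := Metric.isOpen_iff.1 h.open_source _ hb'
  have hfun : (h : (ℝ × ℝ) × (Fin 4 → ℝ) → Jet) = F := funext heq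
  have hrb : ball (m₀, a₀) r ⊆ ball (m₀, a₀) δ := hrsub.trans hsub
  refine ⟨r, h, hr, hrsub, ?_, hsymm, fun u hu => ?_, fun u hu => ?_, fun u hu => ?_,
    fun a ha => ?_⟩
  · rw [hfun]
    exact sF.mono hrb
  · rw [hfun]
    exact (hF u (hrb hu)).1
  · rw [hfun]
    exact (hF u (hrb hu)).2.1
  · rw [hfun]
    exact (hF u (hrb hu)).2.2
  · rw [hfun]
    have hu : (m₀, a) ∈ ball (m₀, a₀) r := by
      rw [← ball_prod_same]
      exact ⟨mem_ball_self hr, ha⟩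
    have := hrb hu
    rw [← ball_prod_same] at this
    exact hF0 a this.2

namespace SolutionChart

variable {m₀ m : ℝ × ℝ} {a₀ a : Fin 4 → ℝ} {δ : ℝ} {u : (ℝ × ℝ) × (Fin 4 → ℝ)}
  {h : OpenPartialHomeomorph ((ℝ × ℝ) × (Fin 4 → ℝ)) Jet}

theorem contDiffAt (hc : S.SolutionChart m₀ a₀ δ h) (hu : u ∈ ball (m₀, a₀) δ) :
    ContDiffAt ℝ ∞ h u :=
  hc.smooth.contDiffAt (isOpen_ball.mem_nhds hu)

theorem differentiableAt (hc : S.SolutionChart m₀ a₀ δ h) (hu : u ∈ ball (m₀, a₀) δ) :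
    DifferentiableAt ℝ h u :=
  (hc.contDiffAt hu).differentiableAt (by simp)

theorem hasFDerivAt_coord (hc : S.SolutionChart m₀ a₀ δ h) (hu : u ∈ ball (m₀, a₀) δ) (i : Fin 6) :
    HasFDerivAt (fun u => h u i) ((ContinuousLinearMap.proj i).comp (fderiv ℝ h u)) u :=
  hasFDerivAt_pi'.1 (hc.differentiableAt hu).hasFDerivAt i

theorem coord_eq (hc : S.SolutionChart m₀ a₀ δ h) (hm : m ∈ ball m₀ δ) (ha : a ∈ ball a₀ δ) :
    h (m, a) 0 = m.1 ∧ h (m, a) 1 = m.2 := by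
  have mem : ∀ m ∈ ball m₀ δ, (m, a) ∈ ball (m₀, a₀) δ := fun m hm => by
    rw [← ball_prod_same]
    exact ⟨hm, ha⟩
  have f1 : ∀ u : (ℝ × ℝ) × (Fin 4 → ℝ), HasFDerivAt (fun u : (ℝ × ℝ) × (Fin 4 → ℝ) => u.1.1)
      ((ContinuousLinearMap.fst ℝ ℝ ℝ).comp (ContinuousLinearMap.fst ℝ (ℝ × ℝ) (Fin 4 → ℝ))) u :=
    fun u => ContinuousLinearMap.hasFDerivAt
      ((ContinuousLinearMap.fst ℝ ℝ ℝ).comp (ContinuousLinearMap.fst ℝ (ℝ × ℝ) (Fin 4 → ℝ)))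
  have f2 : ∀ u : (ℝ × ℝ) × (Fin 4 → ℝ), HasFDerivAt (fun u : (ℝ × ℝ) × (Fin 4 → ℝ) => u.1.2)
      ((ContinuousLinearMap.snd ℝ ℝ ℝ).comp (ContinuousLinearMap.fst ℝ (ℝ × ℝ) (Fin 4 → ℝ))) u :=
    fun u => ContinuousLinearMap.hasFDerivAt
      ((ContinuousLinearMap.snd ℝ ℝ ℝ).comp (ContinuousLinearMap.fst ℝ (ℝ × ℝ) (Fin 4 → ℝ)))
  have h0 := hc.initial a ha
  rw [slice_apply] at h0
  constructor
  · have e := eq_slice_center_of_partials_eq_zero (G := fun u => h u 0 - u.1.1) (a := a)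
      (fun z hz => by
        have hd := (hc.hasFDerivAt_coord (mem z hz) 0).fun_sub (f1 _)
        refine ⟨hd.differentiableAt, ?_, ?_⟩ <;> rw [hd.fderiv] <;>
          simp [hc.dx _ (mem z hz), hc.dy _ (mem z hz), vecDx, vecDy]) hm
    simp only [h0] at e
    simpa [sub_eq_zero] using e
  · have e := eq_slice_center_of_partials_eq_zero (G := fun u => h u 1 - u.1.2) (a := a)
      (fun z hz => by
        have hd := (hc.hasFDerivAt_coord (mem z hz) 1).fun_sub (f2 _)
        refine ⟨hd.differentiableAt, ?_, ?_⟩ <;> rw [hd.fderiv] <;>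
          simp [hc.dx _ (mem z hz), hc.dy _ (mem z hz), vecDx, vecDy]) hm
    simp only [h0] at e
    simpa [sub_eq_zero] using e

theorem deriv_coord (hc : S.SolutionChart m₀ a₀ δ h) (hu : (m, a) ∈ ball (m₀, a₀) δ) (i : Fin 6) :
    derivX (fun m' => h (m', a) i) m = vecDx S.R S.T (h (m, a)) i ∧
    derivY (fun m' => h (m', a) i) m = vecDy S.R S.T (h (m, a)) i := by
  have hd := hc.hasFDerivAt_coord hu i
  have e := fderiv_slice (G := fun u => h u i) hd.differentiableAt
  rw [derivX, derivY, e, e, hd.fderiv, ← hc.dx _ hu, ← hc.dy _ hu]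
  exact ⟨rfl, rfl⟩

/-- The identities D_x z = p, D_y z = q, D_y p = s, D_x p = R and D_y q = T hold along each leaf.
Hence the z-component of a leaf is a solution, and the leaf is its own 2-jet. -/
theorem jetOf_eq (hc : S.SolutionChart m₀ a₀ δ h) (hm : m ∈ ball m₀ δ) (ha : a ∈ ball a₀ δ) :
    jetOf (fun m' => h (m', a) 2) m = h (m, a) ∧
      derivX (derivX fun m' => h (m', a) 2) m = S.R (h (m, a)) ∧
      derivY (derivY fun m' => h (m', a) 2) m = S.T (h (m, a)) := by
  have mem : ∀ m ∈ ball m₀ δ, (m, a) ∈ ball (m₀, a₀) δ := fun m hm => by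
    rw [← ball_prod_same]
    exact ⟨hm, ha⟩
  have ex : (derivX fun m' => h (m', a) 2) =ᶠ[nhds m] fun m' => h (m', a) 3 := by
    filter_upwards [isOpen_ball.mem_nhds hm] with z hz
    exact (hc.deriv_coord (mem z hz) 2).1
  have ey : (derivY fun m' => h (m', a) 2) =ᶠ[nhds m] fun m' => h (m', a) 4 := by
    filter_upwards [isOpen_ball.mem_nhds hm] with z hz
    exact (hc.deriv_coord (mem z hz) 2).2
  have x3 := hc.deriv_coord (mem m hm) 3
  have x4 := hc.deriv_coord (mem m hm) 4
  have xx : derivX (derivX fun m' => h (m', a) 2) m = S.R (h (m, a)) := by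
    rw [derivX, ex.fderiv_eq]
    exact x3.1
  have xy : derivY (derivX fun m' => h (m', a) 2) m = h (m, a) 5 := by
    rw [derivY, ex.fderiv_eq]
    exact x3.2
  have yy : derivY (derivY fun m' => h (m', a) 2) m = S.T (h (m, a)) := by
    rw [derivY, ey.fderiv_eq]
    exact x4.2
  refine ⟨?_, xx, yy⟩
  obtain ⟨c0, c1⟩ := hc.coord_eq hm ha
  rw [jetOf, xy, ex.eq_of_nhds, ey.eq_of_nhds, ← c0, ← c1]
  ext i
  fin_cases i <;> rfl

theorem isGeneralSolution (hc : S.SolutionChart m₀ a₀ δ h) {r : ℝ} (hr : r ≤ δ) :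
    S.IsGeneralSolution (ball m₀ r) (ball a₀ r) (h '' ball (m₀, a₀) r) (fun m a => h (m, a) 2)
      (fun j => (h.symm j).2) := by
  have hb : ball (m₀, a₀) r ⊆ ball (m₀, a₀) δ := ball_subset_ball hr
  have hm := ball_subset_ball (x := m₀) hr
  have ha := ball_subset_ball (x := a₀) hr
  have mem : ∀ m ∈ ball m₀ r, ∀ a ∈ ball a₀ r, (m, a) ∈ ball (m₀, a₀) r := fun m hm a ha => by
    rw [← ball_prod_same]
    exact ⟨hm, ha⟩
  have mem' : ∀ u ∈ ball (m₀, a₀) r, u.1 ∈ ball m₀ r ∧ u.2 ∈ ball a₀ r := fun u hu => by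
    rwa [← ball_prod_same] at hu
  have inv : ∀ u ∈ ball (m₀, a₀) r, h.symm (h u) = u := fun u hu =>
    h.left_inv (hc.subset (hb hu))
  have sζ : ContDiffOn ℝ ∞ (fun u => h u 2) (ball (m₀, a₀) δ) := contDiffOn_pi.1 hc.smooth 2
  refine ⟨isOpen_ball, isOpen_ball,
    h.isOpen_image_of_subset_source isOpen_ball (hb.trans hc.subset), ?_, fun a haa => ⟨?_, ?_⟩,
    ?_, ?_, ?_, ?_, ?_, ?_⟩
  · rw [ball_prod_same]
    exact sζ.mono hb
  · exact (sζ.mono hb).comp (contDiff_id.prodMk contDiff_const).contDiffOn fun m hmm =>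
      mem m hmm a haa
  · intro m hmm
    obtain ⟨e1, e2, e3⟩ := hc.jetOf_eq (hm hmm) (ha haa)
    rw [e1]
    exact ⟨hc.mem_dom _ (hb (mem m hmm a haa)), e2, e3⟩
  · refine contDiff_snd.comp_contDiffOn (hc.smooth_symm.mono ?_)
    rintro _ ⟨u, hu, rfl⟩
    exact h.map_source (hc.subset (hb hu))
  · intro m hmm a haa
    rw [(hc.jetOf_eq (hm hmm) (ha haa)).1]
    exact mem_image_of_mem _ (mem m hmm a haa)
  · intro m hmm a haa
    rw [(hc.jetOf_eq (hm hmm) (ha haa)).1, inv _ (mem m hmm a haa)]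
  · rintro _ ⟨u, hu, rfl⟩
    obtain ⟨h1, h2⟩ := mem' u hu
    obtain ⟨c0, c1⟩ := hc.coord_eq (hm h1) (ha h2)
    rw [Prod.mk.eta] at c0 c1
    rw [c0, c1]
    exact h1
  · rintro _ ⟨u, hu, rfl⟩
    rw [inv u hu]
    exact (mem' u hu).2
  · rintro _ ⟨u, hu, rfl⟩
    obtain ⟨h1, h2⟩ := mem' u hu
    obtain ⟨c0, c1⟩ := hc.coord_eq (hm h1) (ha h2)
    rw [Prod.mk.eta] at c0 c1
    rw [inv u hu, c0, c1]
    exact (hc.jetOf_eq (hm h1) (ha h2)).1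

/-- The differential of the chart and of the map to the space of solutions. -/
theorem fderiv_sol (hc : S.SolutionChart m₀ a₀ δ h) (hu : u ∈ ball (m₀, a₀) δ) :
    DifferentiableAt ℝ (fun j => (h.symm j).2) (h u) ∧
    (∀ v, fderiv ℝ (fun j => (h.symm j).2) (h u) (fderiv ℝ h u v) = v.2) ∧
    ∀ w, ∃ v, fderiv ℝ h u v = w := by
  have hsrc := hc.subset hu
  have ht : h u ∈ h.target := h.map_source hsrc
  have d1 : DifferentiableAt ℝ h.symm (h u) :=
    (hc.smooth_symm.contDiffAt (h.open_target.mem_nhds ht)).differentiableAt (by simp)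
  have d2 := hc.differentiableAt hu
  have e1 : (fderiv ℝ h.symm (h u)).comp (fderiv ℝ h u) = ContinuousLinearMap.id ℝ _ := by
    rw [← fderiv_comp u d1 d2, ← fderiv_id (𝕜 := ℝ) (x := u)]
    exact Filter.EventuallyEq.fderiv_eq (by
      filter_upwards [h.open_source.mem_nhds hsrc] with z hz
      exact h.left_inv hz)
  have e2 : (fderiv ℝ h u).comp (fderiv ℝ h.symm (h u)) = ContinuousLinearMap.id ℝ _ := by
    have d3 : DifferentiableAt ℝ h (h.symm (h u)) := by rwa [h.left_inv hsrc]
    have := fderiv_comp (h u) d3 d1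
    rw [h.left_inv hsrc] at this
    rw [← this, ← fderiv_id (𝕜 := ℝ) (x := h u)]
    exact Filter.EventuallyEq.fderiv_eq (by
      filter_upwards [h.open_target.mem_nhds ht] with z hz
      exact h.right_inv hz)
  refine ⟨d1.snd, fun v => ?_, fun w => ⟨fderiv ℝ h.symm (h u) w, congrArg (fun L => L w) e2⟩⟩
  have e3 : fderiv ℝ (fun j => (h.symm j).2) (h u)
      = (ContinuousLinearMap.snd ℝ (ℝ × ℝ) (Fin 4 → ℝ)).comp (fderiv ℝ h.symm (h u)) :=
    d1.hasFDerivAt.snd.fderiv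
  rw [e3]
  exact congrArg (fun L : _ →L[ℝ] (ℝ × ℝ) × (Fin 4 → ℝ) => (L v).2) e1

theorem fderiv_initial (hc : S.SolutionChart m₀ a₀ δ h) (ha : a ∈ ball a₀ δ) (α : Fin 4 → ℝ) :
    fderiv ℝ h (m₀, a) (0, α) = sliceLin α := by
  have hu : (m₀, a) ∈ ball (m₀, a₀) δ := by
    rw [← ball_prod_same]
    exact ⟨mem_ball_self hc.pos, ha⟩
  have h1 : HasFDerivAt (fun a : Fin 4 → ℝ => (m₀, a))
      (ContinuousLinearMap.inr ℝ (ℝ × ℝ) (Fin 4 → ℝ)) a := hasFDerivAt_prodMk_right m₀ a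
  have h2 := (hc.differentiableAt hu).hasFDerivAt.comp a h1
  have h3 : HasFDerivAt (slice m₀) sliceLin a := sliceLin.hasFDerivAt.const_add _
  have h4 : h ∘ (fun a : Fin 4 → ℝ => (m₀, a)) =ᶠ[nhds a] slice m₀ := by
    filter_upwards [isOpen_ball.mem_nhds ha] with a ha
    exact hc.initial a ha
  rw [(h3.congr_of_eventuallyEq h4).unique h2]
  rfl

theorem fderiv_apply (hc : S.SolutionChart m₀ a₀ δ h) (hu : u ∈ ball (m₀, a₀) δ)
    (v : (ℝ × ℝ) × (Fin 4 → ℝ)) : fderiv ℝ h u v =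
      v.1.1 • vecDx S.R S.T (h u) + v.1.2 • vecDy S.R S.T (h u) + fderiv ℝ h u (0, v.2) := by
  rw [← hc.dx u hu, ← hc.dy u hu, ← map_smul, ← map_smul, ← map_add, ← map_add]
  refine congrArg _ (Prod.ext (Prod.ext ?_ ?_) ?_) <;> simp

/-- The quadratic form of the metric on variations of solutions. -/
theorem fderiv_metricForm (hc : S.SolutionChart m₀ a₀ δ h) (h₁ : ∀ j ∈ S.dom, S.J1 j = 0)
    (h₂ : ∀ j ∈ S.dom, S.J2 j = 0) (hu : u ∈ ball (m₀, a₀) δ) (α : Fin 4 → ℝ) :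
    DifferentiableAt ℝ (fun u => S.metricForm (h u, fderiv ℝ h u (0, α))) u ∧
    fderiv ℝ (fun u => S.metricForm (h u, fderiv ℝ h u (0, α))) u ((1, 0), 0)
      = S.rhoX (h u) * S.metricForm (h u, fderiv ℝ h u (0, α)) ∧
    fderiv ℝ (fun u => S.metricForm (h u, fderiv ℝ h u (0, α))) u ((0, 1), 0)
      = S.rhoY (h u) * S.metricForm (h u, fderiv ℝ h u (0, α)) := by
  have hj := hc.mem_dom u hu
  have hx : (h u, fderiv ℝ h u (0, α)) ∈ S.tdom := ⟨hj, mem_univ _⟩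
  have dQ := S.differentiableAt_of_tdom S.contDiffOn_metricForm hx
  have dh := hc.differentiableAt hu
  have ddh : DifferentiableAt ℝ (fderiv ℝ h) u :=
    ((hc.smooth.fderiv_of_isOpen isOpen_ball (m := ∞) (by simp)).contDiffAt
      (isOpen_ball.mem_nhds hu)).differentiableAt (by simp)
  have dα : ∀ w, DifferentiableAt ℝ (fun u => fderiv ℝ h u w) u := fun w =>
    ddh.clm_apply (differentiableAt_const _)
  have eα : ∀ w w', fderiv ℝ (fun u => fderiv ℝ h u w) u w' = fderiv ℝ (fderiv ℝ h) u w' w :=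
    fun w w' => by
      rw [fderiv_clm_apply ddh (differentiableAt_const _)]
      simp
  have hs : IsSymmSndFDerivAt ℝ h u :=
    (hc.contDiffAt hu).isSymmSndFDerivAt minSmoothness_two_le_infty
  -- The variation ∂_αh is transported by the linearized flow: exchanging the two derivatives of h
  -- shows that (h, ∂_αh) moves along the complete lift of V. The conformal equations for Q then
  -- apply directly.
  have key : ∀ (V : Jet → Jet) (w : (ℝ × ℝ) × (Fin 4 → ℝ)), ContDiffOn ℝ ∞ V S.dom →
      (∀ u ∈ ball (m₀, a₀) δ, fderiv ℝ h u w = V (h u)) →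
      fderiv ℝ (fun u => S.metricForm (h u, fderiv ℝ h u (0, α))) u w
        = lieD (tangentLift V) S.metricForm (h u, fderiv ℝ h u (0, α)) := by
    intro V w hV hVw
    have e1 : fderiv ℝ (fun u => fderiv ℝ h u (0, α)) u w
        = fderiv ℝ V (h u) (fderiv ℝ h u (0, α)) := by
      have dV : DifferentiableAt ℝ V (h u) :=
        (hV.contDiffAt (S.isOpen_dom.mem_nhds hj)).differentiableAt (by simp)
      have c : (fun u => fderiv ℝ h u w) =ᶠ[nhds u] V ∘ h := by
        filter_upwards [isOpen_ball.mem_nhds hu] with z hz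
        exact hVw z hz
      rw [eα, hs.eq, ← eα, c.fderiv_eq, fderiv_comp u dV dh]
      rfl
    have hd := dQ.hasFDerivAt.comp u (dh.hasFDerivAt.prodMk (dα (0, α)).hasFDerivAt)
    rw [show (fun u => S.metricForm (h u, fderiv ℝ h u (0, α)))
      = S.metricForm ∘ fun u => (h u, fderiv ℝ h u (0, α)) from rfl, hd.fderiv]
    show fderiv ℝ S.metricForm _ (fderiv ℝ h u w, fderiv ℝ (fun u => fderiv ℝ h u (0, α)) u w) = _
    rw [e1, hVw u hu]
    rfl
  refine ⟨DifferentiableAt.comp (g := S.metricForm) u dQ (dh.prodMk (dα (0, α))), ?_, ?_⟩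
  · exact (key _ _ S.smooth_vecDx hc.dx).trans (hatX_metricForm h₁ h₂ hx)
  · exact (key _ _ S.smooth_vecDy hc.dy).trans (hatY_metricForm h₁ h₂ hx)

/-- The metric is preserved up to a factor along solutions. -/
theorem metricForm_eq (hc : S.SolutionChart m₀ a₀ δ h) (h₁ : ∀ j ∈ S.dom, S.J1 j = 0)
    (h₂ : ∀ j ∈ S.dom, S.J2 j = 0) {r : ℝ} (hr : r ≤ δ) (ha : a ∈ ball a₀ r) {α' : Fin 4 → ℝ}
    (h0 : ∀ m ∈ ball m₀ r, S.metricForm (h (m, a), fderiv ℝ h (m, a) (0, α')) ≠ 0)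
    (h1 : S.metricForm (slice m₀ a, sliceLin α') = 1) (hm : m ∈ ball m₀ r) (α : Fin 4 → ℝ) :
    S.metricForm (h (m, a), fderiv ℝ h (m, a) (0, α))
      = S.metricForm (h (m, a), fderiv ℝ h (m, a) (0, α'))
        * S.metricForm (slice m₀ a, sliceLin α) := by
  have mem : ∀ m ∈ ball m₀ r, (m, a) ∈ ball (m₀, a₀) δ := fun m hm => by
    rw [← ball_prod_same]
    exact ⟨ball_subset_ball hr hm, ball_subset_ball hr ha⟩
  -- Numerator and denominator are scaled by the same weights ρ_x, ρ_y, so their quotient is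
  -- constant in (x, y). At m₀ the denominator is 1.
  have e := eq_slice_center_of_partials_eq_zero
    (G := fun u => S.metricForm (h u, fderiv ℝ h u (0, α))
      * (S.metricForm (h u, fderiv ℝ h u (0, α')))⁻¹) (a := a) (fun z hz => by
      obtain ⟨d1, x1, y1⟩ := hc.fderiv_metricForm h₁ h₂ (mem z hz) α
      obtain ⟨d2, x2, y2⟩ := hc.fderiv_metricForm h₁ h₂ (mem z hz) α'
      have n := h0 z hz
      exact ⟨d1.fun_mul (d2.fun_inv n), fderiv_quotient_eq_zero d1 d2 n x1 x2,
        fderiv_quotient_eq_zero d1 d2 n y1 y2⟩) hm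
  simp only [hc.initial a (ball_subset_ball hr ha), hc.fderiv_initial (ball_subset_ball hr ha), h1,
    inv_one, mul_one] at e
  rw [← e]
  have n := h0 m hm
  field_simp

end SolutionChart

end PDESystem

/-! ### Descent of the conformal metric to the solution space -/

/-- Four covectors `A₁, …, A₄` with trivial common kernel define a split metric
`2 (A₁ A₂ + A₃ A₄)`. -/
theorem exists_split_basis {A₁ A₂ A₃ A₄ : (Fin 4 → ℝ) →L[ℝ] ℝ}
    (hA : ∀ α, A₁ α = 0 → A₂ α = 0 → A₃ α = 0 → A₄ α = 0 → α = 0) {c : ℝ} (hc : c * c = 1) :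
    ∃ e : Module.Basis (Fin 4) ℝ (Fin 4 → ℝ), ∀ i k,
      c * (A₁ (e i) * A₂ (e k) + A₂ (e i) * A₁ (e k) + A₃ (e i) * A₄ (e k) + A₄ (e i) * A₃ (e k))
        = if i = k then (![1, 1, -1, -1] : Fin 4 → ℝ) i else 0 := by
  have hs : Real.sqrt 2 * Real.sqrt 2 = 2 := Real.mul_self_sqrt (by norm_num)
  have hs0 : Real.sqrt 2 ≠ 0 := by positivity
  -- Each hyperbolic plane is diagonalized by 2c uv = ((u + cv)² - (u - cv)²)/2, valid as c² = 1.
  -- The required basis is dual to these four covectors.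
  let B : Fin 4 → ((Fin 4 → ℝ) →ₗ[ℝ] ℝ) :=
    ![(1 / Real.sqrt 2) • ((A₁ : (Fin 4 → ℝ) →ₗ[ℝ] ℝ) + c • (A₂ : (Fin 4 → ℝ) →ₗ[ℝ] ℝ)),
      (1 / Real.sqrt 2) • ((A₃ : (Fin 4 → ℝ) →ₗ[ℝ] ℝ) + c • (A₄ : (Fin 4 → ℝ) →ₗ[ℝ] ℝ)),
      (1 / Real.sqrt 2) • ((A₁ : (Fin 4 → ℝ) →ₗ[ℝ] ℝ) - c • (A₂ : (Fin 4 → ℝ) →ₗ[ℝ] ℝ)),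
      (1 / Real.sqrt 2) • ((A₃ : (Fin 4 → ℝ) →ₗ[ℝ] ℝ) - c • (A₄ : (Fin 4 → ℝ) →ₗ[ℝ] ℝ))]
  have b0 : ∀ α, B 0 α * Real.sqrt 2 = A₁ α + c * A₂ α := fun α => by
    show 1 / Real.sqrt 2 * (A₁ α + c * A₂ α) * Real.sqrt 2 = _
    field_simp
  have b1 : ∀ α, B 1 α * Real.sqrt 2 = A₃ α + c * A₄ α := fun α => by
    show 1 / Real.sqrt 2 * (A₃ α + c * A₄ α) * Real.sqrt 2 = _
    field_simp
  have b2 : ∀ α, B 2 α * Real.sqrt 2 = A₁ α - c * A₂ α := fun α => by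
    show 1 / Real.sqrt 2 * (A₁ α - c * A₂ α) * Real.sqrt 2 = _
    field_simp
  have b3 : ∀ α, B 3 α * Real.sqrt 2 = A₃ α - c * A₄ α := fun α => by
    show 1 / Real.sqrt 2 * (A₃ α - c * A₄ α) * Real.sqrt 2 = _
    field_simp
  have hinj : Function.Injective (LinearMap.pi B) := by
    rw [← LinearMap.ker_eq_bot, LinearMap.ker_eq_bot']
    intro α hα
    have h0 := b0 α
    have h1 := b1 α
    have h2 := b2 α
    have h3 := b3 α
    rw [show B 0 α = 0 from congrFun hα 0, zero_mul] at h0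
    rw [show B 1 α = 0 from congrFun hα 1, zero_mul] at h1
    rw [show B 2 α = 0 from congrFun hα 2, zero_mul] at h2
    rw [show B 3 α = 0 from congrFun hα 3, zero_mul] at h3
    refine hA α ?_ ?_ ?_ ?_
    · linarith
    · linear_combination -A₂ α * hc - c / 2 * h0 + c / 2 * h2
    · linarith
    · linear_combination -A₄ α * hc - c / 2 * h1 + c / 2 * h3
  let L : (Fin 4 → ℝ) ≃ₗ[ℝ] (Fin 4 → ℝ) := LinearEquiv.ofInjectiveEndo (LinearMap.pi B) hinj
  let e : Module.Basis (Fin 4) ℝ (Fin 4 → ℝ) := Module.Basis.ofEquivFun L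
  have hB : ∀ i k, B k (e i) = if i = k then 1 else 0 := fun i k => by
    have h1 : L (e i) = Pi.single i 1 := by
      simp [e, Module.Basis.ofEquivFun, Module.Basis.coe_ofRepr, L]
    have h2 : B k (e i) = L (e i) k := rfl
    rw [h2, h1, Pi.single_apply]
    simp [eq_comm]
  have key : ∀ α β, c * (A₁ α * A₂ β + A₂ α * A₁ β + A₃ α * A₄ β + A₄ α * A₃ β)
      = B 0 α * B 0 β + B 1 α * B 1 β - B 2 α * B 2 β - B 3 α * B 3 β := fun α β => by
    have e0 := congrArg₂ (· * ·) (b0 α) (b0 β)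
    have e1 := congrArg₂ (· * ·) (b1 α) (b1 β)
    have e2 := congrArg₂ (· * ·) (b2 α) (b2 β)
    have e3 := congrArg₂ (· * ·) (b3 α) (b3 β)
    linear_combination (1 / 2 : ℝ) * (-e0 - e1 + e2 + e3)
      + 1 / 2 * (B 0 α * B 0 β + B 1 α * B 1 β - B 2 α * B 2 β - B 3 α * B 3 β) * hs
  refine ⟨e, fun i k => ?_⟩
  rw [key, hB, hB, hB, hB, hB, hB, hB, hB]
  fin_cases i <;> fin_cases k <;> simp

namespace PDESystem

open Metric

variable {S : PDESystem}

theorem fσ_neg {j : Jet} (hj : j ∈ S.dom) : S.fσ j < 0 :=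
  div_neg_of_neg_of_pos (by norm_num) (by linarith [S.w_pos hj])

theorem nu_vecD (hS : PDESystem) (j : Jet) :
    (lamForm j (vecDx hS.R hS.T j) = 0 ∧ ∀ i, hS.nu i j (vecDx hS.R hS.T j) = 0) ∧
    (lamForm j (vecDy hS.R hS.T j) = 0 ∧ ∀ i, hS.nu i j (vecDy hS.R hS.T j) = 0) := by
  refine ⟨⟨?_, fun i => ?_⟩, ?_, fun i => ?_⟩
  · simp [lamForm_apply, vecDx]
  · fin_cases i <;> simp [nu, vecDx]
  · simp [lamForm_apply, vecDy]
  · fin_cases i <;> simp [nu, vecDy]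

/-- The covectors `β₁, …, β₄` vanish exactly on the span of `D_x` and `D_y`. -/
theorem β_eq_zero_iff {j : Jet} (hj : j ∈ S.dom) (v : Jet) :
    (S.β₁ j v = 0 ∧ S.β₂ j v = 0 ∧ S.β₃ j v = 0 ∧ S.β₄ j v = 0) ↔
      v = v 0 • vecDx S.R S.T j + v 1 • vecDy S.R S.T j := by
  constructor
  · rintro ⟨h1, h2, h3, h4⟩
    have n0 := nu_zero_eq_β hj v
    have n1 := nu_one_eq_β hj v
    have n2 := nu_two_eq_β hj v
    simp only [h1, h2, h3, h4, mul_zero, add_zero, sub_zero] at n0 n1 n2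
    rw [β₄_apply, lamForm_apply] at h4
    rw [nu_zero_apply] at n0
    rw [nu_one_apply] at n1
    rw [nu_two_apply] at n2
    ext i
    fin_cases i <;> simp [vecDx, vecDy] <;> linarith
  · intro h
    obtain ⟨⟨x0, x1⟩, y0, y1⟩ := nu_vecD S j
    have l : lamForm j v = 0 := by
      rw [h, map_add, map_smul, map_smul, x0, y0]
      simp
    have n : ∀ i, S.nu i j v = 0 := fun i => by
      rw [h, map_add, map_smul, map_smul, x1, y1]
      simp
    simp [β₁_apply, β₂_apply, β₃_apply, β₄_apply, l, n]

theorem contDiffOn_comp_slice {F : Type*} [NormedAddCommGroup F] [NormedSpace ℝ F] {G : Jet → F}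
    (hG : ContDiffOn ℝ ∞ G S.dom) {m₀ : ℝ × ℝ} {N : Set (Fin 4 → ℝ)}
    (hN : ∀ a ∈ N, slice m₀ a ∈ S.dom) : ContDiffOn ℝ ∞ (fun a => G (slice m₀ a)) N :=
  hG.comp (contDiff_slice m₀).contDiffOn hN

theorem slice_normalized {m : ℝ × ℝ} {a : Fin 4 → ℝ} (hd : S.cD (slice m a) ≠ 0) :
    S.metricForm (slice m a, sliceLin ![1, 0, 0, (1 - S.cG (slice m a)) / S.cD (slice m a)])
      = 1 := by
  rw [metricForm, quad, sliceLin_apply]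
  simp only [nuHat, lamHat, lamForm_apply, nu_zero_apply, nu_one_apply, nu_two_apply,
    Matrix.cons_val_zero, Matrix.cons_val_one, Matrix.cons_val]
  field_simp
  ring

/-- The symmetric bilinear form `2 (β₁ β₂ + β₃ β₄)`. -/
noncomputable def βform (S : PDESystem) (j v v' : Jet) : ℝ :=
  S.β₁ j v * S.β₂ j v' + S.β₂ j v * S.β₁ j v' + S.β₃ j v * S.β₄ j v' + S.β₄ j v * S.β₃ j v'

theorem βform_polar {j : Jet} (hj : j ∈ S.dom) (v v' : Jet) : S.βform j v v' =
    S.fσ j * (S.metricForm (j, v + v') - S.metricForm (j, v) - S.metricForm (j, v')) := by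
  have h := fun v => β_metric hj v
  have h1 := h (v + v')
  simp only [map_add] at h1
  rw [βform]
  linear_combination h1 - h v - h v'

/-- The metric on N is, up to sign, the polar form of β₁β₂ + β₃β₄ on the fibre over m₀. Transport
along solutions rescales Q by one function, so at every other jet the form is a multiple of the one
over m₀. Only the kernel of the θ's and the proportionality of their form G to the β form enter, so
both orders of θ¹, θ² are covered. -/
theorem descendsToConformalMetric (h₁ : ∀ j ∈ S.dom, S.J1 j = 0) (h₂ : ∀ j ∈ S.dom, S.J2 j = 0)
    {θ : Fin 4 → Lift → (Lift →L[ℝ] ℝ)} {κ : Lift → ℝ} (sκ : ContDiffOn ℝ ∞ κ S.lift)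
    (κ0 : ∀ u ∈ S.lift, κ u ≠ 0)
    (hker : ∀ u ∈ S.lift, ∀ v : Lift, (∀ i, θ i u v = 0) ↔
      S.β₁ u.1 v.1 = 0 ∧ S.β₂ u.1 v.1 = 0 ∧ S.β₃ u.1 v.1 = 0 ∧ S.β₄ u.1 v.1 = 0)
    (hG : ∀ u ∈ S.lift, ∀ v v' : Lift, formG θ u v v' = κ u * S.βform u.1 v.1 v'.1) :
    DescendsToConformalMetric S S.lift θ := by
  intro u₀ hu₀
  obtain ⟨δ, h, hc⟩ := exists_solutionChart hu₀.1
  set m₀ : ℝ × ℝ := (u₀.1 0, u₀.1 1) with hm₀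
  set a₀ : Fin 4 → ℝ := ![u₀.1 2, u₀.1 3, u₀.1 4, u₀.1 5] with ha₀
  have hδ := hc.pos
  have hs₀ : slice m₀ a₀ = u₀.1 := slice_self u₀.1
  have mem : ∀ {r : ℝ} {u : (ℝ × ℝ) × (Fin 4 → ℝ)}, u ∈ ball (m₀, a₀) r ↔
      u.1 ∈ ball m₀ r ∧ u.2 ∈ ball a₀ r := fun {r u} => by rw [← ball_prod_same, mem_prod]
  have hsd : ∀ a ∈ ball a₀ δ, slice m₀ a ∈ S.dom := fun a ha => by
    rw [← hc.initial a ha]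
    exact hc.mem_dom _ (mem.2 ⟨mem_ball_self hδ, ha⟩)
  have hD : ∀ a ∈ ball a₀ δ, S.cD (slice m₀ a) ≠ 0 := fun a ha => by
    have := S.one_sub_pos (hsd a ha)
    rw [cD]
    positivity
  -- A reference variation with λ = 1, ν₁ = ν₂ = 0 over m₀ and ν₃ such that Q = 1. The value `En` of
  -- Q on its transport is positive near the centre and serves as conformal factor.
  let α₀ : (Fin 4 → ℝ) → (Fin 4 → ℝ) := fun a =>
    ![1, 0, 0, (1 - S.cG (slice m₀ a)) / S.cD (slice m₀ a)]
  have sα₀ : ContDiffOn ℝ ∞ α₀ (ball a₀ δ) := by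
    refine contDiffOn_pi.2 fun i => ?_
    fin_cases i
    · exact contDiffOn_const
    · exact contDiffOn_const
    · exact contDiffOn_const
    · exact (contDiffOn_const.sub (contDiffOn_comp_slice S.contDiffOn_cG hsd)).div
        (contDiffOn_comp_slice S.contDiffOn_cD hsd) hD
  let En : (ℝ × ℝ) × (Fin 4 → ℝ) → ℝ := fun u =>
    S.metricForm (h u, fderiv ℝ h u (0, α₀ u.2))
  have sE : ContDiffOn ℝ ∞ En (ball (m₀, a₀) δ) := by
    refine S.contDiffOn_metricForm.comp (hc.smooth.prodMk
      ((hc.smooth.fderiv_of_isOpen isOpen_ball (by simp)).clm_apply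
        (contDiffOn_const.prodMk (sα₀.comp contDiffOn_snd fun u hu => (mem.1 hu).2)))) ?_
    exact fun u hu => ⟨hc.mem_dom u hu, mem_univ _⟩
  have hE₀ : En (m₀, a₀) = 1 := by
    have ha : a₀ ∈ ball a₀ δ := mem_ball_self hδ
    simp only [En]
    rw [hc.initial a₀ ha, hc.fderiv_initial ha]
    exact slice_normalized (hD a₀ ha)
  -- a small product neighbourhood
  let p : ((ℝ × ℝ) × (Fin 4 → ℝ)) × (Fin 5 → ℝ) → Lift := fun z => (h z.1, z.2)
  let Z₀ : Set (((ℝ × ℝ) × (Fin 4 → ℝ)) × (Fin 5 → ℝ)) := Prod.fst ⁻¹' ball (m₀, a₀) δ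
  have oZ₀ : IsOpen Z₀ := isOpen_ball.preimage continuous_fst
  have cp : ContinuousOn p Z₀ :=
    (hc.smooth.continuousOn.comp continuous_fst.continuousOn fun z hz => hz).prodMk
      continuous_snd.continuousOn
  let O : Set Lift := {u | u ∈ S.lift ∧ 0 < κ u * κ u₀}
  have oO : IsOpen O :=
    (sκ.continuousOn.mul continuousOn_const).isOpen_inter_preimage S.isOpen_lift isOpen_Ioi
  let Z : Set (((ℝ × ℝ) × (Fin 4 → ℝ)) × (Fin 5 → ℝ)) :=
    (Z₀ ∩ p ⁻¹' O) ∩ (Z₀ ∩ (fun z => En z.1) ⁻¹' Ioi 0)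
  have oZ : IsOpen Z := (cp.isOpen_inter_preimage oZ₀ oO).inter
    ((sE.continuousOn.comp continuous_fst.continuousOn fun z hz => hz).isOpen_inter_preimage oZ₀
      isOpen_Ioi)
  have hz₀ : ((m₀, a₀), u₀.2) ∈ Z₀ := mem_ball_self hδ
  have hp₀ : h (m₀, a₀) = u₀.1 := (hc.initial a₀ (mem_ball_self hδ)).trans hs₀
  have hz : ((m₀, a₀), u₀.2) ∈ Z := by
    refine ⟨⟨hz₀, ?_⟩, hz₀, ?_⟩
    · have : p ((m₀, a₀), u₀.2) = u₀ := Prod.ext hp₀ rfl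
      rw [mem_preimage, this]
      exact ⟨hu₀, mul_self_pos.2 (κ0 u₀ hu₀)⟩
    · show (0 : ℝ) < En (m₀, a₀)
      rw [hE₀]
      exact one_pos
  obtain ⟨r₁, hr₁, hrZ₁⟩ := Metric.isOpen_iff.1 oZ _ hz
  obtain ⟨r, hr, hrδ, hrr₁⟩ : ∃ r, 0 < r ∧ r ≤ δ ∧ r ≤ r₁ :=
    ⟨min r₁ δ, lt_min hr₁ hδ, min_le_right _ _, min_le_left _ _⟩
  have hrZ : ball (m₀, a₀) r ×ˢ ball u₀.2 r ⊆ Z := by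
    rw [ball_prod_same]
    exact (ball_subset_ball hrr₁).trans hrZ₁
  have hξ : u₀.2 ∈ ball u₀.2 r := mem_ball_self hr
  have hbδ : ∀ u ∈ ball (m₀, a₀) r, u ∈ ball (m₀, a₀) δ := ball_subset_ball hrδ
  have hEpos : ∀ u ∈ ball (m₀, a₀) r, 0 < En u := fun u hu => (hrZ (mk_mem_prod hu hξ)).2.2
  have hVO : ∀ u ∈ ball (m₀, a₀) r, ∀ ξ ∈ ball u₀.2 r, ((h u, ξ) : Lift) ∈ O := fun u hu ξ hξ =>
    (hrZ (mk_mem_prod hu hξ)).1.2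
  have haδ : ∀ a ∈ ball a₀ r, a ∈ ball a₀ δ := ball_subset_ball hrδ
  have hm₀ : m₀ ∈ ball m₀ r := mem_ball_self hr
  have inv : ∀ u ∈ ball (m₀, a₀) r, h.symm (h u) = u := fun u hu =>
    h.left_inv (hc.subset (hbδ u hu))
  let sol : Jet → (Fin 4 → ℝ) := fun j => (h.symm j).2
  let V : Set Lift := (h '' ball (m₀, a₀) r) ×ˢ ball u₀.2 r
  have hV : ∀ u ∈ V, ∃ b ∈ ball (m₀, a₀) r, h b = u.1 ∧ u.2 ∈ ball u₀.2 r := by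
    rintro u ⟨⟨b, hb, e⟩, hu2⟩
    exact ⟨b, hb, e, hu2⟩
  have gen := hc.isGeneralSolution hrδ
  have hfst : Prod.fst '' V = h '' ball (m₀, a₀) r := fst_image_prod _ ⟨_, hξ⟩
  have dsol : ∀ b ∈ ball (m₀, a₀) r, ∀ (ξ : Fin 5 → ℝ) (v : Lift),
      fderiv ℝ (fun u' : Lift => sol u'.1) (h b, ξ) v = fderiv ℝ sol (h b) v.1 := by
    intro b hb ξ v
    have hd : DifferentiableAt ℝ sol (h b) := (hc.fderiv_sol (hbδ b hb)).1
    have e := hd.hasFDerivAt.comp ((h b, ξ) : Lift)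
      (ContinuousLinearMap.fst ℝ Jet (Fin 5 → ℝ)).hasFDerivAt
    exact congrArg (fun L => L v) e.fderiv
  have hVlift : V ⊆ S.lift := by
    intro u hu
    obtain ⟨b, hb, e, hu2⟩ := hV u hu
    have := (hVO b hb u.2 hu2).1
    rwa [e] at this
  have hVκ : ∀ u ∈ V, 0 < κ u * κ u₀ := by
    intro u hu
    obtain ⟨b, hb, e, hu2⟩ := hV u hu
    have := (hVO b hb u.2 hu2).2
    rwa [e] at this
  -- The factor κ has locally constant sign but may be negative. The sign is moved into the metric,
  -- whose signature (+,+,-,-) it does not change.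
  obtain ⟨c, hc1, hcκ⟩ : ∃ c : ℝ, c * c = 1 ∧ 0 < c * κ u₀ := by
    rcases lt_or_gt_of_ne (κ0 u₀ hu₀) with hκ | hκ
    · exact ⟨-1, by norm_num, by linarith⟩
    · exact ⟨1, by norm_num, by linarith⟩
  have hcV : ∀ u ∈ V, 0 < c * κ u := fun u hu => by
    have h1 := mul_pos (hVκ u hu) hcκ
    have h2 : κ u * κ u₀ * (c * κ u₀) = c * κ u * (κ u₀ * κ u₀) := by ring
    rw [h2] at h1
    exact (pos_iff_pos_of_mul_pos h1).2 (mul_self_pos.2 (κ0 u₀ hu₀))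
  let A₁ : (Fin 4 → ℝ) → ((Fin 4 → ℝ) →L[ℝ] ℝ) := fun a => (S.β₁ (slice m₀ a)).comp sliceLin
  let A₂ : (Fin 4 → ℝ) → ((Fin 4 → ℝ) →L[ℝ] ℝ) := fun a => (S.β₂ (slice m₀ a)).comp sliceLin
  let A₃ : (Fin 4 → ℝ) → ((Fin 4 → ℝ) →L[ℝ] ℝ) := fun a => (S.β₃ (slice m₀ a)).comp sliceLin
  let A₄ : (Fin 4 → ℝ) → ((Fin 4 → ℝ) →L[ℝ] ℝ) := fun a => (S.β₄ (slice m₀ a)).comp sliceLin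
  have hsN : ∀ a ∈ ball a₀ r, slice m₀ a ∈ S.dom := fun a ha => hsd a (haδ a ha)
  have sA₁ : ContDiffOn ℝ ∞ A₁ (ball a₀ r) :=
    (contDiffOn_comp_slice S.contDiffOn_β₁ hsN).clm_comp contDiffOn_const
  have sA₂ : ContDiffOn ℝ ∞ A₂ (ball a₀ r) :=
    (contDiffOn_comp_slice S.contDiffOn_β₂ hsN).clm_comp contDiffOn_const
  have sA₃ : ContDiffOn ℝ ∞ A₃ (ball a₀ r) :=
    (contDiffOn_comp_slice S.contDiffOn_β₃ hsN).clm_comp contDiffOn_const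
  have sA₄ : ContDiffOn ℝ ∞ A₄ (ball a₀ r) :=
    (contDiffOn_comp_slice S.contDiffOn_β₄ hsN).clm_comp contDiffOn_const
  let γ : (Fin 4 → ℝ) → ((Fin 4 → ℝ) →L[ℝ] (Fin 4 → ℝ) →L[ℝ] ℝ) := fun a =>
    c • ((A₁ a).smulRight (A₂ a) + (A₂ a).smulRight (A₁ a) + (A₃ a).smulRight (A₄ a)
      + (A₄ a).smulRight (A₃ a))
  have hγ : ∀ a α α', γ a α α' = c * (A₁ a α * A₂ a α' + A₂ a α * A₁ a α' + A₃ a α * A₄ a α'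
      + A₄ a α * A₃ a α') := fun a α α' => rfl
  have hγβ : ∀ a α α', γ a α α' = c * S.βform (slice m₀ a) (sliceLin α) (sliceLin α') :=
    fun a α α' => rfl
  -- The factors record, in turn, the passage from G to the β form, the growth of Q along the
  -- solution, and the ratio of the factors σ between Q and the β form at the two ends.
  let φ : Lift → ℝ := fun u => c * κ u * (En (h.symm u.1) * (S.fσ u.1
    * (S.fσ (slice m₀ (sol u.1)))⁻¹))
  refine ⟨V, ball m₀ r, ball a₀ r, fun m a => h (m, a) 2, sol, gen.isOpen_jets.prod isOpen_ball,
    ⟨⟨(m₀, a₀), mem_ball_self hr, hp₀⟩, hξ⟩, hVlift, ?_, ?_, ?_, ?_, ?_, γ, φ, ⟨?_, ?_⟩, ?_, ?_, ?_⟩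
  · rw [hfst]
    exact gen
  · ext a
    constructor
    · rintro ⟨u, hu, rfl⟩
      exact gen.sol_mem _ hu.1
    · intro ha
      have hb : (m₀, a) ∈ ball (m₀, a₀) r := mem.2 ⟨hm₀, ha⟩
      refine ⟨(h (m₀, a), u₀.2), ⟨mem_image_of_mem _ hb, hξ⟩, ?_⟩
      simp only [sol, inv _ hb]
  · rintro ⟨j, ξ⟩ ⟨⟨b, hb, rfl⟩, -⟩ α
    refine ⟨(fderiv ℝ h b (0, α), 0), ?_⟩
    rw [dsol b hb]
    exact (hc.fderiv_sol (hbδ b hb)).2.1 _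
  · rintro ⟨j, ξ⟩ hu v
    rw [hker _ (hVlift hu)]
    obtain ⟨⟨b, hb, rfl⟩, -⟩ := hu
    rw [dsol b hb]
    have hbd := hbδ b hb
    obtain ⟨-, e1, e2⟩ := hc.fderiv_sol hbd
    show (_ ∧ _) ↔ fderiv ℝ (fun j => (h.symm j).2) (h b) v.1 = 0
    rw [β_eq_zero_iff (hc.mem_dom b hbd)]
    constructor
    · intro hv
      rw [hv, ← hc.dx b hbd, ← hc.dy b hbd, map_add, map_smul, map_smul, e1, e1]
      simp
    · intro hv
      obtain ⟨y, hy⟩ := e2 v.1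
      rw [← hy, e1] at hv
      have h3 := hc.fderiv_apply hbd y
      rw [hv, show ((0 : ℝ × ℝ), (0 : Fin 4 → ℝ)) = 0 from rfl, map_zero, add_zero, hy] at h3
      have c0 : v.1 0 = y.1.1 := by rw [h3]; simp [vecDx, vecDy]
      have c1 : v.1 1 = y.1.2 := by rw [h3]; simp [vecDx, vecDy]
      rw [c0, c1]
      exact h3
  · intro a ha
    have hset : {u ∈ V | sol u.1 = a} =
        (fun z : (ℝ × ℝ) × (Fin 5 → ℝ) => ((h (z.1, a), z.2) : Lift)) ''
          (ball m₀ r ×ˢ ball u₀.2 r) := by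
      ext ⟨j, ξ⟩
      constructor
      · rintro ⟨⟨⟨b, hb, rfl⟩, hu2⟩, hs⟩
        simp only [sol, inv _ hb] at hs
        refine ⟨(b.1, ξ), ⟨(mem.1 hb).1, hu2⟩, ?_⟩
        simp only [← hs]
      · rintro ⟨⟨m, ξ'⟩, ⟨hm, hξ'⟩, e⟩
        have hb : (m, a) ∈ ball (m₀, a₀) r := mem.2 ⟨hm, ha⟩
        rw [← e]
        refine ⟨⟨mem_image_of_mem _ hb, hξ'⟩, ?_⟩
        simp only [sol, inv _ hb]
    rw [hset]
    have hconn : IsConnected (ball m₀ r ×ˢ ball u₀.2 r) :=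
      ((convex_ball m₀ r).isConnected ⟨m₀, hm₀⟩).prod ((convex_ball u₀.2 r).isConnected ⟨_, hξ⟩)
    refine hconn.image _ (ContinuousOn.prodMk ?_ continuous_snd.continuousOn)
    exact hc.smooth.continuousOn.comp (by fun_prop) fun z hz => hbδ _ (mem.2 ⟨hz.1, ha⟩)
  · exact ContDiffOn.const_smul c ((((sA₁.smulRight sA₂).add (sA₂.smulRight sA₁)).add
      (sA₃.smulRight sA₄)).add (sA₄.smulRight sA₃))
  · intro a ha
    refine ⟨fun α α' => ?_, ?_⟩
    · rw [hγ, hγ]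
      ring
    · have hA : ∀ α, A₁ a α = 0 → A₂ a α = 0 → A₃ a α = 0 → A₄ a α = 0 → α = 0 := by
        intro α h1 h2 h3 h4
        have e := (β_eq_zero_iff (hsN a ha) (sliceLin α)).1 ⟨h1, h2, h3, h4⟩
        rw [sliceLin_apply] at e
        simp only [Matrix.cons_val_zero, Matrix.cons_val_one, zero_smul, add_zero] at e
        ext i
        fin_cases i
        · exact congrFun e 2
        · exact congrFun e 3
        · exact congrFun e 4
        · exact congrFun e 5
      obtain ⟨e, he⟩ := exists_split_basis hA hc1
      exact ⟨e, fun i k => by rw [hγ, he]⟩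
  · have hmaps : ∀ u ∈ V, h.symm u.1 ∈ ball (m₀, a₀) r := by
      intro u hu
      obtain ⟨b, hb, e, -⟩ := hV u hu
      rw [← e, inv b hb]
      exact hb
    have s1 : ContDiffOn ℝ ∞ (fun u : Lift => h.symm u.1) V :=
      hc.smooth_symm.comp contDiffOn_fst fun u hu => by
        obtain ⟨b, hb, e, -⟩ := hV u hu
        rw [← e]
        exact h.map_source (hc.subset (hbδ b hb))
    have s2 : ContDiffOn ℝ ∞ (fun u : Lift => S.fσ (slice m₀ (sol u.1))) V :=
      (contDiffOn_comp_slice S.contDiffOn_fσ hsN).comp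
        (contDiff_snd.contDiffOn.comp s1 (mapsTo_univ _ _)) fun u hu => (mem.1 (hmaps u hu)).2
    refine (contDiffOn_const.mul (sκ.mono hVlift)).mul
      ((sE.comp s1 fun u hu => hbδ _ (hmaps u hu)).mul
        ((S.contDiffOn_fσ.comp contDiffOn_fst fun u hu => (hVlift hu).1).mul (s2.inv ?_)))
    exact fun u hu => (fσ_neg (hsN _ (mem.1 (hmaps u hu)).2)).ne
  · intro u hu
    obtain ⟨b, hb, e, -⟩ := hV u hu
    have n1 := fσ_neg (hVlift hu).1
    have n2 := fσ_neg (hsN _ (gen.sol_mem _ hu.1))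
    have e1 : 0 < En (h.symm u.1) := by
      rw [← e, inv b hb]
      exact hEpos b hb
    exact mul_pos (hcV u hu) (mul_pos e1 (mul_pos_of_neg_of_neg n1 (inv_lt_zero.2 n2)))
  · rintro ⟨j, ξ⟩ hu v v'
    rw [hG _ (hVlift hu)]
    obtain ⟨⟨⟨m, a⟩, hb, rfl⟩, -⟩ := hu
    obtain ⟨hm, ha⟩ := mem.1 hb
    have hbd := hbδ _ hb
    have hjd := hc.mem_dom _ hbd
    obtain ⟨-, e1, e2⟩ := hc.fderiv_sol hbd
    obtain ⟨y, hy⟩ := e2 v.1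
    obtain ⟨y', hy'⟩ := e2 v'.1
    have es : sol (h (m, a)) = a := by simp only [sol, inv _ hb]
    have hQ := hc.metricForm_eq h₁ h₂ hrδ ha (α' := α₀ a)
      (fun m' hm' => (hEpos (m', a) (mem.2 ⟨hm', ha⟩)).ne')
      (slice_normalized (hD a (haδ a ha))) hm
    -- D_x and D_y lie in the radical of the β form, so only the components along the parameters of
    -- the solution contribute.
    have hres : ∀ (y y' : (ℝ × ℝ) × (Fin 4 → ℝ)),
        S.βform (h (m, a)) (fderiv ℝ h (m, a) y) (fderiv ℝ h (m, a) y') =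
        S.βform (h (m, a)) (fderiv ℝ h (m, a) (0, y.2)) (fderiv ℝ h (m, a) (0, y'.2)) := by
      intro y y'
      obtain ⟨x1, x2, x3, x4⟩ := (β_eq_zero_iff hjd (vecDx S.R S.T (h (m, a)))).2
        (by simp [vecDx])
      obtain ⟨y1, y2, y3, y4⟩ := (β_eq_zero_iff hjd (vecDy S.R S.T (h (m, a)))).2
        (by simp [vecDy])
      rw [hc.fderiv_apply hbd y, hc.fderiv_apply hbd y']
      simp only [βform, map_add, map_smul, x1, x2, x3, x4, y1, y2, y3, y4, smul_zero, zero_add]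
    have hadd : fderiv ℝ h (m, a) (0, y.2) + fderiv ℝ h (m, a) (0, y'.2)
        = fderiv ℝ h (m, a) (0, y.2 + y'.2) := by
      rw [← map_add]
      simp
    have hn := (fσ_neg (hsN a ha)).ne
    rw [dsol _ hb, dsol _ hb]
    simp only [es, φ, inv _ hb]
    have ey : fderiv ℝ sol (h (m, a)) v.1 = y.2 := by rw [← hy]; exact e1 y
    have ey' : fderiv ℝ sol (h (m, a)) v'.1 = y'.2 := by rw [← hy']; exact e1 y'
    rw [ey, ey', ← hy, ← hy', hres, hγβ, βform_polar hjd, βform_polar (hsN a ha), hadd, ← map_add,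
      hQ (y.2 + y'.2), hQ y.2, hQ y'.2]
    have hi : (S.fσ (slice m₀ a))⁻¹ * S.fσ (slice m₀ a) = 1 := inv_mul_cancel₀ hn
    simp only [En]
    generalize S.metricForm (h (m, a), fderiv ℝ h (m, a) (0, α₀ a)) = X
    generalize S.metricForm (slice m₀ a, sliceLin (y.2 + y'.2)) = Q₁
    generalize S.metricForm (slice m₀ a, sliceLin y.2) = Q₂
    generalize S.metricForm (slice m₀ a, sliceLin y'.2) = Q₃
    generalize S.fσ (h (m, a)) = s
    generalize κ (h (m, a), ξ) = k
    linear_combination -(k * s * X * (Q₁ - Q₂ - Q₃)) * hc1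
      - k * s * X * (Q₁ - Q₂ - Q₃) * c * c * hi

end PDESystem

/-! ### Point transformations -/

namespace PDESystem

variable {S : PDESystem}

theorem pd_congr {F G : Jet → ℝ} (h : EqOn F G S.dom) {j : Jet} (hj : j ∈ S.dom) (i : Fin 6) :
    pd i F j = pd i G j :=
  lieD_congr (V := fun _ => Pi.single i 1) S.isOpen_dom h hj

theorem pd_mul {F G : Jet → ℝ} (hF : S.Sm F) (hG : S.Sm G) {j : Jet} (hj : j ∈ S.dom) (i : Fin 6) :
    pd i (fun j => F j * G j) j = pd i F j * G j + F j * pd i G j :=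
  lieD_mul (V := fun _ => Pi.single i 1) (hF.differentiableAt hj) (hG.differentiableAt hj)

theorem pd_mul_add_mul {F G H K : Jet → ℝ} (hF : S.Sm F) (hG : S.Sm G) (hH : S.Sm H) (hK : S.Sm K)
    {j : Jet} (hj : j ∈ S.dom) (i : Fin 6) :
    pd i (fun j => F j * G j + H j * K j) j =
      pd i F j * G j + F j * pd i G j + (pd i H j * K j + H j * pd i K j) := by
  rw [← pd_mul hF hG hj, ← pd_mul hH hK hj]
  exact lieD_add (V := fun _ => Pi.single i 1)
    ((hF.differentiableAt hj).mul (hG.differentiableAt hj))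
    ((hH.differentiableAt hj).mul (hK.differentiableAt hj))

theorem pd_eq_zero_of_eqOn {F : Jet → ℝ} (h : ∀ j ∈ S.dom, F j = 0) {j : Jet} (hj : j ∈ S.dom)
    (i : Fin 6) : pd i F j = 0 := by
  rw [pd_congr (G := fun _ => 0) h hj]
  simp [pd]

/-- The derivative of `D_x F` in a direction in which `F` is constant, where `F` does not depend on
`s`. -/
theorem pd_Dx {F : Jet → ℝ} (hF : S.Sm F) (h5 : ∀ j ∈ S.dom, pd 5 F j = 0) {i : Fin 6}
    (hi : ∀ j ∈ S.dom, pd i F j = 0) {j : Jet} (hj : j ∈ S.dom) :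
    pd i (S.Dx F) j = (Pi.single i 1 : Jet) 3 * pd 2 F j + pd i S.R j * pd 3 F j
      + (Pi.single i 1 : Jet) 5 * pd 4 F j := by
  have h2 := fderiv_lieD S.isOpen_dom S.smooth_vecDx hF hj (Pi.single i 1)
  have h3 : fderiv ℝ (pd i F) j (vecDx S.R S.T j) = 0 := by
    rw [fderiv_apply_eq_sum_pd]
    exact Finset.sum_eq_zero fun k _ => by rw [pd_eq_zero_of_eqOn hi hj, mul_zero]
  rw [S.fderiv_vecDx hj, S.fderiv_comm_pd hF hj, h3, zero_add] at h2
  refine Eq.trans h2 ?_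
  rw [fderiv_apply_eq_sum_pd]
  have h6 : fderiv ℝ F j (Pi.single 5 1) = 0 := h5 j hj
  simp [Fin.sum_univ_succ, pd, h6]
  ring

theorem pd_Dy {F : Jet → ℝ} (hF : S.Sm F) (h5 : ∀ j ∈ S.dom, pd 5 F j = 0) {i : Fin 6}
    (hi : ∀ j ∈ S.dom, pd i F j = 0) {j : Jet} (hj : j ∈ S.dom) :
    pd i (S.Dy F) j = (Pi.single i 1 : Jet) 4 * pd 2 F j + (Pi.single i 1 : Jet) 5 * pd 3 F j
      + pd i S.T j * pd 4 F j := by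
  have h2 := fderiv_lieD S.isOpen_dom S.smooth_vecDy hF hj (Pi.single i 1)
  have h3 : fderiv ℝ (pd i F) j (vecDy S.R S.T j) = 0 := by
    rw [fderiv_apply_eq_sum_pd]
    exact Finset.sum_eq_zero fun k _ => by rw [pd_eq_zero_of_eqOn hi hj, mul_zero]
  rw [S.fderiv_vecDy hj, S.fderiv_comm_pd hF hj, h3, zero_add] at h2
  refine Eq.trans h2 ?_
  rw [fderiv_apply_eq_sum_pd]
  have h6 : fderiv ℝ F j (Pi.single 5 1) = 0 := h5 j hj
  simp [Fin.sum_univ_succ, pd, h6]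
  ring

/-- A function which depends only on the base point has vanishing derivatives along the fibres. -/
theorem pd_eq_zero_of_basePoint {F : Jet → ℝ} (hF : S.Sm F)
    (h : ∀ j ∈ S.dom, ∀ j' ∈ S.dom, basePoint j = basePoint j' → F j = F j') {j : Jet}
    (hj : j ∈ S.dom) {i : Fin 6} (hi : 3 ≤ i) : pd i F j = 0 := by
  have hl : HasDerivAt (fun t : ℝ => j + t • (Pi.single i 1 : Jet)) (Pi.single i 1) 0 := by
    simpa using ((hasDerivAt_id (0 : ℝ)).smul_const (Pi.single i 1 : Jet)).const_add j
  have hd : HasFDerivAt F (fderiv ℝ F j) (j + (0 : ℝ) • (Pi.single i 1 : Jet)) := by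
    rw [zero_smul, add_zero]
    exact (hF.differentiableAt hj).hasFDerivAt
  have h1 := hd.comp_hasDerivAt (0 : ℝ) hl
  have h2 : (F ∘ fun t : ℝ => j + t • (Pi.single i 1 : Jet)) =ᶠ[nhds 0] fun _ => F j := by
    have ho : ∀ᶠ t : ℝ in nhds 0, j + t • (Pi.single i 1 : Jet) ∈ S.dom := by
      refine hl.continuousAt.eventually (S.isOpen_dom.mem_nhds ?_)
      simpa using hj
    filter_upwards [ho] with t ht
    refine h _ ht _ hj ?_
    have h0 : (0 : Fin 6) ≠ i := by rintro rfl; exact absurd hi (by decide)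
    have h1 : (1 : Fin 6) ≠ i := by rintro rfl; exact absurd hi (by decide)
    have h2 : (2 : Fin 6) ≠ i := by rintro rfl; exact absurd hi (by decide)
    simp [basePoint, h0, h1, h2]
  exact h1.unique ((hasDerivAt_const (0 : ℝ) (F j)).congr_of_eventuallyEq h2)

end PDESystem

namespace PointEquivalence

open PDESystem

variable {S S' : PDESystem} (Φ : PointEquivalence S S')

theorem sm_comp (i : Fin 6) : S.Sm fun j => Φ.toFun j i := contDiffOn_pi.1 Φ.smooth_toFun i

theorem differentiableAt_toFun {j : Jet} (hj : j ∈ S.dom) : DifferentiableAt ℝ Φ.toFun j :=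
  (Φ.smooth_toFun.contDiffAt (S.isOpen_dom.mem_nhds hj)).differentiableAt (by simp)

theorem pd_base {j : Jet} (hj : j ∈ S.dom) {i k : Fin 6} (hi : 3 ≤ i) (hk : k < 3) :
    pd i (fun j => Φ.toFun j k) j = 0 := by
  refine pd_eq_zero_of_basePoint (Φ.sm_comp k) (fun a ha b hb e => ?_) hj hi
  have h1 : basePoint (Φ.toFun a) = basePoint (Φ.toFun b) := by
    rw [Φ.base_toFun a ha, Φ.base_toFun b hb, e]
  obtain ⟨l, rfl⟩ : ∃ l : Fin 3, k = Fin.castLE (by norm_num) l := ⟨⟨k, hk⟩, rfl⟩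
  have h2 := congrFun h1 l
  fin_cases l <;> simpa [basePoint] using h2

theorem pd_baseInv {j : Jet} (hj : j ∈ S'.dom) {i k : Fin 6} (hi : 3 ≤ i) (hk : k < 3) :
    pd i (fun j => Φ.invFun j k) j = 0 := by
  refine pd_eq_zero_of_basePoint (contDiffOn_pi.1 Φ.smooth_invFun k) (fun a ha b hb e => ?_) hj hi
  have h1 : basePoint (Φ.invFun a) = basePoint (Φ.invFun b) := by
    rw [Φ.base_invFun a ha, Φ.base_invFun b hb, e]
  obtain ⟨l, rfl⟩ : ∃ l : Fin 3, k = Fin.castLE (by norm_num) l := ⟨⟨k, hk⟩, rfl⟩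
  have h2 := congrFun h1 l
  fin_cases l <;> simpa [basePoint] using h2

theorem fderiv_inv {j : Jet} (hj : j ∈ S.dom) (v : Jet) :
    fderiv ℝ Φ.invFun (Φ.toFun j) (fderiv ℝ Φ.toFun j v) = v := by
  have hd : DifferentiableAt ℝ Φ.invFun (Φ.toFun j) :=
    (Φ.smooth_invFun.contDiffAt (S'.isOpen_dom.mem_nhds (Φ.mapsTo hj))).differentiableAt (by simp)
  have h1 := hd.hasFDerivAt.comp j (Φ.differentiableAt_toFun hj).hasFDerivAt
  have h2 : (Φ.invFun ∘ Φ.toFun) =ᶠ[nhds j] id := by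
    filter_upwards [S.isOpen_dom.mem_nhds hj] with y hy
    exact Φ.left_inv hy
  exact congrArg (fun L : Jet →L[ℝ] Jet => L v) (h1.unique ((hasFDerivAt_id j).congr_of_eventuallyEq h2))

theorem fderiv_toFun_apply {j : Jet} (hj : j ∈ S.dom) (v : Jet) (i : Fin 6) :
    fderiv ℝ Φ.toFun j v i = fderiv ℝ (fun j => Φ.toFun j i) j v :=
  fderiv_pi_apply (Φ.differentiableAt_toFun hj) v i

/-- The chain rule for the prolonged transformation. -/
theorem Dx_comp {j : Jet} (hj : j ∈ S.dom) :
    S.Dx (fun j => Φ.toFun j 2) j = Φ.toFun j 3 * S.Dx (fun j => Φ.toFun j 0) j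
      + Φ.toFun j 4 * S.Dx (fun j => Φ.toFun j 1) j ∧
    S.Dx (fun j => Φ.toFun j 3) j = S'.R (Φ.toFun j) * S.Dx (fun j => Φ.toFun j 0) j
      + Φ.toFun j 5 * S.Dx (fun j => Φ.toFun j 1) j ∧
    S.Dx (fun j => Φ.toFun j 4) j = Φ.toFun j 5 * S.Dx (fun j => Φ.toFun j 0) j
      + S'.T (Φ.toFun j) * S.Dx (fun j => Φ.toFun j 1) j := by
  obtain ⟨h0, h1, h2⟩ := Φ.prolongs_x j hj
  rw [lamForm_apply] at h0
  rw [nu_zero_apply] at h1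
  rw [nu_one_apply] at h2
  simp only [Φ.fderiv_toFun_apply hj] at h0 h1 h2
  simp only [Dx, opDx]
  exact ⟨by linarith, by linarith, by linarith⟩

theorem Dy_comp {j : Jet} (hj : j ∈ S.dom) :
    S.Dy (fun j => Φ.toFun j 2) j = Φ.toFun j 3 * S.Dy (fun j => Φ.toFun j 0) j
      + Φ.toFun j 4 * S.Dy (fun j => Φ.toFun j 1) j ∧
    S.Dy (fun j => Φ.toFun j 3) j = S'.R (Φ.toFun j) * S.Dy (fun j => Φ.toFun j 0) j
      + Φ.toFun j 5 * S.Dy (fun j => Φ.toFun j 1) j ∧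
    S.Dy (fun j => Φ.toFun j 4) j = Φ.toFun j 5 * S.Dy (fun j => Φ.toFun j 0) j
      + S'.T (Φ.toFun j) * S.Dy (fun j => Φ.toFun j 1) j := by
  obtain ⟨h0, h1, h2⟩ := Φ.prolongs_y j hj
  rw [lamForm_apply] at h0
  rw [nu_zero_apply] at h1
  rw [nu_one_apply] at h2
  simp only [Φ.fderiv_toFun_apply hj] at h0 h1 h2
  simp only [Dy, opDy]
  exact ⟨by linarith, by linarith, by linarith⟩

/-- A vector which is mapped to a multiple of `∂_s` is vertical. -/
theorem eq_zero_of_fderiv_eq {j : Jet} (hj : j ∈ S.dom) {v : Jet}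
    (h : ∀ i : Fin 6, i ≠ 5 → fderiv ℝ Φ.toFun j v i = 0) {k : Fin 6} (hk : k < 3) : v k = 0 := by
  have h1 : fderiv ℝ Φ.toFun j v = fderiv ℝ Φ.toFun j v 5 • Pi.single 5 1 := by
    ext i
    by_cases hi : i = 5
    · subst hi
      simp
    · simp [h i hi, hi]
  have h2 := Φ.fderiv_inv hj v
  have hd : DifferentiableAt ℝ Φ.invFun (Φ.toFun j) :=
    (Φ.smooth_invFun.contDiffAt (S'.isOpen_dom.mem_nhds (Φ.mapsTo hj))).differentiableAt (by simp)
  have h3 := Φ.pd_baseInv (Φ.mapsTo hj) (i := 5) (by decide) hk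
  rw [← h2, h1, map_smul, Pi.smul_apply, fderiv_pi_apply hd]
  rw [pd] at h3
  rw [h3, smul_zero]

/-- If a combination of D_x and D_y has an image without x̄ and ȳ components, the contact relations
leave only a multiple of ∂_s̄. The inverse transformation also covers a map of base points, so it
returns a vector with no x and y components, and the combination was zero. -/
theorem det_ne_zero {j : Jet} (hj : j ∈ S.dom) :
    S.Dx (fun j => Φ.toFun j 0) j * S.Dy (fun j => Φ.toFun j 1) j
      - S.Dx (fun j => Φ.toFun j 1) j * S.Dy (fun j => Φ.toFun j 0) j ≠ 0 := by
  intro h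
  obtain ⟨x2, x3, x4⟩ := Φ.Dx_comp hj
  obtain ⟨y2, y3, y4⟩ := Φ.Dy_comp hj
  have key : ∀ α β : ℝ, α * S.Dx (fun j => Φ.toFun j 0) j + β * S.Dy (fun j => Φ.toFun j 0) j = 0 →
      α * S.Dx (fun j => Φ.toFun j 1) j + β * S.Dy (fun j => Φ.toFun j 1) j = 0 → α = 0 ∧ β = 0 := by
    intro α β h0 h1
    have hv : ∀ i, fderiv ℝ Φ.toFun j (α • vecDx S.R S.T j + β • vecDy S.R S.T j) i
        = α * S.Dx (fun j => Φ.toFun j i) j + β * S.Dy (fun j => Φ.toFun j i) j := fun i => by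
      rw [Φ.fderiv_toFun_apply hj, map_add, map_smul, map_smul]
      rfl
    have hz : ∀ i : Fin 6, i ≠ 5 →
        fderiv ℝ Φ.toFun j (α • vecDx S.R S.T j + β • vecDy S.R S.T j) i = 0 := by
      intro i hi
      rw [hv]
      fin_cases i
      · exact h0
      · exact h1
      · show α * S.Dx (fun j => Φ.toFun j 2) j + β * S.Dy (fun j => Φ.toFun j 2) j = 0
        linear_combination α * x2 + β * y2 + Φ.toFun j 3 * h0 + Φ.toFun j 4 * h1
      · show α * S.Dx (fun j => Φ.toFun j 3) j + β * S.Dy (fun j => Φ.toFun j 3) j = 0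
        linear_combination α * x3 + β * y3 + S'.R (Φ.toFun j) * h0 + Φ.toFun j 5 * h1
      · show α * S.Dx (fun j => Φ.toFun j 4) j + β * S.Dy (fun j => Φ.toFun j 4) j = 0
        linear_combination α * x4 + β * y4 + Φ.toFun j 5 * h0 + S'.T (Φ.toFun j) * h1
      · exact absurd rfl hi
    have e0 := Φ.eq_zero_of_fderiv_eq hj hz (k := 0) (by decide)
    have e1 := Φ.eq_zero_of_fderiv_eq hj hz (k := 1) (by decide)
    simp [vecDx, vecDy] at e0 e1
    exact ⟨e0, e1⟩
  obtain ⟨a1, b1⟩ := key (S.Dy (fun j => Φ.toFun j 0) j) (-S.Dx (fun j => Φ.toFun j 0) j)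
    (by ring) (by linarith)
  obtain ⟨a2, b2⟩ := key (S.Dy (fun j => Φ.toFun j 1) j) (-S.Dx (fun j => Φ.toFun j 1) j)
    (by linarith) (by ring)
  obtain ⟨a3, -⟩ := key 1 0 (by linarith) (by linarith)
  exact one_ne_zero a3

/-- Total derivatives of functions of (x, y, z) do not involve s. Differentiating D_x z̄ = p̄ D_x x̄
+ q̄ D_x ȳ and its D_y counterpart in s gives a homogeneous linear system for ∂_s p̄ and ∂_s q̄ with
nonzero determinant. -/
theorem pd_five_momentum {j : Jet} (hj : j ∈ S.dom) :
    pd 5 (fun j => Φ.toFun j 3) j = 0 ∧ pd 5 (fun j => Φ.toFun j 4) j = 0 := by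
  have hb : ∀ {i : Fin 6}, 3 ≤ i → ∀ {k : Fin 6}, k < 3 → ∀ j ∈ S.dom,
      pd i (fun j => Φ.toFun j k) j = 0 := fun hi _ hk j hj => Φ.pd_base hj hi hk
  have s := Φ.sm_comp
  have D : ∀ {k : Fin 6}, k < 3 → pd 5 (S.Dx fun j => Φ.toFun j k) j = 0 ∧
      pd 5 (S.Dy fun j => Φ.toFun j k) j = 0 := fun {k} hk => by
    have h5 := hb (i := 5) (by decide) hk
    rw [pd_Dx (s k) h5 h5 hj, pd_Dy (s k) h5 h5 hj, hb (i := 3) (by decide) hk j hj,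
      hb (i := 4) (by decide) hk j hj]
    simp
  have e1 := pd_congr (S := S) (fun j hj => (Φ.Dx_comp hj).1) hj 5
  have e2 := pd_congr (S := S) (fun j hj => (Φ.Dy_comp hj).1) hj 5
  have e1 : pd 5 (S.Dx fun j => Φ.toFun j 2) j = _ := e1
  have e2 : pd 5 (S.Dy fun j => Φ.toFun j 2) j = _ := e2
  rw [pd_mul_add_mul (s 3) (s 0).Dx (s 4) (s 1).Dx hj, (D (k := 2) (by decide)).1,
    (D (k := 0) (by decide)).1, (D (k := 1) (by decide)).1] at e1
  rw [pd_mul_add_mul (s 3) (s 0).Dy (s 4) (s 1).Dy hj, (D (k := 2) (by decide)).2,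
    (D (k := 0) (by decide)).2, (D (k := 1) (by decide)).2] at e2
  have hd := Φ.det_ne_zero hj
  constructor
  · refine (mul_eq_zero.1 ?_).resolve_right hd
    linear_combination -S.Dy (fun j => Φ.toFun j 1) j * e1 + S.Dx (fun j => Φ.toFun j 1) j * e2
  · refine (mul_eq_zero.1 ?_).resolve_right hd
    linear_combination S.Dy (fun j => Φ.toFun j 0) j * e1 - S.Dx (fun j => Φ.toFun j 0) j * e2

theorem fderiv_toFun_single {j : Jet} (hj : j ∈ S.dom) :
    fderiv ℝ Φ.toFun j (Pi.single 5 1) = pd 5 (fun j => Φ.toFun j 5) j • Pi.single 5 1 := by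
  have h : ∀ i, fderiv ℝ Φ.toFun j (Pi.single 5 1) i = pd 5 (fun j => Φ.toFun j i) j := fun i =>
    Φ.fderiv_toFun_apply hj _ i
  ext i
  rw [h]
  fin_cases i
  · simpa using Φ.pd_base hj (i := 5) (k := 0) (by decide) (by decide)
  · simpa using Φ.pd_base hj (i := 5) (k := 1) (by decide) (by decide)
  · simpa using Φ.pd_base hj (i := 5) (k := 2) (by decide) (by decide)
  · simpa using (Φ.pd_five_momentum hj).1
  · simpa using (Φ.pd_five_momentum hj).2
  · simp

theorem pd_five_ne_zero {j : Jet} (hj : j ∈ S.dom) : pd 5 (fun j => Φ.toFun j 5) j ≠ 0 := by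
  intro h
  have h1 := Φ.fderiv_inv hj (Pi.single 5 1)
  rw [Φ.fderiv_toFun_single hj, h, zero_smul, map_zero] at h1
  simpa using congrFun h1 5

theorem pd_five_pullback {F : Jet → ℝ} (hF : S'.Sm F) {j : Jet} (hj : j ∈ S.dom) :
    pd 5 (fun j => F (Φ.toFun j)) j = pd 5 F (Φ.toFun j) * pd 5 (fun j => Φ.toFun j 5) j := by
  have h := (hF.differentiableAt (Φ.mapsTo hj)).hasFDerivAt.comp j
    (Φ.differentiableAt_toFun hj).hasFDerivAt
  have h2 : pd 5 (fun j => F (Φ.toFun j)) j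
      = fderiv ℝ F (Φ.toFun j) (fderiv ℝ Φ.toFun j (Pi.single 5 1)) :=
    congrArg (fun L : Jet →L[ℝ] ℝ => L (Pi.single 5 1)) h.fderiv
  rw [h2, Φ.fderiv_toFun_single hj, map_smul, smul_eq_mul, mul_comm]
  rfl

theorem sm_pullback {F : Jet → ℝ} (hF : S'.Sm F) : S.Sm fun j => F (Φ.toFun j) :=
  hF.comp Φ.smooth_toFun Φ.mapsTo

/-- `D_x x̄`. -/
noncomputable def X₁ : Jet → ℝ := S.Dx fun j => Φ.toFun j 0

/-- `D_x ȳ`. -/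
noncomputable def X₂ : Jet → ℝ := S.Dx fun j => Φ.toFun j 1

/-- `D_y x̄`. -/
noncomputable def Y₁ : Jet → ℝ := S.Dy fun j => Φ.toFun j 0

/-- `D_y ȳ`. -/
noncomputable def Y₂ : Jet → ℝ := S.Dy fun j => Φ.toFun j 1

theorem sm_X₁ : S.Sm Φ.X₁ := (Φ.sm_comp 0).Dx

theorem sm_X₂ : S.Sm Φ.X₂ := (Φ.sm_comp 1).Dx

theorem sm_Y₁ : S.Sm Φ.Y₁ := (Φ.sm_comp 0).Dy

theorem sm_Y₂ : S.Sm Φ.Y₂ := (Φ.sm_comp 1).Dy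

theorem pd_five_X {j : Jet} (hj : j ∈ S.dom) :
    pd 5 Φ.X₁ j = 0 ∧ pd 5 Φ.X₂ j = 0 ∧ pd 5 Φ.Y₁ j = 0 ∧ pd 5 Φ.Y₂ j = 0 := by
  have hb : ∀ {i : Fin 6}, 3 ≤ i → ∀ {k : Fin 6}, k < 3 → ∀ j ∈ S.dom,
      pd i (fun j => Φ.toFun j k) j = 0 := fun hi _ hk j hj => Φ.pd_base hj hi hk
  have D : ∀ {k : Fin 6}, k < 3 → pd 5 (S.Dx fun j => Φ.toFun j k) j = 0 ∧
      pd 5 (S.Dy fun j => Φ.toFun j k) j = 0 := fun {k} hk => by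
    have h5 := hb (i := 5) (by decide) hk
    rw [pd_Dx (Φ.sm_comp k) h5 h5 hj, pd_Dy (Φ.sm_comp k) h5 h5 hj,
      hb (i := 3) (by decide) hk j hj, hb (i := 4) (by decide) hk j hj]
    simp
  exact ⟨(D (k := 0) (by decide)).1, (D (k := 1) (by decide)).1, (D (k := 0) (by decide)).2,
    (D (k := 1) (by decide)).2⟩

/-- The matrix of derivatives of the transformed momenta is a multiple of the inverse transpose of
the matrix of total derivatives of the transformed independent variables. -/
theorem momentum_relations {j : Jet} (hj : j ∈ S.dom) : ∃ c : ℝ,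
    pd 3 (fun j => Φ.toFun j 3) j * Φ.X₁ j + pd 3 (fun j => Φ.toFun j 4) j * Φ.X₂ j = c ∧
    pd 4 (fun j => Φ.toFun j 3) j * Φ.X₁ j + pd 4 (fun j => Φ.toFun j 4) j * Φ.X₂ j = 0 ∧
    pd 3 (fun j => Φ.toFun j 3) j * Φ.Y₁ j + pd 3 (fun j => Φ.toFun j 4) j * Φ.Y₂ j = 0 ∧
    pd 4 (fun j => Φ.toFun j 3) j * Φ.Y₁ j + pd 4 (fun j => Φ.toFun j 4) j * Φ.Y₂ j = c := by
  have hb : ∀ {i : Fin 6}, 3 ≤ i → ∀ {k : Fin 6}, k < 3 → ∀ j ∈ S.dom,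
      pd i (fun j => Φ.toFun j k) j = 0 := fun hi _ hk j hj => Φ.pd_base hj hi hk
  have s := Φ.sm_comp
  have D3 : ∀ {k : Fin 6}, k < 3 →
      pd 3 (S.Dx fun j => Φ.toFun j k) j = pd 2 (fun j => Φ.toFun j k) j ∧
      pd 3 (S.Dy fun j => Φ.toFun j k) j = 0 := fun {k} hk => by
    have h5 := hb (i := 5) (by decide) hk
    have h3 := hb (i := 3) (by decide) hk
    rw [pd_Dx (s k) h5 h3 hj, pd_Dy (s k) h5 h3 hj, h3 j hj, hb (i := 4) (by decide) hk j hj]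
    simp
  have D4 : ∀ {k : Fin 6}, k < 3 → pd 4 (S.Dx fun j => Φ.toFun j k) j = 0 ∧
      pd 4 (S.Dy fun j => Φ.toFun j k) j = pd 2 (fun j => Φ.toFun j k) j := fun {k} hk => by
    have h5 := hb (i := 5) (by decide) hk
    have h4 := hb (i := 4) (by decide) hk
    rw [pd_Dx (s k) h5 h4 hj, pd_Dy (s k) h5 h4 hj, h4 j hj, hb (i := 3) (by decide) hk j hj]
    simp
  have e1 : ∀ i, pd i (S.Dx fun j => Φ.toFun j 2) j = _ := fun i =>
    (pd_congr (S := S) (fun j hj => (Φ.Dx_comp hj).1) hj i).trans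
      (pd_mul_add_mul (s 3) (s 0).Dx (s 4) (s 1).Dx hj i)
  have e2 : ∀ i, pd i (S.Dy fun j => Φ.toFun j 2) j = _ := fun i =>
    (pd_congr (S := S) (fun j hj => (Φ.Dy_comp hj).1) hj i).trans
      (pd_mul_add_mul (s 3) (s 0).Dy (s 4) (s 1).Dy hj i)
  have f1 := e1 3
  have f2 := e1 4
  have f3 := e2 3
  have f4 := e2 4
  rw [(D3 (k := 2) (by decide)).1, (D3 (k := 0) (by decide)).1, (D3 (k := 1) (by decide)).1] at f1
  rw [(D4 (k := 2) (by decide)).1, (D4 (k := 0) (by decide)).1, (D4 (k := 1) (by decide)).1] at f2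
  rw [(D3 (k := 2) (by decide)).2, (D3 (k := 0) (by decide)).2, (D3 (k := 1) (by decide)).2] at f3
  rw [(D4 (k := 2) (by decide)).2, (D4 (k := 0) (by decide)).2, (D4 (k := 1) (by decide)).2] at f4
  -- The factor is z̄_z - p̄ x̄_z - q̄ ȳ_z, by which the contact form λ is multiplied.
  refine ⟨pd 2 (fun j => Φ.toFun j 2) j - Φ.toFun j 3 * pd 2 (fun j => Φ.toFun j 0) j
    - Φ.toFun j 4 * pd 2 (fun j => Φ.toFun j 1) j, ?_, ?_, ?_, ?_⟩ <;>
    simp only [X₁, X₂, Y₁, Y₂] <;> linarith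

/-- The first derivatives in `s` of the prolongation formulas. -/
theorem first_order {j : Jet} (hj : j ∈ S.dom) :
    S.Rs j * pd 3 (fun j => Φ.toFun j 3) j + 1 * pd 4 (fun j => Φ.toFun j 3) j
      = S'.Rs (Φ.toFun j) * (pd 5 (fun j => Φ.toFun j 5) j * Φ.X₁ j)
        + pd 5 (fun j => Φ.toFun j 5) j * Φ.X₂ j ∧
    S.Rs j * pd 3 (fun j => Φ.toFun j 4) j + 1 * pd 4 (fun j => Φ.toFun j 4) j
      = S'.Ts (Φ.toFun j) * (pd 5 (fun j => Φ.toFun j 5) j * Φ.X₂ j)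
        + pd 5 (fun j => Φ.toFun j 5) j * Φ.X₁ j ∧
    S.Ts j * pd 4 (fun j => Φ.toFun j 3) j + 1 * pd 3 (fun j => Φ.toFun j 3) j
      = S'.Rs (Φ.toFun j) * (pd 5 (fun j => Φ.toFun j 5) j * Φ.Y₁ j)
        + pd 5 (fun j => Φ.toFun j 5) j * Φ.Y₂ j ∧
    S.Ts j * pd 4 (fun j => Φ.toFun j 4) j + 1 * pd 3 (fun j => Φ.toFun j 4) j
      = S'.Ts (Φ.toFun j) * (pd 5 (fun j => Φ.toFun j 5) j * Φ.Y₂ j)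
        + pd 5 (fun j => Φ.toFun j 5) j * Φ.Y₁ j := by
  have s := Φ.sm_comp
  have p3 : ∀ j ∈ S.dom, pd 5 (fun j => Φ.toFun j 3) j = 0 := fun j hj => (Φ.pd_five_momentum hj).1
  have p4 : ∀ j ∈ S.dom, pd 5 (fun j => Φ.toFun j 4) j = 0 := fun j hj => (Φ.pd_five_momentum hj).2
  have sR := Φ.sm_pullback S'.sm_R
  have sT := Φ.sm_pullback S'.sm_T
  have dR := Φ.pd_five_pullback S'.sm_R hj
  have dT := Φ.pd_five_pullback S'.sm_T hj
  obtain ⟨z1, z2, z3, z4⟩ := Φ.pd_five_X hj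
  have a1 := (pd_congr (S := S) (fun j hj => (Φ.Dx_comp hj).2.1) hj 5).symm.trans
    (pd_Dx (s 3) p3 p3 hj)
  have a2 := (pd_congr (S := S) (fun j hj => (Φ.Dx_comp hj).2.2) hj 5).symm.trans
    (pd_Dx (s 4) p4 p4 hj)
  have a3 := (pd_congr (S := S) (fun j hj => (Φ.Dy_comp hj).2.1) hj 5).symm.trans
    (pd_Dy (s 3) p3 p3 hj)
  have a4 := (pd_congr (S := S) (fun j hj => (Φ.Dy_comp hj).2.2) hj 5).symm.trans
    (pd_Dy (s 4) p4 p4 hj)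
  have b1 := (pd_mul_add_mul sR Φ.sm_X₁ (s 5) Φ.sm_X₂ hj 5).symm.trans a1
  have b2 := (pd_mul_add_mul (s 5) Φ.sm_X₁ sT Φ.sm_X₂ hj 5).symm.trans a2
  have b3 := (pd_mul_add_mul sR Φ.sm_Y₁ (s 5) Φ.sm_Y₂ hj 5).symm.trans a3
  have b4 := (pd_mul_add_mul (s 5) Φ.sm_Y₁ sT Φ.sm_Y₂ hj 5).symm.trans a4
  rw [dR, z1, z2] at b1
  rw [dT, z1, z2] at b2
  rw [dR, z3, z4] at b3
  rw [dT, z3, z4] at b4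
  simp only [Pi.single_eq_same, Pi.single_eq_of_ne (show (3 : Fin 6) ≠ 5 by decide),
    Pi.single_eq_of_ne (show (4 : Fin 6) ≠ 5 by decide)] at b1 b2 b3 b4
  simp only [Rs, Ts]
  exact ⟨by linarith, by linarith, by linarith, by linarith⟩

/-- One more s-derivative of `first_order`. The derivatives of p̄, q̄ in p, q and the total
derivatives of x̄, ȳ are independent of s, so only R_s, T_s, their transformed counterparts and ∂_s
s̄ contribute; τ is ∂_s² s̄. -/
theorem second_order {j : Jet} (hj : j ∈ S.dom) : ∃ τ : ℝ,
    S.Rss j * pd 3 (fun j => Φ.toFun j 3) j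
      = S'.Rss (Φ.toFun j) * pd 5 (fun j => Φ.toFun j 5) j ^ 2 * Φ.X₁ j
        + τ * (S'.Rs (Φ.toFun j) * Φ.X₁ j + Φ.X₂ j) ∧
    S.Rss j * pd 3 (fun j => Φ.toFun j 4) j
      = S'.Tss (Φ.toFun j) * pd 5 (fun j => Φ.toFun j 5) j ^ 2 * Φ.X₂ j
        + τ * (S'.Ts (Φ.toFun j) * Φ.X₂ j + Φ.X₁ j) ∧
    S.Tss j * pd 4 (fun j => Φ.toFun j 3) j
      = S'.Rss (Φ.toFun j) * pd 5 (fun j => Φ.toFun j 5) j ^ 2 * Φ.Y₁ j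
        + τ * (S'.Rs (Φ.toFun j) * Φ.Y₁ j + Φ.Y₂ j) ∧
    S.Tss j * pd 4 (fun j => Φ.toFun j 4) j
      = S'.Tss (Φ.toFun j) * pd 5 (fun j => Φ.toFun j 5) j ^ 2 * Φ.Y₂ j
        + τ * (S'.Ts (Φ.toFun j) * Φ.Y₂ j + Φ.Y₁ j) := by
  have s := Φ.sm_comp
  have p3 : ∀ j ∈ S.dom, pd 5 (fun j => Φ.toFun j 3) j = 0 := fun j hj => (Φ.pd_five_momentum hj).1
  have p4 : ∀ j ∈ S.dom, pd 5 (fun j => Φ.toFun j 4) j = 0 := fun j hj => (Φ.pd_five_momentum hj).2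
  have hc : ∀ {F : Jet → ℝ}, S.Sm F → (∀ j ∈ S.dom, pd 5 F j = 0) → ∀ i,
      pd 5 (pd i F) j = 0 := fun {F} hF h i => by
    show fderiv ℝ (pd i F) j (Pi.single 5 1) = 0
    rw [S.fderiv_pd hF hj, S.fderiv_comm_pd hF hj]
    exact pd_eq_zero_of_eqOn h hj i
  have c1 : S.Sm fun _ => (1 : ℝ) := contDiffOn_const
  have d1 : pd 5 (fun _ : Jet => (1 : ℝ)) j = 0 := by simp [pd]
  have sR := Φ.sm_pullback (S'.sm_R.pd 5)
  have sT := Φ.sm_pullback (S'.sm_T.pd 5)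
  have dR : pd 5 (fun j => S'.Rs (Φ.toFun j)) j = _ := Φ.pd_five_pullback (S'.sm_R.pd 5) hj
  have dT : pd 5 (fun j => S'.Ts (Φ.toFun j)) j = _ := Φ.pd_five_pullback (S'.sm_T.pd 5) hj
  have s5 : S.Sm fun j => pd 5 (fun j => Φ.toFun j 5) j := (s 5).pd 5
  obtain ⟨z1, z2, z3, z4⟩ := Φ.pd_five_X hj
  -- The factors `1 *` in `first_order` give each left side the shape F G + H K, so one product rule
  -- covers both sides.
  have hL : ∀ {F G H : Jet → ℝ}, S.Sm F → S.Sm G → S.Sm H → (∀ j ∈ S.dom, pd 5 G j = 0) →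
      (∀ j ∈ S.dom, pd 5 H j = 0) → ∀ i k,
      pd 5 (fun j => F j * pd i G j + 1 * pd k H j) j = pd 5 F j * pd i G j := by
    intro F G H hF hG hH h1 h2 i k
    rw [pd_mul_add_mul hF (hG.pd i) c1 (hH.pd k) hj, hc hG h1, hc hH h2, d1]
    ring
  have hR : ∀ {F G H : Jet → ℝ}, S.Sm F → S.Sm G → S.Sm H → pd 5 G j = 0 → pd 5 H j = 0 →
      pd 5 (fun y => F y * (pd 5 (fun j => Φ.toFun j 5) y * G y)
        + pd 5 (fun j => Φ.toFun j 5) y * H y) j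
      = pd 5 F j * (pd 5 (fun j => Φ.toFun j 5) j * G j)
        + pd 5 (fun y => pd 5 (fun j => Φ.toFun j 5) y) j * (F j * G j + H j) := by
    intro F G H hF hG hH h1 h2
    rw [pd_mul_add_mul hF (s5.mul hG) s5 hH hj, pd_mul s5 hG hj, h1, h2]
    ring
  have a1 := pd_congr (S := S) (fun j hj => (Φ.first_order hj).1) hj 5
  have a2 := pd_congr (S := S) (fun j hj => (Φ.first_order hj).2.1) hj 5
  have a3 := pd_congr (S := S) (fun j hj => (Φ.first_order hj).2.2.1) hj 5
  have a4 := pd_congr (S := S) (fun j hj => (Φ.first_order hj).2.2.2) hj 5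
  have b1 := (hL (S.sm_R.pd 5) (s 3) (s 3) p3 p3 3 4).symm.trans
    (a1.trans (hR sR Φ.sm_X₁ Φ.sm_X₂ z1 z2))
  have b2 := (hL (S.sm_R.pd 5) (s 4) (s 4) p4 p4 3 4).symm.trans
    (a2.trans (hR sT Φ.sm_X₂ Φ.sm_X₁ z2 z1))
  have b3 := (hL (S.sm_T.pd 5) (s 3) (s 3) p3 p3 4 3).symm.trans
    (a3.trans (hR sR Φ.sm_Y₁ Φ.sm_Y₂ z3 z4))
  have b4 := (hL (S.sm_T.pd 5) (s 4) (s 4) p4 p4 4 3).symm.trans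
    (a4.trans (hR sT Φ.sm_Y₂ Φ.sm_Y₁ z4 z3))
  rw [dR] at b1 b3
  rw [dT] at b2 b4
  simp only [Rs, Ts] at b1 b2 b3 b4
  refine ⟨pd 5 (fun y => pd 5 (fun j => Φ.toFun j 5) y) j, ?_, ?_, ?_, ?_⟩ <;>
    simp only [Rss, Tss, Rs, Ts]
  · linear_combination b1
  · linear_combination b2
  · linear_combination b3
  · linear_combination b4

/-- The transformation of the forms `R_s α² + 2 α β + T_s β²` and `R_ss α² + T_ss β²`. -/
theorem exists_relations {j : Jet} (hj : j ∈ S.dom) : ∃ c σ τ : ℝ, c ≠ 0 ∧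
    c * S.Rs j = σ * (S'.Rs (Φ.toFun j) * Φ.X₁ j ^ 2 + 2 * Φ.X₁ j * Φ.X₂ j
      + S'.Ts (Φ.toFun j) * Φ.X₂ j ^ 2) ∧
    c = σ * (S'.Rs (Φ.toFun j) * Φ.X₁ j * Φ.Y₁ j + Φ.X₁ j * Φ.Y₂ j + Φ.X₂ j * Φ.Y₁ j
      + S'.Ts (Φ.toFun j) * Φ.X₂ j * Φ.Y₂ j) ∧
    c * S.Ts j = σ * (S'.Rs (Φ.toFun j) * Φ.Y₁ j ^ 2 + 2 * Φ.Y₁ j * Φ.Y₂ j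
      + S'.Ts (Φ.toFun j) * Φ.Y₂ j ^ 2) ∧
    c * S.Rss j = τ * (S'.Rs (Φ.toFun j) * Φ.X₁ j ^ 2 + 2 * Φ.X₁ j * Φ.X₂ j
      + S'.Ts (Φ.toFun j) * Φ.X₂ j ^ 2)
      + σ ^ 2 * (S'.Rss (Φ.toFun j) * Φ.X₁ j ^ 2 + S'.Tss (Φ.toFun j) * Φ.X₂ j ^ 2) ∧
    0 = τ * (S'.Rs (Φ.toFun j) * Φ.X₁ j * Φ.Y₁ j + Φ.X₁ j * Φ.Y₂ j + Φ.X₂ j * Φ.Y₁ j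
      + S'.Ts (Φ.toFun j) * Φ.X₂ j * Φ.Y₂ j)
      + σ ^ 2 * (S'.Rss (Φ.toFun j) * Φ.X₁ j * Φ.Y₁ j
        + S'.Tss (Φ.toFun j) * Φ.X₂ j * Φ.Y₂ j) ∧
    c * S.Tss j = τ * (S'.Rs (Φ.toFun j) * Φ.Y₁ j ^ 2 + 2 * Φ.Y₁ j * Φ.Y₂ j
      + S'.Ts (Φ.toFun j) * Φ.Y₂ j ^ 2)
      + σ ^ 2 * (S'.Rss (Φ.toFun j) * Φ.Y₁ j ^ 2 + S'.Tss (Φ.toFun j) * Φ.Y₂ j ^ 2) := by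
  obtain ⟨c, m1, m2, m3, m4⟩ := Φ.momentum_relations hj
  obtain ⟨f1, f2, f3, f4⟩ := Φ.first_order hj
  obtain ⟨τ, t1, t2, t3, t4⟩ := Φ.second_order hj
  have hσ := Φ.pd_five_ne_zero hj
  have hd : Φ.X₁ j * Φ.Y₂ j - Φ.X₂ j * Φ.Y₁ j ≠ 0 := Φ.det_ne_zero hj
  refine ⟨c, pd 5 (fun j => Φ.toFun j 5) j, τ, ?_, ?_, ?_, ?_, ?_, ?_, ?_⟩
  -- If c = 0, the p- and q-derivatives of p̄ vanish by `momentum_relations`, and the first-order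
  -- formulas then force ∂_s s̄ times the determinant to be zero.
  · rintro rfl
    have h3 : pd 3 (fun j => Φ.toFun j 3) j = 0 := (mul_eq_zero.1
      (by linear_combination Φ.Y₂ j * m1 - Φ.X₂ j * m3)).resolve_right hd
    have h4 : pd 4 (fun j => Φ.toFun j 3) j = 0 := (mul_eq_zero.1
      (by linear_combination Φ.Y₂ j * m2 - Φ.X₂ j * m4)).resolve_right hd
    rw [h3, h4] at f1 f3
    refine mul_ne_zero hσ hd ?_
    linear_combination Φ.Y₁ j * f1 - Φ.X₁ j * f3
  · linear_combination Φ.X₁ j * f1 + Φ.X₂ j * f2 - S.Rs j * m1 - m2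
  · linear_combination Φ.Y₁ j * f1 + Φ.Y₂ j * f2 - S.Rs j * m3 - m4
  · linear_combination Φ.Y₁ j * f3 + Φ.Y₂ j * f4 - S.Ts j * m4 - m3
  · linear_combination Φ.X₁ j * t1 + Φ.X₂ j * t2 - S.Rss j * m1
  · linear_combination Φ.Y₁ j * t1 + Φ.Y₂ j * t2 - S.Rss j * m3
  · linear_combination Φ.Y₁ j * t3 + Φ.Y₂ j * t4 - S.Tss j * m4

/-- The form R_sα² + 2αβ + T_sβ² has a mixed term and R_ssα² + T_ssβ² has none, in both systems.
When either second form vanishes, comparison of mixed terms gives τ = 0, and invertibility of the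
Jacobian gives the rest. -/
theorem second_derivatives_eq_zero_iff {j : Jet} (hj : j ∈ S.dom) :
    (S.Rss j = 0 ∧ S.Tss j = 0) ↔ S'.Rss (Φ.toFun j) = 0 ∧ S'.Tss (Φ.toFun j) = 0 := by
  obtain ⟨c, σ, τ, hc, -, f2, -, t1, t2, t3⟩ := Φ.exists_relations hj
  have hd : Φ.X₁ j * Φ.Y₂ j - Φ.X₂ j * Φ.Y₁ j ≠ 0 := Φ.det_ne_zero hj
  have hσ : σ ≠ 0 := by
    rintro rfl
    exact hc (by rw [f2, zero_mul])
  have hσ2 : σ ^ 2 ≠ 0 := pow_ne_zero 2 hσ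
  have hd2 : (Φ.X₁ j * Φ.Y₂ j - Φ.X₂ j * Φ.Y₁ j) ^ 2 ≠ 0 := pow_ne_zero 2 hd
  constructor
  · rintro ⟨h1, h2⟩
    rw [h1, mul_zero] at t1
    rw [h2, mul_zero] at t3
    have hτ : τ = 0 := by
      refine (mul_eq_zero.1 ?_).resolve_right hd2
      linear_combination Φ.Y₁ j * Φ.Y₂ j * t1 - (Φ.X₁ j * Φ.Y₂ j + Φ.X₂ j * Φ.Y₁ j) * t2
        + Φ.X₁ j * Φ.X₂ j * t3
    subst hτ
    constructor
    · refine (mul_eq_zero.1 ((mul_eq_zero.1 ?_).resolve_right hd2)).resolve_left hσ2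
      linear_combination -Φ.Y₂ j ^ 2 * t1 + 2 * Φ.X₂ j * Φ.Y₂ j * t2 - Φ.X₂ j ^ 2 * t3
    · refine (mul_eq_zero.1 ((mul_eq_zero.1 ?_).resolve_right hd2)).resolve_left hσ2
      linear_combination -Φ.Y₁ j ^ 2 * t1 + 2 * Φ.X₁ j * Φ.Y₁ j * t2 - Φ.X₁ j ^ 2 * t3
  · rintro ⟨h1, h2⟩
    rw [h1, h2] at t1 t2 t3
    have hτ : τ = 0 := by
      refine (mul_eq_zero.1 ?_).resolve_right hc
      linear_combination τ * f2 - σ * t2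
    subst hτ
    exact ⟨(mul_eq_zero.1 (by linear_combination t1 : c * S.Rss j = 0)).resolve_left hc,
      (mul_eq_zero.1 (by linear_combination t3 : c * S.Tss j = 0)).resolve_left hc⟩

/-- The first component of the image of the null vector `(-1 + η w, R_s)`. -/
noncomputable def nullVec₁ (η : ℝ) (j : Jet) : ℝ := (-1 + η * S.w j) * Φ.X₁ j + S.Rs j * Φ.Y₁ j

/-- The second component of the image of the null vector `(-1 + η w, R_s)`. -/
noncomputable def nullVec₂ (η : ℝ) (j : Jet) : ℝ := (-1 + η * S.w j) * Φ.X₂ j + S.Rs j * Φ.Y₂ j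

/-- The sign which tells to which of the null lines of the second system the null line of the first
system is mapped. -/
noncomputable def nullSign (η : ℝ) (j : Jet) : ℝ :=
  (S'.Rs (Φ.toFun j) * Φ.nullVec₁ η j + Φ.nullVec₂ η j) / (S'.w (Φ.toFun j) * Φ.nullVec₂ η j)

section

variable {j : Jet} {η : ℝ}

/-- The vector (-1 + ηw, R_s) is null for R_sα² + 2αβ + T_sβ² because w² = 1 - R_sT_s, and its image
is null for the transformed form. On it the τ term of the second-order relation disappears, and the
value of R_ssα² + T_ssβ² is K₁ for η = 1 and K₂ for η = -1. -/
theorem nullVec_relations (hj : j ∈ S.dom) (hη : η ^ 2 = 1) : ∃ c σ : ℝ, c ≠ 0 ∧ σ ≠ 0 ∧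
    S'.Rs (Φ.toFun j) * Φ.nullVec₁ η j ^ 2 + 2 * Φ.nullVec₁ η j * Φ.nullVec₂ η j
      + S'.Ts (Φ.toFun j) * Φ.nullVec₂ η j ^ 2 = 0 ∧
    σ ^ 2 * (S'.Rss (Φ.toFun j) * Φ.nullVec₁ η j ^ 2 + S'.Tss (Φ.toFun j) * Φ.nullVec₂ η j ^ 2)
      = c * (S.Rss j * (1 - η * S.w j) ^ 2 + S.Tss j * S.Rs j ^ 2) := by
  obtain ⟨c, σ, τ, hc, f1, f2, f3, t1, t2, t3⟩ := Φ.exists_relations hj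
  have hσ : σ ≠ 0 := by
    rintro rfl
    exact hc (by rw [f2, zero_mul])
  have hw := S.w_sq hj
  have h0 : S'.Rs (Φ.toFun j) * Φ.nullVec₁ η j ^ 2 + 2 * Φ.nullVec₁ η j * Φ.nullVec₂ η j
      + S'.Ts (Φ.toFun j) * Φ.nullVec₂ η j ^ 2 = 0 := by
    refine (mul_eq_zero.1 ?_).resolve_left hσ
    simp only [nullVec₁, nullVec₂]
    linear_combination -(-1 + η * S.w j) ^ 2 * f1 - 2 * (-1 + η * S.w j) * S.Rs j * f2
      - S.Rs j ^ 2 * f3 + c * S.Rs j * S.w j ^ 2 * hη + c * S.Rs j * hw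
  refine ⟨c, σ, hc, hσ, h0, ?_⟩
  simp only [nullVec₁, nullVec₂] at h0 ⊢
  linear_combination -(-1 + η * S.w j) ^ 2 * t1 - 2 * (-1 + η * S.w j) * S.Rs j * t2
    - S.Rs j ^ 2 * t3 - τ * h0

/-- A null vector with zero second component is zero when R̄_s ≠ 0, whereas the image of the nonzero
vector (-1 + ηw, R_s) under the invertible Jacobian is nonzero. -/
theorem nullVec₂_ne_zero (hj : j ∈ S.dom) (hR : S.Rs j ≠ 0) (hR' : S'.Rs (Φ.toFun j) ≠ 0)
    (hη : η ^ 2 = 1) : Φ.nullVec₂ η j ≠ 0 := by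
  intro h
  obtain ⟨c, σ, -, -, h0, -⟩ := Φ.nullVec_relations hj hη
  rw [h] at h0
  have h1 : Φ.nullVec₁ η j = 0 := by
    have : S'.Rs (Φ.toFun j) * Φ.nullVec₁ η j ^ 2 = 0 := by linear_combination h0
    exact pow_eq_zero_iff (two_ne_zero) |>.1 ((mul_eq_zero.1 this).resolve_left hR')
  have hd : Φ.X₁ j * Φ.Y₂ j - Φ.X₂ j * Φ.Y₁ j ≠ 0 := Φ.det_ne_zero hj
  rw [nullVec₁] at h1
  rw [nullVec₂] at h
  refine mul_ne_zero hR hd ?_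
  linear_combination Φ.X₁ j * h - Φ.X₂ j * h1

/-- Multiplying the null equation by R̄_s and completing the square gives (R̄_s v₁ + v₂)² = w̄² v₂².
-/
theorem nullSign_sq (hj : j ∈ S.dom) (hR : S.Rs j ≠ 0) (hR' : S'.Rs (Φ.toFun j) ≠ 0)
    (hη : η ^ 2 = 1) : Φ.nullSign η j ^ 2 = 1 := by
  obtain ⟨c, σ, -, -, h0, -⟩ := Φ.nullVec_relations hj hη
  have h2 := Φ.nullVec₂_ne_zero hj hR hR' hη
  have hw := (S'.w_pos (Φ.mapsTo hj)).ne'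
  rw [nullSign, div_pow, div_eq_one_iff_eq (pow_ne_zero 2 (mul_ne_zero hw h2)), mul_pow,
    S'.w_sq (Φ.mapsTo hj)]
  linear_combination S'.Rs (Φ.toFun j) * h0

theorem nullVec₁_eq (hj : j ∈ S.dom) (hR : S.Rs j ≠ 0) (hR' : S'.Rs (Φ.toFun j) ≠ 0)
    (hη : η ^ 2 = 1) : S'.Rs (Φ.toFun j) * Φ.nullVec₁ η j
      = (Φ.nullSign η j * S'.w (Φ.toFun j) - 1) * Φ.nullVec₂ η j := by
  have h2 := Φ.nullVec₂_ne_zero hj hR hR' hη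
  have hw := (S'.w_pos (Φ.mapsTo hj)).ne'
  rw [nullSign]
  field_simp
  ring

/-- The image of the null vector is proportional to (-1 + ζw̄, R̄_s), so the transformed quadratic
form evaluated on it is a nonzero multiple of the corresponding K̄. -/
theorem quadratic_eq_zero_iff (hj : j ∈ S.dom) (hR : S.Rs j ≠ 0) (hR' : S'.Rs (Φ.toFun j) ≠ 0)
    (hη : η ^ 2 = 1) {ζ : ℝ} (hζ : Φ.nullSign η j = ζ) :
    S.Rss j * (1 - η * S.w j) ^ 2 + S.Tss j * S.Rs j ^ 2 = 0 ↔
      S'.Rss (Φ.toFun j) * (1 - ζ * S'.w (Φ.toFun j)) ^ 2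
        + S'.Tss (Φ.toFun j) * S'.Rs (Φ.toFun j) ^ 2 = 0 := by
  obtain ⟨c, σ, hc, hσ, -, h0⟩ := Φ.nullVec_relations hj hη
  have h1 := Φ.nullVec₁_eq hj hR hR' hη
  have h2 := Φ.nullVec₂_ne_zero hj hR hR' hη
  rw [hζ] at h1
  have key : σ ^ 2 * Φ.nullVec₂ η j ^ 2 * (S'.Rss (Φ.toFun j) * (1 - ζ * S'.w (Φ.toFun j)) ^ 2
      + S'.Tss (Φ.toFun j) * S'.Rs (Φ.toFun j) ^ 2) = S'.Rs (Φ.toFun j) ^ 2 * c *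
      (S.Rss j * (1 - η * S.w j) ^ 2 + S.Tss j * S.Rs j ^ 2) := by
    linear_combination S'.Rs (Φ.toFun j) ^ 2 * h0 - σ ^ 2 * S'.Rss (Φ.toFun j) *
      (S'.Rs (Φ.toFun j) * Φ.nullVec₁ η j + (ζ * S'.w (Φ.toFun j) - 1) * Φ.nullVec₂ η j) * h1
  have n1 : σ ^ 2 * Φ.nullVec₂ η j ^ 2 ≠ 0 := mul_ne_zero (pow_ne_zero 2 hσ) (pow_ne_zero 2 h2)
  have n2 : S'.Rs (Φ.toFun j) ^ 2 * c ≠ 0 := mul_ne_zero (pow_ne_zero 2 hR') hc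
  constructor
  · intro h
    rw [h, mul_zero] at key
    exact (mul_eq_zero.1 key).resolve_left n1
  · intro h
    rw [h, mul_zero] at key
    exact (mul_eq_zero.1 key.symm).resolve_left n2

/-- The two null lines are distinct, as R_s and w do not vanish, and the invertible Jacobian keeps
them distinct; so they cannot have the same sign. -/
theorem nullSign_neg_one (hj : j ∈ S.dom) (hR : S.Rs j ≠ 0) (hR' : S'.Rs (Φ.toFun j) ≠ 0) :
    Φ.nullSign (-1) j = -Φ.nullSign 1 j := by
  have hm : (-1 : ℝ) ^ 2 = 1 := by norm_num
  have h1 : (1 : ℝ) ^ 2 = 1 := by norm_num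
  rcases sq_eq_sq_iff_eq_or_eq_neg.1
    ((Φ.nullSign_sq hj hR hR' hm).trans (Φ.nullSign_sq hj hR hR' h1).symm) with h | h
  · exfalso
    have e1 := Φ.nullVec₁_eq hj hR hR' h1
    have e2 := Φ.nullVec₁_eq hj hR hR' hm
    rw [h] at e2
    have hd : Φ.X₁ j * Φ.Y₂ j - Φ.X₂ j * Φ.Y₁ j ≠ 0 := Φ.det_ne_zero hj
    have hw := (S.w_pos hj).ne'
    have key : S'.Rs (Φ.toFun j) * (Φ.nullVec₁ 1 j * Φ.nullVec₂ (-1) j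
        - Φ.nullVec₂ 1 j * Φ.nullVec₁ (-1) j) = 0 := by
      linear_combination Φ.nullVec₂ (-1) j * e1 - Φ.nullVec₂ 1 j * e2
    refine mul_ne_zero hR' (mul_ne_zero (mul_ne_zero (mul_ne_zero two_ne_zero hw) hR) hd) ?_
    simp only [nullVec₁, nullVec₂] at key
    linear_combination key
  · exact h

end

theorem continuousOn_nullSign (hR : ∀ j ∈ S.dom, S.Rs j ≠ 0) (hR' : ∀ j ∈ S'.dom, S'.Rs j ≠ 0) :
    ContinuousOn (Φ.nullSign 1) S.dom := by
  have s1 : S.Sm (Φ.nullVec₁ 1) := ((contDiffOn_const.add (contDiffOn_const.mul S.contDiffOn_w)).mul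
    Φ.sm_X₁).add ((S.sm_R.pd 5).mul Φ.sm_Y₁)
  have s2 : S.Sm (Φ.nullVec₂ 1) := ((contDiffOn_const.add (contDiffOn_const.mul S.contDiffOn_w)).mul
    Φ.sm_X₂).add ((S.sm_R.pd 5).mul Φ.sm_Y₂)
  refine ContinuousOn.div (((Φ.sm_pullback (S'.sm_R.pd 5)).mul s1).add s2).continuousOn
    ((Φ.sm_pullback S'.contDiffOn_w).mul s2).continuousOn fun j hj => ?_
  exact mul_ne_zero (S'.w_pos (Φ.mapsTo hj)).ne'
    (Φ.nullVec₂_ne_zero hj (hR j hj) (hR' _ (Φ.mapsTo hj)) (by norm_num))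

/-- The sign is continuous with square 1, hence constant on the connected domain. Its value tells
whether the two null lines, and with them K₁ and K₂, are preserved or interchanged. -/
theorem K_invariance (hS : IsPreconnected S.dom) (hR : ∀ j ∈ S.dom, S.Rs j ≠ 0)
    (hR' : ∀ j ∈ S'.dom, S'.Rs j ≠ 0) :
    (∀ j ∈ S.dom, (S.K1 j = 0 ↔ S'.K1 (Φ.toFun j) = 0) ∧
      (S.K2 j = 0 ↔ S'.K2 (Φ.toFun j) = 0)) ∨
    (∀ j ∈ S.dom, (S.K1 j = 0 ↔ S'.K2 (Φ.toFun j) = 0) ∧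
      (S.K2 j = 0 ↔ S'.K1 (Φ.toFun j) = 0)) := by
  have hm : (-1 : ℝ) ^ 2 = 1 := by norm_num
  have h1 : (1 : ℝ) ^ 2 = 1 := by norm_num
  have e := fun {η : ℝ} (hη : η ^ 2 = 1) {j : Jet} (hj : j ∈ S.dom) {ζ : ℝ}
    (hζ : Φ.nullSign η j = ζ) =>
    Φ.quadratic_eq_zero_iff hj (hR j hj) (hR' _ (Φ.mapsTo hj)) hη hζ
  have neg := fun {j : Jet} (hj : j ∈ S.dom) =>
    Φ.nullSign_neg_one hj (hR j hj) (hR' _ (Φ.mapsTo hj))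
  rcases hS.eq_one_or_eq_neg_one_of_sq_eq (Φ.continuousOn_nullSign hR hR')
    (fun j hj => Φ.nullSign_sq hj (hR j hj) (hR' _ (Φ.mapsTo hj)) h1) with h | h
  · refine Or.inl fun j hj => ⟨?_, ?_⟩
    · simpa only [K1, one_mul] using e h1 hj (show _ = (1 : ℝ) from h hj)
    · simpa only [K2, neg_mul, one_mul, sub_neg_eq_add] using
        e hm hj (show _ = (-1 : ℝ) from (neg hj).trans (congrArg Neg.neg (h hj)))
  · refine Or.inr fun j hj => ⟨?_, ?_⟩
    · simpa only [K1, K2, one_mul, neg_mul, sub_neg_eq_add] using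
        e h1 hj (show _ = (-1 : ℝ) from h hj)
    · simpa only [K1, K2, neg_mul, one_mul, sub_neg_eq_add] using
        e hm hj ((neg hj).trans ((congrArg Neg.neg (h hj)).trans (neg_neg (1 : ℝ))))

end PointEquivalence

/-! ### The normal forms -/

namespace PDESystem

open GroupParams

variable {S : PDESystem} {a m n x y : Lift → ℝ}

theorem descends_liftParams (h₁ : ∀ j ∈ S.dom, S.J1 j = 0) (h₂ : ∀ j ∈ S.dom, S.J2 j = 0)
    (hc : S.FibreCoords a m n x y) :
    DescendsToConformalMetric S S.lift ((S.liftParams a m n x y).theta S) ∧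
      DescendsToConformalMetric S S.lift ((S.liftParams a m n x y).swap.theta S) := by
  have s : ContDiffOn ℝ ∞ (fun u => m u * n u) S.lift := hc.sm.mul hc.sn
  have n0 : ∀ u ∈ S.lift, m u * n u ≠ 0 := fun u hu => mul_ne_zero (hc.m0 u hu) (hc.n0 u hu)
  refine ⟨descendsToConformalMetric h₁ h₂ s n0 (fun u hu v => theta_liftParams_eq_zero hc hu v)
    (fun u hu v v' => formG_liftParams hc hu v v'),
    descendsToConformalMetric h₁ h₂ s n0 (fun u hu v => ?_) (fun u hu v v' => ?_)⟩
  · rw [← theta_liftParams_eq_zero hc hu v]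
    constructor
    · intro h i
      fin_cases i
      exacts [h 1, h 0, h 2, h 3]
    · intro h i
      fin_cases i
      exacts [h 1, h 0, h 2, h 3]
  · rw [βform, ← formG_liftParams hc hu v v', formG, formG, swap_theta_zero, swap_theta_one,
      swap_theta_two, swap_theta_three]
    ring

theorem fk_eq {j : Jet} (hj : j ∈ S.dom) (hR : S.Rs j ≠ 0) : S.fk j = (1 - S.w j) / S.Rs j := by
  rw [fk, div_eq_div_iff (S.one_add_w_ne hj) hR]
  linear_combination S.w_sq hj

theorem neg_fl_mul {j : Jet} (hj : j ∈ S.dom) (hR : S.Rs j ≠ 0) (f : ℝ) :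
    -S.fl j * (-(1 + S.w j) / S.Rs j * f) = f := by
  have := S.one_add_w_ne hj
  rw [fl]
  field_simp

/-- By R_sT_s = (1 - w)(1 + w), the expression in T_s is ((1 + w)/R_s)² times the one in R_s, and
the same square appears through the rescaled fibre coordinate. -/
theorem torsion_eq {j : Jet} (hj : j ∈ S.dom) (hR : S.Rs j ≠ 0) (a f : ℝ) :
    -(a / (8 * (-(1 + S.w j) / S.Rs j * f) ^ 2 * S.w j ^ 4))
      * (S.Rss j * S.Ts j ^ 2 + S.Tss j * (1 + S.w j) ^ 2)
    = -(a / (8 * f ^ 2 * S.w j ^ 4)) * (S.Rss j * (1 - S.w j) ^ 2 + S.Tss j * S.Rs j ^ 2) := by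
  have h1 := S.one_add_w_ne hj
  have hw := (S.w_pos hj).ne'
  have key : S.Rss j * S.Ts j ^ 2 + S.Tss j * (1 + S.w j) ^ 2 = ((1 + S.w j) / S.Rs j) ^ 2
      * (S.Rss j * (1 - S.w j) ^ 2 + S.Tss j * S.Rs j ^ 2) := by
    rw [div_pow, div_mul_eq_mul_div, eq_div_iff (pow_ne_zero 2 hR)]
    linear_combination (S.Rss j * (S.Rs j * S.Ts j + 1 - S.w j ^ 2)) * S.w_sq hj
  rw [key]
  by_cases hf : f = 0
  · simp [hf]
  · field_simp

variable (S) in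
theorem contDiffOn_neg_one_add_w_div (hR : ∀ j ∈ S.dom, S.Rs j ≠ 0) :
    S.Sm fun j => -(1 + S.w j) / S.Rs j :=
  ((contDiffOn_const.add S.contDiffOn_w).neg).div (S.sm_R.pd 5) hR

/-- The ratio of the ν₁ and ν₂ coefficients is -k = (-1 + w)/R_s in β₁ and -1/l = (-1 - w)/R_s in
β₂. For ε = 1 the form θ¹ must be built from β₂, whence the swap; for ε = -1 it is built from β₁.
The weight -(1 + w)/R_s = -1/l makes the ν₂ coefficient of the form built from β₂ a fibre
coordinate. -/
theorem exists_normalForm_of_ne_zero (h₁ : ∀ j ∈ S.dom, S.J1 j = 0) (h₂ : ∀ j ∈ S.dom, S.J2 j = 0)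
    (hR : ∀ j ∈ S.dom, S.Rs j ≠ 0) {ε : ℝ} (hε : ε = 1 ∨ ε = -1) :
    ∃ g : GroupParams,
      (∀ u ∈ S.lift, g.a u = u.2 0 ∧ g.f 0 1 u = u.2 1 ∧ g.f 1 1 u = u.2 2 ∧
        g.f 2 0 u = u.2 3 ∧ g.f 2 1 u = u.2 4 ∧
        g.f 0 0 u = (-1 - ε * S.w u.1) / S.Rs u.1 * g.f 0 1 u ∧
        g.f 1 0 u = (-1 + ε * S.w u.1) / S.Rs u.1 * g.f 1 1 u) ∧
      g.IsNormalized S S.lift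
        (fun u => -(g.a u / (8 * g.f 1 1 u ^ 2 * S.w u.1 ^ 4))
          * (S.Rss u.1 * (1 + ε * S.w u.1) ^ 2 + S.Tss u.1 * S.Rs u.1 ^ 2))
        (fun u => -(g.a u / (8 * g.f 0 1 u ^ 2 * S.w u.1 ^ 4))
          * (S.Rss u.1 * (1 - ε * S.w u.1) ^ 2 + S.Tss u.1 * S.Rs u.1 ^ 2)) ∧
      DescendsToConformalMetric S S.lift (g.theta S) := by
  have s₁ : S.Sm fun _ => (1 : ℝ) := contDiffOn_const
  have s₂ := S.contDiffOn_neg_one_add_w_div hR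
  have z₁ : ∀ j ∈ S.dom, (1 : ℝ) ≠ 0 := fun _ _ => one_ne_zero
  have z₂ : ∀ j ∈ S.dom, -(1 + S.w j) / S.Rs j ≠ 0 := fun j hj =>
    div_ne_zero (neg_ne_zero.2 (S.one_add_w_ne hj)) (hR j hj)
  rcases hε with rfl | rfl
  · obtain ⟨x, y, hc, hxy⟩ := exists_fibreCoords s₁ s₂ z₁ z₂ (i := 2) (i' := 1)
      (Or.inr ⟨rfl, rfl⟩)
    refine ⟨_, fun u hu => ⟨rfl, neg_fl_mul hu.1 (hR _ hu.1) _, one_mul (u.2 2), (hxy u hu).1,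
      (hxy u hu).2, ?_, ?_⟩, (isNormalized_liftParams h₁ h₂ hc (fun u hu => ?_)
      (fun u hu => ?_)).2, (descends_liftParams h₁ h₂ hc).2⟩
    · show -(1 + S.w u.1) / S.Rs u.1 * u.2 1
        = (-1 - 1 * S.w u.1) / S.Rs u.1 * (-S.fl u.1 * (-(1 + S.w u.1) / S.Rs u.1 * u.2 1))
      rw [neg_fl_mul hu.1 (hR _ hu.1)]
      ring
    · show -S.fk u.1 * (1 * u.2 2) = (-1 + 1 * S.w u.1) / S.Rs u.1 * (1 * u.2 2)
      rw [fk_eq hu.1 (hR _ hu.1)]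
      ring
    · show -(u.2 0 / (8 * (-S.fl u.1 * (-(1 + S.w u.1) / S.Rs u.1 * u.2 1)) ^ 2 * S.w u.1 ^ 4))
        * (S.Rss u.1 * (1 - 1 * S.w u.1) ^ 2 + S.Tss u.1 * S.Rs u.1 ^ 2) = _
      rw [neg_fl_mul hu.1 (hR _ hu.1), one_mul, ← torsion_eq hu.1 (hR _ hu.1)]
    · show -(u.2 0 / (8 * (1 * u.2 2) ^ 2 * S.w u.1 ^ 4))
        * (S.Rss u.1 * (1 + 1 * S.w u.1) ^ 2 + S.Tss u.1 * S.Rs u.1 ^ 2) = _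
      rw [one_mul (S.w u.1)]
  · obtain ⟨x, y, hc, hxy⟩ := exists_fibreCoords s₁ s₂ z₁ z₂ (i := 1) (i' := 2)
      (Or.inl ⟨rfl, rfl⟩)
    refine ⟨_, fun u hu => ⟨rfl, one_mul (u.2 1), neg_fl_mul hu.1 (hR _ hu.1) _, (hxy u hu).1,
      (hxy u hu).2, ?_, ?_⟩, (isNormalized_liftParams h₁ h₂ hc (fun u hu => ?_)
      (fun u hu => ?_)).1, (descends_liftParams h₁ h₂ hc).1⟩
    · show -S.fk u.1 * (1 * u.2 1) = (-1 - -1 * S.w u.1) / S.Rs u.1 * (1 * u.2 1)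
      rw [fk_eq hu.1 (hR _ hu.1)]
      ring
    · show -(1 + S.w u.1) / S.Rs u.1 * u.2 2
        = (-1 + -1 * S.w u.1) / S.Rs u.1 * (-S.fl u.1 * (-(1 + S.w u.1) / S.Rs u.1 * u.2 2))
      rw [neg_fl_mul hu.1 (hR _ hu.1)]
      ring
    · show -(u.2 0 / (8 * (-S.fl u.1 * (-(1 + S.w u.1) / S.Rs u.1 * u.2 2)) ^ 2 * S.w u.1 ^ 4))
        * (S.Rss u.1 * (1 + -1 * S.w u.1) ^ 2 + S.Tss u.1 * S.Rs u.1 ^ 2) = _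
      rw [neg_fl_mul hu.1 (hR _ hu.1), neg_one_mul, ← sub_eq_add_neg,
        ← torsion_eq hu.1 (hR _ hu.1)]
    · show -(u.2 0 / (8 * (1 * u.2 1) ^ 2 * S.w u.1 ^ 4))
        * (S.Rss u.1 * (1 - -1 * S.w u.1) ^ 2 + S.Tss u.1 * S.Rs u.1 ^ 2) = _
      rw [neg_one_mul, sub_neg_eq_add]

theorem exists_normalForm (h₁ : ∀ j ∈ S.dom, S.J1 j = 0) (h₂ : ∀ j ∈ S.dom, S.J2 j = 0) :
    ∃ g : GroupParams,
      (∀ u ∈ S.lift, g.a u = u.2 0 ∧ g.f 0 1 u = u.2 1 ∧ g.f 1 0 u = u.2 2 ∧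
        g.f 2 0 u = u.2 3 ∧ g.f 2 1 u = u.2 4 ∧
        g.f 0 0 u = -(S.Ts u.1 / (1 + S.w u.1)) * g.f 0 1 u ∧
        g.f 1 1 u = -(S.Rs u.1 / (1 + S.w u.1)) * g.f 1 0 u) ∧
      g.IsNormalized S S.lift
        (fun u => -(g.a u / (8 * g.f 1 0 u ^ 2 * S.w u.1 ^ 4))
          * (S.Rss u.1 * S.Ts u.1 ^ 2 + S.Tss u.1 * (1 + S.w u.1) ^ 2))
        (fun u => -(g.a u / (8 * g.f 0 1 u ^ 2 * S.w u.1 ^ 4))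
          * (S.Rss u.1 * (1 + S.w u.1) ^ 2 + S.Tss u.1 * S.Rs u.1 ^ 2)) ∧
      DescendsToConformalMetric S S.lift (g.theta S) := by
  have s₁ : S.Sm fun _ => (1 : ℝ) := contDiffOn_const
  have z₁ : ∀ j ∈ S.dom, (1 : ℝ) ≠ 0 := fun _ _ => one_ne_zero
  obtain ⟨x, y, hc, hxy⟩ := exists_fibreCoords s₁ s₁ z₁ z₁ (i := 1) (i' := 2) (Or.inl ⟨rfl, rfl⟩)
  exact ⟨_, fun u hu => ⟨rfl, one_mul (u.2 1), one_mul (u.2 2), (hxy u hu).1, (hxy u hu).2, rfl,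
    rfl⟩, (isNormalized_liftParams h₁ h₂ hc (fun u hu => rfl) (fun u hu => rfl)).1,
    (descends_liftParams h₁ h₂ hc).1⟩

end PDESystem

theorem mainTheorem7 (S : PDESystem)
    (hJ₁ : ∀ j ∈ S.dom, S.J1 j = 0) (hJ₂ : ∀ j ∈ S.dom, S.J2 j = 0) :
    -- the normal form, for either choice of the sign `ε`, where `R_s` has no zeros;
    -- the fibre coordinates are `(a, f₁₂, f₂₂, f₃₁, f₃₂)`
    ((∀ j ∈ S.dom, S.Rs j ≠ 0) → ∀ ε : ℝ, (ε = 1 ∨ ε = -1) →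
      ∃ g : GroupParams,
        (∀ u ∈ S.lift, g.a u = u.2 0 ∧ g.f 0 1 u = u.2 1 ∧ g.f 1 1 u = u.2 2 ∧
          g.f 2 0 u = u.2 3 ∧ g.f 2 1 u = u.2 4 ∧
          g.f 0 0 u = (-1 - ε * S.w u.1) / S.Rs u.1 * g.f 0 1 u ∧
          g.f 1 0 u = (-1 + ε * S.w u.1) / S.Rs u.1 * g.f 1 1 u) ∧
        g.IsNormalized S S.lift
          (fun u => -(g.a u / (8 * g.f 1 1 u ^ 2 * S.w u.1 ^ 4))
            * (S.Rss u.1 * (1 + ε * S.w u.1) ^ 2 + S.Tss u.1 * S.Rs u.1 ^ 2))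
          (fun u => -(g.a u / (8 * g.f 0 1 u ^ 2 * S.w u.1 ^ 4))
            * (S.Rss u.1 * (1 - ε * S.w u.1) ^ 2 + S.Tss u.1 * S.Rs u.1 ^ 2)) ∧
        DescendsToConformalMetric S S.lift (g.theta S)) ∧
    -- the same normal form (`ε = -1`) without any condition on the zeros of `R_s`;
    -- the fibre coordinates are `(a, f₁₂, f₂₁, f₃₁, f₃₂)`
    (∃ g : GroupParams,
        (∀ u ∈ S.lift, g.a u = u.2 0 ∧ g.f 0 1 u = u.2 1 ∧ g.f 1 0 u = u.2 2 ∧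
          g.f 2 0 u = u.2 3 ∧ g.f 2 1 u = u.2 4 ∧
          g.f 0 0 u = -(S.Ts u.1 / (1 + S.w u.1)) * g.f 0 1 u ∧
          g.f 1 1 u = -(S.Rs u.1 / (1 + S.w u.1)) * g.f 1 0 u) ∧
        g.IsNormalized S S.lift
          (fun u => -(g.a u / (8 * g.f 1 0 u ^ 2 * S.w u.1 ^ 4))
            * (S.Rss u.1 * S.Ts u.1 ^ 2 + S.Tss u.1 * (1 + S.w u.1) ^ 2))
          (fun u => -(g.a u / (8 * g.f 0 1 u ^ 2 * S.w u.1 ^ 4))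
            * (S.Rss u.1 * (1 + S.w u.1) ^ 2 + S.Tss u.1 * S.Rs u.1 ^ 2)) ∧
        DescendsToConformalMetric S S.lift (g.theta S)) ∧
    -- point invariance
    ∀ (S' : PDESystem) (Φ : PointEquivalence S S'),
      (IsPreconnected S.dom → (∀ j ∈ S.dom, S.Rs j ≠ 0) → (∀ j ∈ S'.dom, S'.Rs j ≠ 0) →
        (∀ j ∈ S.dom, (S.K1 j = 0 ↔ S'.K1 (Φ.toFun j) = 0) ∧
          (S.K2 j = 0 ↔ S'.K2 (Φ.toFun j) = 0)) ∨
        (∀ j ∈ S.dom, (S.K1 j = 0 ↔ S'.K2 (Φ.toFun j) = 0) ∧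
          (S.K2 j = 0 ↔ S'.K1 (Φ.toFun j) = 0))) ∧
      ∀ j ∈ S.dom, (S.Rss j = 0 ∧ S.Tss j = 0) ↔
        (S'.Rss (Φ.toFun j) = 0 ∧ S'.Tss (Φ.toFun j) = 0) := by
  exact ⟨fun hR ε hε => PDESystem.exists_normalForm_of_ne_zero hJ₁ hJ₂ hR hε,
    PDESystem.exists_normalForm hJ₁ hJ₂, fun S' Φ => ⟨fun hS hR hR' => Φ.K_invariance hS hR hR',
      fun j hj => Φ.second_derivatives_eq_zero_iff hj⟩⟩
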